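/- **Setting.** A weighted set system consists of a finite universe $E$ of $m$ elements and a finite collection $\mathcal S$ of subsets of $E$ with costs $w(S)\ge 0$, such that every element lies in some set. A cover is a subcollection whose union is $E$; the cost of a collection is the sum of the costs of its sets. Let $\tau\ge 1$ be an integer. An element $e\in X\subseteq E$ is a $\tau$-SNC element within $X$ if for every collection $\mathcal P\subseteq\mathcal S$ of sets containing $e$ there is $\mathcal P'\subseteq\mathcal P$ with $|\mathcal P'|\le\tau$ and $X\cap\bigcup\mathcal P=X\cap\bigcup\mathcal P'$. The system is $\tau$-SNC if every nonempty $X\subseteq E$ contains a $\tau$-SNC element within $X$. Its layers are defined by letting $Z_k$ be the set of $\tau$-SNC elements within $E\setminus(Z_1\cup\dots\cup Z_{k-1})$; the decomposition length $L$ is the number of layers until no elements are left. A pair $(\mathcal A,\alpha)$ is $\lambda$-maximal if $\mathcal A$ is a cover, $\alpha:E\to[0,\infty)$ satisfies $\sum_{e\in S}\alpha(e)\le w(S)$ for all $S\in\mathcal S$, and $\sum_{e\in S}\alpha(e)\ge\lambda w(S)$ for all $S\in\mathcal A$. **Forward phase.** Start with $\mathcal A=\emptyset$, $\alpha=0$.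 Epoch $k=1,\dots,L$ repeats the following iteration until $\mathcal A$ covers $Z_k$. Let $U$ be the set of elements of $Z_k$ not covered by $\mathcal A$; for $S\notin\mathcal A$ with $S\cap U\ne\emptyset$ let $p(S)=(w(S)-\sum_{e\in S}\alpha(e))/|S\cap U|$; simultaneously raise $\alpha(e)$ by $\min_{S\ni e}p(S)$ for all $e\in U$; then add to $\mathcal A$ all sets $S$ with $\sum_{e\in S}\alpha(e)\ge w(S)/8$. Let $\mathcal A_k$ be the collection of sets added in epoch $k$ and $F_k$ the set of elements covered by $\mathcal A_k$ but not by $\mathcal A_1\cup\dots\cup\mathcal A_{k-1}$. **Reverse-delete phase.** Start with $\mathcal B=\emptyset$. For $k=L,\dots,1$ let $\mathcal X=\mathcal B\cup\mathcal A_k$, $A=F_k\cup\dots\cup F_L$, $\mathcal Y=\emptyset$; for $j=k,\dots,L$ compute a maximal independent set of the graph whose vertices are the elements of $A\cap Z_j$ not covered by $\mathcal Y$, two of them being adjacent if some set of $\mathcal X$ contains both, and for each element $e$ of it add to $\mathcal Y$ petals of $e$, that is, at most $\tau$ sets of $\mathcal X$ containing $e$ that together cover every element of $Z_j\cup\dots\cup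 Z_L$ which is covered by the sets of $\mathcal X$ containing $e$. Then replace $\mathcal B$ by $\mathcal Y$. **Whole algorithm.** Let $\beta=\max_{e}\min_{S\ni e}w(S)$, and call a set cheap if its cost is at most $\beta/m$. Cover all elements that lie in cheap sets by cheap sets, at most one for each such element. Discard these elements, the cheap sets and the sets of cost greater than $m\beta$, and run the two phases on the remaining (restricted) system. Output the cheap sets taken together with the collection $\mathcal B$. **Theorem.** 1. There is an absolute constant $C$ (in particular independent of the frequency, i.e. of the number of sets containing an element) such that on every $\tau$-SNC system with positive costs, with $m$ elements and decomposition length $L$, the forward phase terminates, with a $\frac18$-maximal pair $(\mathcal A,\alpha)$, after at most $C\,L\,(1+\log m+\log(w_{\max}/w_{\min}))$ iterations. The reverse-delete phase can always be carried out, and whatever maximal independent sets and petals are chosen, it computes at most $L^2$ maximal independent sets and returns a cover $\mathcal B\subseteq\mathcal A$ such that every $e$ with $\alpha(e)>0$ lies in at most $\tau^2$ sets of $\mathcal B$; the cost of $\mathcal B$ is at most $8\tau^2$ times the cost of any cover. 2. There is an absolute constant $C$ such that on every $\tau$-SNC system with $m$ elements, nonnegative costs and decomposition length $L$, the whole algorithm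 can be carried out, and every run of it has the following properties: the forward phase takes at most $C\,L\,(1+\log m)$ iterations and yields a $\frac18$-maximal pair $(\mathcal A,\alpha)$ for the system it is run on; the reverse-delete phase computes at most $L^2$ maximal independent sets; every $e$ with $\alpha(e)>0$ lies in at most $\tau^2$ sets of the output; the output is a cover whose cost is at most $(1+8\tau^2)$ times the cost of any cover. 3. For every $\tau\ge1$ the whole algorithm can be implemented in NC on $\tau$-SNC systems of logarithmic decomposition length: there is a single PRAM program such that, for every constant $c$, on all $\tau$-SNC systems with nonnegative rational costs and $L\le c\,(\lfloor\log_2 m\rfloor+1)$ (where $\lfloor\log_2 0\rfloor$ is read as $0$), it halts in time polylogarithmic in the input length (incidence matrix and costs in binary), with polynomially many processors and integers of polynomially many bits, and its output is the output of a run of the whole algorithm, hence a cover of cost at most $(1+8\tau^2)$ times the cost of any cover. -/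

import Mathlib

/-! ### Weighted set systems -/

/-- A finite weighted set system: a universe `univ` of elements, a finite collection `fam` of (names
of) sets, the set `set S ⊆ univ` with name `S`, and its cost. Distinct names may denote equal sets. -/
structure SetSystem (E I : Type*) where
  univ : Finset E
  fam : Finset I
  set : I → Finset E
  cost : I → ℝ
  set_subset : ∀ S ∈ fam, set S ⊆ univ

namespace SetSystem

variable {E I : Type*} [DecidableEq E] [DecidableEq I] (sys : SetSystem E I)

/-- The elements covered by the collection `P`. -/
def covered (P : Finset I) : Finset E := P.biUnion sys.set

/-- `P` is a subcollection that covers all the elements. -/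
def IsCover (P : Finset I) : Prop := P ⊆ sys.fam ∧ sys.univ ⊆ sys.covered P

/-- Total cost of a collection. -/
noncomputable def totalCost (P : Finset I) : ℝ := ∑ S ∈ P, sys.cost S

/-- Every element lies in some set, so that covers exist. -/
def Feasible : Prop := ∀ e ∈ sys.univ, ∃ S ∈ sys.fam, e ∈ sys.set S

/-- Feasibility for the dual program: maximise `∑ α e` subject to `∑_{e ∈ S} α e ≤ cost S`, `α ≥ 0`. -/
def DualFeasible (α : E → ℝ) : Prop :=
  (∀ e ∈ sys.univ, 0 ≤ α e) ∧ ∀ S ∈ sys.fam, ∑ e ∈ sys.set S, α e ≤ sys.cost S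

/-- A `lam`-maximal pair: a cover and a dual feasible solution such that the dual constraints of
the sets in the cover are tight up to the factor `lam`. -/
def IsMaximalPair (lam : ℝ) (A : Finset I) (α : E → ℝ) : Prop :=
  sys.IsCover A ∧ sys.DualFeasible α ∧ ∀ S ∈ A, lam * sys.cost S ≤ ∑ e ∈ sys.set S, α e

/-! ### The small neighbourhood cover property and the layer decomposition -/

/-- `e` is a `τ`-SNC element within `X`: every collection `P` of sets that contain `e` can be
replaced by at most `τ` of its members without changing the part of `X` that is covered. -/
def IsSNCElement (τ : ℕ) (X : Finset E) (e : E) : Prop :=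
  e ∈ X ∧ ∀ P ⊆ sys.fam, (∀ S ∈ P, e ∈ sys.set S) →
    ∃ P' ⊆ P, P'.card ≤ τ ∧ sys.covered P ∩ X = sys.covered P' ∩ X

/-- `τ`-SNC set systems. -/
def IsSNC (τ : ℕ) : Prop :=
  ∀ X ⊆ sys.univ, X.Nonempty → ∃ e, sys.IsSNCElement τ X e

open Classical in
/-- The elements that are left after `k` layers have been removed. -/
noncomputable def remaining (τ : ℕ) : ℕ → Finset E
  | 0 => sys.univ
  | k + 1 => (remaining τ k).filter (fun e => ¬ sys.IsSNCElement τ (remaining τ k) e)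

open Classical in
/-- The layers, counted from `0`. -/
noncomputable def layer (τ k : ℕ) : Finset E :=
  (sys.remaining τ k).filter (fun e => sys.IsSNCElement τ (sys.remaining τ k) e)

/-- The decomposition length: the number of layers that exhaust the elements. -/
noncomputable def decompLength (τ : ℕ) : ℕ := sInf {k | sys.remaining τ k = ∅}

/-! ### The forward phase -/

/-- The collection and the dual variables kept by the forward phase. -/
structure FwdState (E I : Type*) where
  A : Finset I
  α : E → ℝ

/-- The participating elements of an epoch that processes the layer `Z`. -/
def active (Z : Finset E) (st : FwdState E I) : Finset E := Z \ sys.covered st.A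

/-- The penalty `p(S) = c(S) / d(S)`, where `c(S)` is the slack of the dual constraint and `d(S)` the
number of participating elements of `S`. -/
noncomputable def penalty (Z : Finset E) (st : FwdState E I) (S : I) : ℝ :=
  (sys.cost S - ∑ e ∈ sys.set S, st.α e) / ((sys.set S ∩ sys.active Z st).card : ℝ)

/-- The minimum penalty offered to `e` by the sets containing it. -/
noncomputable def minPenalty (Z : Finset E) (st : FwdState E I) (e : E) : ℝ :=
  sInf (sys.penalty Z st '' {S | S ∈ sys.fam ∧ e ∈ sys.set S})

/-- All participating elements are raised by their minimum penalty. -/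
noncomputable def raise (Z : Finset E) (st : FwdState E I) (e : E) : ℝ :=
  if e ∈ sys.active Z st then st.α e + sys.minPenalty Z st e else st.α e

open Classical in
/-- One iteration: raise the dual variables, then add all sets whose constraint is tight up to the
factor `1/8`. -/
noncomputable def fwdStep (Z : Finset E) (st : FwdState E I) : FwdState E I where
  A := st.A ∪ (sys.fam \ st.A).filter
    (fun S => sys.cost S / 8 ≤ ∑ e ∈ sys.set S, sys.raise Z st e)
  α := sys.raise Z st

/-- An epoch iterates until the layer `Z` is covered. `EpochRun Z st t st'`: started in `st`, the
epoch ends in `st'` after exactly `t` iterations. -/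
inductive EpochRun (Z : Finset E) : FwdState E I → ℕ → FwdState E I → Prop
  | done (st : FwdState E I) : Z ⊆ sys.covered st.A → EpochRun Z st 0 st
  | step (st st' : FwdState E I) (t : ℕ) : ¬ Z ⊆ sys.covered st.A →
      EpochRun Z (sys.fwdStep Z st) t st' → EpochRun Z st (t + 1) st'

/-- A run of the forward phase: `σ k` is the state at the beginning of epoch `k`, which processes
layer `k` and takes `t k` iterations; `σ L` is the final state. -/
def ForwardRun (τ : ℕ) (σ : ℕ → FwdState E I) (t : ℕ → ℕ) : Prop :=
  σ 0 = ⟨∅, fun _ => 0⟩ ∧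
    ∀ k < sys.decompLength τ, sys.EpochRun (sys.layer τ k) (σ k) (t k) (σ (k + 1))

/-! ### The reverse-delete phase -/

/-- Two elements are adjacent if they are distinct and some set of `X` contains both. -/
def conflictGraph (X : Finset I) : SimpleGraph E where
  Adj e₁ e₂ := e₁ ≠ e₂ ∧ ∃ S ∈ X, e₁ ∈ sys.set S ∧ e₂ ∈ sys.set S
  symm := ⟨fun _ _ h => ⟨h.1.symm, h.2.imp fun _ h => ⟨h.1, h.2.2, h.2.1⟩⟩⟩
  loopless := ⟨fun _ h => h.1 rfl⟩

/-- `B` is a maximal independent set of the subgraph of `G` induced on `V`. -/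
def IsMIS (G : SimpleGraph E) (V B : Finset E) : Prop :=
  Maximal (fun B : Finset E => B ⊆ V ∧ G.IsIndepSet (B : Set E)) B

/-- `Q` is a choice of petals for the element `e` of layer `j`: at most `τ` sets of `X` containing
`e` that cover everything which the sets of `X` containing `e` cover in the layers `j, j+1, …`. -/
def IsPetals (τ : ℕ) (X : Finset I) (j : ℕ) (e : E) (Q : Finset I) : Prop :=
  Q ⊆ X.filter (fun S => e ∈ sys.set S) ∧ Q.card ≤ τ ∧
    sys.covered (X.filter (fun S => e ∈ sys.set S)) ∩ sys.remaining τ j =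
      sys.covered Q ∩ sys.remaining τ j

/-- Pruning a cover `X` of `A`. `PruneRun τ X A j Y s Y'`: processing the layers `j, j+1, …` of `A`
from left to right, with `Y` as the current collection, ends with `Y'` after `s` computations of a
maximal independent set. -/
inductive PruneRun (τ : ℕ) (X : Finset I) (A : Finset E) :
    ℕ → Finset I → ℕ → Finset I → Prop
  | done (j : ℕ) (Y : Finset I) : sys.decompLength τ ≤ j → PruneRun τ X A j Y 0 Y
  | step (j : ℕ) (Y : Finset I) (s : ℕ) (Y' : Finset I) (B : Finset E) (petals : E → Finset I) :
      j < sys.decompLength τ →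
      IsMIS (sys.conflictGraph X) ((A ∩ sys.layer τ j) \ sys.covered Y) B →
      (∀ e ∈ B, sys.IsPetals τ X j e (petals e)) →
      PruneRun τ X A (j + 1) (Y ∪ B.biUnion petals) s Y' →
      PruneRun τ X A j Y (s + 1) Y'

/-- The sets added in epoch `k` of the forward phase. -/
def addedSets (σ : ℕ → FwdState E I) (k : ℕ) : Finset I := (σ (k + 1)).A \ (σ k).A

/-- The elements freshly covered in epoch `k` of the forward phase. -/
def freshElements (σ : ℕ → FwdState E I) (k : ℕ) : Finset E :=
  sys.covered (addedSets σ k) \ sys.covered (σ k).A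

/-- `ReverseRun τ σ k B s`: after the epochs `L - 1, …, k` the reverse-delete phase for the forward
run `σ` holds the collection `B` and has computed `s` maximal independent sets. -/
inductive ReverseRun (τ : ℕ) (σ : ℕ → FwdState E I) : ℕ → Finset I → ℕ → Prop
  | start : ReverseRun τ σ (sys.decompLength τ) ∅ 0
  | step (k : ℕ) (B : Finset I) (s : ℕ) (Y : Finset I) (s' : ℕ) :
      ReverseRun τ σ (k + 1) B s →
      sys.PruneRun τ (B ∪ addedSets σ k)
        ((Finset.Ico k (sys.decompLength τ)).biUnion (sys.freshElements σ)) k ∅ s' Y →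
      ReverseRun τ σ k Y (s + s')

/-! ### Preprocessing of the costs, and the whole algorithm -/

/-- The largest, over all elements, of the smallest cost of a set containing the element. -/
noncomputable def threshold : ℝ :=
  sSup ((fun e => sInf (sys.cost '' {S | S ∈ sys.fam ∧ e ∈ sys.set S})) '' (sys.univ : Set E))

open Classical in
/-- The cheap sets: cost at most `threshold / m`. -/
noncomputable def cheap : Finset I :=
  sys.fam.filter (fun S => sys.cost S ≤ sys.threshold / (sys.univ.card : ℝ))

open Classical in
/-- The reduced system: the elements in no cheap set, and the sets (restricted to these elements)
that are not cheap and cost at most `m * threshold`. -/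
noncomputable def reduced : SetSystem E I where
  univ := sys.univ \ sys.covered sys.cheap
  fam := (sys.fam \ sys.cheap).filter
    (fun S => sys.cost S ≤ (sys.univ.card : ℝ) * sys.threshold)
  set S := sys.set S ∩ (sys.univ \ sys.covered sys.cheap)
  cost := sys.cost
  set_subset _ _ := Finset.inter_subset_right

/-- A run of the whole algorithm: a collection `chosen` of cheap sets, at most one for each element
that lies in a cheap set, covers all these elements, and both phases are run on the reduced system,
with `∑ t` iterations in the forward phase and `s` computations of a maximal independent set in the
reverse-delete phase. The output is `out`. -/
structure AlgorithmRun (τ : ℕ) (σ : ℕ → FwdState E I) (t : ℕ → ℕ) (s : ℕ) (out : Finset I) :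
    Prop where
  forward : sys.reduced.ForwardRun τ σ t
  output : ∃ chosen B : Finset I,
    chosen ⊆ sys.cheap ∧ sys.covered chosen = sys.covered sys.cheap ∧
    chosen.card ≤ (sys.covered sys.cheap).card ∧
    sys.reduced.ReverseRun τ σ 0 B s ∧ out = chosen ∪ B

end SetSystem

/-! ### Parallel random access machines

A synchronous PRAM with a fixed program for all inputs. The shared memory consists of integer arrays
(finitely many of them occur in a program). All processors execute the same instruction at the same
time, concurrent reads are allowed, and of several concurrent writes to a cell the one by the
processor of smallest number takes effect. Word lengths are not free: executions carry an
explicit bound on the number of processors and on the bit length of the integers written, so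
that the unit-cost arithmetic is arithmetic on integers of the stated length. -/

namespace PRAM

/-- Shared memory: array name, address, content. -/
abbrev Mem := ℕ → ℤ → ℤ

inductive Op
  | add | sub | mul | div | mod | lt | eq

def Op.eval : Op → ℤ → ℤ → ℤ
  | .add, x, y => x + y
  | .sub, x, y => x - y
  | .mul, x, y => x * y
  | .div, x, y => x / y
  | .mod, x, y => x % y
  | .lt, x, y => if x < y then 1 else 0
  | .eq, x, y => if x = y then 1 else 0

/-- Expressions evaluated by a single processor; `pid` is the number of the processor, and
`read a x` the content of array `a` at address `x`. -/
inductive Expr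
  | const (z : ℤ)
  | pid
  | read (a : ℕ) (x : Expr)
  | bin (o : Op) (x y : Expr)
  | cond (c x y : Expr)

def Expr.eval (M : Mem) (i : ℕ) : Expr → ℤ
  | .const z => z
  | .pid => i
  | .read a x => M a (x.eval M i)
  | .bin o x y => o.eval (x.eval M i) (y.eval M i)
  | .cond c x y => if c.eval M i ≠ 0 then x.eval M i else y.eval M i

/-- The time to evaluate an expression: the number of its operations. -/
def Expr.time : Expr → ℕ
  | .const _ => 1
  | .pid => 1
  | .read _ x => x.time + 1
  | .bin _ x y => x.time + y.time + 1
  | .cond c x y => c.time + x.time + y.time + 1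

/-- Programs. In `par p a x v` the processors `0, …, p - 1` simultaneously write the value of `v` to
the address `x` of the array `a`, where all reads precede all writes. -/
inductive Prog
  | skip
  | par (p : Expr) (a : ℕ) (x v : Expr)
  | seq (P Q : Prog)
  | ite (c : Expr) (P Q : Prog)
  | while (c : Expr) (P : Prog)

open Classical in
/-- The memory after a parallel write by `p` processors. -/
noncomputable def parWrite (M : Mem) (p : ℕ) (a : ℕ) (x v : Expr) : Mem := fun b y =>
  if h : b = a ∧ ∃ i, i < p ∧ x.eval M i = y then v.eval M (Nat.find h.2) else M b y

/-- `Exec N W P M t M'`: started on the memory `M`, the program `P` halts with memory `M'` after time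
`t`, never using more than `N` processors and never writing an integer of more than `W` bits. -/
inductive Exec (N W : ℕ) : Prog → Mem → ℕ → Mem → Prop
  | skip (M : Mem) : Exec N W .skip M 1 M
  | par (p : Expr) (a : ℕ) (x v : Expr) (M : Mem) :
      (p.eval M 0).toNat ≤ N →
      (∀ i < (p.eval M 0).toNat, |v.eval M i| < 2 ^ W) →
      Exec N W (.par p a x v) M (p.time + x.time + v.time)
        (parWrite M (p.eval M 0).toNat a x v)
  | seq (P Q : Prog) (M M' M'' : Mem) (t t' : ℕ) :
      Exec N W P M t M' → Exec N W Q M' t' M'' → Exec N W (.seq P Q) M (t + t') M''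
  | iteTrue (c : Expr) (P Q : Prog) (M M' : Mem) (t : ℕ) : c.eval M 0 ≠ 0 →
      Exec N W P M t M' → Exec N W (.ite c P Q) M (c.time + t) M'
  | iteFalse (c : Expr) (P Q : Prog) (M M' : Mem) (t : ℕ) : c.eval M 0 = 0 →
      Exec N W Q M t M' → Exec N W (.ite c P Q) M (c.time + t) M'
  | whileTrue (c : Expr) (P : Prog) (M M' M'' : Mem) (t t' : ℕ) : c.eval M 0 ≠ 0 →
      Exec N W P M t M' → Exec N W (.while c P) M' t' M'' →
      Exec N W (.while c P) M (c.time + t + t') M''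
  | whileFalse (c : Expr) (P : Prog) (M : Mem) : c.eval M 0 = 0 →
      Exec N W (.while c P) M c.time M

/-- NC: on every input `x` of the class `D`, with `N` the size of `x`, the program halts in time
polylogarithmic in `N`, with polynomially many processors and integers of polynomially many bits, and
the final memory is correct for `x`. -/
def SolvesInNC {X : Type*} (size : X → ℕ) (encode : X → Mem) (D : Set X)
    (correct : X → Mem → Prop) (P : Prog) : Prop :=
  ∃ k : ℕ, ∀ x ∈ D, ∃ (t : ℕ) (M : Mem),
    Exec ((size x + 2) ^ k) ((size x + 2) ^ k) P (encode x) t M ∧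
    t ≤ (Nat.log 2 (size x) + 2) ^ k ∧ correct x M

end PRAM

/-! ### Set systems as machine inputs -/

/-- A set system with `m` elements and `n` sets with nonnegative rational costs. -/
structure RatInstance where
  m : ℕ
  n : ℕ
  set : Fin n → Finset (Fin m)
  cost : Fin n → ℚ≥0

namespace RatInstance

def toSetSystem (x : RatInstance) : SetSystem (Fin x.m) (Fin x.n) where
  univ := Finset.univ
  fam := Finset.univ
  set := x.set
  cost S := (x.cost S : ℝ)
  set_subset _ _ := Finset.subset_univ _

/-- The length of the input: the incidence matrix and the costs in binary. -/
def size (x : RatInstance) : ℕ :=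
  x.m + x.n + x.m * x.n + ∑ S, (Nat.size (x.cost S).num + Nat.size (x.cost S).den)

open Classical in
/-- Array `0` holds `m` and `n`; array `1` the incidence matrix, row by row, one row for each element;
arrays `2` and `3` the numerators and the denominators of the costs. All other cells are zero. -/
noncomputable def encode (x : RatInstance) : PRAM.Mem := fun a y =>
  match a with
  | 0 => if y = 0 then x.m else if y = 1 then x.n else 0
  | 1 => if ∃ (e : Fin x.m) (S : Fin x.n), y = (e : ℤ) * x.n + S ∧ e ∈ x.set S then 1 else 0
  | 2 => if h : 0 ≤ y ∧ y.toNat < x.n then ((x.cost ⟨y.toNat, h.2⟩).num : ℤ) else 0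
  | 3 => if h : 0 ≤ y ∧ y.toNat < x.n then ((x.cost ⟨y.toNat, h.2⟩).den : ℤ) else 0
  | _ => 0

/-- The collection described by the characteristic vector in array `4`. -/
def decode (x : RatInstance) (M : PRAM.Mem) : Finset (Fin x.n) :=
  Finset.univ.filter (fun S => M 4 ((S : ℕ) : ℤ) = 1)

end RatInstance

/-! The forward phase is fast, independently of the frequencies, because the penalties grow
geometrically within an epoch. A set with a participating element has not been added, so its dual
constraint is filled to less than 1/8. Suppose all penalties are at least p. If S still has
participating elements after an iteration, then all its d(S) participating elements were raised by
at least p and the constraint is nevertheless filled to less than 1/8, so d(S)p < w(S)/8. The new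
penalty is at least 7w(S)/8 divided by a number that is at most d(S), hence at least 7p
(`PenaltyBound.step`). At the start of an epoch the penalties are at least 7w_min/(8m)
(`PenaltyBound.init`), and no penalty exceeds w_max, which bounds the number of iterations
(`EpochRun.pow_mul_le`, `ForwardRun.sum_le`).

The reverse-delete phase rests on two facts about one pruning run on a collection X. The elements
whose petals are collected never share a set of X (`PruneRun.exists_petals`): within a layer by
independence, and across layers because the petals of b cover everything in the later layers that
shares a set with b. If e lies in the layer where the run starts, the SNC property of e replaces the
collected sets through e by at most τ of them, and each of these contains at most one chosen
element; so at most τ elements contribute petals through e, at most τ petals each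
(`PruneRun.card_filter_le`). The bound τ² survives the later steps of the reverse phase, because
sets added in an epoch k < i contain no element that is still uncovered when epoch i starts
(`ReverseRun.inv`), and elements with positive dual variable are of this kind
(`ForwardRun.exists_of_alpha_pos`). Charging the costs to the dual variables and weak duality give
the factor 8τ² (`ReverseRun.totalCost_le`).

With β the threshold, the cheap sets that are chosen cost at most β in total, and β is at most the
cost of any cover. The remaining costs lie between β/m and mβ, so the ratio of costs is at most m².
Discarding sets dearer than mβ does not hurt the dual bound: a cover using such a set already costs
more than the whole dual solution (`sum_dual_reduced_le`).

For the NC statement the running time of a program is bounded syntactically by a power of the number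
of iterations per loop (`Prog.timeBound_le`), so only polylogarithmic loop counts, polynomially many
processors and polynomial word length have to be ensured. Sums, products, extrema and quantifiers
are balanced folds (`exists_runs_fold`). Since τ is fixed, SNC elements and petals are found by
trying all tuples of sets, coded as numbers in base R; non-SNC elements are recognized by τ + 1 sets
with private elements (`isSNCElement_iff`). Maximal independent sets come from a derandomized
sampling scheme: with pairwise independent marks some seed decides a constant fraction of the
vertices of large degree (`PairwiseSampling.exists_seed`), and all seeds are tried at once. The dual
variables are kept as integers by multiplying the scale by m! in every iteration, so that the
divisions by d(S) ≤ m are exact (`FwdCore.raiseStage`). -/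

set_option linter.unusedSectionVars false

namespace SetSystem

variable {E I : Type*} [DecidableEq E] [DecidableEq I] {sys : SetSystem E I}

/-! ### Layers -/

lemma mem_covered {P : Finset I} {e : E} : e ∈ sys.covered P ↔ ∃ S ∈ P, e ∈ sys.set S := by
  simp [covered]

lemma covered_mono {P Q : Finset I} (h : P ⊆ Q) : sys.covered P ⊆ sys.covered Q :=
  Finset.biUnion_subset_biUnion_of_subset_left _ h

lemma covered_union (P Q : Finset I) :
    sys.covered (P ∪ Q) = sys.covered P ∪ sys.covered Q := by
  ext e; simp only [mem_covered, Finset.mem_union]; grind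

/-- The same subcollection works: the covering identity is merely intersected with a smaller set. -/
lemma IsSNCElement.mono {τ : ℕ} {X X' : Finset E} {e : E} (h : sys.IsSNCElement τ X e)
    (hX : X' ⊆ X) (he : e ∈ X') : sys.IsSNCElement τ X' e := by
  refine ⟨he, fun P hP hPe => ?_⟩
  obtain ⟨P', h1, h2, h3⟩ := h.2 P hP hPe
  refine ⟨P', h1, h2, ?_⟩
  ext x
  have := Finset.ext_iff.1 h3 x
  simp only [Finset.mem_inter] at this ⊢
  have := @hX x
  tauto

lemma remaining_succ_subset (τ k : ℕ) : sys.remaining τ (k + 1) ⊆ sys.remaining τ k := by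
  classical
  exact Finset.filter_subset _ _

lemma remaining_anti (τ : ℕ) {j k : ℕ} (h : j ≤ k) : sys.remaining τ k ⊆ sys.remaining τ j := by
  induction k, h using Nat.le_induction with
  | base => exact subset_rfl
  | succ k _ ih => exact (remaining_succ_subset τ k).trans ih

lemma remaining_subset_univ (τ k : ℕ) : sys.remaining τ k ⊆ sys.univ :=
  remaining_anti τ (Nat.zero_le k)

lemma mem_remaining_succ {τ k : ℕ} {e : E} : e ∈ sys.remaining τ (k + 1) ↔
    e ∈ sys.remaining τ k ∧ ¬ sys.IsSNCElement τ (sys.remaining τ k) e := by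
  simp [remaining]

lemma mem_layer {τ k : ℕ} {e : E} :
    e ∈ sys.layer τ k ↔ sys.IsSNCElement τ (sys.remaining τ k) e := by
  simp only [layer, Finset.mem_filter]
  exact ⟨fun h => h.2, fun h => ⟨h.1, h⟩⟩

lemma layer_subset_remaining (τ k : ℕ) : sys.layer τ k ⊆ sys.remaining τ k :=
  fun _ h => (mem_layer.1 h).1

lemma layer_subset_univ (τ k : ℕ) : sys.layer τ k ⊆ sys.univ :=
  (layer_subset_remaining τ k).trans (remaining_subset_univ τ k)

lemma mem_layer_or_remaining {τ k : ℕ} {e : E} (h : e ∈ sys.remaining τ k) :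
    e ∈ sys.layer τ k ∨ e ∈ sys.remaining τ (k + 1) := by
  rw [mem_layer, mem_remaining_succ]; tauto

lemma notMem_remaining_succ_of_mem_layer {τ k : ℕ} {e : E} (h : e ∈ sys.layer τ k) :
    e ∉ sys.remaining τ (k + 1) := by
  rw [mem_layer] at h; rw [mem_remaining_succ]; tauto

lemma exists_layer_lt {τ k : ℕ} {e : E} (he : e ∈ sys.univ) (h : e ∉ sys.remaining τ k) :
    ∃ i < k, e ∈ sys.layer τ i := by
  induction k with
  | zero => exact absurd he h
  | succ k ih =>
    by_cases hk : e ∈ sys.remaining τ k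
    · exact ⟨k, k.lt_succ_self, (mem_layer_or_remaining hk).resolve_right h⟩
    · obtain ⟨i, hi, h'⟩ := ih hk
      exact ⟨i, hi.trans k.lt_succ_self, h'⟩

lemma layer_unique {τ j k : ℕ} {e : E} (hj : e ∈ sys.layer τ j) (hk : e ∈ sys.layer τ k) :
    j = k := by
  by_contra hne
  rcases lt_or_gt_of_ne hne with h | h
  · exact notMem_remaining_succ_of_mem_layer hj
      (remaining_anti τ h (layer_subset_remaining τ k hk))
  · exact notMem_remaining_succ_of_mem_layer hk
      (remaining_anti τ h (layer_subset_remaining τ j hj))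

/-- While elements are left, the next layer is nonempty, so the cardinality of the remainder drops
strictly. This makes the infimum in `decompLength` an attained one. -/
lemma IsSNC.exists_remaining_eq_empty {τ : ℕ} (h : sys.IsSNC τ) : ∃ k, sys.remaining τ k = ∅ := by
  by_contra! hne
  have key : ∀ k, (sys.remaining τ k).card + k ≤ sys.univ.card := by
    intro k
    induction k with
    | zero => simp [remaining]
    | succ k ih =>
      have : sys.remaining τ (k + 1) ⊂ sys.remaining τ k := by
        refine (Finset.ssubset_iff_of_subset (remaining_succ_subset τ k)).2 ?_
        obtain ⟨e, he⟩ := h _ (remaining_subset_univ τ k) (hne k)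
        exact ⟨e, he.1, fun h' => (mem_remaining_succ.1 h').2 he⟩
      have := Finset.card_lt_card this
      omega
  have := key (sys.univ.card + 1)
  omega

lemma IsSNC.remaining_decompLength {τ : ℕ} (h : sys.IsSNC τ) :
    sys.remaining τ (sys.decompLength τ) = ∅ :=
  Nat.sInf_mem (s := {k | sys.remaining τ k = ∅}) h.exists_remaining_eq_empty

lemma remaining_nonempty_of_lt {τ k : ℕ} (h : k < sys.decompLength τ) :
    (sys.remaining τ k).Nonempty := by
  rw [Finset.nonempty_iff_ne_empty]
  exact Nat.notMem_of_lt_sInf (s := {k | sys.remaining τ k = ∅}) h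

lemma IsSNC.exists_layer {τ : ℕ} (h : sys.IsSNC τ) {e : E} (he : e ∈ sys.univ) :
    ∃ i < sys.decompLength τ, e ∈ sys.layer τ i :=
  exists_layer_lt he (by simp [h.remaining_decompLength])

/-! ### The forward phase -/

/-- What holds for every state of the forward phase. -/
structure FwdInv (sys : SetSystem E I) (st : FwdState E I) : Prop where
  subset : st.A ⊆ sys.fam
  nonneg : ∀ e, 0 ≤ st.α e
  dual : ∀ S ∈ sys.fam, ∑ e ∈ sys.set S, st.α e ≤ sys.cost S
  tight : ∀ S ∈ st.A, sys.cost S / 8 ≤ ∑ e ∈ sys.set S, st.α e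
  slack : ∀ S ∈ sys.fam, S ∉ st.A → ∑ e ∈ sys.set S, st.α e < sys.cost S / 8

/-- `p` bounds the penalties of all sets with participating elements from below. -/
def PenaltyBound (sys : SetSystem E I) (Z : Finset E) (p : ℝ) (st : FwdState E I) : Prop :=
  0 ≤ p ∧ ∀ S ∈ sys.fam, (sys.set S ∩ sys.active Z st).Nonempty → p ≤ sys.penalty Z st S

section forward

variable {Z : Finset E} {st : FwdState E I}

/-- Positive costs are needed for `slack`: a free set would be tight before the first iteration
without having been added. -/
lemma FwdInv.init (hc : ∀ S ∈ sys.fam, 0 < sys.cost S) :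
    FwdInv sys (⟨∅, fun _ => 0⟩ : FwdState E I) where
  subset := by simp
  nonneg := by simp
  dual S hS := by simpa using (hc S hS).le
  tight := by simp
  slack S hS _ := by have := hc S hS; simp; linarith

lemma FwdInv.penalty_nonneg (h : FwdInv sys st) {S : I} (hS : S ∈ sys.fam) :
    0 ≤ sys.penalty Z st S :=
  div_nonneg (sub_nonneg.2 (h.dual S hS)) (Nat.cast_nonneg _)

lemma finite_penalties (e : E) :
    (sys.penalty Z st '' {S | S ∈ sys.fam ∧ e ∈ sys.set S}).Finite :=
  (sys.fam.finite_toSet.subset fun _ h => h.1).image _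

lemma FwdInv.minPenalty_nonneg (h : FwdInv sys st) (e : E) : 0 ≤ sys.minPenalty Z st e := by
  apply Real.sInf_nonneg
  rintro _ ⟨S, hS, rfl⟩
  exact h.penalty_nonneg hS.1

lemma minPenalty_le {S : I} {e : E} (hS : S ∈ sys.fam) (he : e ∈ sys.set S) :
    sys.minPenalty Z st e ≤ sys.penalty Z st S :=
  csInf_le (finite_penalties e).bddBelow ⟨S, ⟨hS, he⟩, rfl⟩

lemma exists_minPenalty (hf : sys.Feasible) {e : E} (he : e ∈ sys.univ) :
    ∃ S ∈ sys.fam, e ∈ sys.set S ∧ sys.minPenalty Z st e = sys.penalty Z st S := by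
  obtain ⟨S, hS, heS⟩ := hf e he
  obtain ⟨T, hT, h⟩ := Set.Nonempty.csInf_mem
    (s := sys.penalty Z st '' {S | S ∈ sys.fam ∧ e ∈ sys.set S}) ⟨_, S, ⟨hS, heS⟩, rfl⟩
    (finite_penalties e)
  exact ⟨T, hT.1, hT.2, h.symm⟩

lemma sum_raise (S : I) : ∑ e ∈ sys.set S, sys.raise Z st e =
    ∑ e ∈ sys.set S, st.α e + ∑ e ∈ sys.set S ∩ sys.active Z st, sys.minPenalty Z st e := by
  rw [← Finset.filter_mem_eq_inter, Finset.sum_filter, ← Finset.sum_add_distrib]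
  refine Finset.sum_congr rfl fun e _ => ?_
  unfold raise; split_ifs <;> simp

lemma FwdInv.raise_nonneg (h : FwdInv sys st) (e : E) : 0 ≤ sys.raise Z st e := by
  unfold raise
  split_ifs
  · exact add_nonneg (h.nonneg e) (h.minPenalty_nonneg e)
  · exact h.nonneg e

lemma FwdInv.le_raise (h : FwdInv sys st) (e : E) : st.α e ≤ sys.raise Z st e := by
  unfold raise
  split_ifs
  · exact le_add_of_nonneg_right (h.minPenalty_nonneg e)
  · exact le_rfl

/-- Each of the d(S) participating elements of S rises by at most the penalty of S, which is the
slack of S divided by d(S). -/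
lemma FwdInv.sum_raise_le (h : FwdInv sys st) {S : I} (hS : S ∈ sys.fam) :
    ∑ e ∈ sys.set S, sys.raise Z st e ≤ sys.cost S := by
  rw [sum_raise]
  have h1 : ∑ e ∈ sys.set S ∩ sys.active Z st, sys.minPenalty Z st e ≤
      (sys.set S ∩ sys.active Z st).card • sys.penalty Z st S :=
    Finset.sum_le_card_nsmul _ _ _ fun e he => minPenalty_le hS (Finset.mem_inter.1 he).1
  have h2 := h.dual S hS
  rcases Nat.eq_zero_or_pos (sys.set S ∩ sys.active Z st).card with h0 | h0
  · rw [h0, zero_smul] at h1; linarith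
  · rw [nsmul_eq_mul, penalty, mul_div_cancel₀ _ (by positivity)] at h1; linarith

lemma mem_fwdStep_A {S : I} : S ∈ (sys.fwdStep Z st).A ↔ S ∈ st.A ∨ S ∈ sys.fam ∧ S ∉ st.A ∧
    sys.cost S / 8 ≤ ∑ e ∈ sys.set S, sys.raise Z st e := by
  simp [fwdStep, and_assoc]

lemma subset_fwdStep_A : st.A ⊆ (sys.fwdStep Z st).A := Finset.subset_union_left

lemma FwdInv.step (h : FwdInv sys st) : FwdInv sys (sys.fwdStep Z st) where
  subset S hS := by
    rcases mem_fwdStep_A.1 hS with hS | hS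
    exacts [h.subset hS, hS.1]
  nonneg e := h.raise_nonneg e
  dual S hS := h.sum_raise_le hS
  tight S hS := by
    rcases mem_fwdStep_A.1 hS with hS | hS
    · exact (h.tight S hS).trans (Finset.sum_le_sum fun e _ => h.le_raise e)
    · exact hS.2.2
  slack S hS hS' := by
    rw [mem_fwdStep_A] at hS'
    push Not at hS'
    exact hS'.2 hS hS'.1

lemma active_fwdStep_subset : sys.active Z (sys.fwdStep Z st) ⊆ sys.active Z st :=
  Finset.sdiff_subset_sdiff subset_rfl (covered_mono subset_fwdStep_A)

/-- A set with an uncovered element has not been added, so more than 7/8 of its cost is slack, and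
at most m elements share it. No history is used, so the bound is available at the start of every
epoch. -/
lemma PenaltyBound.init (h : FwdInv sys st) {lo : ℝ} (hlo : 0 < lo)
    (hl : ∀ S ∈ sys.fam, lo ≤ sys.cost S) :
    PenaltyBound sys Z (7 / 8 * lo / sys.univ.card) st := by
  refine ⟨by positivity, fun S hS hne => ?_⟩
  obtain ⟨e, he⟩ := hne
  have hSA : S ∉ st.A := fun hA => by
    simp only [Finset.mem_inter, active, Finset.mem_sdiff, mem_covered] at he
    exact he.2.2 ⟨S, hA, he.1⟩
  have h1 := h.slack S hS hSA
  have h2 := hl S hS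
  have h3 : 0 < (sys.set S ∩ sys.active Z st).card := Finset.card_pos.2 ⟨e, he⟩
  have h4 : (sys.set S ∩ sys.active Z st).card ≤ sys.univ.card :=
    Finset.card_le_card (Finset.inter_subset_left.trans (sys.set_subset S hS))
  unfold penalty
  apply div_le_div₀ <;> first | positivity | skip
  · linarith
  · linarith
  · exact_mod_cast h4

/-- The gain per iteration. A set that survives has received at least d·p and is still filled to
less than 1/8 of its cost, hence d·p < cost/8; its new slack exceeds 7/8 of the cost, that is 7d·p,
and is shared by at most d elements. -/
lemma PenaltyBound.step (h : FwdInv sys st) (hf : sys.Feasible) (hZ : Z ⊆ sys.univ) {p : ℝ}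
    (hp : PenaltyBound sys Z p st) :
    PenaltyBound sys Z (7 * p) (sys.fwdStep Z st) := by
  refine ⟨by linarith [hp.1], fun S hS hne => ?_⟩
  have hne' : (sys.set S ∩ sys.active Z st).Nonempty :=
    hne.mono (Finset.inter_subset_inter subset_rfl active_fwdStep_subset)
  obtain ⟨e, he⟩ := hne
  have hSA : S ∉ (sys.fwdStep Z st).A := fun hA => by
    simp only [Finset.mem_inter, active, Finset.mem_sdiff, mem_covered] at he
    exact he.2.2 ⟨S, hA, he.1⟩
  have h1 := (h.step (Z := Z)).slack S hS hSA
  have hSA' : S ∉ st.A := fun h' => hSA (subset_fwdStep_A h')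
  have h1' := h.slack S hS hSA'
  have hcard : (0 : ℝ) < (sys.set S ∩ sys.active Z st).card := by
    exact_mod_cast Finset.card_pos.2 hne'
  have hcard2 : (0 : ℝ) < (sys.set S ∩ sys.active Z (sys.fwdStep Z st)).card := by
    exact_mod_cast Finset.card_pos.2 ⟨e, he⟩
  have hcard3 : ((sys.set S ∩ sys.active Z (sys.fwdStep Z st)).card : ℝ) ≤
      (sys.set S ∩ sys.active Z st).card := by
    exact_mod_cast Finset.card_le_card
      (Finset.inter_subset_inter subset_rfl active_fwdStep_subset)
  have hpos : 0 ≤ ∑ e ∈ sys.set S, st.α e := Finset.sum_nonneg fun e _ => h.nonneg e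
  set d : ℝ := ((sys.set S ∩ sys.active Z st).card : ℝ)
  -- The minimal penalty of a participating element is attained at a set that has this participating
  -- element, so p bounds it from below.
  have h2 : d * p ≤ ∑ e ∈ sys.set S ∩ sys.active Z st, sys.minPenalty Z st e := by
    rw [← nsmul_eq_mul]
    refine Finset.card_nsmul_le_sum _ _ _ fun x hx => ?_
    have hxa := (Finset.mem_inter.1 hx).2
    obtain ⟨T, hT, hxT, hmin⟩ := exists_minPenalty (Z := Z) (st := st) hf
      (hZ (Finset.mem_sdiff.1 hxa).1)
    rw [hmin]
    exact hp.2 T hT ⟨x, Finset.mem_inter.2 ⟨hxT, hxa⟩⟩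
  have h3 : ∑ e ∈ sys.set S, (sys.fwdStep Z st).α e = ∑ e ∈ sys.set S, sys.raise Z st e := rfl
  have h4 := sum_raise (sys := sys) (Z := Z) (st := st) S
  unfold penalty
  rw [le_div_iff₀ hcard2]
  have h5 : 7 * p * (sys.set S ∩ sys.active Z (sys.fwdStep Z st)).card ≤ 7 * p * d :=
    mul_le_mul_of_nonneg_left hcard3 (by linarith [hp.1])
  linarith

lemma EpochRun.inv {t : ℕ} {st' : FwdState E I} (h : sys.EpochRun Z st t st')
    (hi : FwdInv sys st) : FwdInv sys st' := by
  induction h with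
  | done => exact hi
  | step _ _ _ _ _ ih => exact ih hi.step

lemma EpochRun.subset {t : ℕ} {st' : FwdState E I} (h : sys.EpochRun Z st t st') :
    st.A ⊆ st'.A := by
  induction h with
  | done => exact subset_rfl
  | step _ _ _ _ _ ih => exact subset_fwdStep_A.trans ih

lemma EpochRun.covers {t : ℕ} {st' : FwdState E I} (h : sys.EpochRun Z st t st') :
    Z ⊆ sys.covered st'.A := by
  induction h with
  | done _ h => exact h
  | step _ _ _ _ _ ih => exact ih

lemma EpochRun.alpha_eq {t : ℕ} {st' : FwdState E I} (h : sys.EpochRun Z st t st') {e : E}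
    (he : e ∉ sys.active Z st) : st'.α e = st.α e := by
  induction h with
  | done => rfl
  | step st st' t _ _ ih =>
    rw [ih fun h' => he (active_fwdStep_subset h')]
    simp [fwdStep, raise, he]

/-- Any set through an uncovered element has d ≥ 1, so its penalty is at most its cost. This is the
ceiling that stops the geometric growth. -/
lemma PenaltyBound.le_of_active (h : FwdInv sys st) (hf : sys.Feasible) (hZ : Z ⊆ sys.univ)
    {p hi : ℝ} (hp : PenaltyBound sys Z p st) (hhi : ∀ S ∈ sys.fam, sys.cost S ≤ hi)
    (hne : ¬ Z ⊆ sys.covered st.A) : p ≤ hi := by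
  obtain ⟨e, heZ, he⟩ := Finset.not_subset.1 hne
  obtain ⟨S, hS, heS⟩ := hf e (hZ heZ)
  have hmem : e ∈ sys.set S ∩ sys.active Z st :=
    Finset.mem_inter.2 ⟨heS, Finset.mem_sdiff.2 ⟨heZ, he⟩⟩
  refine (hp.2 S hS ⟨e, hmem⟩).trans (le_trans ?_ (hhi S hS))
  have h1 : (1 : ℝ) ≤ (sys.set S ∩ sys.active Z st).card := by
    exact_mod_cast Finset.card_pos.2 ⟨e, hmem⟩
  have h2 : 0 ≤ ∑ e ∈ sys.set S, st.α e := Finset.sum_nonneg fun e _ => h.nonneg e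
  have h3 := h.dual S hS
  exact (div_le_self (by linarith) h1).trans (by linarith)

/-- The ceiling applies whenever an iteration is still started, that is up to the lower bound
reached after t - 1 iterations; this accounts for the factor 7 on the right and for the separate
case of no iteration. -/
lemma EpochRun.iterations_le {t : ℕ} {st' : FwdState E I} (h : sys.EpochRun Z st t st')
    (hI : FwdInv sys st) (hf : sys.Feasible) (hZ : Z ⊆ sys.univ)
    {p hi : ℝ} (hp : PenaltyBound sys Z p st) (hhi : ∀ S ∈ sys.fam, sys.cost S ≤ hi) :
    t = 0 ∨ 7 ^ t * p ≤ 7 * hi := by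
  induction h generalizing p with
  | done => exact Or.inl rfl
  | step st st' t hne _ ih =>
    right
    have h1 := hp.le_of_active hI hf hZ hhi hne
    rcases ih hI.step (hp.step hI hf hZ) with rfl | h2
    · simpa using h1
    · rw [pow_succ]; linarith

/-- Here n is fuel: when it is used up, the lower bound on the penalties is above every cost, so
nothing can be uncovered. -/
lemma exists_epochRun (hI : FwdInv sys st) (hf : sys.Feasible) (hZ : Z ⊆ sys.univ)
    {p hi : ℝ} (hp : PenaltyBound sys Z p st) (hhi : ∀ S ∈ sys.fam, sys.cost S ≤ hi) (n : ℕ)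
    (hn : hi < 7 ^ n * p) : ∃ t st', sys.EpochRun Z st t st' := by
  induction n generalizing st p with
  | zero =>
    refine ⟨0, st, .done st ?_⟩
    by_contra hne
    have := hp.le_of_active hI hf hZ hhi hne
    simp at hn; linarith
  | succ n ih =>
    by_cases hne : Z ⊆ sys.covered st.A
    · exact ⟨0, st, .done st hne⟩
    · obtain ⟨t, st', h⟩ := ih hI.step (hp.step hI hf hZ) (by rw [pow_succ] at hn; linarith)
      exact ⟨t + 1, st', .step st st' t hne h⟩

lemma EpochRun.pow_mul_le {t : ℕ} {st' : FwdState E I} (h : sys.EpochRun Z st t st')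
    (hI : FwdInv sys st) (hf : sys.Feasible) (hZ : Z ⊆ sys.univ) (hne : sys.univ.Nonempty)
    {lo hi : ℝ} (hlo : 0 < lo) (hl : ∀ S ∈ sys.fam, lo ≤ sys.cost S)
    (hhi : ∀ S ∈ sys.fam, sys.cost S ≤ hi) : 7 ^ t * lo ≤ 8 * sys.univ.card * hi := by
  have hm : (1 : ℝ) ≤ sys.univ.card := by exact_mod_cast Finset.card_pos.2 hne
  obtain ⟨e, he⟩ := hne
  obtain ⟨S, hS, -⟩ := hf e he
  have hlh : lo ≤ hi := (hl S hS).trans (hhi S hS)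
  -- With no iteration the claim only needs lo ≤ hi and m ≥ 1. Otherwise the initial bound 7lo/(8m)
  -- is inserted, and the two factors 7 cancel.
  rcases h.iterations_le hI hf hZ (.init hI hlo hl) hhi with rfl | h'
  · nlinarith
  · rw [← mul_div_assoc, div_le_iff₀ (by linarith)] at h'
    linarith

lemma FwdInv.exists_epochRun (hI : FwdInv sys st) (hf : sys.Feasible)
    (hc : ∀ S ∈ sys.fam, 0 < sys.cost S) (hZ : Z ⊆ sys.univ) :
    ∃ t st', sys.EpochRun Z st t st' := by
  rcases sys.univ.eq_empty_or_nonempty with h0 | hne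
  · rw [h0, Finset.subset_empty] at hZ
    exact ⟨0, st, .done st (by simp [hZ])⟩
  · obtain ⟨e, he⟩ := hne
    obtain ⟨S, hS, -⟩ := hf e he
    have hfam : sys.fam.Nonempty := ⟨S, hS⟩
    obtain ⟨S₀, hS₀, hmin⟩ := Finset.exists_min_image sys.fam sys.cost hfam
    obtain ⟨S₁, hS₁, hmax⟩ := Finset.exists_max_image sys.fam sys.cost hfam
    have hp := PenaltyBound.init (Z := Z) hI (hc S₀ hS₀) hmin
    have hpos : 0 < 7 / 8 * sys.cost S₀ / sys.univ.card := by
      have := hc S₀ hS₀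
      have : 0 < sys.univ.card := Finset.card_pos.2 ⟨e, he⟩
      positivity
    obtain ⟨n, hn⟩ := pow_unbounded_of_one_lt (sys.cost S₁ / (7 / 8 * sys.cost S₀ / sys.univ.card))
      (by norm_num : (1 : ℝ) < 7)
    rw [div_lt_iff₀ hpos] at hn
    exact SetSystem.exists_epochRun hI hf hZ hp hmax n hn

end forward

section forwardRun

variable {τ : ℕ} {σ : ℕ → FwdState E I} {t : ℕ → ℕ}

/-- Termination of an epoch needs the invariant, so the recursion runs over states bundled with it.
The epochs beyond the last layer are defined as well, which is harmless. -/
lemma exists_forwardRun (hf : sys.Feasible) (hc : ∀ S ∈ sys.fam, 0 < sys.cost S) (τ : ℕ) :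
    ∃ σ t, sys.ForwardRun τ σ t := by
  have H : ∀ (k : ℕ) (st : {st : FwdState E I // FwdInv sys st}),
      ∃ (t : ℕ) (st' : {st : FwdState E I // FwdInv sys st}),
        sys.EpochRun (sys.layer τ k) st.1 t st'.1 := by
    intro k st
    obtain ⟨t, st', h⟩ := st.2.exists_epochRun hf hc (layer_subset_univ τ k)
    exact ⟨t, ⟨st', h.inv st.2⟩, h⟩
  choose tf nf hn using H
  let σ : ℕ → {st : FwdState E I // FwdInv sys st} := fun k =>
    Nat.rec ⟨_, FwdInv.init hc⟩ nf k
  exact ⟨fun k => (σ k).1, fun k => tf k (σ k), rfl, fun k _ => hn k (σ k)⟩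

lemma ForwardRun.inv (h : sys.ForwardRun τ σ t) (hc : ∀ S ∈ sys.fam, 0 < sys.cost S) {k : ℕ}
    (hk : k ≤ sys.decompLength τ) : FwdInv sys (σ k) := by
  induction k with
  | zero => rw [h.1]; exact .init hc
  | succ k ih => exact (h.2 k hk).inv (ih (Nat.le_of_succ_le hk))

lemma ForwardRun.mono (h : sys.ForwardRun τ σ t) {j k : ℕ} (hjk : j ≤ k)
    (hk : k ≤ sys.decompLength τ) : (σ j).A ⊆ (σ k).A := by
  induction k, hjk using Nat.le_induction with
  | base => exact subset_rfl
  | succ k _ ih => exact (ih (Nat.le_of_succ_le hk)).trans (h.2 k hk).subset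

lemma ForwardRun.layer_subset (h : sys.ForwardRun τ σ t) {j k : ℕ} (hjk : j < k)
    (hk : k ≤ sys.decompLength τ) : sys.layer τ j ⊆ sys.covered (σ k).A :=
  (h.2 j (hjk.trans_le hk)).covers.trans (covered_mono (h.mono hjk hk))

lemma ForwardRun.univ_subset (h : sys.ForwardRun τ σ t) (hs : sys.IsSNC τ) :
    sys.univ ⊆ sys.covered (σ (sys.decompLength τ)).A := fun e he => by
  obtain ⟨i, hi, hei⟩ := hs.exists_layer he
  exact h.layer_subset hi le_rfl hei

lemma ForwardRun.isMaximalPair (h : sys.ForwardRun τ σ t) (hs : sys.IsSNC τ)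
    (hc : ∀ S ∈ sys.fam, 0 < sys.cost S) :
    sys.IsMaximalPair (1 / 8) (σ (sys.decompLength τ)).A (σ (sys.decompLength τ)).α := by
  have hi := h.inv hc le_rfl
  refine ⟨⟨hi.subset, h.univ_subset hs⟩, ⟨fun e _ => hi.nonneg e, hi.dual⟩, fun S hS => ?_⟩
  have := hi.tight S hS
  linarith

/-- A dual variable is only raised in the epoch of its own layer, and only if the element was
uncovered when that epoch began. The frequency bound of the reverse phase is stated for exactly
these elements. -/
lemma ForwardRun.exists_of_alpha_pos (h : sys.ForwardRun τ σ t) {e : E} {k : ℕ}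
    (hk : k ≤ sys.decompLength τ) (he : 0 < (σ k).α e) :
    ∃ i < k, e ∈ sys.layer τ i ∧ e ∉ sys.covered (σ i).A := by
  induction k with
  | zero => rw [h.1] at he; simp at he
  | succ k ih =>
    by_cases hact : e ∈ sys.active (sys.layer τ k) (σ k)
    · exact ⟨k, k.lt_succ_self, Finset.mem_sdiff.1 hact⟩
    · rw [(h.2 k hk).alpha_eq hact] at he
      obtain ⟨i, hi, h'⟩ := ih (Nat.le_of_succ_le hk) he
      exact ⟨i, hi.trans k.lt_succ_self, h'⟩

lemma ForwardRun.pow_mul_le (h : sys.ForwardRun τ σ t) (hf : sys.Feasible) {lo hi : ℝ}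
    (hlo : 0 < lo) (hl : ∀ S ∈ sys.fam, lo ≤ sys.cost S) (hhi : ∀ S ∈ sys.fam, sys.cost S ≤ hi)
    {k : ℕ} (hk : k < sys.decompLength τ) : 7 ^ t k * lo ≤ 8 * sys.univ.card * hi :=
  (h.2 k hk).pow_mul_le (h.inv (fun S hS => hlo.trans_le (hl S hS)) hk.le) hf
    (layer_subset_univ τ k) ((remaining_nonempty_of_lt hk).mono (remaining_subset_univ τ k))
    hlo hl hhi

lemma ForwardRun.sum_le (h : sys.ForwardRun τ σ t) (hf : sys.Feasible)
    (hc : ∀ S ∈ sys.fam, 0 < sys.cost S) {ρ : ℝ}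
    (hρ : ∀ S ∈ sys.fam, ∀ S' ∈ sys.fam, sys.cost S ≤ ρ * sys.cost S') :
    ((∑ k ∈ Finset.range (sys.decompLength τ), t k : ℕ) : ℝ) ≤
      3 * sys.decompLength τ * (1 + Real.log sys.univ.card + Real.log ρ) := by
  rcases Nat.eq_zero_or_pos (sys.decompLength τ) with h0 | hL
  · simp [h0]
  have hne : sys.univ.Nonempty := (remaining_nonempty_of_lt hL).mono (remaining_subset_univ τ 0)
  have hm : (1 : ℝ) ≤ sys.univ.card := by exact_mod_cast Finset.card_pos.2 hne
  obtain ⟨e, he⟩ := hne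
  obtain ⟨S, hS, -⟩ := hf e he
  obtain ⟨S₀, hS₀, hmin⟩ := Finset.exists_min_image sys.fam sys.cost ⟨S, hS⟩
  have hc0 := hc S₀ hS₀
  -- Comparing a set with itself forces ρ ≥ 1, so that log ρ is nonnegative.
  have hρ1 : 1 ≤ ρ := by
    have := hρ S₀ hS₀ S₀ hS₀
    by_contra! hlt
    nlinarith
  have key : ∀ k ∈ Finset.range (sys.decompLength τ),
      (t k : ℝ) ≤ 3 * (1 + Real.log sys.univ.card + Real.log ρ) := by
    intro k hk
    -- Taking logarithms in 7^t ≤ 8mρ, with log 7 ≥ 1 and log 8 ≤ 3, gives the constant 3.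
    have h1 := h.pow_mul_le hf hc0 hmin (fun S hS => hρ S hS S₀ hS₀) (Finset.mem_range.1 hk)
    have h2 : (7 : ℝ) ^ t k ≤ 8 * sys.univ.card * ρ := by
      have : (7 : ℝ) ^ t k * sys.cost S₀ ≤ 8 * sys.univ.card * ρ * sys.cost S₀ := by linarith
      exact le_of_mul_le_mul_right this hc0
    have h3 := Real.log_le_log (by positivity) h2
    rw [Real.log_pow, Real.log_mul (by positivity) (by positivity),
      Real.log_mul (by positivity) (by positivity)] at h3
    have h7 : (1 : ℝ) ≤ Real.log 7 := by
      rw [Real.le_log_iff_exp_le (by norm_num)]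
      linarith [Real.exp_one_lt_d9]
    have h8 : Real.log 8 ≤ 3 := by
      have : Real.log 8 = 3 * Real.log 2 := by
        rw [show (8 : ℝ) = 2 ^ 3 by norm_num, Real.log_pow]; norm_num
      rw [this]; linarith [Real.log_two_lt_d9]
    have hlm := Real.log_nonneg hm
    have hlρ := Real.log_nonneg hρ1
    have : (t k : ℝ) ≤ t k * Real.log 7 := le_mul_of_one_le_right (Nat.cast_nonneg _) h7
    linarith
  push_cast
  refine (Finset.sum_le_card_nsmul _ _ _ key).trans (le_of_eq ?_)
  rw [Finset.card_range, nsmul_eq_mul]; ring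

end forwardRun

end SetSystem

namespace SetSystem

variable {E I : Type*} [DecidableEq E] [DecidableEq I] {sys : SetSystem E I}

/-! ### The reverse-delete phase -/

lemma exists_isMIS (G : SimpleGraph E) (V : Finset E) : ∃ B, IsMIS G V B := by
  have hfin : {B : Finset E | B ⊆ V ∧ G.IsIndepSet (B : Set E)}.Finite :=
    V.powerset.finite_toSet.subset fun B h => by simpa using h.1
  obtain ⟨B, hB⟩ := hfin.exists_maximal ⟨∅, by simp⟩
  exact ⟨B, hB⟩

lemma IsMIS.exists_adj {G : SimpleGraph E} {V B : Finset E} (h : IsMIS G V B) {e : E}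
    (he : e ∈ V) : ∃ b ∈ B, b = e ∨ G.Adj b e := by
  by_contra! hcon
  have h1 : insert e B ⊆ V ∧ G.IsIndepSet ((insert e B : Finset E) : Set E) := by
    refine ⟨Finset.insert_subset he h.prop.1, ?_⟩
    rw [Finset.coe_insert, SimpleGraph.isIndepSet_iff, Set.pairwise_insert]
    exact ⟨h.prop.2, fun b hb _ => ⟨fun hadj => (hcon b hb).2 hadj.symm, (hcon b hb).2⟩⟩
  have h2 := h.le_of_ge h1 (Finset.subset_insert e B) (Finset.mem_insert_self e B)
  exact (hcon e h2).1 rfl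

/-- An element of layer j is SNC within everything from layer j on, and petals have to account for
exactly these layers. -/
lemma exists_isPetals {τ : ℕ} {X : Finset I} (hX : X ⊆ sys.fam) {j : ℕ} {e : E}
    (he : e ∈ sys.layer τ j) : ∃ Q, sys.IsPetals τ X j e Q := by
  obtain ⟨Q, h1, h2, h3⟩ := (mem_layer.1 he).2 (X.filter fun S => e ∈ sys.set S)
    ((Finset.filter_subset _ _).trans hX) (fun S hS => (Finset.mem_filter.1 hS).2)
  exact ⟨Q, h1, h2, h3⟩

lemma exists_pruneRun {τ : ℕ} {X : Finset I} (hX : X ⊆ sys.fam) (A : Finset E) (j : ℕ)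
    (Y : Finset I) : ∃ s Y', sys.PruneRun τ X A j Y s Y' := by
  induction h : sys.decompLength τ - j generalizing j Y with
  | zero => exact ⟨0, Y, .done j Y (by omega)⟩
  | succ n ih =>
    obtain ⟨B, hB⟩ := exists_isMIS (sys.conflictGraph X) ((A ∩ sys.layer τ j) \ sys.covered Y)
    have hBl : ∀ e ∈ B, e ∈ sys.layer τ j := fun e he =>
      (Finset.mem_inter.1 (Finset.mem_sdiff.1 (hB.prop.1 he)).1).2
    have : ∀ e, ∃ Q, e ∈ B → sys.IsPetals τ X j e Q := fun e => by
      by_cases he : e ∈ B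
      · obtain ⟨Q, hQ⟩ := exists_isPetals hX (hBl e he)
        exact ⟨Q, fun _ => hQ⟩
      · exact ⟨∅, fun h => absurd h he⟩
    choose petals hp using this
    obtain ⟨s, Y', hY⟩ := ih (j + 1) (Y ∪ B.biUnion petals) (by omega)
    exact ⟨s + 1, Y', .step j Y s Y' B petals (by omega) hB hp hY⟩

section prune

variable {τ : ℕ} {X : Finset I} {A : Finset E}

lemma PruneRun.count {j s : ℕ} {Y Y' : Finset I} (h : sys.PruneRun τ X A j Y s Y') :
    s = sys.decompLength τ - j := by
  induction h with
  | done j Y h => omega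
  | step j Y s Y' B petals hj _ _ _ ih => omega

lemma PruneRun.subset {j s : ℕ} {Y Y' : Finset I} (h : sys.PruneRun τ X A j Y s Y') :
    Y ⊆ Y' := by
  induction h with
  | done => exact subset_rfl
  | step j Y s Y' B petals _ _ _ _ ih => exact Finset.subset_union_left.trans ih

/-- The sets added by a pruning run are the petals of elements no two of which lie in a common set
of the collection that is pruned. -/
lemma PruneRun.exists_petals {j s : ℕ} {Y Y' : Finset I} (h : sys.PruneRun τ X A j Y s Y') :
    ∃ (Bs : Finset E) (pet : E → Finset I), Y' = Y ∪ Bs.biUnion pet ∧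
      (∀ b ∈ Bs, b ∈ sys.remaining τ j ∧ b ∉ sys.covered Y ∧
        pet b ⊆ X.filter (fun S => b ∈ sys.set S) ∧ (pet b).card ≤ τ) ∧
      ∀ b ∈ Bs, ∀ b' ∈ Bs, b ≠ b' → ∀ S ∈ X, b ∈ sys.set S → b' ∉ sys.set S := by
  induction h with
  | done => exact ⟨∅, fun _ => ∅, by simp, by simp, by simp⟩
  | step j Y s Y' B petals hj hB hp hr ih =>
    obtain ⟨Bs, pet, hY, h1, h2⟩ := ih
    have hBV : ∀ b ∈ B, b ∈ sys.layer τ j ∧ b ∉ sys.covered Y := fun b hb => by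
      have := hB.prop.1 hb
      simp only [Finset.mem_sdiff, Finset.mem_inter] at this
      tauto
    -- Elements chosen later lie in later layers, so the two choices of petals can be glued into one
    -- function.
    have hnot : ∀ b ∈ Bs, b ∉ B := fun b hb hbB =>
      notMem_remaining_succ_of_mem_layer (hBV b hbB).1 (h1 b hb).1
    -- The petals of b cover whatever the sets of X through b cover in the layers from j on. A later
    -- element sharing such a set with b would have been covered when its turn came, so it could not
    -- have been chosen.
    have hcross : ∀ b ∈ B, ∀ b' ∈ Bs, ∀ S ∈ X, b ∈ sys.set S → b' ∉ sys.set S := by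
      intro b hb b' hb' S hS hbS hb'S
      apply (h1 b' hb').2.1
      rw [covered_union, Finset.mem_union]
      right
      have h3 := (hp b hb).2.2
      have h4 : b' ∈ sys.covered (petals b) ∩ sys.remaining τ j := by
        rw [← h3, Finset.mem_inter, mem_covered]
        exact ⟨⟨S, Finset.mem_filter.2 ⟨hS, hbS⟩, hb'S⟩,
          remaining_succ_subset τ j (h1 b' hb').1⟩
      exact covered_mono (Finset.subset_biUnion_of_mem petals hb) (Finset.mem_inter.1 h4).1
    refine ⟨B ∪ Bs, fun b => if b ∈ B then petals b else pet b, ?_, ?_, ?_⟩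
    · rw [hY, Finset.union_assoc, Finset.union_biUnion]
      congr 2
      · exact Finset.biUnion_congr rfl fun b hb => by simp [hb]
      · exact Finset.biUnion_congr rfl fun b hb => by simp [hnot b hb]
    · intro b hb
      rcases Finset.mem_union.1 hb with hb | hb
      · simp only [hb, if_true]
        exact ⟨layer_subset_remaining τ j (hBV b hb).1, (hBV b hb).2, (hp b hb).1, (hp b hb).2.1⟩
      · simp only [hnot b hb, if_false]
        obtain ⟨h3, h4, h5⟩ := h1 b hb
        exact ⟨remaining_succ_subset τ j h3,
          fun h' => h4 (covered_mono Finset.subset_union_left h'), h5⟩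
    · intro b hb b' hb' hne S hS hbS hb'S
      rcases Finset.mem_union.1 hb with hb | hb <;> rcases Finset.mem_union.1 hb' with hb' | hb'
      · exact hB.prop.2 hb hb' hne ⟨hne, S, hS, hbS, hb'S⟩
      · exact hcross b hb b' hb' S hS hbS hb'S
      · exact hcross b' hb' b hb S hS hb'S hbS
      · exact h2 b hb b' hb' hne S hS hbS hb'S

lemma PruneRun.subset_union {j s : ℕ} {Y Y' : Finset I} (h : sys.PruneRun τ X A j Y s Y') :
    Y' ⊆ Y ∪ X := by
  obtain ⟨Bs, pet, hY, h1, -⟩ := h.exists_petals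
  rw [hY]
  exact Finset.union_subset_union subset_rfl (Finset.biUnion_subset.2 fun b hb =>
    (h1 b hb).2.2.1.trans (Finset.filter_subset _ _))

/-- When its layer is processed, an element of A is already covered, or it equals or is adjacent to
a chosen b. In the latter cases it shares a set of X with b, and the petals of b cover it. The
covering of A by X is needed for the case that the element is itself chosen. -/
lemma PruneRun.covers (hs : sys.IsSNC τ) (hA : A ⊆ sys.covered X) {j s : ℕ} {Y Y' : Finset I}
    (h : sys.PruneRun τ X A j Y s Y') : A ∩ sys.remaining τ j ⊆ sys.covered Y' := by
  induction h with
  | done j Y hj =>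
    have : sys.remaining τ j = ∅ := by
      rw [← Finset.subset_empty, ← hs.remaining_decompLength]
      exact remaining_anti τ hj
    simp [this]
  | step j Y s Y' B petals hj hB hp hr ih =>
    intro e he
    obtain ⟨heA, hej⟩ := Finset.mem_inter.1 he
    rcases mem_layer_or_remaining hej with hl | hl
    · refine covered_mono hr.subset ?_
      rw [covered_union, Finset.mem_union]
      by_cases heY : e ∈ sys.covered Y
      · exact Or.inl heY
      right
      obtain ⟨b, hb, hbe⟩ := hB.exists_adj (e := e) (by simp [heA, hl, heY])
      have h1 : e ∈ sys.covered (X.filter fun S => b ∈ sys.set S) ∩ sys.remaining τ j := by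
        rw [Finset.mem_inter, mem_covered]
        refine ⟨?_, hej⟩
        rcases hbe with rfl | ⟨-, S, hS, hbS, heS⟩
        · obtain ⟨S, hS, heS⟩ := mem_covered.1 (hA heA)
          exact ⟨S, Finset.mem_filter.2 ⟨hS, heS⟩, heS⟩
        · exact ⟨S, Finset.mem_filter.2 ⟨hS, hbS⟩, heS⟩
      rw [(hp b hb).2.2] at h1
      exact covered_mono (Finset.subset_biUnion_of_mem petals hb) (Finset.mem_inter.1 h1).1
    · exact ih (Finset.mem_inter.2 ⟨heA, hl⟩)

/-- The SNC property is used twice, once for each factor τ: at e, to bound the number of chosen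
elements with a petal through e, and at each chosen element, to bound the number of its petals. It
is essential that the run starts at the layer of e, since then all chosen elements lie in the set
within which e is SNC. -/
lemma PruneRun.card_filter_le (hX : X ⊆ sys.fam) {j s : ℕ} {Y' : Finset I}
    (h : sys.PruneRun τ X A j ∅ s Y') {e : E} (he : e ∈ sys.layer τ j) :
    (Y'.filter fun S => e ∈ sys.set S).card ≤ τ ^ 2 := by
  obtain ⟨Bs, pet, hY, h1, h2⟩ := h.exists_petals
  rw [Finset.empty_union] at hY
  have hYX : Y' ⊆ X := by simpa using h.subset_union
  obtain ⟨P', hP', hcard, hcov⟩ := (mem_layer.1 he).2 (Y'.filter fun S => e ∈ sys.set S)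
    ((Finset.filter_subset _ _).trans (hYX.trans hX)) (fun S hS => (Finset.mem_filter.1 hS).2)
  set Be := Bs.filter fun b => ∃ S ∈ pet b, e ∈ sys.set S
  -- Every b in `Be` is covered by the collected sets through e, hence by the at most τ sets of
  -- `P'`. As these belong to X, none of them contains two chosen elements.
  have hBe : Be.card ≤ τ := by
    have : ∀ b ∈ Be, ∃ S ∈ P', b ∈ sys.set S := by
      intro b hb
      obtain ⟨hb, S, hS, heS⟩ := Finset.mem_filter.1 hb
      have hbS := (Finset.mem_filter.1 ((h1 b hb).2.2.1 hS)).2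
      have : b ∈ sys.covered P' ∩ sys.remaining τ j := by
        rw [← hcov, Finset.mem_inter, mem_covered]
        refine ⟨⟨S, Finset.mem_filter.2 ⟨?_, heS⟩, hbS⟩, (h1 b hb).1⟩
        rw [hY]; exact Finset.mem_biUnion.2 ⟨b, hb, hS⟩
      exact mem_covered.1 (Finset.mem_inter.1 this).1
    refine (Finset.card_le_card_of_forall_subsingleton (fun b S => b ∈ sys.set S) this
      fun S hS b hb b' hb' => ?_).trans hcard
    by_contra hne
    exact h2 b (Finset.mem_filter.1 hb.1).1 b' (Finset.mem_filter.1 hb'.1).1 hne S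
      (hYX (Finset.mem_filter.1 (hP' hS)).1) hb.2 hb'.2
  have hsub : (Y'.filter fun S => e ∈ sys.set S) ⊆ Be.biUnion pet := by
    intro S hS
    obtain ⟨hS, heS⟩ := Finset.mem_filter.1 hS
    rw [hY] at hS
    obtain ⟨b, hb, hbS⟩ := Finset.mem_biUnion.1 hS
    exact Finset.mem_biUnion.2 ⟨b, Finset.mem_filter.2 ⟨hb, S, hbS, heS⟩, hbS⟩
  calc _ ≤ (Be.biUnion pet).card := Finset.card_le_card hsub
    _ ≤ Be.card * τ := Finset.card_biUnion_le_card_mul _ _ _ fun b hb =>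
        (h1 b (Finset.mem_filter.1 hb).1).2.2.2
    _ ≤ τ ^ 2 := by rw [sq]; exact Nat.mul_le_mul_right _ hBe

end prune

section reverse

variable {τ : ℕ} {σ : ℕ → FwdState E I} {t : ℕ → ℕ}

/-- The fresh elements of the epochs telescope, by descending induction on k. -/
lemma mem_biUnion_freshElements (h : sys.ForwardRun τ σ t) {k : ℕ} {e : E}
    (hk : k ≤ sys.decompLength τ) :
    e ∈ (Finset.Ico k (sys.decompLength τ)).biUnion (sys.freshElements σ) ↔
      e ∈ sys.covered (σ (sys.decompLength τ)).A ∧ e ∉ sys.covered (σ k).A := by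
  induction hn : sys.decompLength τ - k generalizing k with
  | zero =>
    obtain rfl : k = sys.decompLength τ := by omega
    simp
  | succ n ih =>
    have hlt : k < sys.decompLength τ := by omega
    have hmono : (σ k).A ⊆ (σ (k + 1)).A := h.mono k.le_succ hlt
    rw [← Finset.insert_Ico_add_one_left_eq_Ico hlt,
      Finset.biUnion_insert, Finset.mem_union, ih (k := k + 1) hlt (by omega)]
    have h1 : (σ k).A ∪ addedSets σ k = (σ (k + 1)).A := Finset.union_sdiff_of_subset hmono
    have h2 : e ∈ sys.covered (σ (k + 1)).A ↔
        e ∈ sys.covered (σ k).A ∨ e ∈ sys.covered (addedSets σ k) := by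
      rw [← h1, covered_union, Finset.mem_union]
    have h3 := @covered_mono _ _ _ _ sys _ _ (h.mono (Nat.succ_le_of_lt hlt) le_rfl) e
    simp only [freshElements, Finset.mem_sdiff]
    tauto

lemma exists_reverseRun (hI : FwdInv sys (σ (sys.decompLength τ))) (h : sys.ForwardRun τ σ t)
    {k : ℕ} (hk : k ≤ sys.decompLength τ) :
    ∃ B s, sys.ReverseRun τ σ k B s ∧ B ⊆ (σ (sys.decompLength τ)).A := by
  induction hn : sys.decompLength τ - k generalizing k with
  | zero =>
    obtain rfl : k = sys.decompLength τ := by omega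
    exact ⟨∅, 0, .start, by simp⟩
  | succ n ih =>
    obtain ⟨B, s, hB, hsub⟩ := ih (k := k + 1) (by omega) (by omega)
    have hX : B ∪ addedSets σ k ⊆ (σ (sys.decompLength τ)).A :=
      Finset.union_subset hsub (Finset.sdiff_subset.trans (h.mono (by omega) le_rfl))
    obtain ⟨s', Y, hY⟩ := exists_pruneRun (τ := τ) (hX.trans hI.subset)
      ((Finset.Ico k (sys.decompLength τ)).biUnion (sys.freshElements σ)) k ∅
    exact ⟨Y, s + s', .step k B s Y s' hB hY, (by simpa using hY.subset_union : Y ⊆ _).trans hX⟩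

/-- The invariant of the reverse-delete phase. -/
structure RevInv (sys : SetSystem E I) (τ : ℕ) (σ : ℕ → FwdState E I) (k : ℕ) (B : Finset I)
    (s : ℕ) : Prop where
  le : k ≤ sys.decompLength τ
  subset : B ⊆ (σ (sys.decompLength τ)).A
  count : s ≤ (sys.decompLength τ - k) * sys.decompLength τ
  covers : (Finset.Ico k (sys.decompLength τ)).biUnion (sys.freshElements σ) ⊆ sys.covered B
  freq : ∀ i, k ≤ i → ∀ e ∈ sys.layer τ i, e ∉ sys.covered (σ i).A → i < sys.decompLength τ →
    (B.filter fun S => e ∈ sys.set S).card ≤ τ ^ 2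

lemma biUnion_fresh_subset_covered {k : ℕ} {B : Finset I} (hk : k < sys.decompLength τ)
    (hB : (Finset.Ico (k + 1) (sys.decompLength τ)).biUnion (sys.freshElements σ) ⊆
      sys.covered B) :
    (Finset.Ico k (sys.decompLength τ)).biUnion (sys.freshElements σ) ⊆
      sys.covered (B ∪ addedSets σ k) := by
  rw [← Finset.insert_Ico_add_one_left_eq_Ico hk, Finset.biUnion_insert, covered_union,
    Finset.union_comm]
  exact Finset.union_subset_union hB Finset.sdiff_subset

/-- The epochs before k have covered all earlier layers. Hence pruning may start at layer k without
missing any target element. -/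
lemma ForwardRun.notMem_covered_subset_remaining (h : sys.ForwardRun τ σ t) {k : ℕ} {e : E}
    (hk : k ≤ sys.decompLength τ) (heu : e ∈ sys.univ) (he : e ∉ sys.covered (σ k).A) :
    e ∈ sys.remaining τ k := by
  by_contra hr
  obtain ⟨i, hi, hei⟩ := exists_layer_lt heu hr
  exact he (h.layer_subset hi hk hei)

/-- The frequency bound for an element of layer i is established by the pruning run of epoch i,
which starts at that layer. All later pruning runs can only lose sets through this element. -/
lemma ReverseRun.inv (hs : sys.IsSNC τ) (hI : FwdInv sys (σ (sys.decompLength τ)))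
    (h : sys.ForwardRun τ σ t) {k : ℕ} {B : Finset I} {s : ℕ} (hr : sys.ReverseRun τ σ k B s) :
    RevInv sys τ σ k B s := by
  induction hr with
  | start => exact ⟨le_rfl, by simp, by simp, by simp, fun i h1 _ _ _ h2 => by omega⟩
  | step k B s Y s' hr hp ih =>
    have hlt : k < sys.decompLength τ := ih.le
    have hX : B ∪ addedSets σ k ⊆ (σ (sys.decompLength τ)).A :=
      Finset.union_subset ih.subset (Finset.sdiff_subset.trans (h.mono ih.le le_rfl))
    have hYX : Y ⊆ B ∪ addedSets σ k := by simpa using hp.subset_union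
    refine ⟨hlt.le, hYX.trans hX, ?_, ?_, ?_⟩
    -- A pruning run from layer k computes L - k independent sets, which is at most L.
    · have h1 := hp.count
      have h2 := ih.count
      obtain ⟨n, hn⟩ := Nat.exists_eq_add_of_lt hlt
      rw [show sys.decompLength τ - k = (sys.decompLength τ - (k + 1)) + 1 by omega, add_mul]
      omega
    · intro e he
      refine hp.covers hs (biUnion_fresh_subset_covered hlt ih.covers)
        (Finset.mem_inter.2 ⟨he, ?_⟩)
      obtain ⟨h1, h2⟩ := (mem_biUnion_freshElements h hlt.le).1 he
      obtain ⟨S, hS, heS⟩ := mem_covered.1 h1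
      exact h.notMem_covered_subset_remaining hlt.le (sys.set_subset S (hI.subset hS) heS) h2
    · intro i hi e he hne hiL
      rcases hi.eq_or_lt with rfl | hi
      · exact hp.card_filter_le (hX.trans hI.subset) he
      -- Here k < i. The sets added in epoch k already belong to the collection at the start of
      -- epoch i, which misses e; so the sets through e in the new collection all come from the old
      -- one.
      · refine le_trans (Finset.card_le_card fun S hS => ?_) (ih.freq i hi e he hne hiL)
        obtain ⟨hS, heS⟩ := Finset.mem_filter.1 hS
        refine Finset.mem_filter.2 ⟨?_, heS⟩
        rcases Finset.mem_union.1 (hYX hS) with hS | hS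
        · exact hS
        · exact absurd (mem_covered.2 ⟨S, h.mono hi hiL.le (Finset.mem_sdiff.1 hS).1, heS⟩) hne

lemma ReverseRun.isCover (hs : sys.IsSNC τ) (hI : FwdInv sys (σ (sys.decompLength τ)))
    (h : sys.ForwardRun τ σ t) {B : Finset I} {s : ℕ} (hr : sys.ReverseRun τ σ 0 B s) :
    sys.IsCover B := by
  have hi := hr.inv hs hI h
  refine ⟨hi.subset.trans hI.subset, fun e he => hi.covers ?_⟩
  rw [mem_biUnion_freshElements h (Nat.zero_le _)]
  refine ⟨h.univ_subset hs he, ?_⟩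
  rw [h.1]; simp [covered]

lemma ReverseRun.freq (hs : sys.IsSNC τ) (hI : FwdInv sys (σ (sys.decompLength τ)))
    (h : sys.ForwardRun τ σ t) {B : Finset I} {s : ℕ} (hr : sys.ReverseRun τ σ 0 B s) {e : E}
    (he : 0 < (σ (sys.decompLength τ)).α e) :
    (B.filter (fun S => e ∈ sys.set S)).card ≤ τ ^ 2 := by
  obtain ⟨i, hi, hei, hn⟩ := h.exists_of_alpha_pos le_rfl he
  exact (hr.inv hs hI h).freq i (Nat.zero_le _) e hei hn hi

/-- Weak duality. -/
lemma DualFeasible.sum_le_totalCost {α : E → ℝ} (h : sys.DualFeasible α) {D : Finset I}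
    (hD : sys.IsCover D) : ∑ e ∈ sys.univ, α e ≤ sys.totalCost D := by
  have hsub : sys.covered D ⊆ sys.univ :=
    Finset.biUnion_subset.2 fun S hS => sys.set_subset S (hD.1 hS)
  calc ∑ e ∈ sys.univ, α e ≤ ∑ e ∈ sys.covered D, α e :=
        Finset.sum_le_sum_of_subset_of_nonneg hD.2 fun e he _ => h.1 e (hsub he)
    _ ≤ ∑ S ∈ D, ∑ e ∈ sys.set S, α e := by
        have : ∀ T ⊆ D, ∑ e ∈ sys.covered T, α e ≤ ∑ S ∈ T, ∑ e ∈ sys.set S, α e := by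
          intro T
          induction T using Finset.induction_on with
          | empty => simp [covered]
          | insert S T hST ih =>
            intro hT
            rw [covered, Finset.biUnion_insert, Finset.sum_insert hST]
            have h1 := Finset.sum_union_inter (s₁ := sys.set S) (s₂ := sys.covered T) (f := α)
            have h2 : 0 ≤ ∑ e ∈ sys.set S ∩ sys.covered T, α e :=
              Finset.sum_nonneg fun e he => h.1 e (sys.set_subset S
                (hD.1 (hT (Finset.mem_insert_self S T))) (Finset.mem_inter.1 he).1)
            have h3 := ih ((Finset.subset_insert S T).trans hT)
            unfold covered at h1 h2 h3
            linarith
        exact this D subset_rfl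
    _ ≤ sys.totalCost D := Finset.sum_le_sum fun S hS => h.2 S (hD.1 hS)

/-- Each set costs at most 8 times the dual variables it contains. After exchanging the sums, every
element is charged as often as it is covered; elements with zero dual variable do not matter, and
the others are covered at most τ² times. -/
lemma ReverseRun.totalCost_le (hs : sys.IsSNC τ) (hI : FwdInv sys (σ (sys.decompLength τ)))
    (h : sys.ForwardRun τ σ t) {B : Finset I} {s : ℕ} (hr : sys.ReverseRun τ σ 0 B s) :
    sys.totalCost B ≤ 8 * (τ : ℝ) ^ 2 * ∑ e ∈ sys.univ, (σ (sys.decompLength τ)).α e := by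
  have hi := hr.inv hs hI h
  set α := (σ (sys.decompLength τ)).α
  calc sys.totalCost B ≤ ∑ S ∈ B, ∑ e ∈ sys.univ, if e ∈ sys.set S then 8 * α e else 0 := by
        refine Finset.sum_le_sum fun S hS => ?_
        rw [← Finset.sum_filter, Finset.filter_mem_eq_inter,
          Finset.inter_eq_right.2 (sys.set_subset S (hI.subset (hi.subset hS))), ← Finset.mul_sum]
        linarith [hI.tight S (hi.subset hS)]
    _ = ∑ e ∈ sys.univ, (B.filter fun S => e ∈ sys.set S).card * (8 * α e) := by
        rw [Finset.sum_comm]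
        refine Finset.sum_congr rfl fun e _ => ?_
        rw [← Finset.sum_filter, Finset.sum_const, nsmul_eq_mul]
    _ ≤ ∑ e ∈ sys.univ, 8 * (τ : ℝ) ^ 2 * α e := by
        refine Finset.sum_le_sum fun e _ => ?_
        have h0 := hI.nonneg e
        rcases h0.eq_or_lt with h0 | h0
        · change 0 = α e at h0
          simp [← h0]
        · have h1 : ((B.filter fun S => e ∈ sys.set S).card : ℝ) ≤ (τ : ℝ) ^ 2 := by
            exact_mod_cast hr.freq hs hI h h0
          change 0 < α e at h0
          nlinarith
    _ = _ := by rw [Finset.mul_sum]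

end reverse

/-! ### The reduced system -/

section reduced

variable {τ : ℕ}

/-- Truncating the sets to the surviving elements does not change what they cover inside X, and
having fewer sets only weakens the requirement. -/
lemma IsSNCElement.reduced {X : Finset E} {e : E} (hX : X ⊆ sys.reduced.univ)
    (h : sys.IsSNCElement τ X e) : sys.reduced.IsSNCElement τ X e := by
  have hcov : ∀ P : Finset I, sys.reduced.covered P ∩ X = sys.covered P ∩ X := by
    intro P
    ext x
    simp only [Finset.mem_inter, mem_covered, SetSystem.reduced]
    have := @hX x
    simp only [SetSystem.reduced] at this
    constructor
    · rintro ⟨⟨S, hS, hx, -⟩, h'⟩; exact ⟨⟨S, hS, hx⟩, h'⟩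
    · rintro ⟨⟨S, hS, hx⟩, h'⟩; exact ⟨⟨S, hS, hx, this h'⟩, h'⟩
  refine ⟨h.1, fun P hP hPe => ?_⟩
  obtain ⟨P', h1, h2, h3⟩ := h.2 P
    (hP.trans ((Finset.filter_subset _ _).trans Finset.sdiff_subset))
    (fun S hS => (Finset.mem_inter.1 (hPe S hS)).1)
  exact ⟨P', h1, h2, by rw [hcov, hcov, h3]⟩

lemma IsSNC.reduced (h : sys.IsSNC τ) : sys.reduced.IsSNC τ := fun X hX hne => by
  obtain ⟨e, he⟩ := h X (hX.trans Finset.sdiff_subset) hne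
  exact ⟨e, he.reduced hX⟩

/-- Fewer elements and fewer sets make the SNC condition easier, so layers are removed at least as
fast in the reduced system. Therefore preprocessing does not increase L. -/
lemma remaining_reduced_subset (τ k : ℕ) : sys.reduced.remaining τ k ⊆ sys.remaining τ k := by
  induction k with
  | zero => exact Finset.sdiff_subset
  | succ k ih =>
    intro e he
    rw [mem_remaining_succ] at he ⊢
    exact ⟨ih he.1, fun h => he.2 ((h.mono ih he.1).reduced (remaining_subset_univ τ k))⟩

lemma IsSNC.decompLength_reduced_le (h : sys.IsSNC τ) :
    sys.reduced.decompLength τ ≤ sys.decompLength τ := by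
  refine Nat.sInf_le (m := sys.decompLength τ) ?_
  change sys.reduced.remaining τ _ = ∅
  rw [← Finset.subset_empty, ← h.remaining_decompLength]
  exact remaining_reduced_subset τ _

lemma mem_cheap {S : I} : S ∈ sys.cheap ↔
    S ∈ sys.fam ∧ sys.cost S ≤ sys.threshold / (sys.univ.card : ℝ) := by
  simp [cheap]

lemma mem_reduced_fam {S : I} : S ∈ sys.reduced.fam ↔ S ∈ sys.fam ∧
    sys.threshold / (sys.univ.card : ℝ) < sys.cost S ∧
      sys.cost S ≤ (sys.univ.card : ℝ) * sys.threshold := by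
  simp only [SetSystem.reduced, Finset.mem_filter, Finset.mem_sdiff, mem_cheap]
  constructor
  · rintro ⟨⟨h1, h2⟩, h3⟩
    exact ⟨h1, not_le.1 fun h => h2 ⟨h1, h⟩, h3⟩
  · rintro ⟨h1, h2, h3⟩
    exact ⟨⟨h1, fun h => (not_le.2 h2) h.2⟩, h3⟩

/-- The smallest cost of a set containing `e`. -/
noncomputable def minCost (sys : SetSystem E I) (e : E) : ℝ :=
  sInf (sys.cost '' {S | S ∈ sys.fam ∧ e ∈ sys.set S})

lemma finite_costs (e : E) : (sys.cost '' {S | S ∈ sys.fam ∧ e ∈ sys.set S}).Finite :=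
  (sys.fam.finite_toSet.subset fun _ h => h.1).image _

lemma minCost_le {S : I} {e : E} (hS : S ∈ sys.fam) (he : e ∈ sys.set S) :
    sys.minCost e ≤ sys.cost S :=
  csInf_le (finite_costs e).bddBelow ⟨S, ⟨hS, he⟩, rfl⟩

lemma exists_minCost (hf : sys.Feasible) {e : E} (he : e ∈ sys.univ) :
    ∃ S ∈ sys.fam, e ∈ sys.set S ∧ sys.minCost e = sys.cost S := by
  obtain ⟨S, hS, heS⟩ := hf e he
  obtain ⟨T, hT, h⟩ := Set.Nonempty.csInf_mem
    (s := sys.cost '' {S | S ∈ sys.fam ∧ e ∈ sys.set S}) ⟨_, S, ⟨hS, heS⟩, rfl⟩ (finite_costs e)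
  exact ⟨T, hT.1, hT.2, h.symm⟩

lemma minCost_le_threshold {e : E} (he : e ∈ sys.univ) : sys.minCost e ≤ sys.threshold :=
  le_csSup (sys.univ.finite_toSet.image _).bddAbove ⟨e, he, rfl⟩

lemma exists_threshold (hne : sys.univ.Nonempty) : ∃ e ∈ sys.univ, sys.threshold = sys.minCost e := by
  obtain ⟨e, he, h⟩ := Set.Nonempty.csSup_mem (s := sys.minCost '' (sys.univ : Set E))
    (Set.Nonempty.image _ hne) (sys.univ.finite_toSet.image _)
  exact ⟨e, he, h.symm⟩

lemma threshold_nonneg (hc : ∀ S ∈ sys.fam, 0 ≤ sys.cost S) : 0 ≤ sys.threshold := by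
  apply Real.sSup_nonneg
  rintro _ ⟨e, _, rfl⟩
  apply Real.sInf_nonneg
  rintro _ ⟨S, hS, rfl⟩
  exact hc S hS.1

/-- A set that is not cheap costs more than β/m ≥ 0. This lets the forward phase, which needs
positive costs, run on a system whose costs are only nonnegative. -/
lemma reduced_cost_pos (hc : ∀ S ∈ sys.fam, 0 ≤ sys.cost S) :
    ∀ S ∈ sys.reduced.fam, 0 < sys.reduced.cost S := fun _ hS =>
  (div_nonneg (threshold_nonneg hc) (Nat.cast_nonneg _)).trans_lt (mem_reduced_fam.1 hS).2.1

/-- The cheapest set through e costs at most β ≤ mβ. It is not cheap, since otherwise e would have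
been discarded. -/
lemma Feasible.exists_reduced (hf : sys.Feasible) (hc : ∀ S ∈ sys.fam, 0 ≤ sys.cost S) {e : E}
    (he : e ∈ sys.reduced.univ) : ∃ S ∈ sys.reduced.fam, e ∈ sys.reduced.set S ∧
      sys.cost S ≤ sys.threshold := by
  have he' := Finset.mem_sdiff.1 he
  obtain ⟨S, hS, heS, hmin⟩ := exists_minCost hf he'.1
  have hle : sys.cost S ≤ sys.threshold := hmin ▸ minCost_le_threshold he'.1
  have hm : (1 : ℝ) ≤ sys.univ.card := by exact_mod_cast Finset.card_pos.2 ⟨e, he'.1⟩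
  refine ⟨S, mem_reduced_fam.2 ⟨hS, not_le.1 fun h => he'.2 ?_, ?_⟩,
    Finset.mem_inter.2 ⟨heS, he⟩, hle⟩
  · exact mem_covered.2 ⟨S, mem_cheap.2 ⟨hS, h⟩, heS⟩
  · exact hle.trans (le_mul_of_one_le_left (threshold_nonneg hc) hm)

lemma Feasible.reduced (hf : sys.Feasible) (hc : ∀ S ∈ sys.fam, 0 ≤ sys.cost S) :
    sys.reduced.Feasible := fun e he => by
  obtain ⟨S, hS, heS, -⟩ := hf.exists_reduced hc he
  exact ⟨S, hS, heS⟩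

/-- The element at which the maximum β is attained has to be covered, and every set through it costs
at least β. -/
lemma threshold_le_totalCost (hc : ∀ S ∈ sys.fam, 0 ≤ sys.cost S) {D : Finset I}
    (hD : sys.IsCover D) : sys.threshold ≤ sys.totalCost D := by
  rcases sys.univ.eq_empty_or_nonempty with h0 | hne
  · have : sys.threshold = 0 := by simp [threshold, h0]
    rw [this]
    exact Finset.sum_nonneg fun S hS => hc S (hD.1 hS)
  · obtain ⟨e, he, h⟩ := exists_threshold hne
    obtain ⟨S, hS, heS⟩ := mem_covered.1 (hD.2 he)
    rw [h]
    exact (minCost_le (hD.1 hS) heS).trans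
      (Finset.single_le_sum (f := sys.cost) (fun T hT => hc T (hD.1 hT)) hS)

lemma exists_chosen (sys : SetSystem E I) : ∃ chosen ⊆ sys.cheap,
    sys.covered chosen = sys.covered sys.cheap ∧
      chosen.card ≤ (sys.covered sys.cheap).card := by
  have : ∀ e : sys.covered sys.cheap, ∃ S ∈ sys.cheap, e.1 ∈ sys.set S := fun e =>
    mem_covered.1 e.2
  choose f hf hef using this
  have hsub : (sys.covered sys.cheap).attach.image f ⊆ sys.cheap :=
    Finset.image_subset_iff.2 fun e _ => hf e
  exact ⟨_, hsub, (covered_mono hsub).antisymm fun e he =>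
    mem_covered.2 ⟨f ⟨e, he⟩, Finset.mem_image_of_mem f (Finset.mem_attach _ _), hef ⟨e, he⟩⟩,
    Finset.card_image_le.trans Finset.card_attach.le⟩

/-- The optimum of the dual of the reduced system is at most the cost of any cover. -/
lemma sum_dual_reduced_le (hf : sys.Feasible) (hc : ∀ S ∈ sys.fam, 0 ≤ sys.cost S) {α : E → ℝ}
    (hα : sys.reduced.DualFeasible α) {D : Finset I} (hD : sys.IsCover D) :
    ∑ e ∈ sys.reduced.univ, α e ≤ sys.totalCost D := by
  -- If D uses a set dearer than mβ, no cover of the reduced system is extracted from it. Instead,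
  -- every dual variable is at most β, because its element lies in a surviving set of cost at most
  -- β, so the dual sum is at most mβ. If D uses no such set, its surviving members cover the
  -- reduced system and weak duality applies.
  by_cases hex : ∃ S ∈ D, (sys.univ.card : ℝ) * sys.threshold < sys.cost S
  · obtain ⟨S, hS, hlt⟩ := hex
    have h1 : ∀ e ∈ sys.reduced.univ, α e ≤ sys.threshold := by
      intro e he
      obtain ⟨T, hT, heT, hle⟩ := hf.exists_reduced hc he
      refine le_trans ?_ ((hα.2 T hT).trans hle)
      exact Finset.single_le_sum (f := α)
        (fun x hx => hα.1 x (sys.reduced.set_subset T hT hx)) heT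
    calc _ ≤ (sys.reduced.univ.card : ℝ) * sys.threshold := by
          rw [← nsmul_eq_mul]; exact Finset.sum_le_card_nsmul _ _ _ h1
      _ ≤ sys.univ.card * sys.threshold := by
          refine mul_le_mul_of_nonneg_right ?_ (threshold_nonneg hc)
          exact_mod_cast Finset.card_le_card Finset.sdiff_subset
      _ ≤ sys.cost S := hlt.le
      _ ≤ sys.totalCost D := Finset.single_le_sum (f := sys.cost) (fun T hT => hc T (hD.1 hT)) hS
  · push Not at hex
    have hcov : sys.reduced.IsCover (D.filter fun S => S ∈ sys.reduced.fam) := by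
      refine ⟨fun S hS => (Finset.mem_filter.1 hS).2, fun e he => ?_⟩
      have he' := Finset.mem_sdiff.1 he
      obtain ⟨S, hS, heS⟩ := mem_covered.1 (hD.2 he'.1)
      refine mem_covered.2 ⟨S, Finset.mem_filter.2 ⟨hS, mem_reduced_fam.2 ⟨hD.1 hS,
        not_le.1 fun h => he'.2 ?_, hex S hS⟩⟩, Finset.mem_inter.2 ⟨heS, he⟩⟩
      exact mem_covered.2 ⟨S, mem_cheap.2 ⟨hD.1 hS, h⟩, heS⟩
    exact (hα.sum_le_totalCost hcov).trans (Finset.sum_le_sum_of_subset_of_nonneg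
      (Finset.filter_subset _ _) fun S hS _ => hc S (hD.1 hS))

variable {σ : ℕ → FwdState E I} {t : ℕ → ℕ} {s : ℕ} {out : Finset I}

lemma exists_algorithmRun (hf : sys.Feasible)
    (hc : ∀ S ∈ sys.fam, 0 ≤ sys.cost S) : ∃ σ t s out, sys.AlgorithmRun τ σ t s out := by
  obtain ⟨chosen, h1, h2, h3⟩ := exists_chosen sys
  obtain ⟨σ, t, h⟩ := exists_forwardRun (hf.reduced hc) (reduced_cost_pos hc) τ
  obtain ⟨B, s, hB, -⟩ := exists_reverseRun (h.inv (reduced_cost_pos hc) le_rfl) h (Nat.zero_le _)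
  exact ⟨σ, t, s, _, h, chosen, B, h1, h2, h3, hB, rfl⟩

lemma AlgorithmRun.isCover (h : sys.AlgorithmRun τ σ t s out) (hs : sys.IsSNC τ)
    (hc : ∀ S ∈ sys.fam, 0 ≤ sys.cost S) : sys.IsCover out := by
  obtain ⟨hfw, chosen, B, h1, h2, h3, hB, rfl⟩ := h
  have hI := hfw.inv (reduced_cost_pos hc) le_rfl
  have hcov := hB.isCover hs.reduced hI hfw
  refine ⟨Finset.union_subset (h1.trans (Finset.filter_subset _ _)) fun S hS =>
    (mem_reduced_fam.1 (hcov.1 hS)).1, fun e he => ?_⟩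
  rw [covered_union, h2, Finset.mem_union]
  by_cases hch : e ∈ sys.covered sys.cheap
  · exact Or.inl hch
  · right
    obtain ⟨S, hS, heS⟩ := mem_covered.1 (hcov.2 (Finset.mem_sdiff.2 ⟨he, hch⟩))
    exact mem_covered.2 ⟨S, hS, (Finset.mem_inter.1 heS).1⟩

lemma AlgorithmRun.totalCost_le (h : sys.AlgorithmRun τ σ t s out) (hs : sys.IsSNC τ)
    (hf : sys.Feasible) (hc : ∀ S ∈ sys.fam, 0 ≤ sys.cost S) {D : Finset I} (hD : sys.IsCover D) :
    sys.totalCost out ≤ (1 + 8 * (τ : ℝ) ^ 2) * sys.totalCost D := by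
  obtain ⟨hfw, chosen, B, h1, h2, h3, hB, rfl⟩ := h
  have hI := hfw.inv (reduced_cost_pos hc) le_rfl
  have hmax := hfw.isMaximalPair hs.reduced (reduced_cost_pos hc)
  have hcov := hB.isCover hs.reduced hI hfw
  have hBfam : ∀ S ∈ B, S ∈ sys.fam := fun S hS => (mem_reduced_fam.1 (hcov.1 hS)).1
  -- At most m cheap sets are chosen, each of cost at most β/m, and β is at most the cost of D.
  have hch : sys.totalCost chosen ≤ sys.totalCost D := by
    refine le_trans ?_ (threshold_le_totalCost hc hD)
    rcases sys.univ.eq_empty_or_nonempty with h0 | hne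
    · have : (sys.covered sys.cheap).card = 0 := by
        rw [Finset.card_eq_zero, ← Finset.subset_empty, ← h0]
        exact Finset.biUnion_subset.2 fun S hS => sys.set_subset S (mem_cheap.1 hS).1
      rw [this, Nat.le_zero, Finset.card_eq_zero] at h3
      simpa [totalCost, h3] using threshold_nonneg hc
    · have hm : (0 : ℝ) < sys.univ.card := by exact_mod_cast Finset.card_pos.2 hne
      calc sys.totalCost chosen ≤ chosen.card • (sys.threshold / sys.univ.card) :=
            Finset.sum_le_card_nsmul _ _ _ fun S hS => (mem_cheap.1 (h1 hS)).2
        _ ≤ sys.univ.card * (sys.threshold / sys.univ.card) := by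
            rw [nsmul_eq_mul]
            refine mul_le_mul_of_nonneg_right ?_ (div_nonneg (threshold_nonneg hc) hm.le)
            exact_mod_cast h3.trans (Finset.card_le_card
              (Finset.biUnion_subset.2 fun S hS => sys.set_subset S (mem_cheap.1 hS).1))
        _ = sys.threshold := by field_simp
  have hBc : sys.totalCost B ≤ 8 * (τ : ℝ) ^ 2 * sys.totalCost D :=
    (hB.totalCost_le hs.reduced hI hfw).trans (mul_le_mul_of_nonneg_left
      (sum_dual_reduced_le hf hc hmax.2.1 hD) (by positivity))
  have hun : sys.totalCost (chosen ∪ B) ≤ sys.totalCost chosen + sys.totalCost B := by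
    have := Finset.sum_union_inter (s₁ := chosen) (s₂ := B) (f := sys.cost)
    have h0 : 0 ≤ ∑ S ∈ chosen ∩ B, sys.cost S :=
      Finset.sum_nonneg fun S hS => hc S (hBfam S (Finset.mem_inter.1 hS).2)
    unfold totalCost; linarith
  linarith

/-- An element with positive dual variable lies in a layer of the reduced system, hence in no cheap
set, and the chosen cheap sets do not count. -/
lemma AlgorithmRun.freq (h : sys.AlgorithmRun τ σ t s out) (hs : sys.IsSNC τ)
    (hc : ∀ S ∈ sys.fam, 0 ≤ sys.cost S) {e : E}
    (he : 0 < (σ (sys.reduced.decompLength τ)).α e) :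
    (out.filter (fun S => e ∈ sys.set S)).card ≤ τ ^ 2 := by
  obtain ⟨hfw, chosen, B, h1, h2, h3, hB, rfl⟩ := h
  have hI := hfw.inv (reduced_cost_pos hc) le_rfl
  obtain ⟨i, hi, hei, -⟩ := hfw.exists_of_alpha_pos le_rfl he
  have heu : e ∈ sys.univ \ sys.covered sys.cheap := layer_subset_univ τ i hei
  refine le_trans (Finset.card_le_card fun S hS => ?_) (hB.freq hs.reduced hI hfw he)
  obtain ⟨hS, heS⟩ := Finset.mem_filter.1 hS
  rcases Finset.mem_union.1 hS with hS | hS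
  · exact absurd (mem_covered.2 ⟨S, h1 hS, heS⟩) (Finset.mem_sdiff.1 heu).2
  · exact Finset.mem_filter.2 ⟨hS, Finset.mem_inter.2 ⟨heS, heu⟩⟩

lemma AlgorithmRun.count_le (h : sys.AlgorithmRun τ σ t s out) (hs : sys.IsSNC τ)
    (hc : ∀ S ∈ sys.fam, 0 ≤ sys.cost S) : s ≤ sys.decompLength τ ^ 2 := by
  obtain ⟨hfw, chosen, B, h1, h2, h3, hB, rfl⟩ := h
  have h4 := (hB.inv hs.reduced (hfw.inv (reduced_cost_pos hc) le_rfl) hfw).count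
  have h5 := hs.decompLength_reduced_le
  rw [Nat.sub_zero] at h4
  rw [sq]
  exact h4.trans (Nat.mul_le_mul h5 h5)

lemma AlgorithmRun.iterations_le (h : sys.AlgorithmRun τ σ t s out) (hs : sys.IsSNC τ)
    (hf : sys.Feasible) (hc : ∀ S ∈ sys.fam, 0 ≤ sys.cost S) :
    ((∑ k ∈ Finset.range (sys.reduced.decompLength τ), t k : ℕ) : ℝ) ≤
      9 * sys.decompLength τ * (1 + Real.log sys.univ.card) := by
  rcases Nat.eq_zero_or_pos (sys.reduced.decompLength τ) with h0 | hL
  · rw [h0]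
    simp only [Finset.range_zero, Finset.sum_empty, Nat.cast_zero]
    have := Real.log_natCast_nonneg sys.univ.card
    positivity
  have hne : sys.reduced.univ.Nonempty :=
    (remaining_nonempty_of_lt hL).mono (remaining_subset_univ τ 0)
  have hsub : sys.reduced.univ ⊆ sys.univ := Finset.sdiff_subset
  have hm : (1 : ℝ) ≤ sys.univ.card := by exact_mod_cast Finset.card_pos.2 (hne.mono hsub)
  have hm' : (1 : ℝ) ≤ sys.reduced.univ.card := by exact_mod_cast Finset.card_pos.2 hne
  have hmm : (sys.reduced.univ.card : ℝ) ≤ sys.univ.card := by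
    exact_mod_cast Finset.card_le_card hsub
  -- The surviving costs are above β/m and at most mβ, so m² bounds their ratios; log m² = 2 log m
  -- then turns the constant 3 into 9.
  have h1 := h.forward.sum_le (hf.reduced hc) (reduced_cost_pos hc)
    (ρ := (sys.univ.card : ℝ) ^ 2) (by
      intro S hS S' hS'
      refine (mem_reduced_fam.1 hS).2.2.trans ?_
      have := (mem_reduced_fam.1 hS').2.1
      rw [div_lt_iff₀ (by linarith)] at this
      change _ ≤ _ * sys.cost S'
      nlinarith)
  rw [Real.log_pow] at h1
  have h2 := Real.log_le_log (by linarith) hmm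
  have h3 := Real.log_nonneg hm
  have h4 := Real.log_nonneg hm'
  have h5 : (sys.reduced.decompLength τ : ℝ) ≤ sys.decompLength τ := by
    exact_mod_cast hs.decompLength_reduced_le
  refine h1.trans ?_
  push_cast
  calc 3 * (sys.reduced.decompLength τ : ℝ) * (1 + Real.log sys.reduced.univ.card +
        2 * Real.log sys.univ.card)
      ≤ 3 * sys.decompLength τ * (3 * (1 + Real.log sys.univ.card)) := by
        gcongr; linarith
    _ = _ := by ring

end reduced

end SetSystem

namespace PRAM

/-! ### Time bounds and frames -/

/-- The running time if no loop is iterated more than `B` times. -/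
def Prog.timeBound (B : ℕ) : Prog → ℕ
  | .skip => 1
  | .par p _ x v => p.time + x.time + v.time
  | .seq P Q => P.timeBound B + Q.timeBound B
  | .ite c P Q => c.time + P.timeBound B + Q.timeBound B
  | .while c P => c.time + (c.time + P.timeBound B) * B

/-- The number of symbols of a program. -/
def Prog.length : Prog → ℕ
  | .skip => 1
  | .par p _ x v => p.time + x.time + v.time
  | .seq P Q => P.length + Q.length
  | .ite c P Q => c.time + P.length + Q.length
  | .while c P => c.time + P.length

/-- The nesting depth of the loops. -/
def Prog.depth : Prog → ℕ
  | .skip => 0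
  | .par _ _ _ _ => 0
  | .seq P Q => max P.depth Q.depth
  | .ite _ P Q => max P.depth Q.depth
  | .while _ P => P.depth + 1

/-- Every level of nesting costs one factor B + 1. For a fixed program, length and depth are
constants, so a polylogarithmic bound on the loops gives polylogarithmic time without any analysis
of the individual statements. -/
lemma Prog.timeBound_le (B : ℕ) (P : Prog) : P.timeBound B ≤ P.length * (B + 1) ^ P.depth := by
  have mono : ∀ {a b : ℕ}, a ≤ b → (B + 1) ^ a ≤ (B + 1) ^ b := fun h =>
    Nat.pow_le_pow_right (Nat.succ_pos B) h
  induction P with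
  | skip => simp [timeBound, length, depth]
  | par => simp [timeBound, length, depth]
  | seq P Q hP hQ =>
    simp only [timeBound, length, depth, add_mul]
    exact add_le_add (hP.trans (Nat.mul_le_mul_left _ (mono (le_max_left _ _))))
      (hQ.trans (Nat.mul_le_mul_left _ (mono (le_max_right _ _))))
  | ite c P Q hP hQ =>
    simp only [timeBound, length, depth, add_mul]
    exact add_le_add (add_le_add (Nat.le_mul_of_pos_right _ (by positivity))
      (hP.trans (Nat.mul_le_mul_left _ (mono (le_max_left _ _)))))
      (hQ.trans (Nat.mul_le_mul_left _ (mono (le_max_right _ _))))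
  | _ =>
    rename_i c P hP
    simp only [timeBound, length, depth, pow_succ]
    have h1 : 1 ≤ (B + 1) ^ P.depth := Nat.one_le_pow _ _ (Nat.succ_pos B)
    calc c.time + (c.time + P.timeBound B) * B
        ≤ (c.time + P.length) * (B + 1) ^ P.depth
          + (c.time + P.length) * (B + 1) ^ P.depth * B := by
          have h2 : c.time + P.timeBound B ≤ (c.time + P.length) * (B + 1) ^ P.depth := by
            rw [add_mul]
            exact add_le_add (Nat.le_mul_of_pos_right _ h1) hP
          exact add_le_add ((Nat.le_add_right _ _).trans h2) (Nat.mul_le_mul_right _ h2)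
      _ = _ := by ring

/-- The array `b` does not occur on the left of an assignment. -/
def Prog.keeps (b : ℕ) : Prog → Bool
  | .skip => true
  | .par _ a _ _ => a != b
  | .seq P Q => P.keeps b && Q.keeps b
  | .ite _ P Q => P.keeps b && Q.keeps b
  | .while _ P => P.keeps b

/-- Apart from the final output, the phases write to arrays of increasing numbers, so that the
results of earlier phases persist; the syntactic conditions `keeps` and `above` are checked by
evaluation. The arrays 100 and 101 are scratch space for folds. -/
lemma Exec.frame {N W : ℕ} {P : Prog} {M M' : Mem} {t : ℕ} (h : Exec N W P M t M') {b : ℕ}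
    (hb : P.keeps b) : M' b = M b := by
  induction h with
  | skip => rfl
  | par p a x v M _ _ =>
    funext y
    have hab : b ≠ a := (bne_iff_ne.1 hb).symm
    exact dif_neg fun h => hab h.1
  | seq P Q M M' M'' t t' _ _ h1 h2 =>
    simp only [Prog.keeps, Bool.and_eq_true] at hb
    rw [h2 hb.2, h1 hb.1]
  | iteTrue c P Q M M' t _ _ h1 =>
    simp only [Prog.keeps, Bool.and_eq_true] at hb
    exact h1 hb.1
  | iteFalse c P Q M M' t _ _ h1 =>
    simp only [Prog.keeps, Bool.and_eq_true] at hb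
    exact h1 hb.2
  | whileTrue c P M M' M'' t t' _ _ _ h1 h2 => rw [h2 hb, h1 hb]
  | whileFalse => rfl

/-- All arrays that are written have at least the number `k`. -/
def Prog.above (k : ℕ) : Prog → Bool
  | .skip => true
  | .par _ a _ _ => k ≤ a
  | .seq P Q => P.above k && Q.above k
  | .ite _ P Q => P.above k && Q.above k
  | .while _ P => P.above k

lemma Prog.keeps_of_above {k b : ℕ} (hb : b < k) {P : Prog} (h : P.above k) : P.keeps b := by
  induction P with
  | skip => rfl
  | par p a x v =>
    simp only [above, decide_eq_true_eq] at h
    simp only [keeps, bne_iff_ne]; omega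
  | seq P Q hP hQ => simp only [above, keeps, Bool.and_eq_true] at h ⊢; exact ⟨hP h.1, hQ h.2⟩
  | ite c P Q hP hQ => simp only [above, keeps, Bool.and_eq_true] at h ⊢; exact ⟨hP h.1, hQ h.2⟩
  | _ => rename_i hP; exact hP h

/-! ### Runs with bounded loops -/

/-- The resources of a machine: there are `(2 ^ r) ^ K ≤ N` processors, words have `W` bits, and
loops are iterated at most `B` times. -/
structure Params where
  r : ℕ
  K : ℕ
  N : ℕ
  W : ℕ
  B : ℕ
  procs : (2 ^ r) ^ K ≤ N
  word : r * K + 1 ≤ W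
  loops : r * K + 1 ≤ B

namespace Params

variable (p : Params)

/-- The side length of the index cube of the processors. -/
def R : ℕ := 2 ^ p.r

lemma R_pos : 0 < p.R := by unfold R; positivity

lemma one_lt_word : (1 : ℤ) < 2 ^ p.W := by
  have := p.word
  exact one_lt_pow₀ (by norm_num) (by omega)

lemma pow_lt_word : ((p.R ^ p.K : ℕ) : ℤ) < 2 ^ p.W := by
  have h : p.R ^ p.K = 2 ^ (p.r * p.K) := by rw [R, ← pow_mul]
  rw [h]; push_cast
  exact pow_lt_pow_right₀ (by norm_num) (by have := p.word; omega)

/-- `P` halts on `M` with `M'`, within the resources. -/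
def Runs (P : Prog) (M M' : Mem) : Prop :=
  ∃ t ≤ P.timeBound p.B, Exec p.N p.W P M t M'

/-- The loop with condition `c` and body `P` halts after exactly `i` iterations. -/
def Iter (c : Expr) (P : Prog) : ℕ → Mem → Mem → Prop
  | 0, M, M' => c.eval M 0 = 0 ∧ M' = M
  | i + 1, M, M' => c.eval M 0 ≠ 0 ∧ ∃ M₁, p.Runs P M M₁ ∧ Iter c P i M₁ M'

end Params

variable {p : Params}

lemma Params.Runs.frame {P : Prog} {M M' : Mem} (h : p.Runs P M M') {b : ℕ} (hb : P.keeps b) :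
    M' b = M b := by
  obtain ⟨t, -, h⟩ := h
  exact h.frame hb

lemma Params.Runs.frame_lt {P : Prog} {M M' : Mem} (h : p.Runs P M M') {k : ℕ} (hk : P.above k) {b : ℕ}
    (hb : b < k) : M' b = M b :=
  Params.Runs.frame h (Prog.keeps_of_above hb hk)

lemma Params.Runs.seq {P Q : Prog} {M M' M'' : Mem} (h : p.Runs P M M') (h' : p.Runs Q M' M'') :
    p.Runs (.seq P Q) M M'' := by
  obtain ⟨t, ht, h⟩ := h
  obtain ⟨t', ht', h'⟩ := h'
  exact ⟨t + t', add_le_add ht ht', .seq P Q M M' M'' t t' h h'⟩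

lemma Params.Iter.exists_exec {c : Expr} {P : Prog} {i : ℕ} {M M' : Mem} (h : p.Iter c P i M M') :
    ∃ t ≤ c.time + (c.time + P.timeBound p.B) * i, Exec p.N p.W (.while c P) M t M' := by
  induction i generalizing M with
  | zero =>
    obtain ⟨hc, rfl⟩ := h
    exact ⟨c.time, by simp, .whileFalse c P _ hc⟩
  | succ i ih =>
    obtain ⟨hc, M₁, ⟨t, ht, h1⟩, h2⟩ := h
    obtain ⟨t', ht', h3⟩ := ih h2
    refine ⟨c.time + t + t', ?_, .whileTrue c P M M₁ M' t t' hc h1 h3⟩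
    rw [mul_add, mul_one]; omega

lemma Params.Iter.runs {c : Expr} {P : Prog} {i : ℕ} {M M' : Mem} (h : p.Iter c P i M M')
    (hi : i ≤ p.B) : p.Runs (.while c P) M M' := by
  obtain ⟨t, ht, h⟩ := h.exists_exec
  exact ⟨t, ht.trans (Nat.add_le_add_left (Nat.mul_le_mul_left _ hi) _), h⟩

/-! ### Expressions -/

/-- The integer `1` or `0`, according to the truth of a proposition. -/
noncomputable def ind (q : Prop) : ℤ := by classical exact if q then 1 else 0

lemma ind_true {q : Prop} (h : q) : ind q = 1 := by simp [ind, h]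
lemma ind_false {q : Prop} (h : ¬ q) : ind q = 0 := by simp [ind, h]
lemma ind_congr {q q' : Prop} (h : q ↔ q') : ind q = ind q' := by rw [propext h]
lemma ind_eq_ite (q : Prop) [Decidable q] : ind q = if q then 1 else 0 := by
  unfold ind; split_ifs <;> rfl
lemma ind_nonneg (q : Prop) : 0 ≤ ind q := by by_cases h : q <;> simp [ind, h]
lemma ind_le_one (q : Prop) : ind q ≤ 1 := by by_cases h : q <;> simp [ind, h]
lemma abs_ind_le (q : Prop) : |ind q| ≤ 1 := by by_cases h : q <;> simp [ind, h]
@[simp] lemma ind_pos (q : Prop) : 0 < ind q ↔ q := by by_cases h : q <;> simp [ind, h]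
@[simp] lemma ind_eq_zero (q : Prop) : ind q = 0 ↔ ¬ q := by by_cases h : q <;> simp [ind, h]
@[simp] lemma ind_eq_one (q : Prop) : ind q = 1 ↔ q := by by_cases h : q <;> simp [ind, h]
@[simp] lemma ind_mul_ind (q q' : Prop) : ind q * ind q' = ind (q ∧ q') := by
  by_cases h : q <;> by_cases h' : q' <;> simp [ind, h, h']
@[simp] lemma one_sub_ind (q : Prop) : 1 - ind q = ind (¬ q) := by
  by_cases h : q <;> simp [ind, h]
@[simp] lemma ind_add_pos (q q' : Prop) : 0 < ind q + ind q' ↔ q ∨ q' := by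
  by_cases h : q <;> by_cases h' : q' <;> simp [ind, h, h']

namespace Expr

instance : Add Expr := ⟨.bin .add⟩
instance : Sub Expr := ⟨.bin .sub⟩
instance : Mul Expr := ⟨.bin .mul⟩
instance : Div Expr := ⟨.bin .div⟩
instance : Mod Expr := ⟨.bin .mod⟩
instance (n : ℕ) : OfNat Expr n := ⟨.const n⟩

def lt (x y : Expr) : Expr := .bin .lt x y
def eq (x y : Expr) : Expr := .bin .eq x y
def and (x y : Expr) : Expr := x * y
def not (x : Expr) : Expr := 1 - x
def or (x y : Expr) : Expr := lt 0 (x + y)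

variable (M : Mem) (i : ℕ) (x y : Expr)

@[simp] lemma eval_two : (2 : Expr).eval M i = 2 := rfl
@[simp] lemma eval_four : (4 : Expr).eval M i = 4 := rfl
@[simp] lemma eval_eight : (8 : Expr).eval M i = 8 := rfl
@[simp] lemma eval_zero : (0 : Expr).eval M i = 0 := rfl
@[simp] lemma eval_one : (1 : Expr).eval M i = 1 := rfl
@[simp] lemma eval_pid : pid.eval M i = i := rfl
@[simp] lemma eval_read (a : ℕ) : (read a x).eval M i = M a (x.eval M i) := rfl
@[simp] lemma eval_add : (x + y).eval M i = x.eval M i + y.eval M i := rfl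
@[simp] lemma eval_sub : (x - y).eval M i = x.eval M i - y.eval M i := rfl
@[simp] lemma eval_mul : (x * y).eval M i = x.eval M i * y.eval M i := rfl
@[simp] lemma eval_div : (x / y).eval M i = x.eval M i / y.eval M i := rfl
@[simp] lemma eval_mod : (x % y).eval M i = x.eval M i % y.eval M i := rfl
@[simp] lemma eval_lt : (lt x y).eval M i = ind (x.eval M i < y.eval M i) :=
  (ind_eq_ite _).symm
@[simp] lemma eval_eq : (eq x y).eval M i = ind (x.eval M i = y.eval M i) :=
  (ind_eq_ite _).symm
@[simp] lemma eval_and : (and x y).eval M i = x.eval M i * y.eval M i := rfl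
@[simp] lemma eval_not : (not x).eval M i = 1 - x.eval M i := rfl
@[simp] lemma eval_or : (or x y).eval M i = ind (0 < x.eval M i + y.eval M i) := eval_lt _ _ _ _
@[simp] lemma eval_cond (c : Expr) : (cond c x y).eval M i =
    if c.eval M i ≠ 0 then x.eval M i else y.eval M i := rfl

/-- The sum of finitely many expressions. -/
def sum (f : ℕ → Expr) : ℕ → Expr
  | 0 => 0
  | n + 1 => sum f n + f n

@[simp] lemma eval_sum (f : ℕ → Expr) (n : ℕ) :
    (sum f n).eval M i = ∑ j ∈ Finset.range n, (f j).eval M i := by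
  induction n with
  | zero => rfl
  | succ n ih => rw [Finset.sum_range_succ, ← ih]; rfl

/-- The powers of the side length of the index cube. -/
def powR : ℕ → Expr
  | 0 => 1
  | a + 1 => powR a * read 5 0

/-- The number of processors. -/
def procs : Expr := read 5 1

end Expr

/-- The constants of the machine are stored in the array `5`. -/
def Params.Good (p : Params) (M : Mem) : Prop := M 5 0 = (p.R : ℤ) ∧ M 5 1 = ((p.R ^ p.K : ℕ) : ℤ)

lemma Params.Good.congr {M M' : Mem} (h : p.Good M) (h5 : M' 5 = M 5) : p.Good M' := by
  unfold Params.Good; rw [h5]; exact h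

lemma Params.Good.eval_powR {M : Mem} (h : p.Good M) (i a : ℕ) :
    (Expr.powR a).eval M i = ((p.R ^ a : ℕ) : ℤ) := by
  induction a with
  | zero => rfl
  | succ a ih => simp [Expr.powR, ih, h.1, pow_succ]

lemma Params.Good.eval_procs {M : Mem} (h : p.Good M) (i : ℕ) :
    Expr.procs.eval M i = ((p.R ^ p.K : ℕ) : ℤ) := h.2

/-! ### Statements -/

/-- Every processor writes to its own cell of the array `a`. -/
def assign (a : ℕ) (v : Expr) : Prog := .par .procs a .pid v

/-- A single processor writes to the cell `0` of the array `a`. -/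
def setScalar (a : ℕ) (v : Expr) : Prog := .par 1 a 0 v

lemma exists_runs_assign {M : Mem} (hg : p.Good M) (a : ℕ) (v : Expr)
    (hv : ∀ z < p.R ^ p.K, |v.eval M z| < 2 ^ p.W) :
    ∃ M', p.Runs (assign a v) M M' ∧ (∀ z < p.R ^ p.K, M' a (z : ℤ) = v.eval M z) ∧
      ∀ b, b ≠ a → M' b = M b := by
  have hp : (Expr.procs.eval M 0).toNat = p.R ^ p.K := by rw [hg.eval_procs, Int.toNat_natCast]
  refine ⟨_, ⟨_, le_rfl, .par .procs a .pid v M (by rw [hp]; exact p.procs)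
    (by rw [hp]; exact hv)⟩, fun z hz => ?_, fun b hb => ?_⟩
  · have hex : a = a ∧ ∃ i, i < (Expr.procs.eval M 0).toNat ∧ Expr.pid.eval M i = (z : ℤ) :=
      ⟨rfl, z, by rwa [hp], rfl⟩
    -- Every processor writes to the cell with its own number, so exactly one processor writes to a
    -- given cell and the rule for write conflicts is immaterial.
    have hfind : ∀ (d : DecidablePred fun i => i < (Expr.procs.eval M 0).toNat ∧
        Expr.pid.eval M i = (z : ℤ)) (h : ∃ i, i < (Expr.procs.eval M 0).toNat ∧
        Expr.pid.eval M i = (z : ℤ)), @Nat.find _ d h = z := fun d h => by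
      have : ((@Nat.find _ d h : ℕ) : ℤ) = z := (@Nat.find_spec _ d h).2
      exact_mod_cast this
    unfold parWrite
    rw [dif_pos hex]
    exact congrArg (fun i => v.eval M i) (hfind _ hex.2)
  · funext y
    exact dif_neg fun h => hb h.1

lemma exists_runs_setScalar {M : Mem} (a : ℕ) (v : Expr) (hN : 1 ≤ p.N)
    (hv : |v.eval M 0| < 2 ^ p.W) :
    ∃ M', p.Runs (setScalar a v) M M' ∧ M' a 0 = v.eval M 0 ∧ (∀ y, y ≠ 0 → M' a y = M a y) ∧
      ∀ b, b ≠ a → M' b = M b := by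
  have hp : ((1 : Expr).eval M 0).toNat = 1 := rfl
  refine ⟨_, ⟨_, le_rfl, .par 1 a 0 v M hN (by
    intro i hi
    rw [hp, Nat.lt_one_iff] at hi
    rwa [hi])⟩, ?_, fun y hy => ?_, fun b hb => ?_⟩
  · have hex : a = a ∧ ∃ i, i < ((1 : Expr).eval M 0).toNat ∧ (0 : Expr).eval M i = 0 :=
      ⟨rfl, 0, by simp, rfl⟩
    unfold parWrite
    rw [dif_pos hex]
    exact congrArg (fun i => v.eval M i)
      (Nat.lt_one_iff.1 (@Nat.find_spec _ _ hex.2).1)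
  · have : ¬ (a = a ∧ ∃ i, i < ((1 : Expr).eval M 0).toNat ∧ (0 : Expr).eval M i = y) := by
      rintro ⟨-, i, -, h⟩
      exact hy h.symm
    unfold parWrite
    rw [dif_neg this]
  · funext y
    exact dif_neg fun h => hb h.1

lemma Params.one_le_N (p : Params) : 1 ≤ p.N := (Nat.one_le_pow _ _ (by positivity)).trans p.procs

/-- A binary operation for which a value of the fold over `h` arguments is characterized by `rel`. -/
structure FoldOp where
  expr : Expr → Expr → Expr
  fn : ℤ → ℤ → ℤ
  eval : ∀ X Y M i, (expr X Y).eval M i = fn (X.eval M i) (Y.eval M i)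
  rel : ℕ → (ℕ → ℤ) → ℤ → Prop
  congr : ∀ h g g' v, (∀ i < h, g i = g' i) → rel h g v → rel h g' v
  one : ∀ g, rel 1 g (g 0)
  -- One halving of the tree: a fold of the combined pairs at distance h is a fold of all 2h
  -- arguments. For extrema `rel` says that the value is a bound and is attained, which is more
  -- convenient than an iterated operation.
  double : ∀ h g v, rel h (fun i => fn (g i) (g (i + h))) v → rel (h * 2) g v

/-- `out[y]` becomes the fold of `body x y` over `x < R ^ a`, for all `y < R ^ d`. -/
def fold (o : FoldOp) (a d out : ℕ) (body : Expr → Expr → Expr) : Prog :=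
  .seq (assign 100 (.cond (.lt .pid (.powR (a + d)))
    (body (.pid % .powR a) (.pid / .powR a)) 0)) <|
  .seq (setScalar 101 (.powR a)) <|
  .seq (.while (.lt 1 (.read 101 0)) <|
    .seq (setScalar 101 (.read 101 0 / 2)) <|
    assign 100 (.cond (.lt (.pid % .powR a) (.read 101 0))
      (o.expr (.read 100 .pid) (.read 100 (.pid + .read 101 0))) (.read 100 .pid))) <|
  assign out (.cond (.lt (.pid * .powR a) .procs) (.read 100 (.pid * .powR a)) 0)

/-- Balanced reduction inside each block of R^a consecutive cells, by induction on the number n of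
halvings still to be done. The sequence `bnd` bounds the cell contents as a function of the rounds
already performed, so that every written value fits into a word. -/
lemma exists_runs_fold_loop (o : FoldOp) {a : ℕ} (ha : a ≤ p.K) (bnd : ℕ → ℤ)
    (hmono : ∀ j, bnd j ≤ bnd (j + 1))
    (hop : ∀ j u v, |u| ≤ bnd j → |v| ≤ bnd j → |o.fn u v| ≤ bnd (j + 1))
    (hW : bnd (p.r * a) < 2 ^ p.W) (n : ℕ) (hn : n ≤ p.r * a) {M : Mem} (hg : p.Good M)
    (hh : M 101 0 = 2 ^ n)
    (hb : ∀ z < p.R ^ p.K, |M 100 (z : ℤ)| ≤ bnd (p.r * a - n)) :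
    ∃ M', p.Iter (.lt 1 (.read 101 0)) (
        .seq (setScalar 101 (.read 101 0 / 2)) <|
        assign 100 (.cond (.lt (.pid % .powR a) (.read 101 0))
          (o.expr (.read 100 .pid) (.read 100 (.pid + .read 101 0))) (.read 100 .pid))) n M M' ∧
      (∀ z < p.R ^ p.K, |M' 100 (z : ℤ)| < 2 ^ p.W) ∧
      (∀ b, b ≠ 100 → b ≠ 101 → M' b = M b) ∧
      ∀ y < p.R ^ (p.K - a), o.rel (2 ^ n) (fun x => M 100 (x + (p.R ^ a : ℕ) * y : ℤ))
        (M' 100 ((p.R ^ a : ℕ) * y : ℤ)) := by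
  have hbm : ∀ i j, i ≤ j → bnd i ≤ bnd j := fun i j hij =>
    Nat.rec (motive := fun d => bnd i ≤ bnd (i + d)) le_rfl
      (fun d hd => hd.trans (hmono (i + d))) (j - i) |>.trans_eq (by congr 1; omega)
  induction n generalizing M with
  | zero =>
    refine ⟨M, ⟨by simp [hh], rfl⟩, fun z hz => (hb z hz).trans_lt hW, fun _ _ _ => rfl,
      fun y hy => ?_⟩
    simpa using o.one (fun x => M 100 (x + (p.R ^ a : ℕ) * y : ℤ))
  | succ n ih =>
    have h2W : (2 : ℤ) ^ n < 2 ^ p.W := by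
      have : p.r * a ≤ p.r * p.K := Nat.mul_le_mul_left _ ha
      exact pow_lt_pow_right₀ (by norm_num) (by have := p.word; omega)
    obtain ⟨M₁, h1, h1a, -, h1f⟩ := exists_runs_setScalar (p := p) (M := M) 101 (.read 101 0 / 2)
      p.one_le_N (by
        simp [hh, pow_succ, h2W])
    have h1a' : M₁ 101 0 = 2 ^ n := by rw [h1a]; simp [hh, pow_succ]
    have hg1 : p.Good M₁ := hg.congr (h1f 5 (by norm_num))
    have hRa : (2 : ℕ) ^ (n + 1) ∣ p.R ^ a := by
      rw [Params.R, ← pow_mul]; exact pow_dvd_pow 2 hn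
    have hRK : p.R ^ p.K = p.R ^ a * p.R ^ (p.K - a) := by rw [← pow_add]; congr 1; omega
    have hRa0 : 0 < p.R ^ a := by have := p.R_pos; positivity
    have h2le : (2 : ℕ) ^ (n + 1) ≤ p.R ^ a := Nat.le_of_dvd hRa0 hRa
    have hval : ∀ z : ℕ, (Expr.cond (.lt (.pid % .powR a) (.read 101 0))
        (o.expr (.read 100 .pid) (.read 100 (.pid + .read 101 0))) (.read 100 .pid)).eval M₁ z =
        if z % p.R ^ a < 2 ^ n then o.fn (M 100 z) (M 100 ((z + 2 ^ n : ℕ) : ℤ)) else M 100 z := by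
      intro z
      have : ((z : ℤ) % ((p.R ^ a : ℕ) : ℤ) < 2 ^ n) ↔ z % p.R ^ a < 2 ^ n := by
        rw [← Int.natCast_mod]; exact_mod_cast Iff.rfl
      simp only [Expr.eval_cond, Expr.eval_lt, Expr.eval_mod, Expr.eval_pid, hg1.eval_powR,
        Expr.eval_read, Expr.eval_zero, h1a', o.eval, Expr.eval_add, h1f 100 (by norm_num), this,
        ne_eq, ind_eq_zero, not_not]
      push_cast; rfl
    have hbd : ∀ z < p.R ^ p.K, |if z % p.R ^ a < 2 ^ n then
        o.fn (M 100 z) (M 100 ((z + 2 ^ n : ℕ) : ℤ)) else M 100 z| ≤ bnd (p.r * a - n) := by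
      intro z hz
      have e1 : p.r * a - n = p.r * a - (n + 1) + 1 := by omega
      split_ifs with hc
      · rw [e1]
        refine hop _ _ _ (hb z hz) (hb _ ?_)
        -- Since z mod R^a is below 2^n and 2^(n+1) ≤ R^a, the partner z + 2^n lies in the same
        -- block and hence among the cells for which the bound is known.
        have h3 : z / p.R ^ a < p.R ^ (p.K - a) := by
          rw [Nat.div_lt_iff_lt_mul hRa0, mul_comm, ← hRK]; exact hz
        calc z + 2 ^ n = p.R ^ a * (z / p.R ^ a) + (z % p.R ^ a + 2 ^ n) := by
              rw [← add_assoc, Nat.div_add_mod]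
          _ < p.R ^ a * (z / p.R ^ a) + p.R ^ a := by rw [pow_succ] at h2le; omega
          _ = p.R ^ a * (z / p.R ^ a + 1) := by ring
          _ ≤ p.R ^ p.K := by rw [hRK]; exact Nat.mul_le_mul_left _ h3
      · exact (hb z hz).trans (hbm _ _ (by omega))
    obtain ⟨M₂, h2, h2a, h2f⟩ := exists_runs_assign (p := p) hg1 100
      (.cond (.lt (.pid % .powR a) (.read 101 0))
        (o.expr (.read 100 .pid) (.read 100 (.pid + .read 101 0))) (.read 100 .pid)) (by
        intro z hz
        rw [hval]
        exact (hbd z hz).trans_lt ((hbm _ _ (by omega)).trans_lt hW))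
    obtain ⟨M₃, h3, h3b, h3f, h3r⟩ := ih (by omega) (M := M₂)
      (hg1.congr (h2f 5 (by norm_num))) (by rw [h2f 101 (by norm_num), h1a'])
      (fun z hz => by rw [h2a z hz, hval]; exact hbd z hz)
    refine ⟨M₃, ⟨?_, M₂, h1.seq h2, h3⟩, h3b, fun b hb1 hb2 => ?_, fun y hy => ?_⟩
    · have : (1 : ℤ) < 2 ^ (n + 1) := one_lt_pow₀ (by norm_num) (by omega)
      simp [hh, this]
    · rw [h3f b hb1 hb2, h2f b hb1, h1f b hb2]
    · rw [pow_succ]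
      refine o.double _ _ _ ?_
      have h4 := h3r y hy
      have key : ∀ x : ℕ, x < 2 ^ n → M₂ 100 (x + (p.R ^ a : ℕ) * y : ℤ) =
          o.fn (M 100 (x + (p.R ^ a : ℕ) * y : ℤ))
            (M 100 ((x + 2 ^ n : ℕ) + (p.R ^ a : ℕ) * y : ℤ)) := by
        intro x hx
        have hxR : x < p.R ^ a := by rw [pow_succ] at h2le; omega
        have hlt : x + p.R ^ a * y < p.R ^ p.K := by
          calc x + p.R ^ a * y < p.R ^ a * (y + 1) := by rw [mul_add, mul_one]; omega
            _ ≤ _ := by rw [hRK]; exact Nat.mul_le_mul_left _ hy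
        have h5 := h2a _ hlt
        rw [hval, Nat.add_mul_mod_self_left, Nat.mod_eq_of_lt hxR, if_pos hx] at h5
        push_cast at h5 ⊢
        rw [h5]
        congr 2
        ring
      exact o.congr _ _ _ _ key h4
end PRAM

namespace PRAM
variable {p : Params}

/-- The argument with indices x and y is placed in cell x + R^a·y, so all folds for the different y
run side by side. The loop takes r·a ≤ r·K rounds, which is what the bound on loops in `Params`
provides for. -/
lemma exists_runs_fold (o : FoldOp) {a d out : ℕ} (had : a + d ≤ p.K)
    (bnd : ℕ → ℤ) (hmono : ∀ j, bnd j ≤ bnd (j + 1))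
    (hop : ∀ j u v, |u| ≤ bnd j → |v| ≤ bnd j → |o.fn u v| ≤ bnd (j + 1))
    (hW : bnd (p.r * a) < 2 ^ p.W) {M : Mem} (hg : p.Good M) {body : Expr → Expr → Expr}
    (g : ℕ → ℕ → ℤ)
    (hbody : ∀ (X Y : Expr) (i x y : ℕ), x < p.R ^ a → y < p.R ^ d → X.eval M i = (x : ℤ) →
      Y.eval M i = (y : ℤ) → (body X Y).eval M i = g x y)
    (hbnd : ∀ x < p.R ^ a, ∀ y < p.R ^ d, |g x y| ≤ bnd 0) :
    ∃ M', p.Runs (fold o a d out body) M M' ∧ (∀ b < 100, b ≠ out → M' b = M b) ∧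
      ∀ y < p.R ^ d, o.rel (p.R ^ a) (fun x => g x y) (M' out (y : ℤ)) := by
  have ha : a ≤ p.K := by omega
  have hR0 := p.R_pos
  have hRa0 : 0 < p.R ^ a := by positivity
  have hRK : p.R ^ p.K = p.R ^ a * p.R ^ (p.K - a) := by rw [← pow_add]; congr 1; omega
  have hRad : p.R ^ (a + d) = p.R ^ a * p.R ^ d := pow_add _ _ _
  have hdK : p.R ^ d ≤ p.R ^ (p.K - a) := Nat.pow_le_pow_right hR0 (by omega)
  have hlt : ∀ {x y Q : ℕ}, x < p.R ^ a → y < Q → x + p.R ^ a * y < p.R ^ a * Q :=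
    fun {x y Q} hx hy => by
      calc x + p.R ^ a * y < p.R ^ a * (y + 1) := by rw [mul_add, mul_one]; omega
        _ ≤ _ := Nat.mul_le_mul_left _ hy
  have hb0 : 0 ≤ bnd 0 := (abs_nonneg _).trans (hbnd 0 hRa0 0 (by positivity))
  have hval : ∀ z, (Expr.cond (.lt .pid (.powR (a + d)))
      (body (.pid % .powR a) (.pid / .powR a)) 0).eval M z =
      if z < p.R ^ (a + d) then g (z % p.R ^ a) (z / p.R ^ a) else 0 := by
    intro z
    simp only [Expr.eval_cond, Expr.eval_lt, Expr.eval_pid, hg.eval_powR, ne_eq, ind_eq_zero,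
      not_not, Nat.cast_lt, Expr.eval_zero]
    split_ifs with hz
    · refine hbody _ _ _ _ _ (Nat.mod_lt _ hRa0) ?_ ?_ ?_
      · rw [Nat.div_lt_iff_lt_mul hRa0, mul_comm, ← hRad]; exact hz
      · simp [hg.eval_powR]
      · simp [hg.eval_powR]
    · rfl
  have hval0 : ∀ z, |if z < p.R ^ (a + d) then g (z % p.R ^ a) (z / p.R ^ a) else 0| ≤ bnd 0 := by
    intro z
    split_ifs with hz
    · refine hbnd _ (Nat.mod_lt _ hRa0) _ ?_
      rw [Nat.div_lt_iff_lt_mul hRa0, mul_comm, ← hRad]; exact hz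
    · simpa using hb0
  have hb0W : bnd 0 < 2 ^ p.W :=
    (monotone_nat_of_le_succ hmono (Nat.zero_le (p.r * a))).trans_lt hW
  obtain ⟨M₁, h1, h1a, h1f⟩ := exists_runs_assign (p := p) hg 100 (.cond (.lt .pid (.powR (a + d)))
    (body (.pid % .powR a) (.pid / .powR a)) 0)
    (fun z _ => by rw [hval]; exact (hval0 z).trans_lt hb0W)
  have hg1 := hg.congr (h1f 5 (by norm_num))
  have h2W : ((p.R ^ a : ℕ) : ℤ) < 2 ^ p.W := lt_of_le_of_lt
    (by exact_mod_cast Nat.pow_le_pow_right hR0 ha) p.pow_lt_word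
  obtain ⟨M₂, h2, h2a, -, h2f⟩ := exists_runs_setScalar (p := p) (M := M₁) 101 (.powR a)
    p.one_le_N (by rw [hg1.eval_powR, abs_of_nonneg (by positivity)]; exact h2W)
  have hg2 := hg1.congr (h2f 5 (by norm_num))
  obtain ⟨M₃, h3, h3b, h3f, h3r⟩ := exists_runs_fold_loop o ha bnd hmono hop hW (p.r * a) le_rfl
    hg2 (by rw [h2a, hg1.eval_powR, Params.R, ← pow_mul]; push_cast; rfl) (by
      intro z hz
      rw [h2f 100 (by norm_num), h1a z hz, hval, Nat.sub_self]; exact hval0 z)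
  have hg3 := hg2.congr (h3f 5 (by norm_num) (by norm_num))
  have hread : ∀ z : ℕ, (Expr.cond (.lt (.pid * .powR a) .procs)
      (.read 100 (.pid * .powR a)) 0).eval M₃ z =
      if z * p.R ^ a < p.R ^ p.K then M₃ 100 ((z * p.R ^ a : ℕ) : ℤ) else 0 := by
    intro z
    have : ((z : ℤ) * ((p.R ^ a : ℕ) : ℤ) < ((p.R ^ p.K : ℕ) : ℤ)) ↔ z * p.R ^ a < p.R ^ p.K := by
      exact_mod_cast Iff.rfl
    simp only [Expr.eval_cond, Expr.eval_lt, Expr.eval_mul, Expr.eval_pid, hg3.eval_powR,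
      hg3.eval_procs, ne_eq, ind_eq_zero, not_not, this, Expr.eval_read, Expr.eval_zero]
    push_cast; rfl
  obtain ⟨M₄, h4, h4a, h4f⟩ := exists_runs_assign (p := p) hg3 out
    (.cond (.lt (.pid * .powR a) .procs) (.read 100 (.pid * .powR a)) 0) (fun z _ => by
      rw [hread]
      split_ifs with hz
      · exact h3b _ hz
      · simp)
  refine ⟨M₄, h1.seq (h2.seq (Params.Runs.seq (h3.runs ?_) h4)), fun b hb hbo => ?_, fun y hy => ?_⟩
  · have : p.r * a ≤ p.r * p.K := Nat.mul_le_mul_left _ ha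
    have := p.loops
    omega
  · rw [h4f b hbo, h3f b (by omega) (by omega), h2f b (by omega), h1f b (by omega)]
  · have hyK : y < p.R ^ (p.K - a) := hy.trans_le hdK
    have hyK' : y * p.R ^ a < p.R ^ p.K := by
      have := hlt hRa0 hyK
      rw [hRK, mul_comm y]; omega
    have hyN : y < p.R ^ p.K := (Nat.le_mul_of_pos_right y hRa0).trans_lt hyK'
    rw [h4a y hyN, hread, if_pos hyK']
    have h5 := h3r y hyK
    rw [show (2 : ℕ) ^ (p.r * a) = p.R ^ a by rw [Params.R, ← pow_mul]] at h5
    rw [mul_comm y, Nat.cast_mul]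
    refine o.congr _ _ _ _ (fun x hx => ?_) h5
    have h6 : x + p.R ^ a * y < p.R ^ p.K := by rw [hRK]; exact hlt hx hyK
    have h7 := h1a _ h6
    rw [hval, if_pos (by rw [hRad]; exact hlt hx hy), Nat.add_mul_mod_self_left,
      Nat.mod_eq_of_lt hx, Nat.add_mul_div_left _ _ hRa0, Nat.div_eq_of_lt hx, zero_add] at h7
    push_cast at h7 ⊢
    rw [h2f 100 (by norm_num), h7]

/-! ### Special folds -/

def sumOp : FoldOp where
  expr := (· + ·)
  fn := (· + ·)
  eval _ _ _ _ := rfl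
  rel h g v := v = ∑ x ∈ Finset.range h, g x
  congr h g g' v hgg hv := by
    rw [hv]; exact Finset.sum_congr rfl fun i hi => hgg i (Finset.mem_range.1 hi)
  one g := by simp
  double h g v hv := by
    rw [hv, mul_two, Finset.sum_range_add, Finset.sum_add_distrib]
    simp only [add_comm]

def prodOp : FoldOp where
  expr := (· * ·)
  fn := (· * ·)
  eval _ _ _ _ := rfl
  rel h g v := v = ∏ x ∈ Finset.range h, g x
  congr h g g' v hgg hv := by
    rw [hv]; exact Finset.prod_congr rfl fun i hi => hgg i (Finset.mem_range.1 hi)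
  one g := by simp
  double h g v hv := by
    rw [hv, mul_two, Finset.prod_range_add, Finset.prod_mul_distrib]
    simp only [add_comm]

def maxOp : FoldOp where
  expr X Y := .cond (.lt X Y) Y X
  fn := max
  eval X Y M i := by
    simp only [Expr.eval_cond, Expr.eval_lt, ne_eq, ind_eq_zero, not_not]
    split_ifs <;> omega
  rel h g v := (∀ x < h, g x ≤ v) ∧ ∃ x < h, g x = v
  congr h g g' v hgg hv := by
    refine ⟨fun x hx => hgg x hx ▸ hv.1 x hx, ?_⟩
    obtain ⟨x, hx, h⟩ := hv.2
    exact ⟨x, hx, hgg x hx ▸ h⟩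
  one g := by simp
  double h g v hv := by
    obtain ⟨h1, x, hx, h2⟩ := hv
    refine ⟨fun y hy => ?_, ?_⟩
    · by_cases hyh : y < h
      · exact (le_max_left _ _).trans (h1 y hyh)
      · have := (le_max_right _ _).trans (h1 (y - h) (by omega))
        rwa [Nat.sub_add_cancel (by omega)] at this
    · rcases max_choice (g x) (g (x + h)) with h' | h'
      · exact ⟨x, by omega, h'.symm.trans h2⟩
      · exact ⟨x + h, by omega, h'.symm.trans h2⟩

def minOp : FoldOp where
  expr X Y := .cond (.lt X Y) X Y
  fn := min
  eval X Y M i := by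
    simp only [Expr.eval_cond, Expr.eval_lt, ne_eq, ind_eq_zero, not_not]
    split_ifs <;> omega
  rel h g v := (∀ x < h, v ≤ g x) ∧ ∃ x < h, g x = v
  congr h g g' v hgg hv := by
    refine ⟨fun x hx => hgg x hx ▸ hv.1 x hx, ?_⟩
    obtain ⟨x, hx, h⟩ := hv.2
    exact ⟨x, hx, hgg x hx ▸ h⟩
  one g := by simp
  double h g v hv := by
    obtain ⟨h1, x, hx, h2⟩ := hv
    refine ⟨fun y hy => ?_, ?_⟩
    · by_cases hyh : y < h
      · exact (h1 y hyh).trans (min_le_left _ _)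
      · have := (h1 (y - h) (by omega)).trans (min_le_right _ _)
        rwa [Nat.sub_add_cancel (by omega)] at this
    · rcases min_choice (g x) (g (x + h)) with h' | h'
      · exact ⟨x, by omega, h'.symm.trans h2⟩
      · exact ⟨x + h, by omega, h'.symm.trans h2⟩

section

variable {a d out : ℕ} {M : Mem} {body : Expr → Expr → Expr}

/-- `body x y` evaluates to `g x y`. -/
def Evals2 (p : Params) (M : Mem) (a d : ℕ) (body : Expr → Expr → Expr) (g : ℕ → ℕ → ℤ) : Prop :=
  ∀ (X Y : Expr) (i x y : ℕ), x < p.R ^ a → y < p.R ^ d → X.eval M i = (x : ℤ) → Y.eval M i = (y : ℤ) →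
    (body X Y).eval M i = g x y

/-- After a statement that writes only the array `out < 100`. -/
def Post (p : Params) (P : Prog) (M : Mem) (out : ℕ) (Q : (ℤ → ℤ) → Prop) : Prop :=
  ∃ M', p.Runs P M M' ∧ (∀ b < 100, b ≠ out → M' b = M b) ∧ Q (M' out)

lemma sum_spec (had : a + d ≤ p.K) (hg : p.Good M) (g : ℕ → ℕ → ℤ) (b : ℤ)
    (hbody : Evals2 p M a d body g) (hb : ∀ x < p.R ^ a, ∀ y < p.R ^ d, |g x y| ≤ b)
    (hW : (p.R ^ a : ℕ) * b < 2 ^ p.W) :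
    Post p (fold sumOp a d out body) M out fun A =>
      ∀ y < p.R ^ d, A (y : ℤ) = ∑ x ∈ Finset.range (p.R ^ a), g x y := by
  have hR0 := p.R_pos
  have hb0 : 0 ≤ b := (abs_nonneg _).trans (hb 0 (by positivity) 0 (by positivity))
  obtain ⟨M', h1, h2, h3⟩ := exists_runs_fold sumOp had (fun j => 2 ^ j * b)
    (fun j => by rw [pow_succ]; nlinarith [pow_pos (two_pos : (0 : ℤ) < 2) j])
    (fun j u v hu hv => by
      have := abs_add_le u v
      change |u + v| ≤ _
      rw [pow_succ]; linarith)
    (by rw [Params.R, ← pow_mul] at hW; push_cast at hW; exact hW) hg g hbody (by simpa using hb)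
  exact ⟨M', h1, h2, h3⟩

/-- The bound may square in every round, so after j rounds it is b to the power 2^j. -/
lemma prod_spec (had : a + d ≤ p.K) (hg : p.Good M) (g : ℕ → ℕ → ℤ) (b : ℤ)
    (hbody : Evals2 p M a d body g) (hb1 : 1 ≤ b)
    (hb : ∀ x < p.R ^ a, ∀ y < p.R ^ d, |g x y| ≤ b) (hW : b ^ p.R ^ a < 2 ^ p.W) :
    Post p (fold prodOp a d out body) M out fun A =>
      ∀ y < p.R ^ d, A (y : ℤ) = ∏ x ∈ Finset.range (p.R ^ a), g x y := by
  obtain ⟨M', h1, h2, h3⟩ := exists_runs_fold prodOp had (fun j => b ^ 2 ^ j)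
    (fun j => pow_le_pow_right₀ hb1 (Nat.pow_le_pow_right two_pos j.le_succ))
    (fun j u v hu hv => by
      change |u * v| ≤ _
      rw [abs_mul, pow_succ, pow_mul, sq]
      exact mul_le_mul hu hv (abs_nonneg _) ((abs_nonneg _).trans hu))
    (by rw [Params.R, ← pow_mul] at hW; exact hW) hg g hbody (by simpa using hb)
  exact ⟨M', h1, h2, h3⟩

lemma max_spec (had : a + d ≤ p.K) (hg : p.Good M) (g : ℕ → ℕ → ℤ) (b : ℤ)
    (hbody : Evals2 p M a d body g) (hb : ∀ x < p.R ^ a, ∀ y < p.R ^ d, |g x y| ≤ b)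
    (hW : b < 2 ^ p.W) :
    Post p (fold maxOp a d out body) M out fun A =>
      ∀ y < p.R ^ d, (∀ x < p.R ^ a, g x y ≤ A (y : ℤ)) ∧ ∃ x < p.R ^ a, g x y = A (y : ℤ) := by
  obtain ⟨M', h1, h2, h3⟩ := exists_runs_fold maxOp had (fun _ => b) (fun _ => le_rfl)
    (fun j u v hu hv => by
      rw [abs_le] at hu hv ⊢
      change _ ≤ max u v ∧ max u v ≤ _
      omega) hW hg g hbody hb
  exact ⟨M', h1, h2, h3⟩

lemma min_spec (had : a + d ≤ p.K) (hg : p.Good M) (g : ℕ → ℕ → ℤ) (b : ℤ)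
    (hbody : Evals2 p M a d body g) (hb : ∀ x < p.R ^ a, ∀ y < p.R ^ d, |g x y| ≤ b)
    (hW : b < 2 ^ p.W) :
    Post p (fold minOp a d out body) M out fun A =>
      ∀ y < p.R ^ d, (∀ x < p.R ^ a, A (y : ℤ) ≤ g x y) ∧ ∃ x < p.R ^ a, g x y = A (y : ℤ) := by
  obtain ⟨M', h1, h2, h3⟩ := exists_runs_fold minOp had (fun _ => b) (fun _ => le_rfl)
    (fun j u v hu hv => by
      rw [abs_le] at hu hv ⊢
      change _ ≤ min u v ∧ min u v ≤ _
      omega) hW hg g hbody hb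
  exact ⟨M', h1, h2, h3⟩

/-- The maximum of indicators is an existential quantifier. All set-theoretic predicates of the
algorithm are decided in this way. -/
lemma any_spec (had : a + d ≤ p.K) (hg : p.Good M) (q : ℕ → ℕ → Prop)
    (hbody : Evals2 p M a d body fun x y => ind (q x y)) :
    Post p (fold maxOp a d out body) M out fun A =>
      ∀ y < p.R ^ d, A (y : ℤ) = ind (∃ x < p.R ^ a, q x y) := by
  obtain ⟨M', h1, h2, h3⟩ := max_spec had hg _ 1 hbody
    (fun x _ y _ => abs_ind_le _) p.one_lt_word
  refine ⟨M', h1, h2, fun y hy => ?_⟩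
  obtain ⟨h4, x, hx, h5⟩ := h3 y hy
  by_cases hex : ∃ x < p.R ^ a, q x y
  · obtain ⟨x', hx', hq⟩ := hex
    have h6 := h4 x' hx'
    rw [ind_true hq] at h6
    rw [ind_true ⟨x', hx', hq⟩]
    have := ind_le_one (q x y)
    omega
  · rw [ind_false hex, ← h5]
    exact ind_false fun hq => hex ⟨x, hx, hq⟩

end

/-- `out[y]` becomes `v y`, for all `y < R ^ d`. -/
def setArr (d out : ℕ) (v : Expr → Expr) : Prog :=
  assign out (.cond (.lt .pid (.powR d)) (v .pid) 0)

lemma setArr_spec {d out : ℕ} {M : Mem} {v : Expr → Expr} (hd : d ≤ p.K) (hg : p.Good M)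
    (g : ℕ → ℤ) (hv : ∀ (Y : Expr) (i y : ℕ), y < p.R ^ d → Y.eval M i = (y : ℤ) → (v Y).eval M i = g y)
    (hb : ∀ y < p.R ^ d, |g y| < 2 ^ p.W) :
    Post p (setArr d out v) M out fun A => ∀ y < p.R ^ d, A (y : ℤ) = g y := by
  have hval : ∀ z : ℕ, (Expr.cond (.lt .pid (.powR d)) (v .pid) 0).eval M z =
      if z < p.R ^ d then g z else 0 := by
    intro z
    simp only [Expr.eval_cond, Expr.eval_lt, Expr.eval_pid, hg.eval_powR, ne_eq, ind_eq_zero,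
      not_not, Nat.cast_lt, Expr.eval_zero]
    split_ifs with hz
    · exact hv _ _ _ hz rfl
    · rfl
  obtain ⟨M', h1, h2, h3⟩ := exists_runs_assign (p := p) hg out
    (.cond (.lt .pid (.powR d)) (v .pid) 0) (fun z _ => by
      rw [hval]
      split_ifs with hz
      · exact hb z hz
      · simp)
  refine ⟨M', h1, fun b _ hb => h3 b hb, fun y hy => ?_⟩
  rw [h2 y (hy.trans_le (Nat.pow_le_pow_right p.R_pos hd)), hval, if_pos hy]

lemma setArr_ind_spec {d out : ℕ} {M : Mem} {v : Expr → Expr} (hd : d ≤ p.K) (hg : p.Good M)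
    (q : ℕ → Prop)
    (hv : ∀ (Y : Expr) (i y : ℕ), y < p.R ^ d → Y.eval M i = (y : ℤ) → (v Y).eval M i = ind (q y)) :
    Post p (setArr d out v) M out fun A => ∀ y < p.R ^ d, A (y : ℤ) = ind (q y) :=
  setArr_spec hd hg _ hv fun _ _ => (abs_ind_le _).trans_lt p.one_lt_word

lemma setScalar_spec {out : ℕ} {M : Mem} {v : Expr} (z : ℤ) (hv : v.eval M 0 = z)
    (hW : |z| < 2 ^ p.W) : Post p (setScalar out v) M out fun A => A 0 = z := by
  obtain ⟨M', h1, h2, -, h3⟩ := exists_runs_setScalar (p := p) (M := M) out v p.one_le_N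
    (by rwa [hv])
  exact ⟨M', h1, fun b _ hb => h3 b hb, h2.trans hv⟩

/-! ### Multi-dimensional arrays -/

/-- The cell `(y, z)` of an array whose first index is less than `R ^ c`. -/
def Params.adr (p : Params) (c y z : ℕ) : ℤ := ((y + p.R ^ c * z : ℕ) : ℤ)

def Expr.read2 (a c : ℕ) (Y Z : Expr) : Expr := .read a (Y + .powR c * Z)

lemma Expr.eval_read2 {M : Mem} (hg : p.Good M) {a c i : ℕ} {Y Z : Expr} {y z : ℕ}
    (hY : Y.eval M i = (y : ℤ)) (hZ : Z.eval M i = (z : ℤ)) :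
    (Expr.read2 a c Y Z).eval M i = M a (p.adr c y z) := by
  simp [Expr.read2, Params.adr, hY, hZ, hg.eval_powR]

/-- Statements whose output has two indices. -/
def split (c : ℕ) (body : Expr → Expr → Expr → Expr) : Expr → Expr → Expr :=
  fun X Y => body X (Y % .powR c) (Y / .powR c)

lemma Evals2.split {M : Mem} (hg : p.Good M) {a c d : ℕ} {body : Expr → Expr → Expr → Expr}
    {g : ℕ → ℕ → ℕ → ℤ}
    (h : ∀ (X Y Z : Expr) (i x y z : ℕ), x < p.R ^ a → y < p.R ^ c → z < p.R ^ d → X.eval M i = (x : ℤ) →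
      Y.eval M i = (y : ℤ) → Z.eval M i = (z : ℤ) → (body X Y Z).eval M i = g x y z) :
    Evals2 p M a (c + d) (split c body) fun x y => g x (y % p.R ^ c) (y / p.R ^ c) := by
  intro X Y i x y hx hy hX hY
  have hRc : 0 < p.R ^ c := by have := p.R_pos; positivity
  refine h _ _ _ _ _ _ _ hx (Nat.mod_lt _ hRc) ?_ hX ?_ ?_
  · rw [Nat.div_lt_iff_lt_mul hRc, mul_comm, ← pow_add]; exact hy
  · simp [hY, hg.eval_powR]
  · simp [hY, hg.eval_powR]

lemma adr_lt {p : Params} {c d y z : ℕ} (hy : y < p.R ^ c) (hz : z < p.R ^ d) :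
    y + p.R ^ c * z < p.R ^ (c + d) := by
  calc y + p.R ^ c * z < p.R ^ c * (z + 1) := by rw [mul_add, mul_one]; omega
    _ ≤ p.R ^ c * p.R ^ d := Nat.mul_le_mul_left _ hz
    _ = _ := (pow_add _ _ _).symm

lemma adr_mod {p : Params} {c y z : ℕ} (hy : y < p.R ^ c) : (y + p.R ^ c * z) % p.R ^ c = y := by
  rw [Nat.add_mul_mod_self_left, Nat.mod_eq_of_lt hy]

lemma adr_div {p : Params} {c y z : ℕ} (hy : y < p.R ^ c) : (y + p.R ^ c * z) / p.R ^ c = z := by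
  rw [Nat.add_mul_div_left _ _ (by have := p.R_pos; positivity), Nat.div_eq_of_lt hy, zero_add]

lemma any2_spec {a c d out : ℕ} {M : Mem} {body : Expr → Expr → Expr → Expr}
    (had : a + (c + d) ≤ p.K) (hg : p.Good M) (q : ℕ → ℕ → ℕ → Prop)
    (h : ∀ (X Y Z : Expr) (i x y z : ℕ), x < p.R ^ a → y < p.R ^ c → z < p.R ^ d → X.eval M i = (x : ℤ) →
      Y.eval M i = (y : ℤ) → Z.eval M i = (z : ℤ) → (body X Y Z).eval M i = ind (q x y z)) :
    Post p (fold maxOp a (c + d) out (split c body)) M out fun A =>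
      ∀ y < p.R ^ c, ∀ z < p.R ^ d, A (p.adr c y z) = ind (∃ x < p.R ^ a, q x y z) := by
  obtain ⟨M', h1, h2, h3⟩ := any_spec had hg _
    (Evals2.split hg (g := fun x y z => ind (q x y z)) h)
  refine ⟨M', h1, h2, fun y hy z hz => ?_⟩
  rw [Params.adr, h3 _ (adr_lt hy hz), adr_mod hy, adr_div hy]

lemma set2_ind_spec {c d out : ℕ} {M : Mem} {body : Expr → Expr → Expr} (had : c + d ≤ p.K)
    (hg : p.Good M) (q : ℕ → ℕ → Prop)
    (h : ∀ (Y Z : Expr) (i y z : ℕ), y < p.R ^ c → z < p.R ^ d → Y.eval M i = (y : ℤ) →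
      Z.eval M i = (z : ℤ) → (body Y Z).eval M i = ind (q y z)) :
    Post p (setArr (c + d) out (split c (fun _ => body) 0)) M out fun A =>
      ∀ y < p.R ^ c, ∀ z < p.R ^ d, A (p.adr c y z) = ind (q y z) := by
  obtain ⟨M', h1, h2, h3⟩ := setArr_ind_spec (v := split c (fun _ => body) 0) (out := out) had hg
    (fun y => q (y % p.R ^ c) (y / p.R ^ c)) (fun Y i y hy hY =>
      Evals2.split hg (a := 0) (g := fun _ y z => ind (q y z)) (body := fun _ => body)
        (fun X Y Z i x y z _ hy hz _ hY hZ => h Y Z i y z hy hz hY hZ) 0 Y i 0 y (by simp) hy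
        rfl hY)
  refine ⟨M', h1, h2, fun y hy z hz => ?_⟩
  rw [Params.adr, h3 _ (adr_lt hy hz), adr_mod hy, adr_div hy]

end PRAM

/-! ### A derandomized step towards a maximal independent set -/

namespace PairwiseSampling

/-- Pairwise independence: modulo a prime, (a, b) ↦ (aw + b, au + b) is injective for incongruent w
and u, hence a bijection of the q² seeds onto the q² pairs of residues. -/
lemma card_seeds {q : ℕ} (hq : q.Prime) {w u : ℕ} (hwu : ¬ w ≡ u [MOD q]) {t t' : ℕ} (ht : t ≤ q)
    (ht' : t' ≤ q) : ((Finset.range q ×ˢ Finset.range q).filter fun s : ℕ × ℕ =>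
      (s.1 * w + s.2) % q < t ∧ (s.1 * u + s.2) % q < t').card = t * t' := by
  have hq0 := hq.pos
  have := Fact.mk hq
  set D := Finset.range q ×ˢ Finset.range q
  set F : ℕ × ℕ → ℕ × ℕ := fun s => ((s.1 * w + s.2) % q, (s.1 * u + s.2) % q)
  have hmaps : Set.MapsTo F D D := fun s _ => by
    simp [F, D, Nat.mod_lt _ hq0]
  have hinj : Set.InjOn F D := by
    rintro ⟨a, b⟩ hab ⟨a', b'⟩ hab' h
    simp only [D, Finset.coe_product, Finset.coe_range, Set.mem_prod, Set.mem_Iio] at hab hab'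
    simp only [F, Prod.mk.injEq] at h
    have h1 : ((a * w + b : ℕ) : ZMod q) = (a' * w + b' : ℕ) := (ZMod.natCast_eq_natCast_iff _ _ _).2 h.1
    have h2 : ((a * u + b : ℕ) : ZMod q) = (a' * u + b' : ℕ) := (ZMod.natCast_eq_natCast_iff _ _ _).2 h.2
    push_cast at h1 h2
    have h3 : ((a : ZMod q) - a') * ((w : ZMod q) - u) = 0 := by linear_combination h1 - h2
    have h4 : ((w : ZMod q) - u) ≠ 0 := fun h0 =>
      hwu ((ZMod.natCast_eq_natCast_iff _ _ _).1 (sub_eq_zero.1 h0))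
    have h5 : (a : ZMod q) = a' := sub_eq_zero.1 ((mul_eq_zero.1 h3).resolve_right h4)
    have h6 : (b : ZMod q) = b' := by rw [h5] at h1; linear_combination h1
    have h7 := Nat.ModEq.eq_of_lt_of_lt ((ZMod.natCast_eq_natCast_iff _ _ _).1 h5) hab.1 hab'.1
    have h8 := Nat.ModEq.eq_of_lt_of_lt ((ZMod.natCast_eq_natCast_iff _ _ _).1 h6) hab.2 hab'.2
    rw [h7, h8]
  have hsurj : Set.SurjOn F D D := Finset.surjOn_of_injOn_of_card_le F hmaps hinj le_rfl
  rw [← Finset.card_range t, ← Finset.card_range t', ← Finset.card_product]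
  refine Finset.card_nbij F (fun s hs => ?_) (hinj.mono (Finset.filter_subset _ _)) fun s hs => ?_
  · simpa [F] using (Finset.mem_filter.1 hs).2
  · simp only [Finset.coe_product, Finset.coe_range, Set.mem_prod, Set.mem_Iio] at hs
    obtain ⟨x, hx, hxs⟩ := hsurj (a := s) (by simp [D]; omega)
    refine ⟨x, Finset.mem_coe.2 (Finset.mem_filter.2 ⟨hx, ?_⟩), hxs⟩
    rw [← hxs] at hs
    simpa only [Finset.card_range] using hs

open Classical in
lemma sum_indicator {q : ℕ} (hq : q.Prime) {w u : ℕ} (hwu : ¬ w ≡ u [MOD q]) {t : ℕ} (ht : t ≤ q) :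
    ∑ s ∈ Finset.range q ×ˢ Finset.range q, ((if (s.1 * w + s.2) % q < t then (1 : ℤ) else 0) *
      if (s.1 * u + s.2) % q < t then 1 else 0) = t * t := by
  have := card_seeds hq hwu ht ht
  rw [Finset.card_filter] at this
  rw [← Nat.cast_mul, ← this]
  push_cast
  refine Finset.sum_congr rfl fun s _ => ?_
  split_ifs <;> simp_all

open Classical in
lemma sum_indicator_one {q : ℕ} (hq : q.Prime) (w : ℕ) {t : ℕ} (ht : t ≤ q) :
    ∑ s ∈ Finset.range q ×ˢ Finset.range q, (if (s.1 * w + s.2) % q < t then (1 : ℤ) else 0) =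
      q * t := by
  -- The count for a single vertex is obtained from the count for pairs, with w + 1 as second vertex
  -- and the vacuous threshold q.
  have hw : ¬ w ≡ w + 1 [MOD q] := fun h => by
    have h1 : 0 ≡ 1 [MOD q] := Nat.ModEq.add_left_cancel' w (by simpa using h)
    have := (Nat.modEq_iff_dvd' (by norm_num)).1 h1
    exact hq.one_lt.ne' (Nat.dvd_one.1 (by simpa using this))
  have := card_seeds hq hw ht le_rfl
  rw [Finset.card_filter] at this
  rw [mul_comm, ← Nat.cast_mul, ← this]
  push_cast
  refine Finset.sum_congr rfl fun s _ => ?_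
  have := Nat.mod_lt (s.1 * (w + 1) + s.2) hq.pos
  simp [this]

section

variable (V : Finset ℕ) (adj : ℕ → ℕ → Prop) (q t : ℕ)

/-- The marked vertices. -/
def Marked (a b w : ℕ) : Prop := w ∈ V ∧ (a * w + b) % q < t

/-- The marked vertices without marked neighbours. -/
def Selected (a b w : ℕ) : Prop := Marked V q t a b w ∧ ∀ u, Marked V q t a b u → ¬ adj u w

/-- The vertices that are selected or have a selected neighbour. -/
def Killed (a b v : ℕ) : Prop := ∃ w, Selected V adj q t a b w ∧ (w = v ∨ adj w v)

open Classical in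
/-- The closed neighbourhood. -/
noncomputable def nbhd (v : ℕ) : Finset ℕ := V.filter fun u => u = v ∨ adj u v

open Classical in
/-- The vertices with many neighbours. -/
noncomputable def large (Δ : ℕ) : Finset ℕ := V.filter fun v => Δ < 2 * (nbhd V adj v).card

variable {V adj q t}

open Classical in
-- An inclusion-exclusion bound for one seed, with k the number of marked vertices in the closed
-- neighbourhood of v. If v is not killed, each of these k vertices has a marked neighbour, so the
-- first correction term is at least k. If v is killed, the second correction term k² - k keeps the
-- left side at most 1. Only products of two marks occur, so pairwise independence suffices for
-- averaging.
lemma pointwise (hirr : ∀ v, ¬ adj v v) {v : ℕ} (a b : ℕ)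
    (X : ℕ → ℤ) (hX : ∀ w, X w = if (a * w + b) % q < t then 1 else 0) :
    ∑ w ∈ nbhd V adj v, X w - ∑ w ∈ nbhd V adj v, ∑ u ∈ (nbhd V adj w).erase w, X w * X u -
      ∑ w ∈ nbhd V adj v, ∑ u ∈ (nbhd V adj v).erase w, X w * X u ≤
    if Killed V adj q t a b v then 1 else 0 := by
  have h0 : ∀ w, 0 ≤ X w := fun w => by rw [hX]; split_ifs <;> simp
  set k := ∑ w ∈ nbhd V adj v, X w
  have hk0 : 0 ≤ k := Finset.sum_nonneg fun w _ => h0 w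
  have h3 : ∑ w ∈ nbhd V adj v, ∑ u ∈ (nbhd V adj v).erase w, X w * X u = k * k - k := by
    have : ∀ w ∈ nbhd V adj v, ∑ u ∈ (nbhd V adj v).erase w, X w * X u = X w * k - X w := by
      intro w hw
      rw [← Finset.mul_sum, Finset.sum_erase_eq_sub hw, mul_sub]
      congr 1
      rw [hX]; split_ifs <;> simp
    rw [Finset.sum_congr rfl this, Finset.sum_sub_distrib, ← Finset.sum_mul]
  have hkk : k ≤ k * k := by
    rcases hk0.eq_or_lt with h | h
    · simp [← h]
    · exact le_mul_of_one_le_left hk0 h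
  rw [h3]
  split_ifs with hkill
  · have h4 : 0 ≤ ∑ w ∈ nbhd V adj v, ∑ u ∈ (nbhd V adj w).erase w, X w * X u :=
      Finset.sum_nonneg fun w _ => Finset.sum_nonneg fun u _ => mul_nonneg (h0 w) (h0 u)
    -- What is left to show is 2k - k² ≤ 1.
    nlinarith [sq_nonneg (k - 1)]
  · have h4 : k ≤ ∑ w ∈ nbhd V adj v, ∑ u ∈ (nbhd V adj w).erase w, X w * X u := by
      refine Finset.sum_le_sum fun w hw => ?_
      rw [← Finset.mul_sum]
      by_cases hm : (a * w + b) % q < t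
      · have hwV := Finset.mem_filter.1 hw
        have : ∃ u, Marked V q t a b u ∧ adj u w := by
          by_contra! hcon
          exact hkill ⟨w, ⟨⟨hwV.1, hm⟩, hcon⟩, hwV.2⟩
        obtain ⟨u, hu, huw⟩ := this
        have huw' : u ≠ w := fun h => hirr w (h ▸ huw)
        have h5 : X u ≤ ∑ u ∈ (nbhd V adj w).erase w, X u :=
          Finset.single_le_sum (f := X) (fun i _ => h0 i)
            (Finset.mem_erase.2 ⟨huw', Finset.mem_filter.2 ⟨hu.1, Or.inr huw⟩⟩)
        rw [hX u, if_pos hu.2] at h5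
        exact le_mul_of_one_le_right (h0 w) h5
      · rw [hX w, if_neg hm, zero_mul]
    linarith

open Classical in
/-- Some seed kills a constant fraction of the vertices of large degree. -/
theorem exists_seed (hirr : ∀ v, ¬ adj v v) (hq : q.Prime) (hV : ∀ v ∈ V, v < q) {Δ : ℕ}
    (hΔ : 0 < Δ) (hdeg : ∀ v ∈ V, (nbhd V adj v).card ≤ Δ) (hΔq : 4 * Δ ≤ q)
    (ht : t = q / (4 * Δ)) :
    ∃ a < q, ∃ b < q, (large V adj Δ).card ≤
      32 * ((large V adj Δ).filter fun v => Killed V adj q t a b v).card := by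
  have hq0 := hq.pos
  have htq : t ≤ q := ht ▸ Nat.div_le_self _ _
  -- The marking probability t/q lies between 1/(8Δ) and 1/(4Δ); the hypothesis 4Δ ≤ q guarantees t
  -- ≥ 1, so that rounding down loses at most a factor 2.
  have ht1 : 4 * Δ * t ≤ q := ht ▸ Nat.mul_div_le q (4 * Δ)
  have ht2 : q ≤ 8 * Δ * t := by
    have h1 : q < 4 * Δ * (t + 1) := by
      rw [ht]; exact Nat.lt_mul_div_succ q (by omega)
    have h2 : 1 ≤ t := by rw [ht]; exact (Nat.one_le_div_iff (by omega)).2 hΔq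
    nlinarith
  have hmod : ∀ {w u : ℕ}, w ∈ V → u ∈ V → w ≠ u → ¬ w ≡ u [MOD q] := fun hw hu hne h =>
    hne (h.eq_of_lt_of_lt (hV _ hw) (hV _ hu))
  have hnb : ∀ {v w : ℕ}, w ∈ nbhd V adj v → w ∈ V := fun h => (Finset.mem_filter.1 h).1
  set D := Finset.range q ×ˢ Finset.range q
  set X : ℕ × ℕ → ℕ → ℤ := fun s w => if (s.1 * w + s.2) % q < t then 1 else 0
  -- For each vertex of large degree, at least a 1/32 fraction of the q² seeds kills it.
  have key : ∀ v ∈ large V adj Δ, (q : ℤ) * q ≤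
      32 * ∑ s ∈ D, if Killed V adj q t s.1 s.2 v then (1 : ℤ) else 0 := by
    intro v hv
    obtain ⟨hvV, hvd⟩ := Finset.mem_filter.1 hv
    have h1 := Finset.sum_le_sum fun s (_ : s ∈ D) =>
      pointwise (V := V) (q := q) (t := t) hirr (v := v) s.1 s.2 (X s) (fun _ => rfl)
    rw [Finset.sum_sub_distrib, Finset.sum_sub_distrib] at h1
    have e1 : ∑ s ∈ D, ∑ w ∈ nbhd V adj v, X s w = (nbhd V adj v).card * (q * t) := by
      rw [Finset.sum_comm, Finset.sum_congr rfl fun w _ => sum_indicator_one hq w htq,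
        Finset.sum_const, nsmul_eq_mul]
    have e2 : ∀ U : ℕ → Finset ℕ, (∀ w, U w ⊆ V) → (∀ w ∈ V, (U w).card ≤ Δ) →
        ∑ s ∈ D, ∑ w ∈ nbhd V adj v, ∑ u ∈ (U w).erase w, X s w * X s u ≤
          (nbhd V adj v).card * (Δ * (t * t)) := by
      intro U hU hc
      rw [Finset.sum_comm, ← nsmul_eq_mul]
      refine Finset.sum_le_card_nsmul _ _ _ fun w hw => ?_
      rw [Finset.sum_comm, Finset.sum_congr rfl fun u hu => sum_indicator hq
        (hmod (hnb hw) (hU w (Finset.mem_of_mem_erase hu)) (Finset.ne_of_mem_erase hu).symm) htq,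
        Finset.sum_const, nsmul_eq_mul]
      refine mul_le_mul_of_nonneg_right ?_ (by positivity)
      exact_mod_cast (Finset.card_erase_le).trans (hc w (hnb hw))
    have e3 := e2 (fun w => nbhd V adj w) (fun w => Finset.filter_subset _ _) hdeg
    have e4 := e2 (fun _ => nbhd V adj v) (fun w => Finset.filter_subset _ _)
      (fun _ _ => hdeg v hvV)
    rw [e1] at h1
    set d : ℤ := ((nbhd V adj v).card : ℤ) with hd
    have hd0 : 0 ≤ d := Nat.cast_nonneg _
    have hvd' : (Δ : ℤ) < 2 * d := by rw [hd]; exact_mod_cast hvd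
    have ht1' : 4 * (Δ : ℤ) * t ≤ q := by exact_mod_cast ht1
    have ht2' : (q : ℤ) ≤ 8 * Δ * t := by exact_mod_cast ht2
    have ht0 : (0 : ℤ) ≤ t := Nat.cast_nonneg _
    have hqz : (0 : ℤ) ≤ q := Nat.cast_nonneg _
    have h2 : d * (q * t) - 2 * (d * (Δ * (t * t))) ≤
        ∑ s ∈ D, if Killed V adj q t s.1 s.2 v then (1 : ℤ) else 0 := by linarith
    -- The main term is dtq. The two corrections take away at most 2dΔt², which is at most half of
    -- it because 4Δt ≤ q. Since 2d > Δ and 8Δt ≥ q, the remaining half is at least q²/32.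
    have h3 : (q : ℤ) * q ≤ 16 * (d * t) * q := by
      refine mul_le_mul_of_nonneg_right ?_ hqz
      nlinarith
    have h4 : d * t * (4 * (Δ : ℤ) * t) ≤ d * t * q :=
      mul_le_mul_of_nonneg_left ht1' (mul_nonneg hd0 ht0)
    linarith
  -- If every seed killed less than a 1/32 fraction, summing over all seeds would contradict the
  -- bound per vertex.
  by_contra! hcon
  have hsum : ((large V adj Δ).card : ℤ) * (q * q) ≤ 32 * ∑ s ∈ D,
      (((large V adj Δ).filter fun v => Killed V adj q t s.1 s.2 v).card : ℤ) := by
    have h1 := Finset.card_nsmul_le_sum _ _ _ key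
    rw [nsmul_eq_mul, ← Finset.mul_sum, Finset.sum_comm] at h1
    refine h1.trans (le_of_eq ?_)
    congr 1
    refine Finset.sum_congr rfl fun s _ => ?_
    rw [Finset.card_filter]; push_cast; rfl
  have hlt : 32 * ∑ s ∈ D,
      (((large V adj Δ).filter fun v => Killed V adj q t s.1 s.2 v).card : ℤ) <
      (large V adj Δ).card * (q * q) := by
    rw [Finset.mul_sum]
    have hD : (D.card : ℤ) = q * q := by simp [D]
    rw [mul_comm, ← hD, ← nsmul_eq_mul, ← Finset.sum_const]
    refine Finset.sum_lt_sum_of_nonempty ⟨(0, 0), by simp [D, hq0]⟩ fun s hs => ?_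
    simp only [D, Finset.mem_product, Finset.mem_range] at hs
    exact_mod_cast hcon s.1 hs.1 s.2 hs.2
  linarith

end

end PairwiseSampling

/-! ### Maximal independent sets on the machine -/

namespace PairwiseSampling

/-- The invariant of a computation of a maximal independent set of the vertices `V`: the vertices in
`cur` are undecided, the set `I` has been selected. -/
structure MISInv (V : Finset ℕ) (adj : ℕ → ℕ → Prop) (cur I : Finset ℕ) : Prop where
  cur_subset : cur ⊆ V
  subset : I ⊆ V
  indep : ∀ u ∈ I, ∀ v ∈ I, ¬ adj u v
  dom : ∀ v ∈ V, v ∈ cur ∨ ∃ w ∈ I, w = v ∨ adj w v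
  sep : ∀ v ∈ cur, ∀ w ∈ I, w ≠ v ∧ ¬ adj w v

open Classical in
-- This holds for every seed, good or bad: a marked vertex without marked neighbours is adjacent to
-- no other such vertex, and exactly the selected vertices and their neighbours become decided. The
-- quality of the seed only matters for the number of rounds.
lemma MISInv.step {V : Finset ℕ} {adj : ℕ → ℕ → Prop} {cur I : Finset ℕ}
    (hsymm : ∀ u v, adj u v → adj v u) (h : MISInv V adj cur I) (q t a b : ℕ) :
    MISInv V adj (cur.filter fun v => ¬ Killed cur adj q t a b v)
      (I ∪ cur.filter fun v => Selected cur adj q t a b v) where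
  cur_subset := (Finset.filter_subset _ _).trans h.cur_subset
  subset := Finset.union_subset h.subset ((Finset.filter_subset _ _).trans h.cur_subset)
  indep u hu v hv huv := by
    simp only [Finset.mem_union, Finset.mem_filter] at hu hv
    rcases hu with hu | hu <;> rcases hv with hv | hv
    · exact h.indep u hu v hv huv
    · exact (h.sep v hv.1 u hu).2 huv
    · exact (h.sep u hu.1 v hv).2 (hsymm _ _ huv)
    · exact hv.2.2 u hu.2.1 huv
  dom v hv := by
    by_cases hk : Killed cur adj q t a b v
    · obtain ⟨w, hw, hwv⟩ := hk
      exact Or.inr ⟨w, Finset.mem_union_right _ (Finset.mem_filter.2 ⟨hw.1.1, hw⟩), hwv⟩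
    · rcases h.dom v hv with h' | ⟨w, hw, hwv⟩
      · exact Or.inl (Finset.mem_filter.2 ⟨h', hk⟩)
      · exact Or.inr ⟨w, Finset.mem_union_left _ hw, hwv⟩
  sep v hv w hw := by
    obtain ⟨hv, hk⟩ := Finset.mem_filter.1 hv
    rcases Finset.mem_union.1 hw with hw | hw
    · exact h.sep v hv w hw
    · have hs := (Finset.mem_filter.1 hw).2
      exact ⟨fun h' => hk ⟨w, hs, Or.inl h'⟩, fun h' => hk ⟨w, hs, Or.inr h'⟩⟩

lemma nbhd_mono {V V' : Finset ℕ} (h : V' ⊆ V) (adj : ℕ → ℕ → Prop) (v : ℕ) :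
    nbhd V' adj v ⊆ nbhd V adj v := by
  classical exact Finset.filter_subset_filter _ h

lemma mem_nbhd {V : Finset ℕ} {adj : ℕ → ℕ → Prop} {u v : ℕ} :
    u ∈ nbhd V adj v ↔ u ∈ V ∧ (u = v ∨ adj u v) := by
  classical exact Finset.mem_filter

lemma mem_large {V : Finset ℕ} {adj : ℕ → ℕ → Prop} {Δ v : ℕ} :
    v ∈ large V adj Δ ↔ v ∈ V ∧ Δ < 2 * (nbhd V adj v).card := by
  classical exact Finset.mem_filter

end PairwiseSampling

namespace PRAM
variable {p : Params}
open PRAM.Expr PairwiseSampling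

lemma sum_ind {n : ℕ} {s : Finset ℕ} (h : ∀ x ∈ s, x < n) :
    ∑ x ∈ Finset.range n, ind (x ∈ s) = s.card := by
  simp only [ind_eq_ite, Finset.sum_ite_mem, Finset.sum_const, nsmul_eq_mul, mul_one]
  rw [Finset.inter_eq_right.2 fun x hx => Finset.mem_range.2 (h x hx)]

lemma Params.pow_mul_one_lt {a : ℕ} (h : a ≤ p.K) : ((p.R ^ a : ℕ) : ℤ) * 1 < 2 ^ p.W := by
  rw [mul_one]
  exact lt_of_le_of_lt (by exact_mod_cast Nat.pow_le_pow_right p.R_pos h) p.pow_lt_word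

/-- The closed neighbourhoods in the current graph: array `62` holds the degrees, `63` the vertices
of large degree, and `64` whether there are any. -/
def degrees : Prog :=
  .seq (fold sumOp 1 1 62 fun U V => (read 61 U).and ((eq U V).or (read2 52 1 U V))) <|
  .seq (setArr 1 63 fun V => (read 61 V).and (lt (read 60 0) (2 * read 62 V))) <|
  fold maxOp 1 0 64 fun V _ => read 63 V

lemma degrees_spec (hK : 4 ≤ p.K) {M : Mem} (hg : p.Good M) {cur : Finset ℕ} {c : ℕ → ℕ → Prop}
    {Δ : ℕ} (hcur : ∀ x < p.R, M 61 (x : ℤ) = ind (x ∈ cur)) (hcR : ∀ x ∈ cur, x < p.R)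
    (hadj : ∀ u < p.R, ∀ v < p.R, M 52 (p.adr 1 u v) = ind (c u v)) (hΔ : M 60 0 = (Δ : ℤ)) :
    ∃ M', p.Runs degrees M M' ∧ (∀ b < 62, M' b = M b) ∧
      (∀ x < p.R, M' 63 (x : ℤ) = ind (x ∈ large cur (fun u v => u ≠ v ∧ c u v) Δ)) ∧
      M' 64 0 = ind (large cur (fun u v => u ≠ v ∧ c u v) Δ).Nonempty := by
  obtain ⟨M₁, h1, f1, q1⟩ := sum_spec (p := p) (a := 1) (d := 1) (out := 62) (M := M)
    (body := fun U V => (read 61 U).and ((eq U V).or (read2 52 1 U V))) (by omega) hg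
    (fun u v => ind (u ∈ nbhd cur (fun u v => u ≠ v ∧ c u v) v)) 1 (by
      intro U V i u v hu hv hU hV
      rw [pow_one] at hu hv
      simp [hU, hV, hcur u hu, eval_read2 hg hU hV, hadj u hu v hv]
      refine ind_congr ?_
      rw [mem_nbhd]
      tauto)
    (fun _ _ _ _ => abs_ind_le _) (p.pow_mul_one_lt (by omega))
  have hmem : ∀ x, x ∈ large cur (fun u v => u ≠ v ∧ c u v) Δ → x < p.R := fun x hx =>
    hcR x (mem_large.1 hx).1
  obtain ⟨M₂, h2, f2, q2⟩ := setArr_ind_spec (p := p) (d := 1) (out := 63) (M := M₁)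
    (v := fun V => (read 61 V).and (lt (read 60 0) (2 * read 62 V))) (by omega)
    (hg.congr (by simp [f1]))
    (fun v => v ∈ large cur (fun u v => u ≠ v ∧ c u v) Δ) (by
      intro V i v hv hV
      have hv' := hv
      rw [pow_one] at hv'
      simp only [eval_and, eval_read, hV, eval_lt, eval_mul, eval_two, eval_zero]
      rw [f1 _ (by norm_num) (by norm_num), f1 _ (by norm_num) (by norm_num), hcur v hv', hΔ,
        q1 v hv, pow_one, sum_ind, ind_mul_ind]
      · refine ind_congr ?_
        rw [mem_large]
        refine and_congr Iff.rfl ?_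
        norm_cast
      · intro x hx
        exact hcR x (mem_nbhd.1 hx).1)
  obtain ⟨M₃, h3, f3, q3⟩ := any_spec (p := p) (a := 1) (d := 0) (out := 64) (M := M₂)
    (body := fun V _ => read 63 V) (by omega) (hg.congr (by simp [f1, f2]))
    (fun v _ => v ∈ large cur (fun u v => u ≠ v ∧ c u v) Δ) (by
      intro U V i u v hu hv hU hV
      simp [hU, q2 u hu])
  refine ⟨M₃, h1.seq (h2.seq h3), fun b hb => ?_, fun x hx => ?_, ?_⟩
  · exact (h1.seq (h2.seq h3)).frame_lt (k := 62) rfl hb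
  · rw [f3 _ (by norm_num) (by norm_num), q2 x (by rwa [pow_one])]
  · have := q3 0 (by simp)
    rw [Nat.cast_zero] at this
    rw [this]
    refine ind_congr ⟨fun ⟨x, _, hx⟩ => ⟨x, hx⟩, fun ⟨x, hx⟩ => ⟨x, ?_, hx⟩⟩
    rw [pow_one]; exact hmem x hx

/-- One round: all seeds are tried, and the one that decides most vertices of large degree is used. -/
def round : Prog :=
  .seq (setArr 3 65 <| split 1 (fun _ W S => (read 61 W).and
    (lt ((S % powR 1 * W + S / powR 1) % read 22 0) (read 22 0 / (4 * read 60 0)))) 0) <|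
  .seq (fold maxOp 1 3 66 <| split 1 fun U W S =>
    (read2 65 1 U S).and ((not (eq U W)).and (read2 52 1 U W))) <|
  .seq (fold maxOp 1 3 67 <| split 1 fun W V S =>
    ((read2 65 1 W S).and (not (read2 66 1 W S))).and ((eq W V).or (read2 52 1 W V))) <|
  .seq (fold sumOp 1 2 68 fun V S => (read 63 V).and (read2 67 1 V S)) <|
  .seq (fold maxOp 2 0 69 fun S _ => read 68 S) <|
  .seq (fold minOp 2 0 70 fun S _ => .cond (eq (read 68 S) (read 69 0)) S (powR 2)) <|
  .seq (setArr 1 53 fun V => (read 53 V).or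
    ((read2 65 1 V (read 70 0)).and (not (read2 66 1 V (read 70 0))))) <|
  setArr 1 61 fun V => (read 61 V).and (not (read2 67 1 V (read 70 0)))

open Classical in
-- All numbers s < R² are tried as seeds (s mod R, s / R), which includes every pair of residues
-- modulo q because q < R. The requirement of four indices comes from quantifying over one vertex
-- for every pair of a vertex and a seed, the seed taking two indices.
lemma round_spec (hK : 4 ≤ p.K) {M : Mem} (hg : p.Good M) {cur I : Finset ℕ} {c : ℕ → ℕ → Prop}
    {Δ q : ℕ} (hcur : ∀ x < p.R, M 61 (x : ℤ) = ind (x ∈ cur))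
    (hI : ∀ x < p.R, M 53 (x : ℤ) = ind (x ∈ I))
    (hadj : ∀ u < p.R, ∀ v < p.R, M 52 (p.adr 1 u v) = ind (c u v)) (hΔ : M 60 0 = (Δ : ℤ))
    (hH : ∀ x < p.R, M 63 (x : ℤ) = ind (x ∈ large cur (fun u v => u ≠ v ∧ c u v) Δ))
    (hcq : ∀ x ∈ cur, x < q) (hqR : q < p.R)
    (hq : q.Prime) (hqM : M 22 0 = (q : ℤ)) (hΔ0 : 0 < Δ) (hΔq : 4 * Δ ≤ q)
    (hdeg : ∀ v ∈ cur, (nbhd cur (fun u v => u ≠ v ∧ c u v) v).card ≤ Δ) :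
    ∃ M' a b, p.Runs round M M' ∧ (∀ b < 60, b ≠ 53 → M' b = M b) ∧ M' 60 = M 60 ∧
      (∀ x < p.R, M' 61 (x : ℤ) = ind (x ∈ cur.filter fun v =>
        ¬ Killed cur (fun u v => u ≠ v ∧ c u v) q (q / (4 * Δ)) a b v)) ∧
      (∀ x < p.R, M' 53 (x : ℤ) = ind (x ∈ I ∪ cur.filter fun v =>
        Selected cur (fun u v => u ≠ v ∧ c u v) q (q / (4 * Δ)) a b v)) ∧
      (large cur (fun u v => u ≠ v ∧ c u v) Δ).card ≤
        32 * ((large cur (fun u v => u ≠ v ∧ c u v) Δ).filter fun v =>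
          Killed cur (fun u v => u ≠ v ∧ c u v) q (q / (4 * Δ)) a b v).card := by
  set adj : ℕ → ℕ → Prop := fun u v => u ≠ v ∧ c u v with hadjdef
  set t := q / (4 * Δ) with ht
  set H := large cur adj Δ
  have hR1 : p.R ^ 1 = p.R := pow_one _
  have hHR : ∀ x ∈ H, x < p.R := fun x hx => (hcq x (mem_large.1 hx).1).trans hqR
  obtain ⟨M₁, h1, f1, q1⟩ := set2_ind_spec (p := p) (c := 1) (d := 2) (out := 65) (M := M)
    (body := fun W S => (read 61 W).and
      (lt ((S % powR 1 * W + S / powR 1) % read 22 0) (read 22 0 / (4 * read 60 0))))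
    (by omega) hg (fun w s => Marked cur q t (s % p.R) (s / p.R) w) (by
      intro W S i w s hw hs hW hS
      rw [hR1] at hw
      simp only [eval_and, eval_read, hW, eval_lt, eval_mod, eval_add, eval_mul, eval_div, hS,
        hg.eval_powR, eval_zero, eval_four, hΔ, hqM, hcur w hw, hR1, ind_mul_ind]
      refine ind_congr (and_congr Iff.rfl ?_)
      rw [ht]; norm_cast)
  have g1 := hg.congr (M' := M₁) (by simp [f1])
  obtain ⟨M₂, h2, f2, q2⟩ := any2_spec (p := p) (a := 1) (c := 1) (d := 2) (out := 66) (M := M₁)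
    (body := fun U W S => (read2 65 1 U S).and ((not (eq U W)).and (read2 52 1 U W)))
    (by omega) g1 (fun u w s => Marked cur q t (s % p.R) (s / p.R) u ∧ adj u w) (by
      intro U W S i u w s hu hw hs hU hW hS
      rw [eval_and, eval_read2 g1 hU hS, q1 u hu s hs, eval_and, eval_not, eval_eq, hU, hW,
        eval_read2 g1 hU hW, f1 _ (by norm_num) (by norm_num), hadj u (hR1 ▸ hu) w (hR1 ▸ hw)]
      simp [hadjdef])
  have g2 := g1.congr (M' := M₂) (by simp [f2])
  have q2' : ∀ y < p.R ^ 1, ∀ z < p.R ^ 2, 1 - M₂ 66 (p.adr 1 y z) =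
      ind (∀ u, Marked cur q t (z % p.R) (z / p.R) u → ¬ adj u y) := by
    intro y hy z hz
    rw [q2 y hy z hz, one_sub_ind]
    refine ind_congr ?_
    push Not
    exact ⟨fun h u hu => h u (by rw [hR1]; exact (hcq u hu.1).trans hqR) hu, fun h u _ hu => h u hu⟩
  have hsel : ∀ y < p.R ^ 1, ∀ z < p.R ^ 2, M₁ 65 (p.adr 1 y z) * (1 - M₂ 66 (p.adr 1 y z)) =
      ind (Selected cur adj q t (z % p.R) (z / p.R) y) := by
    intro y hy z hz
    rw [q1 y hy z hz, q2' y hy z hz, ind_mul_ind]; rfl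
  obtain ⟨M₃, h3, f3, q3⟩ := any2_spec (p := p) (a := 1) (c := 1) (d := 2) (out := 67) (M := M₂)
    (body := fun W V S => ((read2 65 1 W S).and (not (read2 66 1 W S))).and
      ((eq W V).or (read2 52 1 W V)))
    (by omega) g2 (fun w v s => Selected cur adj q t (s % p.R) (s / p.R) w ∧ (w = v ∨ adj w v)) (by
      intro U W S i u w s hu hw hs hU hW hS
      rw [eval_and, eval_and, eval_read2 g2 hU hS, f2 _ (by norm_num) (by norm_num), eval_not,
        eval_read2 g2 hU hS, hsel u hu s hs, eval_or, eval_eq, hU, hW,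
        eval_read2 g2 hU hW, f2 _ (by norm_num) (by norm_num), f1 _ (by norm_num) (by norm_num),
        hadj u (hR1 ▸ hu) w (hR1 ▸ hw), ind_add_pos, ind_mul_ind]
      refine ind_congr (and_congr Iff.rfl ?_)
      simp only [hadjdef, Nat.cast_inj]
      tauto)
  have g3 := g2.congr (M' := M₃) (by simp [f3])
  have q3' : ∀ y < p.R ^ 1, ∀ z < p.R ^ 2, M₃ 67 (p.adr 1 y z) =
      ind (Killed cur adj q t (z % p.R) (z / p.R) y) := by
    intro y hy z hz
    rw [q3 y hy z hz]
    exact ind_congr ⟨fun ⟨w, _, h⟩ => ⟨w, h⟩, fun ⟨w, h⟩ =>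
      ⟨w, by rw [hR1]; exact (hcq w h.1.1.1).trans hqR, h⟩⟩
  obtain ⟨M₄, h4, f4, q4⟩ := sum_spec (p := p) (a := 1) (d := 2) (out := 68) (M := M₃)
    (body := fun V S => (read 63 V).and (read2 67 1 V S)) (by omega) g3
    (fun v s => ind (v ∈ H.filter fun v => Killed cur adj q t (s % p.R) (s / p.R) v)) 1 (by
      intro V S i v s hv hs hV hS
      rw [eval_and, eval_read, hV, eval_read2 g3 hV hS, q3' v hv s hs,
        f3 _ (by norm_num) (by norm_num), f2 _ (by norm_num) (by norm_num),
        f1 _ (by norm_num) (by norm_num), hH v (hR1 ▸ hv), ind_mul_ind]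
      exact ind_congr Finset.mem_filter.symm)
    (fun _ _ _ _ => abs_ind_le _) (p.pow_mul_one_lt (by omega))
  have g4 := g3.congr (M' := M₄) (by simp [f4])
  have q4' : ∀ s < p.R ^ 2, M₄ 68 (s : ℤ) =
      ((H.filter fun v => Killed cur adj q t (s % p.R) (s / p.R) v).card : ℤ) := by
    intro s hs
    rw [q4 s hs, hR1, sum_ind fun x hx => hHR x (Finset.mem_filter.1 hx).1]
  have hHle : ∀ s, ((H.filter fun v => Killed cur adj q t (s % p.R) (s / p.R) v).card : ℤ) ≤
      ((p.R ^ p.K : ℕ) : ℤ) := by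
    intro s
    have h1 : H ⊆ Finset.range p.R := fun x hx => Finset.mem_range.2 (hHR x hx)
    have h2 := (Finset.card_le_card ((Finset.filter_subset _ _).trans h1 :
      (H.filter fun v => Killed cur adj q t (s % p.R) (s / p.R) v) ⊆ _))
    rw [Finset.card_range] at h2
    exact_mod_cast h2.trans (Nat.le_self_pow (by omega) _)
  obtain ⟨M₅, h5, f5, q5⟩ := max_spec (p := p) (a := 2) (d := 0) (out := 69) (M := M₄)
    (body := fun S _ => read 68 S) (by omega) g4
    (fun s _ => ((H.filter fun v => Killed cur adj q t (s % p.R) (s / p.R) v).card : ℤ)) _ (by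
      intro S V i s v hs hv hS hV
      rw [eval_read, hS, q4' s hs]) (fun s _ _ _ => by
        rw [abs_of_nonneg (Nat.cast_nonneg _)]; exact hHle s) p.pow_lt_word
  have g5 := g4.congr (M' := M₅) (by simp [f5])
  obtain ⟨hmax, s₁, hs₁, hs₁max⟩ := q5 0 (by simp)
  rw [Nat.cast_zero] at hmax hs₁max
  -- Seeds that do not attain the maximum are represented by R², which exceeds every seed, so the
  -- minimum is the smallest optimal seed.
  obtain ⟨M₆, h6, f6, q6⟩ := min_spec (p := p) (a := 2) (d := 0) (out := 70) (M := M₅)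
    (body := fun S _ => .cond (eq (read 68 S) (read 69 0)) S (powR 2)) (by omega) g5
    (fun s _ => if ((H.filter fun v => Killed cur adj q t (s % p.R) (s / p.R) v).card : ℤ) =
      M₅ 69 0 then (s : ℤ) else ((p.R ^ 2 : ℕ) : ℤ)) ((p.R ^ 2 : ℕ) : ℤ) (by
      intro S V i s v hs hv hS hV
      rw [eval_cond, eval_eq, eval_read, eval_read, hS, eval_zero, f5 _ (by norm_num) (by norm_num),
        q4' s hs, g5.eval_powR]
      simp only [ne_eq, ind_eq_zero, not_not]) (fun s hs _ _ => by
        split_ifs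
        · rw [Nat.abs_cast]; exact_mod_cast hs.le
        · rw [Nat.abs_cast]) (by simpa using p.pow_mul_one_lt (a := 2) (by omega))
  have g6 := g5.congr (M' := M₆) (by simp [f6])
  obtain ⟨hmin, s, hs, hsmin⟩ := q6 0 (by simp)
  rw [Nat.cast_zero] at hmin hsmin
  have hs70 : M₆ 70 0 = (s : ℤ) ∧
      ((H.filter fun v => Killed cur adj q t (s % p.R) (s / p.R) v).card : ℤ) = M₅ 69 0 := by
    have h7 := hmin s₁ hs₁
    rw [if_pos hs₁max] at h7
    have h8 : (s₁ : ℤ) < ((p.R ^ 2 : ℕ) : ℤ) := by exact_mod_cast hs₁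
    split_ifs at hsmin with hc
    · exact ⟨hsmin.symm, hc⟩
    · omega
  obtain ⟨M₇, h7, f7, q7⟩ := setArr_ind_spec (p := p) (d := 1) (out := 53) (M := M₆)
    (v := fun V => (read 53 V).or
      ((read2 65 1 V (read 70 0)).and (not (read2 66 1 V (read 70 0))))) (by omega) g6
    (fun v => v ∈ I ∪ cur.filter fun v => Selected cur adj q t (s % p.R) (s / p.R) v) (by
      intro V i v hv hV
      have hS : (read 70 0).eval M₆ i = (s : ℤ) := hs70.1
      have e1 : M₆ 65 = M₁ 65 := by simp [f6, f5, f4, f3, f2]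
      have e2 : M₆ 66 = M₂ 66 := by simp [f6, f5, f4, f3]
      have e3 : M₆ 53 = M 53 := by simp [f6, f5, f4, f3, f2, f1]
      rw [eval_or, eval_read, hV, eval_and, eval_read2 g6 hV hS, eval_not, eval_read2 g6 hV hS,
        e1, e2, hsel v hv s hs, e3, hI v (hR1 ▸ hv), ind_add_pos]
      refine ind_congr ?_
      rw [Finset.mem_union, Finset.mem_filter]
      exact or_congr Iff.rfl ⟨fun h => ⟨h.1.1, h⟩, fun h => h.2⟩)
  have g7 := g6.congr (M' := M₇) (by simp [f7])
  obtain ⟨M₈, h8, f8, q8⟩ := setArr_ind_spec (p := p) (d := 1) (out := 61) (M := M₇)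
    (v := fun V => (read 61 V).and (not (read2 67 1 V (read 70 0)))) (by omega) g7
    (fun v => v ∈ cur.filter fun v => ¬ Killed cur adj q t (s % p.R) (s / p.R) v) (by
      intro V i v hv hV
      have hS : (read 70 0).eval M₇ i = (s : ℤ) := by
        rw [eval_read, eval_zero, f7 _ (by norm_num) (by norm_num)]; exact hs70.1
      have e1 : M₇ 67 = M₃ 67 := by simp [f7, f6, f5, f4]
      have e3 : M₇ 61 = M 61 := by simp [f7, f6, f5, f4, f3, f2, f1]
      rw [eval_and, eval_read, hV, eval_not, eval_read2 g7 hV hS, e1, q3' v hv s hs, e3,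
        hcur v (hR1 ▸ hv), one_sub_ind, ind_mul_ind]
      exact ind_congr (by rw [Finset.mem_filter]))
  have hrun : p.Runs round M M₈ :=
    h1.seq (h2.seq (h3.seq (h4.seq (h5.seq (h6.seq (h7.seq h8))))))
  refine ⟨M₈, s % p.R, s / p.R, hrun, fun b hb hb' => ?_, ?_,
    fun x hx => q8 x (hR1.symm ▸ hx), fun x hx => ?_, ?_⟩
  · simp (disch := omega) only [f8, f7, f6, f5, f4, f3, f2, f1]
  · exact hrun.frame rfl
  · rw [f8 _ (by norm_num) (by norm_num)]; exact q7 x (hR1.symm ▸ hx)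
  -- The good pair (a, b) is coded by a + R·b, and the seed that was picked kills at least as many
  -- vertices.
  · obtain ⟨a, ha, b, hb, hab⟩ := exists_seed (V := cur) (adj := adj) (q := q) (t := t)
      (fun v h => h.1 rfl) hq hcq hΔ0 hdeg hΔq ht
    refine hab.trans (Nat.mul_le_mul_left _ ?_)
    have hs' : a + p.R ^ 1 * b < p.R ^ 2 :=
      adr_lt (d := 1) (hR1.symm ▸ ha.trans hqR) (hR1.symm ▸ hb.trans hqR)
    have h9 := hmax _ hs'
    have e1 := adr_mod (p := p) (c := 1) (z := b) (hR1.symm ▸ ha.trans hqR)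
    have e2 := adr_div (p := p) (c := 1) (z := b) (hR1.symm ▸ ha.trans hqR)
    rw [hR1] at e1 e2 h9
    rw [← hs70.2, e1, e2] at h9
    exact_mod_cast h9

end PRAM

namespace PRAM
variable {p : Params}
open PRAM.Expr PairwiseSampling

/-- The state of the memory in a computation of a maximal independent set. -/
structure MISState (p : Params) (q : ℕ) (c : ℕ → ℕ → Prop) (V : Finset ℕ) (Δ : ℕ) (M : Mem)
    (cur I : Finset ℕ) : Prop where
  good : p.Good M
  prime : M 22 0 = (q : ℤ)
  adj : ∀ u < p.R, ∀ v < p.R, M 52 (p.adr 1 u v) = ind (c u v)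
  delta : M 60 0 = (Δ : ℤ)
  und : ∀ x < p.R, M 61 (x : ℤ) = ind (x ∈ cur)
  sel : ∀ x < p.R, M 53 (x : ℤ) = ind (x ∈ I)
  inv : MISInv V (fun u v => u ≠ v ∧ c u v) cur I
  deg : ∀ v ∈ cur, (nbhd cur (fun u v => u ≠ v ∧ c u v) v).card ≤ Δ

lemma MISState.run_degrees {q : ℕ} {c : ℕ → ℕ → Prop} {V cur I : Finset ℕ} {Δ : ℕ} {M : Mem}
    (hK : 4 ≤ p.K) (h : MISState p q c V Δ M cur I) (hcR : ∀ x ∈ cur, x < p.R) :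
    ∃ M', p.Runs degrees M M' ∧ MISState p q c V Δ M' cur I ∧ (∀ b < 60, M' b = M b) ∧
      (∀ x < p.R, M' 63 (x : ℤ) = ind (x ∈ large cur (fun u v => u ≠ v ∧ c u v) Δ)) ∧
      M' 64 0 = ind (large cur (fun u v => u ≠ v ∧ c u v) Δ).Nonempty := by
  obtain ⟨M', h1, f1, q1, q2⟩ := degrees_spec hK h.good h.und hcR h.adj h.delta
  refine ⟨M', h1, ⟨h.good.congr (f1 5 (by norm_num)), ?_, ?_, ?_, ?_, ?_, h.inv, h.deg⟩,
    fun b hb => f1 b (by omega), q1, q2⟩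
  · rw [f1 _ (by norm_num), h.prime]
  · rw [f1 _ (by norm_num)]; exact h.adj
  · rw [f1 _ (by norm_num), h.delta]
  · rw [f1 _ (by norm_num)]; exact h.und
  · rw [f1 _ (by norm_num)]; exact h.sel

/-- Each round removes at least 1/32 of the vertices of large degree. The hypothesis on i says that
i such reductions leave fewer than one vertex. -/
lemma MISState.iter_round {q : ℕ} {c : ℕ → ℕ → Prop} {V : Finset ℕ} {Δ : ℕ} (hK : 4 ≤ p.K)
    (hc : ∀ u v, c u v → c v u) (hVq : ∀ x ∈ V, x < q) (hqR : q < p.R) (hq : q.Prime)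
    (hΔ0 : 0 < Δ) (hΔq : 4 * Δ ≤ q) (i : ℕ) {cur I : Finset ℕ} {M : Mem}
    (h : MISState p q c V Δ M cur I)
    (hH : ∀ x < p.R, M 63 (x : ℤ) = ind (x ∈ large cur (fun u v => u ≠ v ∧ c u v) Δ))
    (hH' : M 64 0 = ind (large cur (fun u v => u ≠ v ∧ c u v) Δ).Nonempty)
    (hi : (large cur (fun u v => u ≠ v ∧ c u v) Δ).card * 31 ^ i < 32 ^ i) :
    ∃ j ≤ i, ∃ M' cur' I', p.Iter (read 64 0) (.seq round degrees) j M M' ∧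
      MISState p q c V Δ M' cur' I' ∧ large cur' (fun u v => u ≠ v ∧ c u v) Δ = ∅ ∧
      ∀ b < 60, b ≠ 53 → M' b = M b := by
  classical
  by_cases hne : (large cur (fun u v => u ≠ v ∧ c u v) Δ).Nonempty
  swap
  · refine ⟨0, Nat.zero_le _, M, cur, I, ⟨?_, rfl⟩, h, Finset.not_nonempty_iff_eq_empty.1 hne,
      fun _ _ _ => rfl⟩
    simp only [eval_read, eval_zero, hH', ind_eq_zero, hne, not_false_eq_true]
  induction i generalizing cur I M with
  | zero => simp at hi; simp [hi] at hne
  | succ i ih =>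
    have hcq : ∀ x ∈ cur, x < q := fun x hx => hVq x (h.inv.cur_subset hx)
    obtain ⟨M₁, a, b, h1, f1, f60, q61, q53, hcard⟩ := round_spec hK h.good h.und h.sel h.adj h.delta
      hH hcq hqR hq h.prime hΔ0 hΔq h.deg
    set cur₁ := cur.filter fun v =>
      ¬ Killed cur (fun u v => u ≠ v ∧ c u v) q (q / (4 * Δ)) a b v with hcur₁
    have hsub : cur₁ ⊆ cur := Finset.filter_subset _ _
    have s1 : MISState p q c V Δ M₁ cur₁ (I ∪ cur.filter fun v =>
        Selected cur (fun u v => u ≠ v ∧ c u v) q (q / (4 * Δ)) a b v) :=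
      { good := h.good.congr (f1 5 (by norm_num) (by norm_num))
        prime := by rw [f1 _ (by norm_num) (by norm_num), h.prime]
        adj := by rw [f1 _ (by norm_num) (by norm_num)]; exact h.adj
        delta := by rw [f60, h.delta]
        und := q61
        sel := q53
        inv := h.inv.step (fun u v huv => ⟨huv.1.symm, hc _ _ huv.2⟩) _ _ _ _
        deg := fun v hv => (Finset.card_le_card (nbhd_mono hsub _ v)).trans (h.deg v (hsub hv)) }
    obtain ⟨M₂, h2, s2, f2, q63, q64⟩ := s1.run_degrees hK
      (fun x hx => (hcq x (hsub hx)).trans hqR)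
    set H := large cur (fun u v => u ≠ v ∧ c u v) Δ
    set H₁ := large cur₁ (fun u v => u ≠ v ∧ c u v) Δ
    -- Neighbourhoods only shrink, so no vertex newly acquires large degree.
    have hH₁ : H₁ ⊆ H.filter fun v =>
        ¬ Killed cur (fun u v => u ≠ v ∧ c u v) q (q / (4 * Δ)) a b v := by
      intro v hv
      obtain ⟨hv1, hv2⟩ := mem_large.1 hv
      refine Finset.mem_filter.2 ⟨mem_large.2 ⟨hsub hv1, hv2.trans_le ?_⟩,
        (Finset.mem_filter.1 hv1).2⟩
      exact Nat.mul_le_mul_left _ (Finset.card_le_card (nbhd_mono hsub _ v))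
    have h32 : 32 * H₁.card ≤ 31 * H.card := by
      have e1 := Finset.card_le_card hH₁
      have e2 := Finset.card_filter_add_card_filter_not (s := H) fun v =>
        Killed cur (fun u v => u ≠ v ∧ c u v) q (q / (4 * Δ)) a b v
      omega
    have hi' : H₁.card * 31 ^ i < 32 ^ i := by
      have e1 : 32 * (H₁.card * 31 ^ i) ≤ H.card * 31 ^ (i + 1) := by
        rw [← mul_assoc, pow_succ]
        calc 32 * H₁.card * 31 ^ i ≤ 31 * H.card * 31 ^ i := Nat.mul_le_mul_right _ h32
          _ = _ := by ring
      rw [pow_succ 32] at hi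
      omega
    have hstep : ∃ j ≤ i, ∃ M' cur' I', p.Iter (read 64 0) (.seq round degrees) j M₂ M' ∧
        MISState p q c V Δ M' cur' I' ∧ large cur' (fun u v => u ≠ v ∧ c u v) Δ = ∅ ∧
        ∀ b < 60, b ≠ 53 → M' b = M₂ b := by
      by_cases hne' : H₁.Nonempty
      · exact ih s2 q63 q64 hi' hne'
      · refine ⟨0, Nat.zero_le _, M₂, _, _, ⟨?_, rfl⟩, s2,
          Finset.not_nonempty_iff_eq_empty.1 hne', fun _ _ _ => rfl⟩
        simp only [eval_read, eval_zero, q64, ind_eq_zero, hne', not_false_eq_true]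
    obtain ⟨j, hj, M', cur', I', h3, s3, hl, f3⟩ := hstep
    refine ⟨j + 1, by omega, M', cur', I', ⟨?_, M₂, h1.seq h2, h3⟩, s3, hl, fun b hb hb' => ?_⟩
    · simp only [eval_read, eval_zero, hH', ne_eq, ind_eq_zero, hne, not_true, not_false_eq_true]
    · rw [f3 b hb hb', f2 b hb, f1 b hb hb']

/-- The body of the loop over the degree bounds. -/
def misStage : Prog :=
  .seq degrees <| .seq (.while (read 64 0) (.seq round degrees)) <| setScalar 60 (read 60 0 / 2)

lemma MISState.run_stage {q : ℕ} {c : ℕ → ℕ → Prop} {V : Finset ℕ} (hK : 4 ≤ p.K)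
    (hB : 23 * p.r ≤ p.B)
    (hc : ∀ u v, c u v → c v u) (hVq : ∀ x ∈ V, x < q) (hqR : q < p.R) (hq : q.Prime)
    {Δ : ℕ} (hΔ0 : 0 < Δ) (hΔq : 4 * Δ ≤ q) {cur I : Finset ℕ} {M : Mem}
    (h : MISState p q c V Δ M cur I) :
    ∃ M' cur' I', p.Runs misStage M M' ∧
      MISState p q c V (Δ / 2) M' cur' I' ∧ ∀ b < 60, b ≠ 53 → M' b = M b := by
  have hcq : ∀ x ∈ cur, x < q := fun x hx => hVq x (h.inv.cur_subset hx)
  obtain ⟨M₁, h1, s1, f1, q63, q64⟩ := h.run_degrees hK (fun x hx => (hcq x hx).trans hqR)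
  have hsub : large cur (fun u v => u ≠ v ∧ c u v) Δ ⊆ Finset.range q := fun x hx =>
    Finset.mem_range.2 (hcq x (mem_large.1 hx).1)
  have hcard := Finset.card_le_card hsub
  rw [Finset.card_range] at hcard
  -- There are fewer than R = 2^r vertices, and 23 rounds halve the number of those with large
  -- degree, since 2·31^23 ≤ 32^23.
  obtain ⟨i, hi, M₂, cur', I', h2, s2, hl, f2⟩ := s1.iter_round hK hc hVq hqR hq
    hΔ0 hΔq (23 * p.r) q63 q64 (by
      calc _ < 2 ^ p.r * 31 ^ (23 * p.r) :=
            Nat.mul_lt_mul_of_pos_right (hcard.trans_lt hqR) (by positivity)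
        _ = (2 * 31 ^ 23) ^ p.r := by rw [mul_pow, ← pow_mul]
        _ ≤ (32 ^ 23) ^ p.r := Nat.pow_le_pow_left (by norm_num) _
        _ = _ := by rw [← pow_mul])
  have hdeg : ∀ v ∈ cur', 2 * (nbhd cur' (fun u v => u ≠ v ∧ c u v) v).card ≤ Δ := fun v hv => by
    by_contra hlt
    have : v ∈ large cur' (fun u v => u ≠ v ∧ c u v) Δ := mem_large.2 ⟨hv, not_le.1 hlt⟩
    rw [hl] at this
    simp at this
  obtain ⟨M₃, h3, f3, q3⟩ := setScalar_spec (p := p) (out := 60) (M := M₂)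
    (v := read 60 0 / 2) (((Δ / 2 : ℕ) : ℤ)) (by
      simp only [eval_div, eval_read, eval_zero, s2.delta, eval_two]; norm_cast) (by
      rw [Nat.abs_cast]
      refine lt_of_le_of_lt ?_ p.pow_lt_word
      have : p.R ^ 1 ≤ p.R ^ p.K := Nat.pow_le_pow_right p.R_pos (by omega)
      rw [pow_one] at this
      exact_mod_cast ((Nat.div_le_self _ _).trans (by omega)).trans this)
  refine ⟨M₃, cur', I', h1.seq ((h2.runs (hi.trans hB)).seq h3),
    { good := s2.good.congr (f3 5 (by norm_num) (by norm_num))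
      prime := by rw [f3 _ (by norm_num) (by norm_num), s2.prime]
      adj := by rw [f3 _ (by norm_num) (by norm_num)]; exact s2.adj
      delta := q3
      und := by rw [f3 _ (by norm_num) (by norm_num)]; exact s2.und
      sel := by rw [f3 _ (by norm_num) (by norm_num)]; exact s2.sel
      inv := s2.inv
      deg := fun v hv => by have := hdeg v hv; omega }, fun b hb hb' => ?_⟩
  rw [f3 b (by omega) (by omega), f2 b hb hb', f1 b hb]

/-- Every stage halves the bound on the closed degrees. A closed neighbourhood contains its vertex,
so once the bound is 0 no vertex is undecided. -/
lemma MISState.iter_stage {q : ℕ} {c : ℕ → ℕ → Prop} {V : Finset ℕ} (hK : 4 ≤ p.K)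
    (hB : 23 * p.r ≤ p.B)
    (hc : ∀ u v, c u v → c v u) (hVq : ∀ x ∈ V, x < q) (hqR : q < p.R) (hq : q.Prime)
    (j : ℕ) (hj : 4 * 2 ^ j ≤ q) {cur I : Finset ℕ} {M : Mem}
    (h : MISState p q c V (2 ^ j) M cur I) :
    ∃ M' I', p.Iter (lt 0 (read 60 0)) misStage (j + 1) M M' ∧
      MISState p q c V 0 M' ∅ I' ∧ ∀ b < 60, b ≠ 53 → M' b = M b := by
  induction j generalizing M cur I with
  | zero =>
    obtain ⟨M₁, cur', I', h1, s1, f1⟩ := h.run_stage hK hB hc hVq hqR hq (by norm_num) hj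
    have hcur : cur' = ∅ := Finset.eq_empty_of_forall_notMem fun v hv => by
      have h4 : 0 < (nbhd cur' (fun u v => u ≠ v ∧ c u v) v).card :=
        Finset.card_pos.2 ⟨v, mem_nbhd.2 ⟨hv, Or.inl rfl⟩⟩
      have := s1.deg v hv
      omega
    subst hcur
    exact ⟨M₁, I', ⟨by simp [h.delta], M₁, h1, by simp [s1.delta], rfl⟩, s1, f1⟩
  | succ j ih =>
    obtain ⟨M₁, cur', I', h1, s1, f1⟩ := h.run_stage hK hB hc hVq hqR hq (by positivity) hj
    rw [pow_succ, Nat.mul_div_cancel _ two_pos] at s1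
    obtain ⟨M', I'', h6, s6, f6⟩ := ih (by rw [pow_succ] at hj; omega) s1
    exact ⟨M', I'', ⟨by simp [h.delta], M₁, h1, h6⟩, s6,
      fun b hb hb' => by rw [f6 b hb hb', f1 b hb hb']⟩

/-- Array `53` becomes a maximal independent set of the vertices in the array `51`, for the closed
adjacency matrix in the array `52`; the array `22` holds a prime number. -/
def mis : Prog :=
  .seq (setArr 1 61 fun V => read 51 V) <|
  .seq (setArr 1 53 fun _ => 0) <|
  .seq (setScalar 60 (read 5 0 / 8)) <|
  .while (lt 0 (read 60 0)) misStage

/-- The vertices are numbers below R/8, so R/8 is a valid first degree bound, and 4·(R/8) = R/2 < q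
is what the sampling lemma requires. The relation c may be reflexive; adjacency always means c
between distinct vertices. -/
lemma mis_spec (hK : 4 ≤ p.K) (hB : 23 * p.r ≤ p.B) (hr : 3 ≤ p.r) {M : Mem} (hg : p.Good M)
    {q : ℕ} {c : ℕ → ℕ → Prop} {V : Finset ℕ} (hc : ∀ u v, c u v → c v u)
    (hq : q.Prime) (hqM : M 22 0 = (q : ℤ)) (hq2 : p.R / 2 < q) (hqR : q < p.R)
    (hV : ∀ x ∈ V, x < p.R / 8) (hVM : ∀ x < p.R, M 51 (x : ℤ) = ind (x ∈ V))
    (hadj : ∀ u < p.R, ∀ v < p.R, M 52 (p.adr 1 u v) = ind (c u v)) :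
    ∃ M' I, p.Runs mis M M' ∧ (∀ b < 60, b ≠ 53 → M' b = M b) ∧
      (∀ x < p.R, M' 53 (x : ℤ) = ind (x ∈ I)) ∧ I ⊆ V ∧
      (∀ u ∈ I, ∀ v ∈ I, u ≠ v → ¬ c u v) ∧ ∀ v ∈ V, ∃ w ∈ I, w = v ∨ c w v := by
  have hR1 : p.R ^ 1 = p.R := pow_one _
  have hR8 : p.R / 8 = 2 ^ (p.r - 3) := by
    have : p.R = 2 ^ (p.r - 3) * 8 := by
      rw [Params.R, show (8 : ℕ) = 2 ^ 3 by norm_num, ← pow_add]; congr 1; omega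
    omega
  obtain ⟨M₁, h1, f1, q1⟩ := setArr_ind_spec (p := p) (d := 1) (out := 61) (M := M)
    (v := fun V => read 51 V) (by omega) hg (fun x => x ∈ V) (by
      intro X i x hx hX
      rw [eval_read, hX, hVM x (hR1 ▸ hx)])
  have g1 := hg.congr (M' := M₁) (by simp [f1])
  obtain ⟨M₂, h2, f2, q2⟩ := setArr_ind_spec (p := p) (d := 1) (out := 53) (M := M₁)
    (v := fun _ => 0) (by omega) g1 (fun x => x ∈ (∅ : Finset ℕ)) (by
      intro X i x hx hX
      simp [ind])
  have g2 := g1.congr (M' := M₂) (by simp [f2])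
  obtain ⟨M₃, h3, f3, q3⟩ := setScalar_spec (p := p) (out := 60) (M := M₂)
    (v := read 5 0 / 8) ((2 ^ (p.r - 3) : ℕ) : ℤ) (by
      simp only [eval_div, eval_read, eval_zero, g2.1, eval_eight]; rw [← hR8]; norm_cast) (by
      rw [Nat.abs_cast, ← hR8]
      refine lt_of_le_of_lt ?_ p.pow_lt_word
      have : p.R ^ 1 ≤ p.R ^ p.K := Nat.pow_le_pow_right p.R_pos (by omega)
      rw [pow_one] at this
      exact_mod_cast (Nat.div_le_self _ _).trans this)
  have g3 := g2.congr (M' := M₃) (by simp [f3])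
  have s3 : MISState p q c V (2 ^ (p.r - 3)) M₃ V ∅ :=
    { good := g3
      prime := by simp (disch := omega) only [f3, f2, f1, hqM]
      adj := by simpa (disch := omega) only [f3, f2, f1] using hadj
      delta := q3
      und := fun x hx => by simp (disch := omega) only [f3, f2]; exact q1 x (hR1.symm ▸ hx)
      sel := fun x hx => by simp (disch := omega) only [f3]; exact q2 x (hR1.symm ▸ hx)
      inv := ⟨subset_rfl, Finset.empty_subset _, by simp, fun v hv => Or.inl hv, by simp⟩
      deg := fun v _ => by
        have e1 : nbhd V (fun u v => u ≠ v ∧ c u v) v ⊆ Finset.range (p.R / 8) := fun x hx =>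
          Finset.mem_range.2 (hV x (mem_nbhd.1 hx).1)
        have e2 := Finset.card_le_card e1
        rwa [Finset.card_range, hR8] at e2 }
  obtain ⟨M₄, I, h4, s4, f4⟩ := s3.iter_stage hK hB hc
    (fun x hx => (hV x hx).trans (by omega)) hqR hq _ (by omega)
  refine ⟨M₄, I, h1.seq (h2.seq (h3.seq (h4.runs (by omega)))), fun b hb hb' => ?_, s4.sel,
    s4.inv.subset, fun u hu v hv huv hcuv => s4.inv.indep u hu v hv ⟨huv, hcuv⟩, fun v hv => ?_⟩
  · simp (disch := omega) only [f4, f3, f2, f1]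
  · rcases s4.inv.dom v hv with h' | ⟨w, hw, h' | h'⟩
    · simp at h'
    · exact ⟨w, hw, Or.inl h'⟩
    · exact ⟨w, hw, Or.inr h'.2⟩

end PRAM

/-! ### SNC elements and private elements -/

namespace SetSystem

variable {E I : Type*} [DecidableEq E] [DecidableEq I] {sys : SetSystem E I}

/-- An element is a `τ`-SNC element unless `τ + 1` sets that contain it have private elements. -/
lemma isSNCElement_iff {τ : ℕ} {X : Finset E} {e : E} : sys.IsSNCElement τ X e ↔ e ∈ X ∧
    ¬ ∃ f : Fin (τ + 1) → I, (∀ i, f i ∈ sys.fam ∧ e ∈ sys.set (f i)) ∧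
      ∀ i, ∃ x ∈ X, x ∈ sys.set (f i) ∧ ∀ j, j ≠ i → x ∉ sys.set (f j) := by
  refine and_congr_right fun _ => ⟨fun h => ?_, fun h P hP heP => ?_⟩
  · rintro ⟨f, hf, hpriv⟩
    have hinj : Function.Injective f := fun i j hij => by
      by_contra hne
      obtain ⟨x, -, hx, hx'⟩ := hpriv i
      exact hx' j (Ne.symm hne) (hij ▸ hx)
    obtain ⟨P', hP', hcard, hcov⟩ := h (Finset.univ.image f)
      (fun S hS => by obtain ⟨i, -, rfl⟩ := Finset.mem_image.1 hS; exact (hf i).1)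
      (fun S hS => by obtain ⟨i, -, rfl⟩ := Finset.mem_image.1 hS; exact (hf i).2)
    -- Private elements make the τ + 1 sets distinct, so τ of them cannot be all; the private
    -- element of an omitted set is lost.
    have : ∃ i, f i ∉ P' := by
      by_contra hall
      push Not at hall
      have h1 := Finset.card_le_card (show Finset.univ.image f ⊆ P' by
        intro S hS; obtain ⟨i, -, rfl⟩ := Finset.mem_image.1 hS; exact hall i)
      rw [Finset.card_image_of_injective _ hinj, Finset.card_univ, Fintype.card_fin] at h1
      omega
    obtain ⟨i, hi⟩ := this
    obtain ⟨x, hxX, hx, hx'⟩ := hpriv i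
    have hmem : x ∈ sys.covered (Finset.univ.image f) ∩ X := Finset.mem_inter.2
      ⟨mem_covered.2 ⟨f i, Finset.mem_image_of_mem _ (Finset.mem_univ i), hx⟩, hxX⟩
    rw [hcov] at hmem
    obtain ⟨S, hS, hxS⟩ := mem_covered.1 (Finset.mem_inter.1 hmem).1
    obtain ⟨j, -, rfl⟩ := Finset.mem_image.1 (hP' hS)
    exact hx' j (fun hj => hi (hj ▸ hS)) hxS
  · classical
    -- Conversely, take a smallest subcollection with the same trace on X. If it had more than τ
    -- members, one of any τ + 1 of them would have no element private among these, and could be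
    -- dropped.
    obtain ⟨P', hP'mem, hmin⟩ := Finset.exists_min_image
      (P.powerset.filter fun Q => sys.covered P ∩ X = sys.covered Q ∩ X) Finset.card
      ⟨P, by simp⟩
    simp only [Finset.mem_filter, Finset.mem_powerset] at hP'mem hmin
    obtain ⟨hP'P, hcov⟩ := hP'mem
    refine ⟨P', hP'P, ?_, hcov⟩
    by_contra hlt
    push Not at hlt
    obtain ⟨Q, hQP, hQ⟩ := Finset.exists_subset_card_eq (Nat.succ_le_of_lt hlt)
    let f := Q.equivFinOfCardEq hQ
    refine h ⟨fun i => (f.symm i : I), fun i => ⟨hP (hP'P (hQP (f.symm i).2)),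
      heP _ (hP'P (hQP (f.symm i).2))⟩, fun i => ?_⟩
    by_contra hno
    push Not at hno
    set S : I := (f.symm i : I) with hS
    have hSP' : S ∈ P' := hQP (f.symm i).2
    have := hmin (P'.erase S) ⟨(Finset.erase_subset _ _).trans hP'P, hcov.trans ?_⟩
    · rw [Finset.card_erase_of_mem hSP'] at this
      have := Finset.card_pos.2 ⟨S, hSP'⟩
      omega
    · refine Finset.Subset.antisymm (fun x hx => ?_)
        (Finset.inter_subset_inter_right (covered_mono (Finset.erase_subset _ _)))
      obtain ⟨hx1, hxX⟩ := Finset.mem_inter.1 hx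
      refine Finset.mem_inter.2 ⟨?_, hxX⟩
      obtain ⟨T, hT, hxT⟩ := mem_covered.1 hx1
      by_cases hTS : T = S
      · obtain ⟨j, hj, hxj⟩ := hno x hxX (hTS ▸ hxT)
        refine mem_covered.2 ⟨_, Finset.mem_erase.2 ⟨fun h' => hj ?_, hQP (f.symm j).2⟩, hxj⟩
        exact f.symm.injective (Subtype.ext h')
      · exact mem_covered.2 ⟨T, Finset.mem_erase.2 ⟨hTS, hT⟩, hxT⟩

lemma layer_eq_empty {τ : ℕ} (hs : sys.IsSNC τ) {k : ℕ} (hk : sys.decompLength τ ≤ k) :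
    sys.layer τ k = ∅ :=
  Finset.subset_empty.1 (((layer_subset_remaining τ k).trans (remaining_anti τ hk)).trans
    hs.remaining_decompLength.subset)

end SetSystem

namespace SetSystem

variable {E I : Type*} [DecidableEq E] [DecidableEq I] {sys : SetSystem E I}

lemma decompLength_le_card {τ : ℕ} (hs : sys.IsSNC τ) : sys.decompLength τ ≤ sys.univ.card := by
  have key : ∀ k ≤ sys.decompLength τ, (sys.remaining τ k).card + k ≤ sys.univ.card := by
    intro k hk
    induction k with
    | zero => rfl
    | succ k ih =>
      obtain ⟨e, he⟩ := hs _ (remaining_subset_univ τ k) (remaining_nonempty_of_lt (τ := τ) hk)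
      have h1 : sys.remaining τ (k + 1) ⊂ sys.remaining τ k :=
        Finset.ssubset_iff_subset_ne.2 ⟨remaining_succ_subset τ k, fun h' =>
          (mem_remaining_succ.1 (h'.symm ▸ he.1 : e ∈ sys.remaining τ (k + 1))).2 he⟩
      have := Finset.card_lt_card h1
      have := ih (by omega)
      omega
  have := key _ le_rfl
  omega

end SetSystem

namespace PRAM
variable {p : Params}
open PRAM.Expr SetSystem

/-! ### Sets of numbers -/

/-- The number `y` denotes a member of `s`. -/
def In {k : ℕ} (s : Finset (Fin k)) (y : ℕ) : Prop := ∃ e ∈ s, (e : ℕ) = y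

section
variable {k m n : ℕ} {s t : Finset (Fin k)} {y : ℕ}

@[simp] lemma in_val {e : Fin k} : In s (e : ℕ) ↔ e ∈ s :=
  ⟨fun ⟨_, h, he⟩ => Fin.ext he ▸ h, fun h => ⟨e, h, rfl⟩⟩

lemma In.mono (h : In s y) (hst : s ⊆ t) : In t y := by
  obtain ⟨e, he, rfl⟩ := h; exact ⟨e, hst he, rfl⟩

lemma in_iff : In s y ↔ ∃ h : y < k, (⟨y, h⟩ : Fin k) ∈ s :=
  ⟨fun ⟨e, h, he⟩ => by subst he; exact ⟨e.2, h⟩, fun ⟨h, hs⟩ => ⟨_, hs, rfl⟩⟩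

@[simp] lemma in_union : In (s ∪ t) y ↔ In s y ∨ In t y := by
  simp only [in_iff, Finset.mem_union]; grind

@[simp] lemma in_inter : In (s ∩ t) y ↔ In s y ∧ In t y := by
  simp only [in_iff, Finset.mem_inter]; grind

@[simp] lemma in_sdiff : In (s \ t) y ↔ In s y ∧ ¬ In t y := by
  simp only [in_iff, Finset.mem_sdiff]; grind

@[simp] lemma in_empty : ¬ In (∅ : Finset (Fin k)) y := by simp [In]

lemma exists_in {R : ℕ} (hk : k ≤ R) {q : ℕ → Prop} :
    (∃ x < R, In s x ∧ q x) ↔ ∃ e ∈ s, q e :=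
  ⟨fun ⟨_, _, ⟨e, he, hx⟩, hq⟩ => ⟨e, he, hx ▸ hq⟩,
    fun ⟨e, he, hq⟩ => ⟨e, e.2.trans_le hk, in_val.2 he, hq⟩⟩

lemma sum_in {R : ℕ} (hk : k ≤ R) (f : ℕ → ℤ) :
    ∑ x ∈ Finset.range R, ind (In s x) * f x = ∑ e ∈ s, f e := by
  have h1 : s.map Fin.valEmbedding ⊆ Finset.range R := fun x hx => by
    obtain ⟨e, -, rfl⟩ := Finset.mem_map.1 hx
    exact Finset.mem_range.2 (e.2.trans_le hk)
  rw [show ∑ e ∈ s, f (e : ℕ) = ∑ x ∈ s.map Fin.valEmbedding, f x from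
    (Finset.sum_map s Fin.valEmbedding f).symm, ← Finset.sum_subset h1]
  · refine Finset.sum_congr rfl fun x hx => ?_
    rw [ind_true, one_mul]
    obtain ⟨e, he, rfl⟩ := Finset.mem_map.1 hx
    exact ⟨e, he, rfl⟩
  · intro x _ hx
    rw [ind_false, zero_mul]
    rintro ⟨e, he, rfl⟩
    exact hx (Finset.mem_map_of_mem Fin.valEmbedding he)

/-- The incidence relation between numbers of elements and of sets. -/
def Inc (sys : SetSystem (Fin m) (Fin n)) (y z : ℕ) : Prop :=
  ∃ (e : Fin m) (S : Fin n), (e : ℕ) = y ∧ (S : ℕ) = z ∧ S ∈ sys.fam ∧ e ∈ sys.set S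

variable {sys : SetSystem (Fin m) (Fin n)}

lemma inc_val {e : Fin m} {S : Fin n} : Inc sys e S ↔ S ∈ sys.fam ∧ e ∈ sys.set S :=
  ⟨fun ⟨_, _, he, hS, h⟩ => by rwa [Fin.ext he, Fin.ext hS] at h, fun h => ⟨e, S, rfl, rfl, h⟩⟩

lemma inc_val_right {S : Fin n} (hS : S ∈ sys.fam) : Inc sys y S ↔ In (sys.set S) y :=
  ⟨fun ⟨_, _, he, h', _, h⟩ => ⟨_, Fin.ext h' ▸ h, he⟩, fun ⟨e, h, he⟩ => ⟨e, S, he, rfl, hS, h⟩⟩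

lemma exists_in_inc {R : ℕ} (hn : n ≤ R) {P : Finset (Fin n)} (hP : P ⊆ sys.fam) :
    (∃ z < R, In P z ∧ Inc sys y z) ↔ In (sys.covered P) y := by
  rw [exists_in hn]
  constructor
  · rintro ⟨S, hS, e, S', rfl, h', -, he⟩
    exact in_val.2 (mem_covered.2 ⟨S, hS, Fin.ext h' ▸ he⟩)
  · rintro ⟨e, he, rfl⟩
    obtain ⟨S, hS, he⟩ := mem_covered.1 he
    exact ⟨S, hS, inc_val.2 ⟨hP hS, he⟩⟩

end

/-! ### Tuples -/

/-- The digit number `i` of `t`. -/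
def Params.digit (p : Params) (i t : ℕ) : ℕ := t / p.R ^ i % p.R

lemma Params.digit_lt (p : Params) (i t : ℕ) : p.digit i t < p.R := Nat.mod_lt _ p.R_pos

lemma Params.exists_digits (p : Params) (k : ℕ) (f : ℕ → ℕ) (hf : ∀ i < k, f i < p.R) :
    ∃ t < p.R ^ k, ∀ i < k, p.digit i t = f i := by
  induction k with
  | zero => exact ⟨0, by simp, by simp⟩
  | succ k ih =>
    obtain ⟨t, ht, h⟩ := ih fun i hi => hf i (by omega)
    have hR := p.R_pos
    refine ⟨t + p.R ^ k * f k, adr_lt (d := 1) ht (by simpa using hf k (by omega)), fun i hi => ?_⟩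
    rcases Nat.lt_succ_iff_lt_or_eq.1 hi with hi | rfl
    · rw [← h i hi, Params.digit, Params.digit]
      have : p.R ^ k * f k = p.R ^ i * (p.R * (p.R ^ (k - i - 1) * f k)) := by
        rw [← mul_assoc, ← mul_assoc, ← pow_succ, ← pow_add]
        congr 2; omega
      rw [this, Nat.add_mul_div_left _ _ (by positivity), Nat.add_mul_mod_self_left]
    · rw [Params.digit, adr_div ht, Nat.mod_eq_of_lt (hf _ (by omega))]

namespace Expr

/-- The digit number `i` of a number. -/
def digit (i : ℕ) (T : Expr) : Expr := T / powR i % powR 1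

lemma eval_digit {M : Mem} (hg : p.Good M) {i j t : ℕ} {T : Expr} (hT : T.eval M i = (t : ℤ)) :
    (digit j T).eval M i = (p.digit j t : ℤ) := by
  simp [digit, hT, hg.eval_powR, Params.digit]

def any (f : ℕ → Expr) (n : ℕ) : Expr := lt 0 (sum f n)

def all (f : ℕ → Expr) (n : ℕ) : Expr := not (any (fun j => not (f j)) n)

lemma eval_any {M : Mem} {i n : ℕ} {f : ℕ → Expr} {q : ℕ → Prop}
    (h : ∀ j < n, (f j).eval M i = ind (q j)) : (any f n).eval M i = ind (∃ j < n, q j) := by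
  rw [any, eval_lt, eval_zero, eval_sum, Finset.sum_congr rfl fun j hj => h j (Finset.mem_range.1 hj)]
  refine ind_congr ?_
  constructor
  · intro hpos
    obtain ⟨j, hj, h'⟩ := Finset.exists_lt_of_sum_lt (f := fun _ => (0 : ℤ)) (by simpa using hpos)
    exact ⟨j, Finset.mem_range.1 hj, (ind_pos _).1 h'⟩
  · rintro ⟨j, hj, hq⟩
    exact Finset.sum_pos' (fun _ _ => ind_nonneg _) ⟨j, Finset.mem_range.2 hj, by simpa using hq⟩

lemma eval_all {M : Mem} {i n : ℕ} {f : ℕ → Expr} {q : ℕ → Prop}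
    (h : ∀ j < n, (f j).eval M i = ind (q j)) : (all f n).eval M i = ind (∀ j < n, q j) := by
  rw [all, eval_not, eval_any (q := fun j => ¬ q j), one_sub_ind]
  · exact ind_congr (by push Not; rfl)
  · intro j hj; rw [eval_not, h j hj, one_sub_ind]

end Expr

/-! ### The layers -/

/-- The memory holds the set system `sys` and a prime number. -/
structure SysMem {m n : ℕ} (p : Params) (sys : SetSystem (Fin m) (Fin n)) (M : Mem) : Prop where
  good : p.Good M
  m_le : m ≤ p.R / 8
  n_le : n ≤ p.R
  r_le : 3 ≤ p.r
  el : ∀ y < p.R, M 19 (y : ℤ) = ind (In sys.univ y)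
  fam : ∀ z < p.R, M 20 (z : ℤ) = ind (In sys.fam z)
  inc : ∀ y < p.R, ∀ z < p.R, M 21 (p.adr 1 y z) = ind (Inc sys y z)
  prime : ∃ q : ℕ, q.Prime ∧ M 22 0 = (q : ℤ) ∧ p.R / 2 < q ∧ q < p.R

lemma SysMem.congr {m n : ℕ} {sys : SetSystem (Fin m) (Fin n)} {M M' : Mem} (h : SysMem p sys M)
    (hM : ∀ b < 24, M' b = M b) : SysMem p sys M' where
  good := h.good.congr (hM 5 (by norm_num))
  m_le := h.m_le
  n_le := h.n_le
  r_le := h.r_le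
  el := by rw [hM 19 (by norm_num)]; exact h.el
  fam := by rw [hM 20 (by norm_num)]; exact h.fam
  inc := by rw [hM 21 (by norm_num)]; exact h.inc
  prime := by rw [hM 22 (by norm_num)]; exact h.prime

/-- The elements that are not `τ`-SNC elements within the remaining ones are marked. -/
def testLayer (τ : ℕ) : Prog :=
  .seq (fold maxOp 1 (1 + (τ + 1)) 75 <| split 1 fun X S T => (read 26 X).and
    ((read2 21 1 X S).and (eq (sum (fun j => read2 21 1 X (digit j T)) (τ + 1)) 1))) <|
  fold maxOp (τ + 1) 1 76 fun T E => all (fun i => (read2 21 1 E (digit i T)).and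
    (read2 75 1 (digit i T) T)) (τ + 1)

/-- A family of τ + 1 sets is a number below R^(τ + 1), read digit by digit in base R. Quantifying
over an element for every pair of a set and such a tuple uses τ + 3 indices, hence polynomially many
processors for fixed τ. -/
lemma testLayer_spec {τ m n : ℕ} (hK : τ + 3 ≤ p.K) {sys : SetSystem (Fin m) (Fin n)} {M : Mem}
    (h : SysMem p sys M) {X : Finset (Fin m)} (hX : ∀ y < p.R, M 26 (y : ℤ) = ind (In X y)) :
    ∃ M', p.Runs (testLayer τ) M M' ∧ (∀ b < 75, M' b = M b) ∧
      ∀ e ∈ X, 1 - M' 76 (e : ℕ) = ind (sys.IsSNCElement τ X e) := by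
  have hR1 : p.R ^ 1 = p.R := pow_one _
  have hm : m ≤ p.R := h.m_le.trans (Nat.div_le_self _ _)
  obtain ⟨M₁, h1, f1, q1⟩ := any2_spec (p := p) (a := 1) (c := 1) (d := τ + 1) (out := 75) (M := M)
    (body := fun X S T => (read 26 X).and
      ((read2 21 1 X S).and (eq (sum (fun j => read2 21 1 X (digit j T)) (τ + 1)) 1)))
    (by omega) h.good (fun x s t => In X x ∧ Inc sys x s ∧
      ∑ j ∈ Finset.range (τ + 1), ind (Inc sys x (p.digit j t)) = 1) (by
      intro X S T i x s t hx hs ht hX' hS hT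
      rw [hR1] at hx hs
      rw [eval_and, eval_read, hX', hX x hx, eval_and, eval_read2 h.good hX' hS, h.inc x hx s hs,
        eval_eq, eval_sum, eval_one, Finset.sum_congr rfl fun j _ => by
          rw [eval_read2 h.good hX' (eval_digit h.good hT), h.inc x hx _ (p.digit_lt _ _)],
        ind_mul_ind, ind_mul_ind])
  have g1 := h.good.congr (M' := M₁) (by simp [f1])
  obtain ⟨M₂, h2, f2, q2⟩ := any_spec (p := p) (a := τ + 1) (d := 1) (out := 76) (M := M₁)
    (body := fun T E => all (fun i => (read2 21 1 E (digit i T)).and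
      (read2 75 1 (digit i T) T)) (τ + 1)) (by omega) g1
    (fun t e => ∀ i < τ + 1, Inc sys e (p.digit i t) ∧ ∃ x < p.R ^ 1, In X x ∧
      Inc sys x (p.digit i t) ∧ ∑ j ∈ Finset.range (τ + 1), ind (Inc sys x (p.digit j t)) = 1) (by
      intro T E i t e ht he hT hE
      rw [hR1] at he
      refine eval_all fun j hj => ?_
      rw [eval_and, eval_read2 g1 hE (eval_digit g1 hT), f1 _ (by norm_num) (by norm_num),
        h.inc e he _ (p.digit_lt _ _), eval_read2 g1 (eval_digit g1 hT) hT,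
        q1 _ (by rw [hR1]; exact p.digit_lt _ _) t ht, ind_mul_ind])
  refine ⟨M₂, h1.seq h2, fun b hb => (h1.seq h2).frame_lt (k := 75) rfl hb, fun e he => ?_⟩
  rw [q2 e (by rw [hR1]; exact e.2.trans_le hm), one_sub_ind]
  refine ind_congr ?_
  rw [isSNCElement_iff]
  simp only [he, true_and, hR1]
  refine not_congr ?_
  -- An element of the i-th set is private exactly if it lies in one set of the tuple, counted with
  -- multiplicity; this also excludes repeated sets.
  have key : ∀ (t x : ℕ) (i : ℕ), i < τ + 1 → Inc sys x (p.digit i t) →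
      (∑ j ∈ Finset.range (τ + 1), ind (Inc sys x (p.digit j t)) = 1 ↔
        ∀ j < τ + 1, j ≠ i → ¬ Inc sys x (p.digit j t)) := by
    intro t x i hi hinc
    rw [← Finset.add_sum_erase _ _ (Finset.mem_range.2 hi), ind_true hinc, add_eq_left,
      Finset.sum_eq_zero_iff_of_nonneg fun _ _ => ind_nonneg _]
    simp only [Finset.mem_erase, Finset.mem_range, ind_eq_zero]
    exact ⟨fun h j hj hji => h j ⟨hji, hj⟩, fun h j hj => h j hj.2 hj.1⟩
  constructor
  · rintro ⟨t, -, ht⟩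
    have hex : ∀ i : Fin (τ + 1), ∃ S : Fin n, (S : ℕ) = p.digit i t ∧ S ∈ sys.fam ∧
        e ∈ sys.set S := fun i => by
      obtain ⟨⟨e', S, he', hS, h'⟩, -⟩ := ht i i.2
      exact ⟨S, hS, by rwa [Fin.ext he'] at h'⟩
    choose f hf using hex
    refine ⟨f, fun i => (hf i).2, fun i => ?_⟩
    obtain ⟨-, x, -, ⟨x', hx', rfl⟩, hinc, hsum⟩ := ht i i.2
    rw [key t _ i i.2 hinc] at hsum
    rw [← (hf i).1, inc_val] at hinc
    refine ⟨x', hx', hinc.2, fun j hj hxj => hsum j j.2 (fun h' => hj (Fin.ext h')) ?_⟩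
    rw [← (hf j).1, inc_val]
    exact ⟨(hf j).2.1, hxj⟩
  · rintro ⟨f, hf, hpriv⟩
    obtain ⟨t, ht, hd⟩ := p.exists_digits (τ + 1) (fun i => if h : i < τ + 1 then f ⟨i, h⟩ else 0)
      (fun i hi => by rw [dif_pos hi]; exact (f _).2.trans_le h.n_le)
    have hd' : ∀ i : Fin (τ + 1), p.digit i t = (f i : ℕ) := fun i => by
      rw [hd i i.2, dif_pos i.2]
    refine ⟨t, ht, fun i hi => ?_⟩
    obtain ⟨x, hx, hxi, hxj⟩ := hpriv ⟨i, hi⟩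
    have hinc : Inc sys x (p.digit i t) := by
      rw [hd' ⟨i, hi⟩, inc_val]; exact ⟨(hf _).1, hxi⟩
    refine ⟨by rw [hd' ⟨i, hi⟩, inc_val]; exact hf _, x, x.2.trans_le hm, in_val.2 hx, hinc, ?_⟩
    rw [key t x i hi hinc]
    intro j hj hji hinc'
    rw [hd' ⟨j, hj⟩, inc_val] at hinc'
    exact hxj ⟨j, hj⟩ (fun h' => hji (congrArg Fin.val h')) hinc'.2

/-- One layer is split off. -/
def layerStage (τ : ℕ) : Prog :=
  .seq (testLayer τ) <|
  .seq (setArr 1 24 fun E => .cond ((read 26 E).and (not (read 76 E))) (read 25 0) (read 24 E)) <|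
  .seq (setArr 1 26 fun E => (read 26 E).and (read 76 E)) <|
  .seq (setScalar 25 (read 25 0 + 1)) <|
  fold maxOp 1 0 27 fun E _ => read 26 E

/-- Array `24` receives the indices of the layers, array `25` their number. -/
def layers (τ : ℕ) : Prog :=
  .seq (setArr 1 24 fun _ => 0 - 1) <|
  .seq (setArr 1 26 fun E => read 19 E) <|
  .seq (setScalar 25 0) <|
  .seq (fold maxOp 1 0 27 fun E _ => read 26 E) <|
  .while (read 27 0) (layerStage τ)

/-- The state of the memory after `k` layers have been split off. -/
structure LayerState {m n : ℕ} (p : Params) (sys : SetSystem (Fin m) (Fin n)) (τ k : ℕ) (M : Mem) :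
    Prop where
  mem : SysMem p sys M
  rem : ∀ y < p.R, M 26 (y : ℤ) = ind (In (sys.remaining τ k) y)
  num : M 25 0 = (k : ℤ)
  flag : M 27 0 = ind (sys.remaining τ k).Nonempty
  lay : ∀ y < p.R, (∀ j : ℕ, M 24 (y : ℤ) = j ↔ j < k ∧ In (sys.layer τ j) y) ∧
    -1 ≤ M 24 (y : ℤ) ∧ M 24 (y : ℤ) < k

variable {m n τ : ℕ} {sys : SetSystem (Fin m) (Fin n)}

lemma nonempty_spec {a out : ℕ} {M : Mem} (hK : 1 ≤ p.K) (hg : p.Good M) (hm : m ≤ p.R)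
    {X : Finset (Fin m)} (hX : ∀ y < p.R, M a (y : ℤ) = ind (In X y)) :
    Post p (fold maxOp 1 0 out fun E _ => read a E) M out fun A => A 0 = ind X.Nonempty := by
  obtain ⟨M₁, h1, f1, q1⟩ := any_spec (p := p) (a := 1) (d := 0) (out := out) (M := M)
    (body := fun E _ => read a E) (by omega) hg (fun y _ => In X y) (by
      intro E Y i y _ hy _ hE _
      rw [eval_read, hE, hX y (by simpa using hy)])
  refine ⟨M₁, h1, f1, ?_⟩
  have := q1 0 (by simp)
  rw [Nat.cast_zero, pow_one] at this
  refine this.trans (ind_congr ?_)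
  refine ⟨fun ⟨_, _, e, he, _⟩ => ⟨e, he⟩, fun ⟨e, he⟩ => ⟨e, e.2.trans_le hm, e, he, rfl⟩⟩

open Classical in
lemma LayerState.step {k : ℕ} (hK : τ + 3 ≤ p.K) {M : Mem} (h : LayerState p sys τ k M)
    (hk : k < p.R) :
    ∃ M', p.Runs (layerStage τ) M M' ∧ LayerState p sys τ (k + 1) M' ∧ ∀ b < 24, M' b = M b := by
  have hR1 : p.R ^ 1 = p.R := pow_one _
  have hkW : ((k : ℤ) + 1) < 2 ^ p.W := by
    refine lt_of_le_of_lt ?_ p.pow_lt_word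
    have : p.R ^ 1 ≤ p.R ^ p.K := Nat.pow_le_pow_right p.R_pos (by omega)
    rw [hR1] at this
    exact_mod_cast (Nat.succ_le_of_lt hk).trans this
  obtain ⟨M₁, h1, f1, q1⟩ := testLayer_spec hK h.mem h.rem
  have hm : m ≤ p.R := h.mem.m_le.trans (Nat.div_le_self _ _)
  have g1 := h.mem.good.congr (M' := M₁) (by simp [f1])
  have hcond : ∀ y < p.R, M₁ 26 (y : ℤ) * (1 - M₁ 76 (y : ℤ)) = ind (In (sys.layer τ k) y) := by
    intro y hy
    rw [f1 _ (by norm_num), h.rem y hy]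
    by_cases hin : In (sys.remaining τ k) y
    · obtain ⟨e, he, rfl⟩ := hin
      rw [q1 e he, ind_mul_ind]
      exact ind_congr (by rw [in_val, in_val, mem_layer]; exact ⟨fun h => h.2, fun h => ⟨he, h⟩⟩)
    · rw [ind_false hin, zero_mul, ind_false]
      exact fun h' => hin (h'.mono (layer_subset_remaining τ k))
  obtain ⟨M₂, h2, f2, q2⟩ := setArr_spec (p := p) (d := 1) (out := 24) (M := M₁)
    (v := fun E => .cond ((read 26 E).and (not (read 76 E))) (read 25 0) (read 24 E)) (by omega) g1
    (fun y => if In (sys.layer τ k) y then (k : ℤ) else M 24 (y : ℤ)) (by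
      intro E i y hy hE
      rw [hR1] at hy
      rw [eval_cond, eval_and, eval_read, eval_not, eval_read, hE, hcond y hy, eval_read,
        eval_read, eval_zero, hE, f1 _ (by norm_num), f1 _ (by norm_num), h.num]
      simp only [ne_eq, ind_eq_zero, not_not]) (by
      intro y hy
      rw [hR1] at hy
      have := (h.lay y hy).2
      split_ifs
      · rw [abs_lt]; omega
      · rw [abs_lt]; omega)
  have g2 := g1.congr (M' := M₂) (by simp [f2])
  obtain ⟨M₃, h3, f3, q3⟩ := setArr_ind_spec (p := p) (d := 1) (out := 26) (M := M₂)
    (v := fun E => (read 26 E).and (read 76 E)) (by omega) g2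
    (fun y => In (sys.remaining τ (k + 1)) y) (by
      intro E i y hy hE
      rw [hR1] at hy
      have := hcond y hy
      rw [eval_and, eval_read, eval_read, hE, f2 _ (by norm_num) (by norm_num),
        f2 _ (by norm_num) (by norm_num)]
      rw [mul_sub, mul_one, f1 26 (by norm_num), h.rem y hy] at this
      rw [f1 26 (by norm_num), h.rem y hy]
      have e1 : ind (In (sys.remaining τ k) y) - ind (In (sys.layer τ k) y) =
          ind (In (sys.remaining τ (k + 1)) y) := by
        by_cases hin : In (sys.remaining τ k) y
        · obtain ⟨e, he, rfl⟩ := hin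
          rw [ind_true (in_val.2 he), one_sub_ind]
          exact ind_congr (by rw [in_val, in_val, mem_layer, mem_remaining_succ]; tauto)
        · rw [ind_false hin, ind_false, ind_false]
          · simp
          · exact fun h' => hin (h'.mono (remaining_succ_subset τ k))
          · exact fun h' => hin (h'.mono (layer_subset_remaining τ k))
      omega)
  have g3 := g2.congr (M' := M₃) (by simp [f3])
  obtain ⟨M₄, h4, f4, q4⟩ := setScalar_spec (p := p) (out := 25) (M := M₃)
    (v := read 25 0 + 1) ((k + 1 : ℕ) : ℤ) (by
      rw [eval_add, eval_read, eval_zero, eval_one, f3 _ (by norm_num) (by norm_num),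
        f2 _ (by norm_num) (by norm_num), f1 _ (by norm_num), h.num]; norm_cast)
    (by rw [Nat.abs_cast]; push_cast; exact hkW)
  have g4 := g3.congr (M' := M₄) (by simp [f4])
  have q4' : ∀ y < p.R, M₄ 26 (y : ℤ) = ind (In (sys.remaining τ (k + 1)) y) := fun y hy => by
    rw [f4 _ (by norm_num) (by norm_num), q3 y (hR1.symm ▸ hy)]
  obtain ⟨M₅, h5, f5, q5⟩ := nonempty_spec (p := p) (out := 27) (M := M₄) (by omega) g4 hm q4'
  have hrun : p.Runs (layerStage τ) M M₅ := h1.seq (h2.seq (h3.seq (h4.seq h5)))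
  have hfr : ∀ b < 24, M₅ b = M b := fun b hb => hrun.frame_lt (k := 24) rfl hb
  refine ⟨M₅, hrun, ⟨h.mem.congr hfr, ?_, ?_, q5, fun y hy => ?_⟩, hfr⟩
  · rw [f5 _ (by norm_num) (by norm_num)]; exact q4'
  · rw [f5 _ (by norm_num) (by norm_num)]; exact q4
  · have e1 : M₅ 24 = M₂ 24 := by simp [f5, f4, f3]
    have hl := h.lay y hy
    rw [e1, q2 y (hR1.symm ▸ hy)]
    split_ifs with hc
    · refine ⟨fun j => ?_, by omega, by push_cast; omega⟩
      constructor
      · intro hj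
        have : k = j := by exact_mod_cast hj
        subst this
        exact ⟨by omega, hc⟩
      · rintro ⟨-, hj⟩
        obtain ⟨e, he, rfl⟩ := hc
        exact_mod_cast layer_unique he (in_val.1 hj)
    · refine ⟨fun j => (hl.1 j).trans ⟨fun h' => ⟨by omega, h'.2⟩, fun h' => ⟨?_, h'.2⟩⟩, hl.2.1, ?_⟩
      · rcases Nat.lt_succ_iff_lt_or_eq.1 h'.1 with hj | rfl
        · exact hj
        · exact absurd h'.2 hc
      · push_cast; omega

/-- The memory holds the layers. -/
structure LayMem (p : Params) (sys : SetSystem (Fin m) (Fin n)) (τ : ℕ) (M : Mem) : Prop where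
  mem : SysMem p sys M
  len : M 25 0 = (sys.decompLength τ : ℤ)
  lay : ∀ y < p.R, ∀ j : ℕ, M 24 (y : ℤ) = j ↔ In (sys.layer τ j) y
  rem : ∀ y < p.R, ∀ j : ℕ, (j : ℤ) ≤ M 24 (y : ℤ) ↔ In (sys.remaining τ j) y

lemma LayMem.congr {M M' : Mem} (h : LayMem p sys τ M) (hM : ∀ b < 26, M' b = M b) :
    LayMem p sys τ M' where
  mem := h.mem.congr fun b hb => hM b (by omega)
  len := by rw [hM 25 (by norm_num)]; exact h.len
  lay := by rw [hM 24 (by norm_num)]; exact h.lay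
  rem := by rw [hM 24 (by norm_num)]; exact h.rem

lemma LayerState.iter (hK : τ + 3 ≤ p.K) (hL : sys.decompLength τ ≤ p.R) (hs : sys.IsSNC τ) (i : ℕ)
    {k : ℕ} (hk : k + i = sys.decompLength τ) {M : Mem} (h : LayerState p sys τ k M) :
    ∃ M', p.Iter (read 27 0) (layerStage τ) i M M' ∧ LayerState p sys τ (sys.decompLength τ) M' ∧
      ∀ b < 24, M' b = M b := by
  induction i generalizing k M with
  | zero =>
    obtain rfl : k = sys.decompLength τ := by omega
    refine ⟨M, ⟨?_, rfl⟩, h, fun _ _ => rfl⟩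
    rw [eval_read, eval_zero, h.flag, hs.remaining_decompLength]
    simp
  | succ i ih =>
    obtain ⟨M₁, h1, s1, f1⟩ := h.step hK (by omega)
    obtain ⟨M₂, h2, s2, f2⟩ := ih (by omega) s1
    refine ⟨M₂, ⟨?_, M₁, h1, h2⟩, s2, fun b hb => by rw [f2 b hb, f1 b hb]⟩
    rw [eval_read, eval_zero, h.flag, ne_eq, ind_eq_zero, not_not]
    exact remaining_nonempty_of_lt (by omega)

/-- The initial value -1 is kept by numbers that denote no element of the universe. Therefore
membership in the remainder before layer j is the comparison of j with the stored index. -/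
lemma layers_spec (hK : τ + 3 ≤ p.K) (hL : sys.decompLength τ ≤ p.R) (hB : sys.decompLength τ ≤ p.B)
    (hs : sys.IsSNC τ) {M : Mem} (h : SysMem p sys M) :
    ∃ M', p.Runs (layers τ) M M' ∧ LayMem p sys τ M' ∧ ∀ b < 24, M' b = M b := by
  have hR1 : p.R ^ 1 = p.R := pow_one _
  have hm : m ≤ p.R := h.m_le.trans (Nat.div_le_self _ _)
  obtain ⟨M₁, h1, f1, q1⟩ := setArr_spec (p := p) (d := 1) (out := 24) (M := M)
    (v := fun _ => 0 - 1) (by omega) h.good (fun _ => -1) (fun _ _ _ _ _ => rfl)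
    (fun _ _ => by simpa using p.one_lt_word)
  have g1 := h.good.congr (M' := M₁) (by simp [f1])
  obtain ⟨M₂, h2, f2, q2⟩ := setArr_ind_spec (p := p) (d := 1) (out := 26) (M := M₁)
    (v := fun E => read 19 E) (by omega) g1 (fun y => In (sys.remaining τ 0) y) (by
      intro E i y hy hE
      rw [eval_read, hE, f1 _ (by norm_num) (by norm_num), h.el y (hR1 ▸ hy)]; rfl)
  have g2 := g1.congr (M' := M₂) (by simp [f2])
  obtain ⟨M₃, h3, f3, q3⟩ := setScalar_spec (p := p) (out := 25) (M := M₂)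
    (v := 0) ((0 : ℕ) : ℤ) rfl (by simp)
  have g3 := g2.congr (M' := M₃) (by simp [f3])
  have q3' : ∀ y < p.R, M₃ 26 (y : ℤ) = ind (In (sys.remaining τ 0) y) := fun y hy => by
    rw [f3 _ (by norm_num) (by norm_num), q2 y (hR1.symm ▸ hy)]
  obtain ⟨M₄, h4, f4, q4⟩ := nonempty_spec (p := p) (out := 27) (M := M₃) (by omega) g3 hm q3'
  have hfr : ∀ b < 24, M₄ b = M b := fun b hb => by
    simp (disch := omega) only [f4, f3, f2, f1]
  have s4 : LayerState p sys τ 0 M₄ :=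
    { mem := h.congr hfr
      rem := by rw [f4 _ (by norm_num) (by norm_num)]; exact q3'
      num := by rw [f4 _ (by norm_num) (by norm_num)]; exact q3
      flag := q4
      lay := fun y hy => by
        have e1 : M₄ 24 (y : ℤ) = -1 := by
          rw [f4 _ (by norm_num) (by norm_num), f3 _ (by norm_num) (by norm_num),
            f2 _ (by norm_num) (by norm_num), q1 y (hR1.symm ▸ hy)]
        rw [e1]
        refine ⟨fun j => ⟨fun h' => by omega, fun h' => by omega⟩, le_rfl, by simp⟩ }
  obtain ⟨M₅, h5, s5, f5⟩ := s4.iter hK hL hs _ (zero_add _)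
  refine ⟨M₅, h1.seq (h2.seq (h3.seq (h4.seq (h5.runs hB)))), ⟨s5.mem, s5.num, fun y hy j => ?_,
    fun y hy j => ?_⟩, fun b hb => by rw [f5 b hb, hfr b hb]⟩
  · rw [(s5.lay y hy).1]
    refine ⟨fun h' => h'.2, fun h' => ⟨?_, h'⟩⟩
    by_contra hj
    rw [layer_eq_empty hs (not_lt.1 hj)] at h'
    exact in_empty h'
  · constructor
    · intro hj
      obtain ⟨i, hi⟩ := Int.eq_ofNat_of_zero_le ((Int.natCast_nonneg j).trans hj)
      rw [hi] at hj
      exact (((s5.lay y hy).1 i).1 hi).2.mono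
        ((layer_subset_remaining τ i).trans (remaining_anti τ (by exact_mod_cast hj)))
    · rintro ⟨e, he, rfl⟩
      obtain ⟨i, hi, hei⟩ := hs.exists_layer (remaining_subset_univ τ j he)
      rw [((s5.lay e hy).1 i).2 ⟨hi, in_val.2 hei⟩]
      by_contra hlt
      push Not at hlt
      exact notMem_remaining_succ_of_mem_layer hei (remaining_anti τ (by exact_mod_cast hlt) he)

end PRAM

namespace PRAM
variable {p : Params}
open PRAM.Expr SetSystem
variable {m n τ : ℕ} {sys : SetSystem (Fin m) (Fin n)} {σ : ℕ → FwdState (Fin m) (Fin n)}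

/-! ### The reverse-delete phase -/

/-- The memory holds the result of the forward phase. -/
structure FwdMem (p : Params) (sys : SetSystem (Fin m) (Fin n)) (τ : ℕ)
    (σ : ℕ → FwdState (Fin m) (Fin n)) (M : Mem) : Prop where
  mem : LayMem p sys τ M
  epoch : ∀ z < p.R, ∀ j ≤ sys.decompLength τ,
    0 ≤ M 34 (z : ℤ) ∧ M 34 (z : ℤ) < j ↔ In (σ j).A z

lemma FwdMem.congr {M M' : Mem} (h : FwdMem p sys τ σ M) (hM : ∀ b < 35, M' b = M b) :
    FwdMem p sys τ σ M' where
  mem := h.mem.congr fun b hb => hM b (by omega)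
  epoch := by rw [hM 34 (by norm_num)]; exact h.epoch

lemma FwdMem.good {M : Mem} (h : FwdMem p sys τ σ M) : p.Good M := h.mem.mem.good

lemma FwdMem.m_le {M : Mem} (h : FwdMem p sys τ σ M) : m ≤ p.R :=
  h.mem.mem.m_le.trans (Nat.div_le_self _ _)

/-- The sets denoted by the digits of `t`. -/
def digitSets (p : Params) (n τ t : ℕ) : Finset (Fin n) :=
  Finset.univ.filter fun S => ∃ i < τ, p.digit i t = S

lemma mem_digitSets {t : ℕ} {S : Fin n} : S ∈ digitSets p n τ t ↔ ∃ i < τ, p.digit i t = S := by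
  simp [digitSets]

lemma card_digitSets_le (t : ℕ) : (digitSets p n τ t).card ≤ τ := by
  rw [← Finset.card_map Fin.valEmbedding]
  refine (Finset.card_le_card (t := (Finset.range τ).image fun i => p.digit i t) ?_).trans
    (Finset.card_image_le.trans_eq (Finset.card_range τ))
  intro x hx
  obtain ⟨S, hS, rfl⟩ := Finset.mem_map.1 hx
  obtain ⟨i, hi, h⟩ := mem_digitSets.1 hS
  exact Finset.mem_image.2 ⟨i, Finset.mem_range.2 hi, h⟩

/-- Collections with fewer than τ members are padded by repeating a member, so all digits denote
members; this is why the collection must be nonempty. -/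
lemma exists_digitSets_eq (hn : n ≤ p.R) {Q : Finset (Fin n)} (hQ : Q.Nonempty) (hτ : Q.card ≤ τ) :
    ∃ t < p.R ^ τ, digitSets p n τ t = Q ∧ ∀ i < τ, ∃ S ∈ Q, p.digit i t = (S : ℕ) := by
  obtain ⟨S₀, hS₀⟩ := hQ
  obtain ⟨t, ht, hd⟩ := p.exists_digits τ
    (fun i => if h : i < Q.card then ((Q.equivFin.symm ⟨i, h⟩ : Fin n) : ℕ) else S₀) (fun i _ => by
      split_ifs
      · exact (Q.equivFin.symm _ : Fin n).2.trans_le hn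
      · exact S₀.2.trans_le hn)
  have hQd : ∀ i < τ, ∃ S ∈ Q, p.digit i t = (S : ℕ) := fun i hi => by
    rw [hd i hi]
    split_ifs with h
    · exact ⟨_, (Q.equivFin.symm ⟨i, h⟩).2, rfl⟩
    · exact ⟨S₀, hS₀, rfl⟩
  refine ⟨t, ht, ?_, hQd⟩
  ext S
  rw [mem_digitSets]
  constructor
  · rintro ⟨i, hi, h⟩
    obtain ⟨S', hS', h'⟩ := hQd i hi
    rwa [Fin.ext (h.symm.trans h')]
  · intro hS
    refine ⟨Q.equivFin ⟨S, hS⟩, (Q.equivFin ⟨S, hS⟩).2.trans_le hτ, ?_⟩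
    rw [hd _ ((Q.equivFin ⟨S, hS⟩).2.trans_le hτ), dif_pos (Q.equivFin ⟨S, hS⟩).2]
    simp

/-- The digits of `t` denote petals of the element number `b`. -/
def ValidPetals (p : Params) (sys : SetSystem (Fin m) (Fin n)) (τ : ℕ) (X : Finset (Fin n))
    (j b t : ℕ) : Prop :=
  (∀ i < τ, In X (p.digit i t) ∧ Inc sys b (p.digit i t)) ∧
    ¬ ∃ x < p.R, In (sys.remaining τ j) x ∧ (∃ S < p.R, In X S ∧ Inc sys x S ∧ Inc sys b S) ∧
      ¬ ∃ i < τ, Inc sys x (p.digit i t)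

lemma ValidPetals.isPetals (hm : m ≤ p.R) (hn : n ≤ p.R) {X : Finset (Fin n)} (hX : X ⊆ sys.fam)
    {j t : ℕ} {b : Fin m} (h : ValidPetals p sys τ X j b t) :
    sys.IsPetals τ X j b (digitSets p n τ t) := by
  have hsub : digitSets p n τ t ⊆ X.filter (fun S => b ∈ sys.set S) := fun S hS => by
    obtain ⟨i, hi, hd⟩ := mem_digitSets.1 hS
    have h1 := h.1 i hi
    rw [hd, in_val, inc_val] at h1
    exact Finset.mem_filter.2 ⟨h1.1, h1.2.2⟩
  refine ⟨hsub, card_digitSets_le t, Finset.Subset.antisymm (fun x hx => ?_)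
    (Finset.inter_subset_inter_right (covered_mono hsub))⟩
  obtain ⟨hx1, hx2⟩ := Finset.mem_inter.1 hx
  obtain ⟨S, hS, hxS⟩ := mem_covered.1 hx1
  obtain ⟨hSX, hbS⟩ := Finset.mem_filter.1 hS
  refine Finset.mem_inter.2 ⟨?_, hx2⟩
  by_contra hno
  refine h.2 ⟨x, x.2.trans_le hm, in_val.2 hx2, ⟨S, S.2.trans_le hn, in_val.2 hSX,
    inc_val.2 ⟨hX hSX, hxS⟩, inc_val.2 ⟨hX hSX, hbS⟩⟩, ?_⟩
  rintro ⟨i, hi, e, S', he, hS', -, hinc⟩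
  rw [Fin.ext he] at hinc
  exact hno (mem_covered.2 ⟨S', mem_digitSets.2 ⟨i, hi, hS'.symm⟩, hinc⟩)

/-- Petals exist by the SNC property. They are nonempty because b itself is covered by X, so they
can be coded by a tuple. -/
lemma exists_validPetals (hn : n ≤ p.R) {X : Finset (Fin n)} (hX : X ⊆ sys.fam)
    {j : ℕ} {b : Fin m} (hb : b ∈ sys.layer τ j) (hbX : b ∈ sys.covered X) :
    ∃ t < p.R ^ τ, ValidPetals p sys τ X j b t := by
  obtain ⟨Q, hQ, hcard, hcov⟩ := exists_isPetals hX hb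
  have hne : Q.Nonempty := by
    obtain ⟨S, hS, hbS⟩ := mem_covered.1 hbX
    have : b ∈ sys.covered (X.filter fun S => b ∈ sys.set S) ∩ sys.remaining τ j :=
      Finset.mem_inter.2 ⟨mem_covered.2 ⟨S, Finset.mem_filter.2 ⟨hS, hbS⟩, hbS⟩,
        layer_subset_remaining τ j hb⟩
    rw [hcov] at this
    obtain ⟨S', hS', -⟩ := mem_covered.1 (Finset.mem_inter.1 this).1
    exact ⟨S', hS'⟩
  obtain ⟨t, ht, hset, hdig⟩ := exists_digitSets_eq hn hne hcard
  refine ⟨t, ht, fun i hi => ?_, ?_⟩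
  · obtain ⟨S, hS, hd⟩ := hdig i hi
    obtain ⟨hSX, hbS⟩ := Finset.mem_filter.1 (hQ hS)
    rw [hd, in_val, inc_val]
    exact ⟨hSX, hX hSX, hbS⟩
  · rintro ⟨_, -, ⟨x, hx, rfl⟩, ⟨_, -, ⟨S, hS, rfl⟩, h1, h2⟩, hno⟩
    rw [inc_val] at h1 h2
    have : x ∈ sys.covered (X.filter fun S => b ∈ sys.set S) ∩ sys.remaining τ j :=
      Finset.mem_inter.2 ⟨mem_covered.2 ⟨S, Finset.mem_filter.2 ⟨hS, h2.2⟩, h1.2⟩, hx⟩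
    rw [hcov] at this
    obtain ⟨S', hS', hx'⟩ := mem_covered.1 (Finset.mem_inter.1 this).1
    rw [← hset] at hS'
    obtain ⟨i, hi, hd⟩ := mem_digitSets.1 hS'
    refine hno ⟨i, hi, ?_⟩
    rw [hd, inc_val]
    exact ⟨hX (Finset.mem_filter.1 (hQ (hset ▸ hS'))).1, hx'⟩

/-- The layer whose number is in the array `50` is processed. -/
def pruneStage (τ : ℕ) : Prog :=
  .seq (fold maxOp 1 1 54 fun S E => (read 49 S).and (read2 21 1 E S)) <|
  .seq (setArr 1 51 fun E => (not (read 48 E)).and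
    ((eq (read 24 E) (read 50 0)).and (not (read 54 E)))) <|
  .seq mis <|
  .seq (fold maxOp 1 (1 + τ) 56 <| split 1 fun X E T => (not (lt (read 24 X) (read 50 0))).and
    ((read2 52 1 X E).and (not (any (fun i => read2 21 1 X (digit i T)) τ)))) <|
  .seq (fold minOp τ 1 55 fun T E => .cond
    ((all (fun i => (read 47 (digit i T)).and (read2 21 1 E (digit i T))) τ).and
      (not (read2 56 1 E T))) T (powR τ)) <|
  .seq (fold maxOp 1 1 57 fun E S => (read 53 E).and
    (any (fun i => eq S (digit i (read 55 E))) τ)) <|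
  .seq (setArr 1 49 fun S => (read 49 S).or (read 57 S)) <|
  setScalar 50 (read 50 0 + 1)

/-- The state of the memory while a cover `X` of `A` is pruned. -/
structure PruneState (p : Params) (sys : SetSystem (Fin m) (Fin n)) (τ : ℕ)
    (σ : ℕ → FwdState (Fin m) (Fin n)) (X : Finset (Fin n)) (A : Finset (Fin m)) (j : ℕ)
    (Y : Finset (Fin n)) (M : Mem) : Prop where
  mem : FwdMem p sys τ σ M
  cover : ∀ z < p.R, M 47 (z : ℤ) = ind (In X z)
  target : ∀ e ∈ sys.univ, M 48 ((e : ℕ) : ℤ) = ind (e ∉ A)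
  adj : ∀ u < p.R, ∀ v < p.R, M 52 (p.adr 1 u v) =
    ind (∃ S < p.R, In X S ∧ Inc sys u S ∧ Inc sys v S)
  cur : ∀ z < p.R, M 49 (z : ℤ) = ind (In Y z)
  num : M 50 0 = (j : ℤ)

open Classical in
-- One step of a pruning run. For every element the smallest tuple coding valid petals is found by
-- exhaustive search, but it is used only for the members of the independent set, where a valid
-- tuple exists.
lemma PruneState.step (hK : τ + 4 ≤ p.K) (hB : 23 * p.r ≤ p.B) {X Y : Finset (Fin n)}
    {A : Finset (Fin m)} (hX : X ⊆ sys.fam) (hY : Y ⊆ sys.fam) (hA : A ⊆ sys.covered X) {j : ℕ}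
    (hj : j < p.R) {M : Mem} (h : PruneState p sys τ σ X A j Y M) :
    ∃ M' B petals, p.Runs (pruneStage τ) M M' ∧ (∀ b < 48, M' b = M b) ∧
      IsMIS (sys.conflictGraph X) ((A ∩ sys.layer τ j) \ sys.covered Y) B ∧
      (∀ e ∈ B, sys.IsPetals τ X j e (petals e)) ∧
      PruneState p sys τ σ X A (j + 1) (Y ∪ B.biUnion petals) M' := by
  have hR1 : p.R ^ 1 = p.R := pow_one _
  have hm := h.mem.m_le
  have hn := h.mem.mem.mem.n_le
  have hsys := h.mem.mem.mem
  obtain ⟨M₁, h1, f1, q1⟩ := any_spec (p := p) (a := 1) (d := 1) (out := 54) (M := M)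
    (body := fun S E => (read 49 S).and (read2 21 1 E S)) (by omega) h.mem.good
    (fun s e => In Y s ∧ Inc sys e s) (by
      intro S E i s e hs he hS hE
      rw [hR1] at hs he
      rw [eval_and, eval_read, hS, h.cur s hs, eval_read2 h.mem.good hE hS, hsys.inc e he s hs,
        ind_mul_ind])
  have g1 := h.mem.good.congr (M' := M₁) (by simp [f1])
  have q1' : ∀ y < p.R, M₁ 54 (y : ℤ) = ind (In (sys.covered Y) y) := fun y hy => by
    rw [q1 y (hR1.symm ▸ hy), hR1]; exact ind_congr (exists_in_inc hn hY)
  set V := (A ∩ sys.layer τ j) \ sys.covered Y with hVdef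
  obtain ⟨M₂, h2, f2, q2⟩ := setArr_ind_spec (p := p) (d := 1) (out := 51) (M := M₁)
    (v := fun E => (not (read 48 E)).and ((eq (read 24 E) (read 50 0)).and (not (read 54 E))))
    (by omega) g1 (fun y => In V y) (by
      intro E i y hy hE
      rw [hR1] at hy
      simp only [eval_and, eval_not, eval_read, eval_eq, hE, eval_zero]
      rw [q1' y hy, f1 _ (by norm_num) (by norm_num), f1 _ (by norm_num) (by norm_num),
        f1 _ (by norm_num) (by norm_num), h.num, ind_congr (h.mem.mem.lay y hy j), one_sub_ind,
        ind_mul_ind]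
      -- The array 48 is specified on the universe only; for other numbers the comparison of layers
      -- already gives 0.
      by_cases hl : In (sys.layer τ j) y
      · obtain ⟨e, he, rfl⟩ := hl
        rw [h.target e (layer_subset_univ τ j he), one_sub_ind, ind_mul_ind]
        refine ind_congr ?_
        simp only [in_val, hVdef, Finset.mem_sdiff, Finset.mem_inter, not_not, he, true_and,
          and_true]
      · rw [ind_false (fun h' => hl h'.1), mul_zero, ind_false]
        rw [hVdef, in_sdiff, in_inter]
        exact fun h' => hl h'.1.2)
  have g2 := g1.congr (M' := M₂) (by simp [f2])
  obtain ⟨q, hq, hqM, hq1, hq2⟩ := hsys.prime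
  obtain ⟨M₃, I, h3, f3, q3, hIV, hindep, hdom⟩ := mis_spec (M := M₂) (q := q)
    (V := V.map Fin.valEmbedding) (c := fun u v => ∃ S < p.R, In X S ∧ Inc sys u S ∧ Inc sys v S)
    (by omega) hB hsys.r_le g2 (fun u v ⟨S, hS, h1, h2, h3⟩ => ⟨S, hS, h1, h3, h2⟩) hq
    (by rw [f2 _ (by norm_num) (by norm_num), f1 _ (by norm_num) (by norm_num), hqM]) hq1 hq2
    (fun x hx => by
      obtain ⟨e, -, rfl⟩ := Finset.mem_map.1 hx; exact e.2.trans_le hsys.m_le)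
    (fun x hx => by rw [q2 x (hR1.symm ▸ hx)]; exact ind_congr (by simp [In]))
    (by rw [f2 _ (by norm_num) (by norm_num), f1 _ (by norm_num) (by norm_num)]; exact h.adj)
  have g3 := g2.congr (M' := M₃) (f3 5 (by norm_num) (by norm_num))
  have e3 : ∀ b < 48, M₃ b = M b := fun b hb => by simp (disch := omega) only [f3, f2, f1]
  have e50 : M₃ 50 = M 50 := by simp (disch := omega) only [f3, f2, f1]
  have e49 : M₃ 49 = M 49 := by simp (disch := omega) only [f3, f2, f1]
  have e52 : M₃ 52 = M 52 := by simp (disch := omega) only [f3, f2, f1]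
  have e48 : M₃ 48 = M 48 := by simp (disch := omega) only [f3, f2, f1]
  obtain ⟨M₄, h4, f4, q4⟩ := any2_spec (p := p) (a := 1) (c := 1) (d := τ) (out := 56) (M := M₃)
    (body := fun X E T => (not (lt (read 24 X) (read 50 0))).and
      ((read2 52 1 X E).and (not (any (fun i => read2 21 1 X (digit i T)) τ))))
    (by omega) g3 (fun x e t => In (sys.remaining τ j) x ∧
      (∃ S < p.R, In X S ∧ Inc sys x S ∧ Inc sys e S) ∧ ¬ ∃ i < τ, Inc sys x (p.digit i t)) (by
      intro X E T i x e t hx he ht hX hE hT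
      rw [hR1] at hx he
      rw [eval_and, eval_and, eval_not, eval_lt, eval_read, eval_read, hX, eval_zero,
        e3 24 (by norm_num), e50, h.num, eval_read2 g3 hX hE, e52, h.adj x hx e he, eval_not,
        eval_any (q := fun i => Inc sys x (p.digit i t)) (fun i _ => by
          rw [eval_read2 g3 hX (eval_digit g3 hT), e3 21 (by norm_num),
            hsys.inc x hx _ (p.digit_lt _ _)]), one_sub_ind, one_sub_ind, ind_mul_ind, ind_mul_ind]
      refine ind_congr (and_congr ?_ Iff.rfl)
      rw [not_lt, h.mem.mem.rem x hx])
  have g4 := g3.congr (M' := M₄) (by simp [f4])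
  obtain ⟨M₅, h5, f5, q5⟩ := min_spec (p := p) (a := τ) (d := 1) (out := 55) (M := M₄)
    (body := fun T E => .cond
      ((all (fun i => (read 47 (digit i T)).and (read2 21 1 E (digit i T))) τ).and
        (not (read2 56 1 E T))) T (powR τ)) (by omega) g4
    (fun t e => if ValidPetals p sys τ X j e t then (t : ℤ) else ((p.R ^ τ : ℕ) : ℤ))
    ((p.R ^ τ : ℕ) : ℤ) (by
      intro T E i t e ht he hT hE
      have he' := he
      rw [hR1] at he
      rw [eval_cond, eval_and, eval_all (q := fun i => In X (p.digit i t) ∧ Inc sys e (p.digit i t))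
        (fun i _ => by
          rw [eval_and, eval_read, eval_digit g4 hT, eval_read2 g4 hE (eval_digit g4 hT),
            f4 _ (by norm_num) (by norm_num), f4 _ (by norm_num) (by norm_num), e3 21 (by norm_num),
            hsys.inc e he _ (p.digit_lt _ _), e3 47 (by norm_num), h.cover _ (p.digit_lt _ _),
            ind_mul_ind]), eval_not, eval_read2 g4 hE hT, q4 e he' t ht, one_sub_ind, ind_mul_ind,
        hT, g4.eval_powR]
      simp only [ne_eq, ind_eq_zero, not_not, hR1]
      exact if_congr Iff.rfl rfl rfl) (fun t ht _ _ => by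
        split_ifs
        · rw [Nat.abs_cast]; exact_mod_cast ht.le
        · rw [Nat.abs_cast]) (by simpa using p.pow_mul_one_lt (a := τ) (by omega))
  have g5 := g4.congr (M' := M₅) (by simp [f5])
  -- The value R^τ signals that no tuple is valid. Any smaller value is a valid tuple.
  have hpt : ∀ y : ℕ, ∃ t : ℕ, y < p.R → M₅ 55 (y : ℤ) = (t : ℤ) ∧
      ((∃ t' < p.R ^ τ, ValidPetals p sys τ X j y t') → ValidPetals p sys τ X j y t) := by
    intro y
    by_cases hy : y < p.R
    · obtain ⟨hmin, t, ht, hval⟩ := q5 y (hR1.symm ▸ hy)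
      by_cases hv : ValidPetals p sys τ X j y t
      · exact ⟨t, fun _ => ⟨by rw [← hval, if_pos hv], fun _ => hv⟩⟩
      · refine ⟨p.R ^ τ, fun _ => ⟨by rw [← hval, if_neg hv], ?_⟩⟩
        rintro ⟨t', ht', hv'⟩
        have := hmin t' ht'
        rw [← hval, if_neg hv, if_pos hv'] at this
        exact absurd (by exact_mod_cast this) (not_le.2 ht')
    · exact ⟨0, fun h => absurd h hy⟩
  choose pt hpt using hpt
  set B : Finset (Fin m) := Finset.univ.filter fun e => (e : ℕ) ∈ I with hBdef
  have hBI : ∀ y : ℕ, In B y ↔ y ∈ I := fun y => by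
    constructor
    · rintro ⟨e, he, rfl⟩; simpa [hBdef] using he
    · intro hy
      obtain ⟨e, -, rfl⟩ := Finset.mem_map.1 (hIV hy)
      exact ⟨e, by simpa [hBdef] using hy, rfl⟩
  obtain ⟨M₆, h6, f6, q6⟩ := any_spec (p := p) (a := 1) (d := 1) (out := 57) (M := M₅)
    (body := fun E S => (read 53 E).and (any (fun i => eq S (digit i (read 55 E))) τ)) (by omega) g5
    (fun e s => In B e ∧ ∃ i < τ, s = p.digit i (pt e)) (by
      intro E S i e s he hs hE hS
      rw [hR1] at he hs
      rw [eval_and, eval_read, hE, f5 _ (by norm_num) (by norm_num),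
        f4 _ (by norm_num) (by norm_num), q3 e he,
        eval_any (q := fun i => s = p.digit i (pt e)) (fun i _ => by
          rw [eval_eq, hS, eval_digit g5 (t := pt e) (by rw [eval_read, hE, (hpt e he).1])]
          exact ind_congr Nat.cast_inj), ind_mul_ind]
      exact ind_congr (and_congr (hBI e).symm Iff.rfl))
  have g6 := g5.congr (M' := M₆) (by simp [f6])
  set petals : Fin m → Finset (Fin n) := fun e => digitSets p n τ (pt e) with hpetals
  have hBV : B ⊆ V := fun e he => by
    obtain ⟨e', he', h'⟩ := Finset.mem_map.1 (hIV ((hBI e).1 (in_val.2 he)))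
    exact Fin.ext h' ▸ he'
  have hpet : ∀ e ∈ B, ValidPetals p sys τ X j e (pt e) := fun e he => by
    refine (hpt e (e.2.trans_le hm)).2 (exists_validPetals hn hX (j := j) ?_ ?_)
    · have := hBV he
      simp only [hVdef, Finset.mem_sdiff, Finset.mem_inter] at this
      exact this.1.2
    · have := hBV he
      simp only [hVdef, Finset.mem_sdiff, Finset.mem_inter] at this
      exact hA this.1.1
  obtain ⟨M₇, h7, f7, q7⟩ := setArr_ind_spec (p := p) (d := 1) (out := 49) (M := M₆)
    (v := fun S => (read 49 S).or (read 57 S)) (by omega) g6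
    (fun z => In (Y ∪ B.biUnion petals) z) (by
      intro S i z hz hS
      rw [eval_or, eval_read, eval_read, hS, q6 z hz, f6 _ (by norm_num) (by norm_num),
        f5 _ (by norm_num) (by norm_num), f4 _ (by norm_num) (by norm_num), e49,
        h.cur z (hR1 ▸ hz), ind_add_pos, hR1, exists_in hm]
      refine ind_congr ?_
      rw [in_union]
      refine or_congr Iff.rfl ?_
      constructor
      · rintro ⟨e, he, i, hi, rfl⟩
        obtain ⟨⟨S', hS', hd⟩, -⟩ := (hpet e he).1 i hi
        rw [← hd, in_val, Finset.mem_biUnion]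
        exact ⟨e, he, mem_digitSets.2 ⟨i, hi, hd.symm⟩⟩
      · rintro ⟨S', hS', rfl⟩
        obtain ⟨e, he, h'⟩ := Finset.mem_biUnion.1 hS'
        obtain ⟨i, hi, hd⟩ := mem_digitSets.1 h'
        exact ⟨e, he, i, hi, hd.symm⟩)
  have hjW : ((j : ℤ) + 1) < 2 ^ p.W := by
    refine lt_of_le_of_lt ?_ p.pow_lt_word
    have : p.R ^ 1 ≤ p.R ^ p.K := Nat.pow_le_pow_right p.R_pos (by omega)
    rw [hR1] at this
    exact_mod_cast (Nat.succ_le_of_lt hj).trans this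
  obtain ⟨M₈, h8, f8, q8⟩ := setScalar_spec (p := p) (out := 50) (M := M₇)
    (v := read 50 0 + 1) ((j + 1 : ℕ) : ℤ) (by
      rw [eval_add, eval_read, eval_zero, eval_one, f7 _ (by norm_num) (by norm_num),
        f6 _ (by norm_num) (by norm_num), f5 _ (by norm_num) (by norm_num),
        f4 _ (by norm_num) (by norm_num), e50, h.num]; norm_cast)
    (by rw [Nat.abs_cast]; push_cast; exact hjW)
  have hrun : p.Runs (pruneStage τ) M M₈ :=
    h1.seq (h2.seq (h3.seq (h4.seq (h5.seq (h6.seq (h7.seq h8))))))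
  have hfr : ∀ b < 49, M₈ b = M b := fun b hb => hrun.frame_lt (k := 49) rfl hb
  refine ⟨M₈, B, petals, hrun, fun b hb => hfr b (by omega), ?_,
    fun e he => (hpet e he).isPetals hm hn hX, ?_⟩
  · have hc : ∀ u v : Fin m, (∃ S < p.R, In X S ∧ Inc sys u S ∧ Inc sys v S) ↔
        ∃ S ∈ X, u ∈ sys.set S ∧ v ∈ sys.set S := fun u v => by
      rw [exists_in hn]
      exact ⟨fun ⟨S, hS, h1, h2⟩ => ⟨S, hS, (inc_val.1 h1).2, (inc_val.1 h2).2⟩,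
        fun ⟨S, hS, h1, h2⟩ => ⟨S, hS, inc_val.2 ⟨hX hS, h1⟩, inc_val.2 ⟨hX hS, h2⟩⟩⟩
    refine ⟨⟨hBV, fun u hu v hv huv hadj => ?_⟩, fun B' hB' hBB' v hv => ?_⟩
    · exact hindep u ((hBI u).1 (in_val.2 hu)) v ((hBI v).1 (in_val.2 hv))
        (fun h' => huv (Fin.ext h')) ((hc u v).2 hadj.2)
    · obtain ⟨w, hw, hwv⟩ := hdom v (Finset.mem_map_of_mem _ (hB'.1 hv))
      obtain ⟨w, hwB, rfl⟩ := (hBI w).2 hw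
      by_cases heq : w = v
      · exact heq ▸ hwB
      · refine absurd ⟨heq, (hc w v).1 ?_⟩ (hB'.2 (hBB' hwB) hv heq)
        rcases hwv with h' | h'
        · exact absurd (Fin.ext h') heq
        · exact h'
  · exact
      { mem := h.mem.congr fun b hb => hfr b (by omega)
        cover := by rw [hfr 47 (by norm_num)]; exact h.cover
        target := by rw [hfr 48 (by norm_num)]; exact h.target
        adj := by
          simp (disch := omega) only [f8, f7, f6, f5, f4, e52]; exact h.adj
        cur := fun z hz => by
          rw [f8 _ (by norm_num) (by norm_num)]; exact q7 z (hR1.symm ▸ hz)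
        num := q8 }

lemma PruneState.iter (hK : τ + 4 ≤ p.K) (hB : 23 * p.r ≤ p.B) (hL : sys.decompLength τ ≤ p.R)
    {X : Finset (Fin n)} {A : Finset (Fin m)} (hX : X ⊆ sys.fam) (hA : A ⊆ sys.covered X) (i : ℕ)
    {j : ℕ} (hj : j + i = sys.decompLength τ) {Y : Finset (Fin n)} (hY : Y ⊆ sys.fam) {M : Mem}
    (h : PruneState p sys τ σ X A j Y M) :
    ∃ M' Y', p.Iter (lt (read 50 0) (read 25 0)) (pruneStage τ) i M M' ∧
      sys.PruneRun τ X A j Y i Y' ∧ (∀ b < 48, M' b = M b) ∧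
      PruneState p sys τ σ X A (sys.decompLength τ) Y' M' := by
  induction i generalizing j Y M with
  | zero =>
    obtain rfl : j = sys.decompLength τ := by omega
    refine ⟨M, Y, ⟨?_, rfl⟩, .done _ _ le_rfl, fun _ _ => rfl, h⟩
    simp [h.num, h.mem.mem.len]
  | succ i ih =>
    obtain ⟨M₁, B, petals, h1, f1, hmis, hpet, s1⟩ := h.step hK hB hX hY hA (by omega)
    obtain ⟨M₂, Y', h2, hrun, f2, s2⟩ := ih (by omega) (Finset.union_subset hY fun S hS => by
      obtain ⟨e, he, hSe⟩ := Finset.mem_biUnion.1 hS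
      exact hX (Finset.mem_filter.1 ((hpet e he).1 hSe)).1) s1
    refine ⟨M₂, Y', ⟨?_, M₁, h1, h2⟩, .step j Y i Y' B petals (by omega) hmis hpet hrun,
      fun b hb => by rw [f2 b hb, f1 b hb], s2⟩
    simp [h.num, h.mem.mem.len]
    omega

/-- The sets of one epoch are added and the resulting collection is pruned. -/
def reverseStage (τ : ℕ) : Prog :=
  .seq (setScalar 45 (read 45 0 - 1)) <|
  .seq (setArr 1 47 fun S => (read 46 S).or (eq (read 34 S) (read 45 0))) <|
  .seq (fold maxOp 1 1 48 fun S E => ((not (lt (read 34 S) 0)).and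
    (lt (read 34 S) (read 45 0))).and (read2 21 1 E S)) <|
  .seq (fold maxOp 1 (1 + 1) 52 <| split 1 fun S U V => (read 47 S).and
    ((read2 21 1 U S).and (read2 21 1 V S))) <|
  .seq (setArr 1 49 fun _ => 0) <|
  .seq (setScalar 50 (read 45 0)) <|
  .seq (.while (lt (read 50 0) (read 25 0)) (pruneStage τ)) <|
  setArr 1 46 fun S => read 49 S

/-- The reverse-delete phase, with its result in the array `46`. -/
def reverse (τ : ℕ) : Prog :=
  .seq (setArr 1 46 fun _ => 0) <|
  .seq (setScalar 45 (read 25 0)) <|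
  .while (lt 0 (read 45 0)) (reverseStage τ)

/-- The state of the memory in the reverse-delete phase. -/
structure RevState (p : Params) (sys : SetSystem (Fin m) (Fin n)) (τ : ℕ)
    (σ : ℕ → FwdState (Fin m) (Fin n)) (k : ℕ) (M : Mem) (B : Finset (Fin n)) : Prop where
  mem : FwdMem p sys τ σ M
  cur : ∀ z < p.R, M 46 (z : ℤ) = ind (In B z)
  num : M 45 0 = (k : ℤ)
  run : ∃ s, sys.ReverseRun τ σ k B s

variable {t : ℕ → ℕ}

/-- The sets added in epoch k are those with entry k in the array 34. The fresh elements are not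
computed: since everything is covered in the end, the target of the pruning is the complement of
what was covered before epoch k. -/
lemma RevState.step (hK : τ + 4 ≤ p.K) (hB : 23 * p.r ≤ p.B) (hL : sys.decompLength τ ≤ p.R)
    (hLB : sys.decompLength τ ≤ p.B) (hs : sys.IsSNC τ)
    (hI : FwdInv sys (σ (sys.decompLength τ))) (hf : sys.ForwardRun τ σ t) {k : ℕ}
    (hk : k + 1 ≤ sys.decompLength τ) {M : Mem} {B : Finset (Fin n)}
    (h : RevState p sys τ σ (k + 1) M B) :
    ∃ M' B', p.Runs (reverseStage τ) M M' ∧ (∀ b < 45, M' b = M b) ∧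
      RevState p sys τ σ k M' B' := by
  have hR1 : p.R ^ 1 = p.R := pow_one _
  have hm := h.mem.m_le
  have hn := h.mem.mem.mem.n_le
  have hsys := h.mem.mem.mem
  obtain ⟨s, hrun⟩ := h.run
  have hinv := hrun.inv hs hI hf
  have hAf : ∀ j ≤ sys.decompLength τ, (σ j).A ⊆ sys.fam := fun j hj =>
    (hf.mono hj le_rfl).trans hI.subset
  set X := B ∪ addedSets σ k with hXdef
  have hX : X ⊆ sys.fam := Finset.union_subset (hinv.subset.trans hI.subset)
    (Finset.sdiff_subset.trans (hAf _ hk))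
  set A := (Finset.Ico k (sys.decompLength τ)).biUnion (sys.freshElements σ) with hAdef
  have hA : A ⊆ sys.covered X := biUnion_fresh_subset_covered hk hinv.covers
  have hRW : ((p.R : ℕ) : ℤ) < 2 ^ p.W := by
    refine lt_of_le_of_lt ?_ p.pow_lt_word
    have : p.R ^ 1 ≤ p.R ^ p.K := Nat.pow_le_pow_right p.R_pos (by omega)
    rw [hR1] at this
    exact_mod_cast this
  have hkW : |((k : ℕ) : ℤ)| < 2 ^ p.W := by
    rw [Nat.abs_cast]
    exact lt_of_le_of_lt (by exact_mod_cast (by omega : k ≤ p.R)) hRW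
  obtain ⟨M₁, h1, f1, q1⟩ := setScalar_spec (p := p) (out := 45) (M := M)
    (v := read 45 0 - 1) (k : ℤ) (by
      rw [eval_sub, eval_read, eval_zero, eval_one, h.num]; push_cast; ring) hkW
  have g1 := h.mem.good.congr (M' := M₁) (by simp [f1])
  obtain ⟨M₂, h2, f2, q2⟩ := setArr_ind_spec (p := p) (d := 1) (out := 47) (M := M₁)
    (v := fun S => (read 46 S).or (eq (read 34 S) (read 45 0))) (by omega) g1
    (fun z => In X z) (by
      intro S i z hz hS
      rw [hR1] at hz
      rw [eval_or, eval_eq, eval_read, eval_read, eval_read, hS, eval_zero, q1,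
        f1 _ (by norm_num) (by norm_num), f1 _ (by norm_num) (by norm_num), h.cur z hz, ind_add_pos]
      refine ind_congr ?_
      rw [hXdef, in_union, addedSets, in_sdiff, ← h.mem.epoch z hz _ hk,
        ← h.mem.epoch z hz k (by omega)]
      push_cast
      refine or_congr Iff.rfl ?_
      omega)
  have g2 := g1.congr (M' := M₂) (by simp [f2])
  obtain ⟨M₃, h3, f3, q3⟩ := any_spec (p := p) (a := 1) (d := 1) (out := 48) (M := M₂)
    (body := fun S E => ((not (lt (read 34 S) 0)).and
      (lt (read 34 S) (read 45 0))).and (read2 21 1 E S)) (by omega) g2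
    (fun z y => In (σ k).A z ∧ Inc sys y z) (by
      intro S E i z y hz hy hS hE
      rw [hR1] at hz hy
      rw [eval_and, eval_and, eval_not, eval_lt, eval_lt, eval_read, eval_read, hS, eval_zero,
        eval_read2 g2 hE hS, f2 _ (by norm_num) (by norm_num),
        f2 _ (by norm_num) (by norm_num), f2 _ (by norm_num) (by norm_num), q1,
        f1 _ (by norm_num) (by norm_num), f1 _ (by norm_num) (by norm_num), hsys.inc y hy z hz,
        one_sub_ind, ind_mul_ind, ind_mul_ind]
      refine ind_congr (and_congr ?_ Iff.rfl)
      rw [← h.mem.epoch z hz k (by omega), not_lt])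
  have g3 := g2.congr (M' := M₃) (by simp [f3])
  obtain ⟨M₄, h4, f4, q4⟩ := any2_spec (p := p) (a := 1) (c := 1) (d := 1) (out := 52) (M := M₃)
    (body := fun S U V => (read 47 S).and ((read2 21 1 U S).and (read2 21 1 V S))) (by omega) g3
    (fun s u v => In X s ∧ Inc sys u s ∧ Inc sys v s) (by
      intro S U V i s u v hs hu hv hS hU hV
      rw [eval_and, eval_and, eval_read, eval_read2 g3 hU hS, eval_read2 g3 hV hS, hS]
      rw [hR1] at hs hu hv
      rw [f3 _ (by norm_num) (by norm_num), f3 _ (by norm_num) (by norm_num),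
        q2 s (hR1.symm ▸ hs), f2 _ (by norm_num) (by norm_num), f1 _ (by norm_num) (by norm_num),
        hsys.inc u hu s hs, hsys.inc v hv s hs, ind_mul_ind, ind_mul_ind])
  have g4 := g3.congr (M' := M₄) (by simp [f4])
  obtain ⟨M₅, h5, f5, q5⟩ := setArr_ind_spec (p := p) (d := 1) (out := 49) (M := M₄)
    (v := fun _ => 0) (by omega) g4 (fun z => In (∅ : Finset (Fin n)) z) (by
      intro S i z hz hS; rw [ind_false in_empty]; rfl)
  obtain ⟨M₆, h6, f6, q6⟩ := setScalar_spec (p := p) (out := 50) (M := M₅)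
    (v := read 45 0) (k : ℤ) (by
      rw [eval_read, eval_zero, f5 _ (by norm_num) (by norm_num), f4 _ (by norm_num) (by norm_num),
        f3 _ (by norm_num) (by norm_num), f2 _ (by norm_num) (by norm_num), q1]) hkW
  have s6 : PruneState p sys τ σ X A k ∅ M₆ :=
    { mem := h.mem.congr fun b hb => by simp (disch := omega) only [f6, f5, f4, f3, f2, f1]
      cover := fun z hz => by
        simp (disch := omega) only [f6, f5, f4, f3]; exact q2 z (hR1.symm ▸ hz)
      target := fun e he => by
        simp (disch := omega) only [f6, f5, f4]
        rw [q3 e (by rw [hR1]; exact e.2.trans_le hm), hR1]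
        refine ind_congr ((exists_in_inc hn (hAf k (by omega))).trans ?_)
        rw [in_val, hAdef, mem_biUnion_freshElements hf (by omega)]
        have := hf.univ_subset hs he
        tauto
      adj := fun u hu v hv => by
        simp (disch := omega) only [f6, f5]
        rw [q4 u (hR1.symm ▸ hu) v (hR1.symm ▸ hv), hR1]
      cur := fun z hz => by
        simp (disch := omega) only [f6]; exact q5 z (hR1.symm ▸ hz)
      num := q6 }
  obtain ⟨M₇, Y', h7, hpr, f7, s7⟩ := s6.iter hK hB hL hX hA (sys.decompLength τ - k) (by omega)
    (Finset.empty_subset _)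
  obtain ⟨M₈, h8, f8, q8⟩ := setArr_ind_spec (p := p) (d := 1) (out := 46) (M := M₇)
    (v := fun S => read 49 S) (by omega) s7.mem.good (fun z => In Y' z) (by
      intro S i z hz hS
      rw [eval_read, hS, s7.cur z (hR1 ▸ hz)])
  have hrun8 : p.Runs (reverseStage τ) M M₈ := h1.seq (h2.seq (h3.seq (h4.seq (h5.seq (h6.seq
    ((h7.runs (by omega)).seq h8))))))
  have hfr : ∀ b < 45, M₈ b = M b := fun b hb => hrun8.frame_lt (k := 45) rfl hb
  refine ⟨M₈, Y', hrun8, hfr,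
    { mem := h.mem.congr fun b hb => hfr b (by omega)
      cur := fun z hz => q8 z (hR1.symm ▸ hz)
      num := by
        simp (disch := omega) only [f8, f7, f6, f5, f4, f3, f2]; exact q1
      run := ⟨_, .step k B s Y' _ hrun hpr⟩ }⟩

lemma RevState.iter (hK : τ + 4 ≤ p.K) (hB : 23 * p.r ≤ p.B) (hL : sys.decompLength τ ≤ p.R)
    (hLB : sys.decompLength τ ≤ p.B) (hs : sys.IsSNC τ)
    (hI : FwdInv sys (σ (sys.decompLength τ))) (hf : sys.ForwardRun τ σ t) (k : ℕ)
    (hk : k ≤ sys.decompLength τ) {M : Mem} {B : Finset (Fin n)}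
    (h : RevState p sys τ σ k M B) :
    ∃ M' B', p.Iter (lt 0 (read 45 0)) (reverseStage τ) k M M' ∧ (∀ b < 45, M' b = M b) ∧
      RevState p sys τ σ 0 M' B' := by
  induction k generalizing M B with
  | zero => exact ⟨M, B, ⟨by simp [h.num], rfl⟩, fun _ _ => rfl, h⟩
  | succ k ih =>
    obtain ⟨M₁, B₁, h1, f1, s1⟩ := h.step hK hB hL hLB hs hI hf hk
    obtain ⟨M₂, B₂, h2, f2, s2⟩ := ih (by omega) s1
    refine ⟨M₂, B₂, ⟨?_, M₁, h1, h2⟩, fun b hb => by rw [f2 b hb, f1 b hb], s2⟩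
    simp [h.num]

lemma reverse_spec (hK : τ + 4 ≤ p.K) (hB : 23 * p.r ≤ p.B) (hL : sys.decompLength τ ≤ p.R)
    (hLB : sys.decompLength τ ≤ p.B) (hs : sys.IsSNC τ)
    (hI : FwdInv sys (σ (sys.decompLength τ))) (hf : sys.ForwardRun τ σ t) {M : Mem}
    (h : FwdMem p sys τ σ M) :
    ∃ M' B s, p.Runs (reverse τ) M M' ∧ (∀ b < 45, M' b = M b) ∧ sys.ReverseRun τ σ 0 B s ∧
      ∀ z < p.R, M' 46 (z : ℤ) = ind (In B z) := by
  have hR1 : p.R ^ 1 = p.R := pow_one _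
  obtain ⟨M₁, h1, f1, q1⟩ := setArr_ind_spec (p := p) (d := 1) (out := 46) (M := M)
    (v := fun _ => 0) (by omega) h.good (fun z => In (∅ : Finset (Fin n)) z) (by
      intro S i z hz hS; rw [ind_false in_empty]; rfl)
  obtain ⟨M₂, h2, f2, q2⟩ := setScalar_spec (p := p) (out := 45) (M := M₁)
    (v := read 25 0) (sys.decompLength τ : ℤ) (by
      rw [eval_read, eval_zero, f1 _ (by norm_num) (by norm_num), h.mem.len]) (by
      rw [Nat.abs_cast]
      refine lt_of_le_of_lt ?_ p.pow_lt_word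
      have : p.R ^ 1 ≤ p.R ^ p.K := Nat.pow_le_pow_right p.R_pos (by omega)
      rw [hR1] at this
      exact_mod_cast hL.trans this)
  have s2 : RevState p sys τ σ (sys.decompLength τ) M₂ ∅ :=
    { mem := h.congr fun b hb => by simp (disch := omega) only [f2, f1]
      cur := fun z hz => by
        rw [f2 _ (by norm_num) (by norm_num)]; exact q1 z (hR1.symm ▸ hz)
      num := q2
      run := ⟨_, .start⟩ }
  obtain ⟨M₃, B, h3, f3, s3⟩ := s2.iter hK hB hL hLB hs hI hf _ le_rfl
  obtain ⟨s, hs⟩ := s3.run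
  exact ⟨M₃, B, s, h1.seq (h2.seq (h3.runs hLB)), fun b hb => by
    simp (disch := omega) only [f3, f2, f1], hs, s3.cur⟩

end PRAM

namespace PRAM
variable {p : Params}
open PRAM.Expr SetSystem
variable {m n τ : ℕ} {sys : SetSystem (Fin m) (Fin n)} {σ : ℕ → FwdState (Fin m) (Fin n)}

/-! ### The forward phase -/

lemma Params.R_lt_word (hK : 1 ≤ p.K) : ((p.R : ℕ) : ℤ) < 2 ^ p.W := by
  refine lt_of_le_of_lt ?_ p.pow_lt_word
  have : p.R ^ 1 ≤ p.R ^ p.K := Nat.pow_le_pow_right p.R_pos hK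
  rw [pow_one] at this
  exact_mod_cast this

/-- The memory in epoch `k` of the forward phase. The costs and the dual variables are integers, up
to the scale `D`, and bounded by `b`. -/
structure FwdCore (p : Params) (sys : SetSystem (Fin m) (Fin n)) (τ : ℕ)
    (σ : ℕ → FwdState (Fin m) (Fin n)) (k F : ℕ) (D : ℝ) (b : ℤ) (st : FwdState (Fin m) (Fin n))
    (M : Mem) : Prop where
  mem : LayMem p sys τ M
  factor : M 7 0 = (F : ℤ)
  num : M 30 0 = (k : ℤ)
  scale_pos : 0 < D
  cost : ∀ S ∈ sys.fam, (M 31 ((S : ℕ) : ℤ) : ℝ) = D * sys.cost S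
  cost_bound : ∀ z < p.R, 0 ≤ M 31 (z : ℤ) ∧ M 31 (z : ℤ) ≤ b
  dual : ∀ e : Fin m, (M 32 ((e : ℕ) : ℤ) : ℝ) = D * st.α e
  dual_bound : ∀ y < p.R, 0 ≤ M 32 (y : ℤ) ∧ M 32 (y : ℤ) ≤ b
  range : ∀ z < p.R, -1 ≤ M 34 (z : ℤ) ∧ M 34 (z : ℤ) ≤ k
  added : ∀ z < p.R, 0 ≤ M 34 (z : ℤ) ↔ In st.A z
  epoch : ∀ z < p.R, ∀ j ≤ k, 0 ≤ M 34 (z : ℤ) ∧ M 34 (z : ℤ) < j ↔ In (σ j).A z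

lemma FwdCore.congr {k F : ℕ} {D : ℝ} {b : ℤ} {st : FwdState (Fin m) (Fin n)} {M M' : Mem}
    (h : FwdCore p sys τ σ k F D b st M) (hM : ∀ b < 35, M' b = M b) :
    FwdCore p sys τ σ k F D b st M' where
  mem := h.mem.congr fun b hb => hM b (by omega)
  factor := by rw [hM 7 (by norm_num)]; exact h.factor
  num := by rw [hM 30 (by norm_num)]; exact h.num
  scale_pos := h.scale_pos
  cost := by rw [hM 31 (by norm_num)]; exact h.cost
  cost_bound := by rw [hM 31 (by norm_num)]; exact h.cost_bound
  dual := by rw [hM 32 (by norm_num)]; exact h.dual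
  dual_bound := by rw [hM 32 (by norm_num)]; exact h.dual_bound
  range := by rw [hM 34 (by norm_num)]; exact h.range
  added := by rw [hM 34 (by norm_num)]; exact h.added
  epoch := by rw [hM 34 (by norm_num)]; exact h.epoch

/-- Array `35` receives the participating elements, array `36` whether there are any. -/
def activate : Prog :=
  .seq (fold maxOp 1 1 37 fun S E => (not (lt (read 34 S) 0)).and (read2 21 1 E S)) <|
  .seq (setArr 1 35 fun E => (eq (read 24 E) (read 30 0)).and (not (read 37 E))) <|
  fold maxOp 1 0 36 fun E _ => read 35 E

lemma FwdCore.activate {k F : ℕ} {D : ℝ} {b : ℤ} {st : FwdState (Fin m) (Fin n)} {M : Mem}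
    (hK : 2 ≤ p.K) (h : FwdCore p sys τ σ k F D b st M) (hA : st.A ⊆ sys.fam) :
    ∃ M', p.Runs activate M M' ∧ (∀ b < 35, M' b = M b) ∧ FwdCore p sys τ σ k F D b st M' ∧
      (∀ y < p.R, M' 35 (y : ℤ) = ind (In (sys.active (sys.layer τ k) st) y)) ∧
      M' 36 0 = ind (sys.active (sys.layer τ k) st).Nonempty := by
  have hR1 : p.R ^ 1 = p.R := pow_one _
  have hsys := h.mem.mem
  have hm : m ≤ p.R := hsys.m_le.trans (Nat.div_le_self _ _)
  obtain ⟨M₁, h1, f1, q1⟩ := any_spec (p := p) (a := 1) (d := 1) (out := 37) (M := M)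
    (body := fun S E => (not (lt (read 34 S) 0)).and (read2 21 1 E S)) (by omega) hsys.good
    (fun z y => In st.A z ∧ Inc sys y z) (by
      intro S E i z y hz hy hS hE
      rw [hR1] at hz hy
      rw [eval_and, eval_not, eval_lt, eval_read, hS, eval_zero, eval_read2 hsys.good hE hS,
        hsys.inc y hy z hz, one_sub_ind, ind_mul_ind, not_lt, h.added z hz])
  have g1 := hsys.good.congr (M' := M₁) (by simp [f1])
  obtain ⟨M₂, h2, f2, q2⟩ := setArr_ind_spec (p := p) (d := 1) (out := 35) (M := M₁)
    (v := fun E => (eq (read 24 E) (read 30 0)).and (not (read 37 E))) (by omega) g1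
    (fun y => In (sys.active (sys.layer τ k) st) y) (by
      intro E i y hy hE
      rw [eval_and, eval_eq, eval_not, eval_read, eval_read, eval_read, hE, eval_zero, q1 y hy,
        f1 _ (by norm_num) (by norm_num), f1 _ (by norm_num) (by norm_num), h.num, one_sub_ind,
        ind_mul_ind]
      refine ind_congr ?_
      rw [hR1] at hy ⊢
      rw [h.mem.lay y hy, exists_in_inc hsys.n_le hA, active, in_sdiff])
  have g2 := g1.congr (M' := M₂) (by simp [f2])
  have q2' : ∀ y < p.R, M₂ 35 (y : ℤ) = ind (In (sys.active (sys.layer τ k) st) y) :=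
    fun y hy => q2 y (hR1.symm ▸ hy)
  obtain ⟨M₃, h3, f3, q3⟩ := nonempty_spec (p := p) (out := 36) (M := M₂) (by omega) g2 hm q2'
  have hrun : p.Runs PRAM.activate M M₃ := h1.seq (h2.seq h3)
  have hfr : ∀ b < 35, M₃ b = M b := fun b hb => hrun.frame_lt (k := 35) rfl hb
  refine ⟨M₃, hrun, hfr, h.congr hfr, fun y hy => ?_, q3⟩
  rw [f3 _ (by norm_num) (by norm_num)]; exact q2' y hy

/-- The dual variables are raised, and the almost tight sets are added. -/
def raiseStage : Prog :=
  .seq (fold sumOp 1 1 38 fun E S => (read 35 E).and (read2 21 1 E S)) <|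
  .seq (fold sumOp 1 1 42 fun E S => read2 21 1 E S * read 32 E) <|
  .seq (setArr 1 31 fun S => read 31 S * read 7 0) <|
  .seq (setArr 1 39 fun S => (read 31 S - read 42 S * read 7 0) / read 38 S) <|
  .seq (fold maxOp 1 0 40 fun S _ => read 39 S) <|
  .seq (fold minOp 1 1 41 fun S E => .cond (read2 21 1 E S) (read 39 S) (read 40 0)) <|
  .seq (setArr 1 32 fun E => read 32 E * read 7 0 + read 35 E * read 41 E) <|
  .seq (fold sumOp 1 1 42 fun E S => read2 21 1 E S * read 32 E) <|
  setArr 1 34 fun S => .cond (((read 20 S).and (lt (read 34 S) 0)).and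
    (not (lt (8 * read 42 S) (read 31 S)))) (read 30 0) (read 34 S)

lemma sum_dual_spec (hK : 2 ≤ p.K) {M : Mem} (hsys : SysMem p sys M) {b : ℤ}
    (hb : ∀ y < p.R, 0 ≤ M 32 (y : ℤ) ∧ M 32 (y : ℤ) ≤ b) (hW : (p.R : ℤ) * b < 2 ^ p.W) :
    Post p (fold sumOp 1 1 42 fun E S => read2 21 1 E S * read 32 E) M 42 fun A =>
      (∀ S ∈ sys.fam, A ((S : ℕ) : ℤ) = ∑ e ∈ sys.set S, M 32 ((e : ℕ) : ℤ)) ∧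
      ∀ z < p.R, ¬ In sys.fam z → A (z : ℤ) = 0 := by
  have hR1 : p.R ^ 1 = p.R := pow_one _
  have hm : m ≤ p.R := hsys.m_le.trans (Nat.div_le_self _ _)
  obtain ⟨M₁, h1, f1, q1⟩ := sum_spec (p := p) (a := 1) (d := 1) (out := 42) (M := M)
    (body := fun E S => read2 21 1 E S * read 32 E) hK hsys.good
    (fun y z => ind (Inc sys y z) * M 32 (y : ℤ)) b (by
      intro E S i y z hy hz hE hS
      rw [hR1] at hy hz
      rw [eval_mul, eval_read2 hsys.good hE hS, eval_read, hE, hsys.inc y hy z hz])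
    (fun y hy z _ => by
      rw [hR1] at hy
      have := hb y hy
      by_cases hc : Inc sys y z
      · rw [ind_true hc, one_mul, abs_of_nonneg this.1]; exact this.2
      · rw [ind_false hc, zero_mul, abs_zero]; omega) (by rw [hR1]; exact hW)
  refine ⟨M₁, h1, f1, fun S hS => ?_, fun z hz hno => ?_⟩
  · rw [q1 S (by rw [hR1]; exact S.2.trans_le hsys.n_le), hR1,
      ← sum_in hm (s := sys.set S) (fun y => M 32 (y : ℤ))]
    exact Finset.sum_congr rfl fun y _ => by rw [ind_congr (inc_val_right hS)]
  · rw [q1 z (hR1.symm ▸ hz)]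
    refine Finset.sum_eq_zero fun y _ => ?_
    rw [ind_false, zero_mul]
    rintro ⟨e, S, -, rfl, hS, -⟩
    exact hno (in_val.2 hS)

open Classical in
-- Exact arithmetic on integers: before dividing by d(S) ≤ m, everything is multiplied by F, a
-- common multiple of 1, …, m. The scale D and the bound b on all costs and dual variables grow by
-- the factor F per iteration. Minima and the test for tightness do not depend on the scale.
lemma FwdCore.raiseStage {k F : ℕ} {D : ℝ} {b : ℤ} {st : FwdState (Fin m) (Fin n)} {M : Mem}
    (hK : 2 ≤ p.K) (h : FwdCore p sys τ σ k F D b st M) (hF : 1 ≤ F)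
    (hdvd : ∀ d, 1 ≤ d → d ≤ m → d ∣ F) (hfeas : sys.Feasible) (hI : FwdInv sys st)
    (hk : k < p.R) (hW : (p.R : ℤ) * (b * F) < 2 ^ p.W)
    (hact : ∀ y < p.R, M 35 (y : ℤ) = ind (In (sys.active (sys.layer τ k) st) y)) :
    ∃ M', p.Runs raiseStage M M' ∧
      FwdCore p sys τ σ k F (D * F) (b * F) (sys.fwdStep (sys.layer τ k) st) M' := by
  have hR1 : p.R ^ 1 = p.R := pow_one _
  have hsys := h.mem.mem
  have hm : m ≤ p.R := hsys.m_le.trans (Nat.div_le_self _ _)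
  have hn := hsys.n_le
  have hb0 : 0 ≤ b := by have := h.cost_bound 0 p.R_pos; omega
  have hF' : (1 : ℤ) ≤ F := by exact_mod_cast hF
  have hbF : b ≤ b * F := le_mul_of_one_le_right hb0 hF'
  have hR' : (1 : ℤ) ≤ p.R := by exact_mod_cast p.R_pos
  have hbFW : b * F < 2 ^ p.W :=
    (le_mul_of_one_le_left (by positivity) hR').trans_lt hW
  have hFR : (0 : ℝ) < F := by exact_mod_cast hF
  have hDF : 0 < D * F := mul_pos h.scale_pos hFR
  set Z := sys.layer τ k with hZ
  set U := sys.active Z st with hU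
  have hUu : U ⊆ sys.univ := Finset.sdiff_subset.trans (layer_subset_univ τ k)
  -- the number of participating elements
  obtain ⟨M₁, h1, f1, q1⟩ := sum_spec (p := p) (a := 1) (d := 1) (out := 38) (M := M)
    (body := fun E S => (read 35 E).and (read2 21 1 E S)) hK hsys.good
    (fun y z => ind (In U y ∧ Inc sys y z)) 1 (by
      intro E S i y z hy hz hE hS
      rw [hR1] at hy hz
      rw [eval_and, eval_read2 hsys.good hE hS, eval_read, hE, hsys.inc y hy z hz, hact y hy,
        ind_mul_ind])
    (fun _ _ _ _ => abs_ind_le _) (p.pow_mul_one_lt (by omega))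
  have q1' : ∀ S ∈ sys.fam, M₁ 38 ((S : ℕ) : ℤ) = ((sys.set S ∩ U).card : ℤ) := fun S hS => by
    rw [q1 S (by rw [hR1]; exact S.2.trans_le hn), hR1]
    have := sum_in hm (s := sys.set S ∩ U) (fun _ => 1)
    simp only [mul_one, Finset.sum_const, nsmul_eq_mul] at this
    rw [← this]
    refine Finset.sum_congr rfl fun y _ => ind_congr ?_
    rw [inc_val_right hS, in_inter, and_comm]
  have s1 : SysMem p sys M₁ := hsys.congr fun b hb => by simp (disch := omega) only [f1]
  -- the old sums
  obtain ⟨M₂, h2, f2, q2, q2'⟩ := sum_dual_spec hK s1 (b := b)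
    (by rw [f1 _ (by norm_num) (by norm_num)]; exact h.dual_bound)
    ((mul_le_mul_of_nonneg_left hbF (by omega)).trans_lt hW)
  rw [f1 _ (by norm_num) (by norm_num)] at q2
  have g2 : p.Good M₂ := s1.good.congr (by simp [f2])
  have hsum : ∀ S ∈ sys.fam, (M₂ 42 ((S : ℕ) : ℤ) : ℝ) = D * ∑ e ∈ sys.set S, st.α e :=
    fun S hS => by
      rw [q2 S hS, Int.cast_sum, Finset.mul_sum]
      exact Finset.sum_congr rfl fun e _ => h.dual e
  have hslack : ∀ z < p.R, 0 ≤ M₂ 42 (z : ℤ) ∧ M₂ 42 (z : ℤ) ≤ M 31 (z : ℤ) := by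
    intro z hz
    by_cases hin : In sys.fam z
    · obtain ⟨S, hS, rfl⟩ := hin
      constructor
      · rw [q2 S hS]
        exact Finset.sum_nonneg fun e _ => (h.dual_bound e (e.2.trans_le hm)).1
      · have : (M₂ 42 ((S : ℕ) : ℤ) : ℝ) ≤ M 31 ((S : ℕ) : ℤ) := by
          rw [hsum S hS, h.cost S hS]
          exact mul_le_mul_of_nonneg_left (hI.dual S hS) h.scale_pos.le
        exact_mod_cast this
    · rw [q2' z hz hin]; exact ⟨le_rfl, (h.cost_bound z hz).1⟩
  -- the costs are rescaled
  obtain ⟨M₃, h3, f3, q3⟩ := setArr_spec (p := p) (d := 1) (out := 31) (M := M₂)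
    (v := fun S => read 31 S * read 7 0) (by omega) g2 (fun z => M 31 (z : ℤ) * F) (by
      intro S i z hz hS
      rw [eval_mul, eval_read, eval_read, hS, eval_zero, f2 _ (by norm_num) (by norm_num),
        f2 _ (by norm_num) (by norm_num), f1 _ (by norm_num) (by norm_num),
        f1 _ (by norm_num) (by norm_num), h.factor]) (by
      intro z hz
      have := h.cost_bound z (hR1 ▸ hz)
      rw [abs_of_nonneg (mul_nonneg this.1 (by omega))]
      exact (mul_le_mul_of_nonneg_right this.2 (by omega)).trans_lt hbFW)
  have g3 := g2.congr (M' := M₃) (by simp [f3])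
  -- the penalties
  set pen : ℕ → ℤ := fun z => (M 31 (z : ℤ) * F - M₂ 42 (z : ℤ) * F) / M₁ 38 (z : ℤ) with hpen
  have hpenb : ∀ z < p.R, |pen z| ≤ b * F := by
    intro z hz
    refine (Int.abs_ediv_le_abs _ _).trans ?_
    have e1 := hslack z hz
    have e2 := h.cost_bound z hz
    rw [← sub_mul, abs_of_nonneg (mul_nonneg (by omega) (by omega))]
    exact mul_le_mul_of_nonneg_right (by omega) (by omega)
  obtain ⟨M₄, h4, f4, q4⟩ := setArr_spec (p := p) (d := 1) (out := 39) (M := M₃)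
    (v := fun S => (read 31 S - read 42 S * read 7 0) / read 38 S) (by omega) g3 pen (by
      intro S i z hz hS
      rw [eval_div, eval_sub, eval_mul, eval_read, eval_read, eval_read, eval_read, hS, eval_zero,
        q3 z hz, f3 42 (by norm_num) (by norm_num), f3 7 (by norm_num) (by norm_num),
        f3 38 (by norm_num) (by norm_num), f2 38 (by norm_num) (by norm_num),
        f2 7 (by norm_num) (by norm_num), f1 7 (by norm_num) (by norm_num), h.factor])
    (fun z hz => (hpenb z (hR1 ▸ hz)).trans_lt hbFW)
  have g4 := g3.congr (M' := M₄) (by simp [f4])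
  obtain ⟨M₅, h5, f5, q5⟩ := max_spec (p := p) (a := 1) (d := 0) (out := 40) (M := M₄)
    (body := fun S _ => read 39 S) (by omega) g4 (fun z _ => pen z) (b * F) (by
      intro S Y i z y hz _ hS _
      rw [eval_read, hS, q4 z hz]) (fun z hz _ _ => hpenb z (hR1 ▸ hz)) hbFW
  have g5 := g4.congr (M' := M₅) (by simp [f5])
  obtain ⟨hbig, z₀, hz₀, hbig₀⟩ := q5 0 (by simp)
  rw [Nat.cast_zero] at hbig hbig₀
  rw [hR1] at hbig hz₀
  -- the minimal penalties
  obtain ⟨M₆, h6, f6, q6⟩ := min_spec (p := p) (a := 1) (d := 1) (out := 41) (M := M₅)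
    (body := fun S E => .cond (read2 21 1 E S) (read 39 S) (read 40 0)) hK g5
    (fun z y => if Inc sys y z then pen z else M₅ 40 0) (b * F) (by
      intro S E i z y hz hy hS hE
      rw [hR1] at hy
      have e21 : M₅ 21 = M 21 := by simp (disch := omega) only [f5, f4, f3, f2, f1]
      rw [eval_cond, eval_read2 g5 hE hS, eval_read, eval_read, hS, eval_zero, e21,
        hsys.inc y hy z (hR1 ▸ hz), f5 39 (by norm_num) (by norm_num), q4 z hz]
      simp only [ne_eq, ind_eq_zero, not_not]) (fun z hz y _ => by
        split_ifs
        · exact hpenb z (hR1 ▸ hz)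
        · rw [← hbig₀]; exact hpenb z₀ hz₀) hbFW
  have g6 := g5.congr (M' := M₆) (by simp [f6])
  -- The quotient is meaningful only for sets with participating elements. The value computed for
  -- other sets is never used to raise anything, since no participating element lies in them.
  have hpenR : ∀ S ∈ sys.fam, (sys.set S ∩ U).Nonempty →
      (pen S : ℝ) = D * F * sys.penalty Z st S := by
    intro S hS hne
    have hd1 : 1 ≤ (sys.set S ∩ U).card := Finset.card_pos.2 hne
    have hd2 : (sys.set S ∩ U).card ≤ m := (Finset.card_le_univ _).trans_eq (Fintype.card_fin m)
    obtain ⟨c, hc⟩ := hdvd _ hd1 hd2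
    have hd0 : ((sys.set S ∩ U).card : ℤ) ≠ 0 := by positivity
    have hd0' : ((sys.set S ∩ U).card : ℝ) ≠ 0 := by positivity
    have e1 : pen S = (M 31 ((S : ℕ) : ℤ) - M₂ 42 ((S : ℕ) : ℤ)) * c := by
      rw [hpen]
      dsimp only
      rw [q1' S hS, ← sub_mul, hc]
      push_cast
      rw [show (M 31 ((S : ℕ) : ℤ) - M₂ 42 ((S : ℕ) : ℤ)) * (((sys.set S ∩ U).card : ℤ) * c) =
        ((sys.set S ∩ U).card : ℤ) * ((M 31 ((S : ℕ) : ℤ) - M₂ 42 ((S : ℕ) : ℤ)) * c) by ring,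
        Int.mul_ediv_cancel_left _ hd0]
    rw [e1, SetSystem.penalty, ← hU, hc]
    push_cast
    rw [h.cost S hS, hsum S hS]
    field_simp
  -- Sets not containing e enter the minimum with the largest of all penalties, which cannot
  -- undercut the true minimum.
  have hmp : ∀ e ∈ U, (M₆ 41 ((e : ℕ) : ℤ) : ℝ) = D * F * sys.minPenalty Z st e := by
    intro e he
    obtain ⟨hle, z, hz, hval⟩ := q6 e (by rw [hR1]; exact e.2.trans_le hm)
    obtain ⟨S₀, hS₀, heS₀, hmin⟩ := exists_minPenalty (Z := Z) (st := st) hfeas (hUu he)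
    have hne : ∀ S, e ∈ sys.set S → (sys.set S ∩ U).Nonempty := fun S h' =>
      ⟨e, Finset.mem_inter.2 ⟨h', he⟩⟩
    have e1 : M₆ 41 ((e : ℕ) : ℤ) ≤ pen S₀ := by
      have := hle S₀ (by rw [hR1]; exact S₀.2.trans_le hn)
      rwa [if_pos (inc_val.2 ⟨hS₀, heS₀⟩)] at this
    have e2 : (pen S₀ : ℝ) = D * F * sys.minPenalty Z st e := by
      rw [hpenR S₀ hS₀ (hne _ heS₀), hmin]
    refine le_antisymm (e2 ▸ Int.cast_le.2 e1) ?_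
    rw [← hval]
    split_ifs with hc
    · obtain ⟨e', S, he', rfl, hS, heS⟩ := hc
      rw [Fin.ext he'] at heS
      rw [hpenR S hS (hne _ heS)]
      exact mul_le_mul_of_nonneg_left (minPenalty_le hS heS) hDF.le
    · rw [← e2]
      exact Int.cast_le.2 (hbig S₀ (S₀.2.trans_le hn))
  have hraise : ∀ e : Fin m, ((M 32 ((e : ℕ) : ℤ) * F + ind (In U e) * M₆ 41 ((e : ℕ) : ℤ) : ℤ) : ℝ) =
      D * F * sys.raise Z st e := by
    intro e
    push_cast
    rw [h.dual e, SetSystem.raise, ← hU]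
    split_ifs with he
    · rw [ind_true (in_val.2 he), hmp e he]; push_cast; ring
    · rw [ind_false (fun h' => he (in_val.1 h'))]; push_cast; ring
  have hstep : FwdInv sys (sys.fwdStep Z st) := hI.step
  have hdb : ∀ y < p.R, 0 ≤ M 32 (y : ℤ) * F + ind (In U y) * M₆ 41 (y : ℤ) ∧
      M 32 (y : ℤ) * F + ind (In U y) * M₆ 41 (y : ℤ) ≤ b * F := by
    intro y hy
    by_cases hin : In U y
    · obtain ⟨e, he, rfl⟩ := hin
      have e1 := hraise e
      constructor
      · have : (0 : ℝ) ≤ D * F * sys.raise Z st e := mul_nonneg hDF.le (hstep.nonneg e)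
        rw [← e1] at this
        exact_mod_cast this
      -- By dual feasibility a dual variable is at most the cost of any set through its element, so
      -- the bound for the costs also bounds the dual variables.
      · obtain ⟨S, hS, heS⟩ := hfeas e (hUu he)
        have e2 : D * F * sys.raise Z st e ≤ D * F * sys.cost S := by
          refine mul_le_mul_of_nonneg_left (le_trans ?_ (hstep.dual S hS)) hDF.le
          exact Finset.single_le_sum (f := (sys.fwdStep Z st).α) (fun e _ => hstep.nonneg e) heS
        rw [← e1, mul_right_comm, ← h.cost S hS] at e2
        have e3 : M 32 ((e : ℕ) : ℤ) * F + ind (In U e) * M₆ 41 ((e : ℕ) : ℤ) ≤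
            M 31 ((S : ℕ) : ℤ) * F := by exact_mod_cast e2
        exact e3.trans (mul_le_mul_of_nonneg_right (h.cost_bound S (S.2.trans_le hn)).2 (by omega))
    · rw [ind_false hin, zero_mul, add_zero]
      have := h.dual_bound y hy
      exact ⟨mul_nonneg this.1 (by omega), mul_le_mul_of_nonneg_right this.2 (by omega)⟩
  -- the dual variables are raised
  obtain ⟨M₇, h7, f7, q7⟩ := setArr_spec (p := p) (d := 1) (out := 32) (M := M₆)
    (v := fun E => read 32 E * read 7 0 + read 35 E * read 41 E) (by omega) g6
    (fun y => M 32 (y : ℤ) * F + ind (In U y) * M₆ 41 (y : ℤ)) (by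
      intro E i y hy hE
      have e1 : M₆ 32 = M 32 := by simp (disch := omega) only [f6, f5, f4, f3, f2, f1]
      have e2 : M₆ 7 = M 7 := by simp (disch := omega) only [f6, f5, f4, f3, f2, f1]
      have e3 : M₆ 35 = M 35 := by simp (disch := omega) only [f6, f5, f4, f3, f2, f1]
      simp only [eval_add, eval_mul, eval_read, hE, eval_zero]
      rw [e1, e2, e3, h.factor, hact y (hR1 ▸ hy)]) (fun y hy => by
      have := hdb y (hR1 ▸ hy)
      rw [abs_of_nonneg this.1]; exact this.2.trans_lt hbFW)
  have s7 : SysMem p sys M₇ := hsys.congr fun b hb => by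
    simp (disch := omega) only [f7, f6, f5, f4, f3, f2, f1]
  obtain ⟨M₈, h8, f8, q8, q8'⟩ := sum_dual_spec hK s7 (b := b * F)
    (fun y hy => by rw [q7 y (hR1.symm ▸ hy)]; exact hdb y hy) hW
  have g8 : p.Good M₈ := s7.good.congr (by simp [f8])
  have hsum8 : ∀ S ∈ sys.fam, (M₈ 42 ((S : ℕ) : ℤ) : ℝ) =
      D * F * ∑ e ∈ sys.set S, sys.raise Z st e := fun S hS => by
    rw [q8 S hS, Int.cast_sum, Finset.mul_sum]
    refine Finset.sum_congr rfl fun e _ => ?_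
    rw [q7 e (by rw [hR1]; exact e.2.trans_le hm), hraise e]
  have e31 : ∀ z < p.R, M₈ 31 (z : ℤ) = M 31 (z : ℤ) * F := fun z hz => by
    rw [f8 _ (by norm_num) (by norm_num), f7 _ (by norm_num) (by norm_num),
      f6 _ (by norm_num) (by norm_num), f5 _ (by norm_num) (by norm_num),
      f4 _ (by norm_num) (by norm_num)]
    exact q3 z (hR1.symm ▸ hz)
  have hcostF : ∀ S ∈ sys.fam, ((M 31 ((S : ℕ) : ℤ) * F : ℤ) : ℝ) = D * F * sys.cost S :=
    fun S hS => by push_cast; rw [h.cost S hS]; ring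
  have e34 : M₈ 34 = M 34 := by simp (disch := omega) only [f8, f7, f6, f5, f4, f3, f2, f1]
  have hnew : ∀ z < p.R, M 20 (z : ℤ) * ind (M 34 (z : ℤ) < 0) *
      (1 - ind (8 * M₈ 42 (z : ℤ) < M 31 (z : ℤ) * F)) =
      ind (In ((sys.fwdStep Z st).A \ st.A) z) := by
    intro z hz
    rw [hsys.fam z hz, one_sub_ind, ind_mul_ind, ind_mul_ind]
    refine ind_congr ?_
    rw [← not_le, h.added z hz]
    by_cases hin : In sys.fam z
    · obtain ⟨S, hS, rfl⟩ := hin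
      rw [in_val, in_val, in_val, Finset.mem_sdiff, mem_fwdStep_A, not_lt]
      have : M 31 ((S : ℕ) : ℤ) * F ≤ 8 * M₈ 42 ((S : ℕ) : ℤ) ↔
          sys.cost S / 8 ≤ ∑ e ∈ sys.set S, sys.raise Z st e := by
        rw [← Int.cast_le (R := ℝ), hcostF S hS]
        push_cast
        rw [hsum8 S hS, show 8 * (D * F * ∑ e ∈ sys.set S, sys.raise Z st e) =
          D * F * (8 * ∑ e ∈ sys.set S, sys.raise Z st e) by ring, mul_le_mul_iff_right₀ hDF,
          div_le_iff₀ (by norm_num), mul_comm]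
      rw [this]
      tauto
    · refine iff_of_false (fun h' => hin h'.1.1) fun h' => hin (h'.mono ?_)
      exact Finset.sdiff_subset.trans hstep.subset
  obtain ⟨M₉, h9, f9, q9⟩ := setArr_spec (p := p) (d := 1) (out := 34) (M := M₈)
    (v := fun S => .cond (((read 20 S).and (lt (read 34 S) 0)).and
      (not (lt (8 * read 42 S) (read 31 S)))) (read 30 0) (read 34 S)) (by omega) g8
    (fun z => if In ((sys.fwdStep Z st).A \ st.A) z then (k : ℤ) else M 34 (z : ℤ)) (by
      intro S i z hz hS
      rw [hR1] at hz
      have e20 : M₈ 20 = M 20 := by simp (disch := omega) only [f8, f7, f6, f5, f4, f3, f2, f1]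
      have e30 : M₈ 30 = M 30 := by simp (disch := omega) only [f8, f7, f6, f5, f4, f3, f2, f1]
      simp only [eval_cond, eval_and, eval_read, eval_lt, eval_not, eval_mul, eval_eight, hS,
        eval_zero]
      rw [e20, e34, e30, e31 z hz, h.num, hnew z hz]
      simp only [ne_eq, ind_eq_zero, not_not]) (fun z hz => by
      have := h.range z (hR1 ▸ hz)
      have hRW := p.R_lt_word (by omega)
      split_ifs
      · rw [abs_lt]; omega
      · rw [abs_lt]; omega)
  have q9' : ∀ z < p.R, M₉ 34 (z : ℤ) =
      if In ((sys.fwdStep Z st).A \ st.A) z then (k : ℤ) else M 34 (z : ℤ) := fun z hz =>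
    q9 z (hR1.symm ▸ hz)
  have hrun : p.Runs PRAM.raiseStage M M₉ :=
    h1.seq (h2.seq (h3.seq (h4.seq (h5.seq (h6.seq (h7.seq (h8.seq h9)))))))
  have hfr : ∀ b < 31, M₉ b = M b := fun b hb => hrun.frame_lt (k := 31) rfl hb
  have e32 : M₉ 32 = M₇ 32 := by simp (disch := omega) only [f9, f8]
  refine ⟨M₉, hrun,
    { mem := h.mem.congr fun b hb => hfr b (by omega)
      factor := by rw [hfr 7 (by norm_num)]; exact h.factor
      num := by rw [hfr 30 (by norm_num)]; exact h.num
      scale_pos := hDF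
      cost := fun S hS => by
        rw [f9 _ (by norm_num) (by norm_num), e31 S (S.2.trans_le hn), hcostF S hS]
      cost_bound := fun z hz => by
        rw [f9 _ (by norm_num) (by norm_num), e31 z hz]
        have := h.cost_bound z hz
        exact ⟨mul_nonneg this.1 (by omega), mul_le_mul_of_nonneg_right this.2 (by omega)⟩
      dual := fun e => by
        rw [e32, q7 e (by rw [hR1]; exact e.2.trans_le hm), hraise e]; rfl
      dual_bound := fun y hy => by
        rw [e32, q7 y (hR1.symm ▸ hy)]; exact hdb y hy
      range := fun z hz => by
        rw [q9' z hz]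
        have := h.range z hz
        split_ifs <;> omega
      added := fun z hz => by
        rw [q9' z hz]
        split_ifs with hc
        · rw [in_sdiff] at hc
          exact iff_of_true (by omega) hc.1
        · rw [h.added z hz]
          refine ⟨fun h' => h'.mono subset_fwdStep_A, fun h' => ?_⟩
          by_contra hno
          exact hc (in_sdiff.2 ⟨h', hno⟩)
      epoch := fun z hz j hj => by
        rw [q9' z hz, ← h.epoch z hz j hj]
        split_ifs with hc
        · rw [in_sdiff, ← h.added z hz] at hc
          omega
        · rfl }⟩

end PRAM

/-! ### The loops of the forward phase -/

namespace PRAM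
variable {p : Params}
open PRAM.Expr SetSystem
variable {m n τ : ℕ} {sys : SetSystem (Fin m) (Fin n)} {σ : ℕ → FwdState (Fin m) (Fin n)}

/-- An iteration is a function of the state, so the machine retraces the given epoch step by step
and its loop takes the same number of iterations. -/
lemma FwdCore.epochRun {k F : ℕ} (hK : 2 ≤ p.K) (hF : 1 ≤ F)
    (hdvd : ∀ d, 1 ≤ d → d ≤ m → d ∣ F) (hfeas : sys.Feasible) (hk : k < p.R)
    {st st' : FwdState (Fin m) (Fin n)} {t : ℕ} (hrun : sys.EpochRun (sys.layer τ k) st t st')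
    {D : ℝ} {b : ℤ} {M : Mem} (h : FwdCore p sys τ σ k F D b st M) (hI : FwdInv sys st)
    (hW : (p.R : ℤ) * (b * F ^ t) < 2 ^ p.W)
    (hact : ∀ y < p.R, M 35 (y : ℤ) = ind (In (sys.active (sys.layer τ k) st) y))
    (hflag : M 36 0 = ind (sys.active (sys.layer τ k) st).Nonempty) :
    ∃ M' D', p.Iter (read 36 0) (.seq PRAM.raiseStage PRAM.activate) t M M' ∧
      FwdCore p sys τ σ k F D' (b * F ^ t) st' M' := by
  have hF' : (1 : ℤ) ≤ F := by exact_mod_cast hF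
  induction hrun generalizing D b M with
  | done st hcov =>
    refine ⟨M, D, ⟨?_, rfl⟩, by simpa using h⟩
    rw [eval_read, eval_zero, hflag, ind_eq_zero, Finset.not_nonempty_iff_eq_empty, active,
      Finset.sdiff_eq_empty_iff_subset]
    exact hcov
  | step st st' t hcov _ ih =>
    have hb0 : 0 ≤ b := by have := h.cost_bound 0 p.R_pos; omega
    have hpow : (1 : ℤ) ≤ (F : ℤ) ^ t := one_le_pow₀ hF'
    obtain ⟨M₁, h1, s1⟩ := h.raiseStage hK hF hdvd hfeas hI hk (by
      refine lt_of_le_of_lt (mul_le_mul_of_nonneg_left ?_ (Int.natCast_nonneg _)) hW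
      rw [pow_succ', ← mul_assoc]
      exact le_mul_of_one_le_right (by positivity) hpow) hact
    obtain ⟨M₂, h2, -, s2, q35, q36⟩ := s1.activate hK hI.step.subset
    obtain ⟨M₃, D', h3, s3⟩ := ih s2 hI.step (by
      rw [pow_succ', ← mul_assoc b] at hW; exact hW) q35 q36
    refine ⟨M₃, D', ⟨?_, M₂, h1.seq h2, h3⟩, ?_⟩
    · rw [eval_read, eval_zero, hflag, ne_eq, ind_eq_zero, not_not, active,
        Finset.sdiff_nonempty]
      exact hcov
    · rw [pow_succ', ← mul_assoc]; exact s3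

/-- One epoch. -/
def epoch : Prog :=
  .seq activate <| .seq (.while (read 36 0) (.seq raiseStage activate)) <|
  setScalar 30 (read 30 0 + 1)

/-- The forward phase: array `34` receives the epochs in which the sets are added. -/
def forward : Prog :=
  .seq (setScalar 30 0) <|
  .seq (setArr 1 31 fun S => read 23 S) <|
  .seq (setArr 1 32 fun _ => 0) <|
  .seq (setArr 1 34 fun _ => 0 - 1) <|
  .while (lt (read 30 0) (read 25 0)) epoch

variable {t : ℕ → ℕ}

lemma FwdCore.epoch_spec {k F : ℕ} (hK : 2 ≤ p.K) (hF : 1 ≤ F)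
    (hdvd : ∀ d, 1 ≤ d → d ≤ m → d ∣ F) (hfeas : sys.Feasible)
    (hc : ∀ S ∈ sys.fam, 0 < sys.cost S) (hf : sys.ForwardRun τ σ t)
    (hL : sys.decompLength τ ≤ p.R) (hk : k < sys.decompLength τ) (ht : t k ≤ p.B)
    {D : ℝ} {b : ℤ} {M : Mem} (h : FwdCore p sys τ σ k F D b (σ k) M)
    (hW : (p.R : ℤ) * (b * F ^ t k) < 2 ^ p.W) :
    ∃ M' D', p.Runs PRAM.epoch M M' ∧
      FwdCore p sys τ σ (k + 1) F D' (b * F ^ t k) (σ (k + 1)) M' := by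
  have hI := hf.inv hc hk.le
  obtain ⟨M₁, h1, -, s1, q35, q36⟩ := h.activate hK hI.subset
  obtain ⟨M₂, D', h2, s2⟩ := s1.epochRun hK hF hdvd hfeas (by omega) (hf.2 k hk) hI hW q35 q36
  have hRW := p.R_lt_word (by omega)
  obtain ⟨M₃, h3, f3, q3⟩ := setScalar_spec (p := p) (out := 30) (M := M₂)
    (v := read 30 0 + 1) ((k + 1 : ℕ) : ℤ) (by
      rw [eval_add, eval_read, eval_zero, eval_one, s2.num]; norm_cast)
    (by rw [Nat.abs_cast]; omega)
  refine ⟨M₃, D', h1.seq ((h2.runs ht).seq h3),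
    { mem := s2.mem.congr fun b hb => f3 b (by omega) (by omega)
      factor := by rw [f3 _ (by norm_num) (by norm_num)]; exact s2.factor
      num := q3
      scale_pos := s2.scale_pos
      cost := by rw [f3 _ (by norm_num) (by norm_num)]; exact s2.cost
      cost_bound := by rw [f3 _ (by norm_num) (by norm_num)]; exact s2.cost_bound
      dual := by rw [f3 _ (by norm_num) (by norm_num)]; exact s2.dual
      dual_bound := by rw [f3 _ (by norm_num) (by norm_num)]; exact s2.dual_bound
      range := fun z hz => by
        rw [f3 _ (by norm_num) (by norm_num)]
        have := s2.range z hz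
        push_cast
        omega
      added := by rw [f3 _ (by norm_num) (by norm_num)]; exact s2.added
      epoch := fun z hz j hj => by
        rw [f3 _ (by norm_num) (by norm_num)]
        -- No entry exceeds k, so for j = k + 1 the condition says only that the set has been added.
        rcases Nat.le_succ_iff.1 hj with hj | rfl
        · exact s2.epoch z hz j hj
        · rw [← s2.added z hz]
          have := s2.range z hz
          push_cast
          omega }⟩

lemma FwdCore.iter {F : ℕ} (hK : 2 ≤ p.K) (hF : 1 ≤ F)
    (hdvd : ∀ d, 1 ≤ d → d ≤ m → d ∣ F) (hfeas : sys.Feasible)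
    (hc : ∀ S ∈ sys.fam, 0 < sys.cost S) (hf : sys.ForwardRun τ σ t)
    (hL : sys.decompLength τ ≤ p.R) (ht : ∀ k < sys.decompLength τ, t k ≤ p.B) {b : ℤ} (hb : 0 ≤ b)
    (hW : (p.R : ℤ) * (b * F ^ ∑ k ∈ Finset.range (sys.decompLength τ), t k) < 2 ^ p.W) (i : ℕ)
    {k : ℕ} (hi : k + i = sys.decompLength τ) {D : ℝ} {M : Mem}
    (h : FwdCore p sys τ σ k F D (b * F ^ ∑ j ∈ Finset.range k, t j) (σ k) M) :
    ∃ M', p.Iter (lt (read 30 0) (read 25 0)) PRAM.epoch i M M' ∧ FwdMem p sys τ σ M' := by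
  induction i generalizing k D M with
  | zero =>
    obtain rfl : k = sys.decompLength τ := by omega
    exact ⟨M, ⟨by simp [h.num, h.mem.len], rfl⟩, h.mem, h.epoch⟩
  | succ i ih =>
    have hF' : (1 : ℤ) ≤ F := by exact_mod_cast hF
    obtain ⟨M₁, D', h1, s1⟩ := h.epoch_spec hK hF hdvd hfeas hc hf hL (by omega)
      (ht k (by omega)) (by
        refine lt_of_le_of_lt (mul_le_mul_of_nonneg_left ?_ (Int.natCast_nonneg _)) hW
        rw [mul_assoc, ← pow_add, ← Finset.sum_range_succ]
        refine mul_le_mul_of_nonneg_left (pow_le_pow_right₀ hF' ?_) hb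
        exact Finset.sum_le_sum_of_subset (Finset.range_subset_range.2 (by omega)))
    rw [mul_assoc, ← pow_add, ← Finset.sum_range_succ] at s1
    obtain ⟨M₂, h2, s2⟩ := ih (by omega) s1
    refine ⟨M₂, ⟨?_, M₁, h1, h2⟩, s2⟩
    simp [h.num, h.mem.len]
    omega

lemma forward_spec {F : ℕ} (hK : 2 ≤ p.K) (hF : 1 ≤ F)
    (hdvd : ∀ d, 1 ≤ d → d ≤ m → d ∣ F) (hfeas : sys.Feasible)
    (hc : ∀ S ∈ sys.fam, 0 < sys.cost S) (hf : sys.ForwardRun τ σ t)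
    (hL : sys.decompLength τ ≤ p.R) (hLB : sys.decompLength τ ≤ p.B)
    (ht : ∀ k < sys.decompLength τ, t k ≤ p.B) {b : ℤ}
    (hW : (p.R : ℤ) * (b * F ^ ∑ k ∈ Finset.range (sys.decompLength τ), t k) < 2 ^ p.W) {M : Mem}
    (h : LayMem p sys τ M) (hMF : M 7 0 = (F : ℤ)) {D : ℝ} (hD : 0 < D)
    (hcost : ∀ S ∈ sys.fam, (M 23 ((S : ℕ) : ℤ) : ℝ) = D * sys.cost S)
    (hb : ∀ z < p.R, 0 ≤ M 23 (z : ℤ) ∧ M 23 (z : ℤ) ≤ b) :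
    ∃ M', p.Runs forward M M' ∧ FwdMem p sys τ σ M' ∧ ∀ b < 30, M' b = M b := by
  have hR1 : p.R ^ 1 = p.R := pow_one _
  have hb0 : 0 ≤ b := by have := hb 0 p.R_pos; omega
  have hF' : (1 : ℤ) ≤ F := by exact_mod_cast hF
  have hbW : b < 2 ^ p.W := by
    refine lt_of_le_of_lt ?_ hW
    have h1 : b * 1 ≤ b * F ^ ∑ k ∈ Finset.range (sys.decompLength τ), t k :=
      mul_le_mul_of_nonneg_left (one_le_pow₀ hF') hb0
    rw [mul_one] at h1
    exact h1.trans (le_mul_of_one_le_left (by positivity) (by exact_mod_cast p.R_pos))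
  obtain ⟨M₁, h1, f1, q1⟩ := setScalar_spec (p := p) (out := 30) (M := M)
    (v := 0) ((0 : ℕ) : ℤ) rfl (by simp)
  have g1 := h.mem.good.congr (M' := M₁) (by simp [f1])
  obtain ⟨M₂, h2, f2, q2⟩ := setArr_spec (p := p) (d := 1) (out := 31) (M := M₁)
    (v := fun S => read 23 S) (by omega) g1 (fun z => M 23 (z : ℤ)) (by
      intro S i z hz hS
      rw [eval_read, hS, f1 _ (by norm_num) (by norm_num)]) (fun z hz => by
      have := hb z (hR1 ▸ hz)
      rw [abs_of_nonneg this.1]; omega)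
  have g2 := g1.congr (M' := M₂) (by simp [f2])
  obtain ⟨M₃, h3, f3, q3⟩ := setArr_spec (p := p) (d := 1) (out := 32) (M := M₂)
    (v := fun _ => 0) (by omega) g2 (fun _ => 0) (fun _ _ _ _ _ => rfl) (fun _ _ => by simp)
  have g3 := g2.congr (M' := M₃) (by simp [f3])
  obtain ⟨M₄, h4, f4, q4⟩ := setArr_spec (p := p) (d := 1) (out := 34) (M := M₃)
    (v := fun _ => 0 - 1) (by omega) g3 (fun _ => -1) (fun _ _ _ _ _ => rfl)
    (fun _ _ => by simpa using p.one_lt_word)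
  have e31 : M₄ 31 = M₂ 31 := by simp (disch := omega) only [f4, f3]
  have e32 : M₄ 32 = M₃ 32 := by simp (disch := omega) only [f4]
  have hσ : σ 0 = ⟨∅, fun _ => 0⟩ := hf.1
  have hm : m ≤ p.R := h.mem.m_le.trans (Nat.div_le_self _ _)
  have s4 : FwdCore p sys τ σ 0 F D (b * F ^ ∑ j ∈ Finset.range 0, t j) (σ 0) M₄ :=
    { mem := h.congr fun b hb => by simp (disch := omega) only [f4, f3, f2, f1]
      factor := by simp (disch := omega) only [f4, f3, f2, f1]; exact hMF
      num := by simp (disch := omega) only [f4, f3, f2]; exact q1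
      scale_pos := hD
      cost := fun S hS => by
        rw [e31, q2 S (by rw [hR1]; exact S.2.trans_le h.mem.n_le), hcost S hS]
      cost_bound := fun z hz => by
        rw [e31, q2 z (hR1.symm ▸ hz)]; simpa using hb z hz
      dual := fun e => by
        rw [e32, q3 e (by rw [hR1]; exact e.2.trans_le hm), hσ]; simp
      dual_bound := fun y hy => by
        rw [e32, q3 y (hR1.symm ▸ hy)]; simpa using hb0
      range := fun z hz => by rw [q4 z (hR1.symm ▸ hz)]; simp
      added := fun z hz => by rw [q4 z (hR1.symm ▸ hz), hσ]; simp
      epoch := fun z hz j hj => by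
        obtain rfl : j = 0 := by omega
        rw [q4 z (hR1.symm ▸ hz), hσ]; simp }
  obtain ⟨M₅, h5, s5⟩ := s4.iter hK hF hdvd hfeas hc hf hL ht hb0 hW _ (zero_add _)
  have hrun : p.Runs forward M M₅ := h1.seq (h2.seq (h3.seq (h4.seq (h5.runs hLB))))
  exact ⟨M₅, hrun, s5, fun b hb => hrun.frame_lt (k := 30) rfl hb⟩

end PRAM

namespace PRAM
variable {p : Params}
open PRAM.Expr SetSystem

/-! ### The input -/

/-- The number of processors is computed from the input. -/
def setResources (K : ℕ) : Prog :=
  .seq (setScalar 5 8) <|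
  .seq (.while (not (lt (8 * (read 0 0 + read 0 1)) (read 5 0))) (setScalar 5 (2 * read 5 0))) <|
  .par 1 5 1 (powR K)

lemma exists_runs_setCell {M : Mem} (a : ℕ) (c : ℤ) (v : Expr) (hv : |v.eval M 0| < 2 ^ p.W) :
    ∃ M', p.Runs (.par 1 a (.const c) v) M M' ∧ M' a c = v.eval M 0 ∧
      (∀ y, y ≠ c → M' a y = M a y) ∧ ∀ b, b ≠ a → M' b = M b := by
  have hp : ((1 : Expr).eval M 0).toNat = 1 := rfl
  refine ⟨_, ⟨_, le_rfl, .par 1 a (.const c) v M p.one_le_N (by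
    intro i hi
    rw [hp, Nat.lt_one_iff] at hi
    rwa [hi])⟩, ?_, fun y hy => ?_, fun b hb => ?_⟩
  · have hex : a = a ∧ ∃ i, i < ((1 : Expr).eval M 0).toNat ∧ (Expr.const c).eval M i = c :=
      ⟨rfl, 0, by simp, rfl⟩
    unfold parWrite
    rw [dif_pos hex]
    exact congrArg (fun i => v.eval M i)
      (Nat.lt_one_iff.1 (@Nat.find_spec _ _ hex.2).1)
  · have : ¬ (a = a ∧ ∃ i, i < ((1 : Expr).eval M 0).toNat ∧ (Expr.const c).eval M i = y) := by
      rintro ⟨-, i, -, h⟩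
      exact hy h.symm
    unfold parWrite
    rw [dif_neg this]
  · funext y
    exact dif_neg fun h => hb h.1

lemma eval_powR_of_eq {M : Mem} {R : ℕ} (h : M 5 0 = (R : ℤ)) (i a : ℕ) :
    (Expr.powR a).eval M i = ((R ^ a : ℕ) : ℤ) := by
  induction a with
  | zero => rfl
  | succ a ih => simp [Expr.powR, ih, h, pow_succ]

/-- Starting from 8, doubling stops at the first power of two above s = 8(m + n), whose exponent is
the larger of 3 and the binary length of s. -/
lemma iter_double {s : ℕ} {M₀ : Mem} (h0 : 8 * (M₀ 0 0 + M₀ 0 1) = (s : ℤ))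
    (hr : p.r = max 3 s.size) (hK : 1 ≤ p.K) (i : ℕ) {j : ℕ} (hj : 3 ≤ j) (hji : j + i = p.r) {M : Mem}
    (h5 : M 5 0 = ((2 ^ j : ℕ) : ℤ)) (hM : ∀ b, b ≠ 5 → M b = M₀ b) :
    ∃ M', p.Iter (not (lt (8 * (read 0 0 + read 0 1)) (read 5 0))) (setScalar 5 (2 * read 5 0)) i M M' ∧
      M' 5 0 = (p.R : ℤ) ∧ ∀ b, b ≠ 5 → M' b = M₀ b := by
  have heval : (not (lt (8 * (read 0 0 + read 0 1)) (read 5 0))).eval M 0 = ind (¬ s < 2 ^ j) := by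
    rw [eval_not, eval_lt, eval_mul, eval_add, eval_eight, eval_read, eval_read, eval_read,
      eval_zero, eval_one, hM 0 (by norm_num), h0, h5, one_sub_ind]
    exact ind_congr (not_congr (by norm_cast))
  rw [← Nat.size_le] at heval
  induction i generalizing j M with
  | zero =>
    refine ⟨M, ⟨?_, rfl⟩, by rw [h5, Params.R]; congr, hM⟩
    rw [heval, ind_eq_zero, not_not]
    omega
  | succ i ih =>
    have hjr : 2 ^ (j + 1) ≤ p.R := Nat.pow_le_pow_right (by norm_num) (by omega)
    obtain ⟨M₁, h1, q1, -, f1⟩ := exists_runs_setScalar (p := p) (M := M) 5 (2 * read 5 0)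
      p.one_le_N (by
        rw [eval_mul, eval_read, eval_two, eval_zero, h5]
        have : (2 : ℤ) * ((2 ^ j : ℕ) : ℤ) = ((2 ^ (j + 1) : ℕ) : ℤ) := by push_cast; ring
        rw [this, Nat.abs_cast]
        exact lt_of_le_of_lt (by exact_mod_cast hjr) (p.R_lt_word hK))
    have q1' : M₁ 5 0 = ((2 ^ (j + 1) : ℕ) : ℤ) := by
      rw [q1, eval_mul, eval_read, eval_two, eval_zero, h5]; push_cast; ring
    have hM₁ : ∀ b, b ≠ 5 → M₁ b = M₀ b := fun b hb => by rw [f1 b hb, hM b hb]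
    obtain ⟨M₂, h2, q2, f2⟩ := ih (by omega) (by omega) q1' hM₁ (by
      rw [eval_not, eval_lt, eval_mul, eval_add, eval_eight, eval_read, eval_read, eval_read,
        eval_zero, eval_one, hM₁ 0 (by norm_num), h0, q1', one_sub_ind, Nat.size_le]
      exact ind_congr (not_congr (by norm_cast)))
    refine ⟨M₂, ⟨?_, M₁, h1, h2⟩, q2, f2⟩
    rw [heval, ne_eq, ind_eq_zero, not_not]
    have h4 : 4 ≤ s.size := by omega
    omega

lemma setResources_spec {s : ℕ} {M : Mem} (h0 : 8 * (M 0 0 + M 0 1) = (s : ℤ))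
    (hr : p.r = max 3 s.size) (hK : 1 ≤ p.K) :
    ∃ M', p.Runs (setResources p.K) M M' ∧ p.Good M' ∧ ∀ b, b ≠ 5 → M' b = M b := by
  have hR8 : 2 ^ 3 ≤ p.R := Nat.pow_le_pow_right (by norm_num) (by omega)
  have hRW := p.R_lt_word hK
  obtain ⟨M₁, h1, q1, -, f1⟩ := exists_runs_setScalar (p := p) (M := M) 5 8 p.one_le_N (by
    rw [eval_eight, abs_of_pos (by norm_num)]
    exact lt_of_le_of_lt (by exact_mod_cast hR8) hRW)
  obtain ⟨M₂, h2, q2, f2⟩ := iter_double h0 hr hK (p.r - 3) le_rfl (by omega) (M := M₁)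
    (by rw [q1]; rfl) f1
  have hv : (powR p.K).eval M₂ 0 = ((p.R ^ p.K : ℕ) : ℤ) := eval_powR_of_eq q2 0 _
  obtain ⟨M₃, h3, q3, q3', f3⟩ := exists_runs_setCell (p := p) (M := M₂) 5 1 (powR p.K) (by
    rw [hv, Nat.abs_cast]; exact p.pow_lt_word)
  refine ⟨M₃, h1.seq ((h2.runs ?_).seq h3), ⟨?_, by rw [q3, hv]⟩, fun b hb => by
    rw [f3 b hb, f2 b hb]⟩
  · have := p.loops
    have : p.r ≤ p.r * p.K := Nat.le_mul_of_pos_right _ hK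
    omega
  · rw [q3' 0 (by norm_num), q2]

/-- The incidence matrix is copied, and the costs are multiplied by a common denominator. -/
def load : Prog :=
  .seq (setArr (1 + 1) 10 <| split 1 (fun _ Y Z => ((lt Y (read 0 0)).and (lt Z (read 0 1))).and
    (read 1 (Y * read 0 1 + Z))) 0) <|
  .seq (fold prodOp 1 0 6 fun Z _ => .cond (lt Z (read 0 1)) (read 3 Z) 1) <|
  .seq (fold prodOp 1 0 7 fun Y _ => .cond (lt Y (read 0 0)) (Y + 1) 1) <|
  setArr 1 11 fun Z => .cond (lt Z (read 0 1)) (read 2 Z * read 6 0 / read 3 Z) 0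

/-- The memory holds an instance whose costs are scaled by `D`. -/
structure InstMem (p : Params) (x : RatInstance) (D : ℝ) (M : Mem) : Prop where
  good : p.Good M
  m_le : x.m ≤ p.R / 8
  n_le : x.n ≤ p.R
  r_le : 3 ≤ p.r
  m_eq : M 0 0 = (x.m : ℤ)
  n_eq : M 0 1 = (x.n : ℤ)
  factor : M 7 0 = (x.m.factorial : ℤ)
  inc : ∀ y < p.R, ∀ z < p.R, M 10 (p.adr 1 y z) = ind (Inc x.toSetSystem y z)
  scale_pos : 0 < D
  cost : ∀ S : Fin x.n, (M 11 ((S : ℕ) : ℤ) : ℝ) = D * x.toSetSystem.cost S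
  cost_bound : ∀ z < p.R, 0 ≤ M 11 (z : ℤ) ∧ M 11 (z : ℤ) ≤ 2 ^ (x.size * (p.R + 1))
  cost_zero : ∀ z < p.R, x.n ≤ z → M 11 (z : ℤ) = 0

lemma InstMem.congr {x : RatInstance} {D : ℝ} {M M' : Mem} (h : InstMem p x D M)
    (hM : ∀ b < 12, M' b = M b) : InstMem p x D M' where
  good := h.good.congr (hM 5 (by norm_num))
  m_le := h.m_le
  n_le := h.n_le
  r_le := h.r_le
  m_eq := by rw [hM 0 (by norm_num)]; exact h.m_eq
  n_eq := by rw [hM 0 (by norm_num)]; exact h.n_eq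
  factor := by rw [hM 7 (by norm_num)]; exact h.factor
  inc := by rw [hM 10 (by norm_num)]; exact h.inc
  scale_pos := h.scale_pos
  cost := by rw [hM 11 (by norm_num)]; exact h.cost
  cost_bound := by rw [hM 11 (by norm_num)]; exact h.cost_bound
  cost_zero := by rw [hM 11 (by norm_num)]; exact h.cost_zero

open Classical in
lemma encode_inc (x : RatInstance) {y z : ℕ} (hz : z < x.n) :
    x.encode 1 ((y : ℤ) * x.n + z) = ind (Inc x.toSetSystem y z) := by
  rw [ind_eq_ite]
  unfold RatInstance.encode
  refine if_congr ?_ rfl rfl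
  constructor
  · rintro ⟨e, S, h, hS⟩
    have h' : y * x.n + z = e * x.n + S := by exact_mod_cast h
    have h1 : z = S := by
      have := congrArg (· % x.n) h'
      simpa [Nat.mul_add_mod', Nat.mod_eq_of_lt hz, Nat.mod_eq_of_lt S.2] using this
    have h2 : y = e := by
      subst h1
      exact Nat.eq_of_mul_eq_mul_right (by omega) (Nat.add_right_cancel h')
    exact ⟨e, S, h2.symm, h1.symm, Finset.mem_univ _, hS⟩
  · rintro ⟨e, S, rfl, rfl, -, hS⟩
    exact ⟨e, S, rfl, hS⟩

lemma encode_num (x : RatInstance) (S : Fin x.n) : x.encode 2 ((S : ℕ) : ℤ) = ((x.cost S).num : ℤ) := by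
  simp [RatInstance.encode]

lemma encode_den (x : RatInstance) (S : Fin x.n) : x.encode 3 ((S : ℕ) : ℤ) = ((x.cost S).den : ℤ) := by
  simp [RatInstance.encode]

lemma num_lt (x : RatInstance) (S : Fin x.n) : (x.cost S).num < 2 ^ x.size ∧
    (x.cost S).den < 2 ^ x.size := by
  have h1 : (x.cost S).num.size + (x.cost S).den.size ≤ x.size := by
    refine (Finset.single_le_sum (f := fun S => (x.cost S).num.size + (x.cost S).den.size)
      (fun _ _ => Nat.zero_le _) (Finset.mem_univ S)).trans ?_
    exact Nat.le_add_left _ _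
  exact ⟨Nat.size_le.1 (by omega), Nat.size_le.1 (by omega)⟩

/-- The costs become integers at the scale of the product of all denominators; there are at most R
denominators of at most `x.size` bits each. The factorial of m, the factor of the forward phase, is
another product. -/
lemma load_spec (hK : 2 ≤ p.K) {x : RatInstance} {M : Mem} (hg : p.Good M) (hm : x.m ≤ p.R / 8)
    (hn : x.n ≤ p.R) (hr : 3 ≤ p.r) (hM : ∀ b < 4, M b = x.encode b)
    (hW1 : x.size * (p.R + 1) < p.W) (hW2 : p.r * p.R < p.W) :
    ∃ M' D, p.Runs load M M' ∧ InstMem p x D M' := by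
  have hR1 : p.R ^ 1 = p.R := pow_one _
  have hmR : x.m ≤ p.R := hm.trans (Nat.div_le_self _ _)
  have m0 : M 0 0 = (x.m : ℤ) := by rw [hM 0 (by norm_num)]; simp [RatInstance.encode]
  have n0 : M 0 1 = (x.n : ℤ) := by rw [hM 0 (by norm_num)]; simp [RatInstance.encode]
  obtain ⟨M₁, h1, f1, q1⟩ := set2_ind_spec (p := p) (c := 1) (d := 1) (out := 10) (M := M)
    (body := fun Y Z => ((lt Y (read 0 0)).and (lt Z (read 0 1))).and
      (read 1 (Y * read 0 1 + Z))) hK hg (fun y z => Inc x.toSetSystem y z) (by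
      intro Y Z i y z hy hz hY hZ
      rw [eval_and, eval_and, eval_lt, eval_lt, eval_read, eval_read, eval_read, eval_add, eval_mul,
        eval_read, eval_zero, eval_one, hY, hZ, m0, n0, ind_mul_ind]
      by_cases hlt : (y : ℤ) < x.m ∧ (z : ℤ) < x.n
      · rw [ind_true hlt, one_mul, hM 1 (by norm_num), encode_inc x (by exact_mod_cast hlt.2)]
      · rw [ind_false hlt, zero_mul, ind_false]
        rintro ⟨e, S, rfl, rfl, -⟩
        exact hlt ⟨by exact_mod_cast e.2, by exact_mod_cast S.2⟩)
  have g1 := hg.congr (M' := M₁) (by simp [f1])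
  set den : ℕ → ℕ := fun z => if h : z < x.n then (x.cost ⟨z, h⟩).den else 1 with hden
  have hden1 : ∀ z, 1 ≤ den z ∧ den z ≤ 2 ^ x.size := fun z => by
    rw [hden]; dsimp only
    split_ifs with h
    · exact ⟨(x.cost ⟨z, h⟩).den_pos, (num_lt x ⟨z, h⟩).2.le⟩
    · exact ⟨le_rfl, Nat.one_le_two_pow⟩
  obtain ⟨M₂, h2, f2, q2⟩ := prod_spec (p := p) (a := 1) (d := 0) (out := 6) (M := M₁)
    (body := fun Z _ => .cond (lt Z (read 0 1)) (read 3 Z) 1) (by omega) g1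
    (fun z _ => (den z : ℤ)) (2 ^ x.size) (by
      intro Z Y i z y hz _ hZ _
      simp only [eval_cond, eval_lt, eval_read, eval_one, hZ, ne_eq, ind_eq_zero, not_not]
      rw [f1 _ (by norm_num) (by norm_num), f1 _ (by norm_num) (by norm_num), n0, hden]
      dsimp only
      split_ifs with h h' h'
      · rw [hM 3 (by norm_num), ← encode_den x ⟨z, h'⟩]
      · omega
      · omega
      · rfl) (one_le_pow₀ (by norm_num)) (fun z _ _ _ => by
        rw [Nat.abs_cast]; exact_mod_cast (hden1 z).2) (by
        rw [hR1, ← pow_mul]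
        exact pow_lt_pow_right₀ (by norm_num) (by rw [mul_add] at hW1; omega))
  have g2 := g1.congr (M' := M₂) (by simp [f2])
  have q2' : M₂ 6 0 = ((∏ z ∈ Finset.range p.R, den z : ℕ) : ℤ) := by
    have := q2 0 (by simp)
    rw [Nat.cast_zero, hR1] at this
    rw [this, Nat.cast_prod]
  set Dn := ∏ z ∈ Finset.range p.R, den z with hDn
  obtain ⟨M₃, h3, f3, q3⟩ := prod_spec (p := p) (a := 1) (d := 0) (out := 7) (M := M₂)
    (body := fun Y _ => .cond (lt Y (read 0 0)) (Y + 1) 1) (by omega) g2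
    (fun y _ => ((if y < x.m then y + 1 else 1 : ℕ) : ℤ)) p.R (by
      intro Y Z i y z hz _ hY _
      simp only [eval_cond, eval_lt, eval_read, eval_add, eval_one, hY, ne_eq, ind_eq_zero, not_not,
        eval_zero]
      rw [f2 _ (by norm_num) (by norm_num), f1 _ (by norm_num) (by norm_num), m0]
      push_cast
      simp only [Nat.cast_lt]) (by exact_mod_cast p.R_pos) (fun y hy _ _ => by
        rw [Nat.abs_cast]
        have := p.R_pos
        split_ifs
        · exact_mod_cast (by omega : y + 1 ≤ p.R)
        · exact_mod_cast (by omega : 1 ≤ p.R)) (by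
        rw [hR1, Params.R]
        push_cast
        rw [← pow_mul]
        exact pow_lt_pow_right₀ (by norm_num) hW2)
  have g3 := g2.congr (M' := M₃) (by simp [f3])
  have q3' : M₃ 7 0 = (x.m.factorial : ℤ) := by
    have := q3 0 (by simp)
    rw [Nat.cast_zero, hR1] at this
    rw [this, ← Nat.cast_prod, ← Finset.prod_range_add_one_eq_factorial,
      ← Finset.prod_subset (Finset.range_subset_range.2 hmR)]
    · congr 1
      exact Finset.prod_congr rfl fun y hy => if_pos (Finset.mem_range.1 hy)
    · intro y _ hy
      exact if_neg fun h => hy (Finset.mem_range.2 h)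
  have hDn1 : 1 ≤ Dn := Finset.one_le_prod' fun z _ => (hden1 z).1
  have hDnle : Dn ≤ 2 ^ (x.size * p.R) := by
    calc Dn ≤ ∏ _z ∈ Finset.range p.R, 2 ^ x.size := Finset.prod_le_prod' fun z _ => (hden1 z).2
      _ = _ := by rw [Finset.prod_const, Finset.card_range, pow_mul]
  set w : ℕ → ℕ := fun z => if h : z < x.n then (x.cost ⟨z, h⟩).num * Dn / (x.cost ⟨z, h⟩).den else 0
    with hw
  have hwle : ∀ z, w z ≤ 2 ^ (x.size * (p.R + 1)) := fun z => by
    rw [hw]; dsimp only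
    split_ifs with h
    · refine (Nat.div_le_self _ _).trans ?_
      rw [mul_add, mul_one, pow_add, mul_comm]
      exact Nat.mul_le_mul hDnle (num_lt x ⟨z, h⟩).1.le
    · exact Nat.zero_le _
  obtain ⟨M₄, h4, f4, q4⟩ := setArr_spec (p := p) (d := 1) (out := 11) (M := M₃)
    (v := fun Z => .cond (lt Z (read 0 1)) (read 2 Z * read 6 0 / read 3 Z) 0) (by omega) g3
    (fun z => (w z : ℤ)) (by
      intro Z i z hz hZ
      have e0 : M₃ 0 = M 0 := by simp (disch := omega) only [f3, f2, f1]
      have e2 : M₃ 2 = M 2 := by simp (disch := omega) only [f3, f2, f1]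
      have e3 : M₃ 3 = M 3 := by simp (disch := omega) only [f3, f2, f1]
      have e6 : M₃ 6 = M₂ 6 := by simp (disch := omega) only [f3]
      simp only [eval_cond, eval_lt, eval_read, eval_div, eval_mul, eval_one, eval_zero, hZ, ne_eq,
        ind_eq_zero, not_not]
      rw [e0, e2, e3, e6, n0, q2', hw, hM 2 (by norm_num), hM 3 (by norm_num)]
      dsimp only
      split_ifs with h h' h'
      · have a1 := encode_num x ⟨z, h'⟩
        have a2 := encode_den x ⟨z, h'⟩
        dsimp only at a1 a2
        rw [a1, a2]; norm_cast
      · omega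
      · omega
      · rfl) (fun z _ => by
        rw [Nat.abs_cast]
        refine lt_of_le_of_lt (b := ((2 ^ (x.size * (p.R + 1)) : ℕ) : ℤ)) ?_ ?_
        · exact_mod_cast hwle z
        · push_cast
          exact pow_lt_pow_right₀ (by norm_num) hW1)
  have g4 := g3.congr (M' := M₄) (by simp [f4])
  refine ⟨M₄, Dn, h1.seq (h2.seq (h3.seq h4)),
    { good := g4
      m_le := hm
      n_le := hn
      r_le := hr
      m_eq := by simp (disch := omega) only [f4, f3, f2, f1]; exact m0
      n_eq := by simp (disch := omega) only [f4, f3, f2, f1]; exact n0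
      factor := by simp (disch := omega) only [f4]; exact q3'
      inc := fun y hy z hz => by
        simp (disch := omega) only [f4, f3, f2]
        exact q1 y (hR1.symm ▸ hy) z (hR1.symm ▸ hz)
      scale_pos := by exact_mod_cast hDn1
      cost := fun S => ?_
      cost_bound := fun z hz => by
        rw [q4 z (hR1.symm ▸ hz)]
        exact ⟨Int.natCast_nonneg _, by exact_mod_cast hwle z⟩
      cost_zero := fun z hz hzn => by
        rw [q4 z (hR1.symm ▸ hz), hw]
        simp [not_lt.2 hzn] }⟩
  rw [q4 S (by rw [hR1]; exact S.2.trans_le hn), hw]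
  dsimp only
  rw [dif_pos S.2]
  -- The denominator is one of the factors of the product, so the integer division by it is exact.
  have hdvd : (x.cost S).den ∣ Dn := by
    have : den S ∣ Dn := Finset.dvd_prod_of_mem _ (Finset.mem_range.2 (S.2.trans_le hn))
    rw [hden] at this
    dsimp only at this
    rwa [dif_pos S.2] at this
  obtain ⟨c, hc⟩ := hdvd
  have hd0 : 0 < (x.cost S).den := (x.cost S).den_pos
  have hd0' : ((x.cost S).den : ℝ) ≠ 0 := by positivity
  rw [hc, show (x.cost S).num * ((x.cost S).den * c) = (x.cost S).den * ((x.cost S).num * c) by ring,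
    Nat.mul_div_cancel_left _ hd0]
  change _ = _ * ((x.cost S : ℚ≥0) : ℝ)
  have hcost : ((x.cost S : ℚ≥0) : ℝ) = (x.cost S).num / (x.cost S).den := by
    conv_lhs => rw [← NNRat.num_div_den (x.cost S)]
    push_cast; rfl
  rw [hcost]
  push_cast
  field_simp

end PRAM

namespace PRAM
variable {p : Params}
open PRAM.Expr SetSystem

/-! ### Preprocessing -/

/-- The threshold is computed (array `14`), and cheap sets are chosen (array `18`). -/
def chooseCheap : Prog :=
  .seq (fold maxOp 1 0 12 fun Z _ => read 11 Z) <|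
  .seq (fold minOp 1 1 13 fun Z Y => .cond (read2 10 1 Y Z) (read 11 Z) (read 12 0)) <|
  .seq (fold maxOp 1 0 14 fun Y _ => .cond (lt Y (read 0 0)) (read 13 Y) 0) <|
  .seq (setArr 1 15 fun Z => (lt Z (read 0 1)).and
    (not (lt (read 14 0) (read 11 Z * (read 0 0 + eq (read 0 0) 0))))) <|
  .seq (fold maxOp 1 1 16 fun Z Y => (read 15 Z).and (read2 10 1 Y Z)) <|
  .seq (fold minOp 1 1 17 fun Z Y => .cond ((read 15 Z).and (read2 10 1 Y Z)) Z (read 5 0)) <|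
  fold maxOp 1 1 18 fun Y Z => (read 16 Y).and (eq Z (read 17 Y))

/-- Division by m is cleared. For m = 0 the quotient is 0 by convention and so is the threshold;
replacing the factor 0 by 1 keeps the equivalence. -/
lemma mem_cheap_iff (x : RatInstance) (S : Fin x.n) : S ∈ x.toSetSystem.cheap ↔
    x.toSetSystem.cost S * (x.m + if x.m = 0 then 1 else 0 : ℕ) ≤ x.toSetSystem.threshold := by
  have hcard : x.toSetSystem.univ.card = x.m := Fintype.card_fin _
  rw [mem_cheap, hcard]
  have hS : S ∈ x.toSetSystem.fam := Finset.mem_univ S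
  by_cases hm : x.m = 0
  · have h0 : x.toSetSystem.threshold = 0 := by
      have : x.toSetSystem.univ = ∅ := Finset.card_eq_zero.1 (hcard.trans hm)
      simp [threshold, this]
    simp [hS, hm, h0]
  · have : (0 : ℝ) < x.m := by positivity
    rw [if_neg hm, add_zero, le_div_iff₀ this]
    simp [hS]

lemma cost_nonneg (x : RatInstance) : ∀ S ∈ x.toSetSystem.fam, 0 ≤ x.toSetSystem.cost S :=
  fun S _ => NNRat.cast_nonneg (x.cost S)

open Classical in
lemma chooseCheap_spec (hK : 2 ≤ p.K) {x : RatInstance} (hf : x.toSetSystem.Feasible) {D : ℝ}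
    {M : Mem} (h : InstMem p x D M) (hW : x.size * (p.R + 1) < p.W) :
    ∃ M' chosen, p.Runs chooseCheap M M' ∧ (∀ b < 12, M' b = M b) ∧
      (M' 14 0 : ℝ) = D * x.toSetSystem.threshold ∧
      (∀ z < p.R, M' 15 (z : ℤ) = ind (In x.toSetSystem.cheap z)) ∧
      (∀ y < p.R, M' 16 (y : ℤ) = ind (In (x.toSetSystem.covered x.toSetSystem.cheap) y)) ∧
      (∀ z < p.R, M' 18 (z : ℤ) = ind (In chosen z)) ∧ chosen ⊆ x.toSetSystem.cheap ∧
      x.toSetSystem.covered chosen = x.toSetSystem.covered x.toSetSystem.cheap ∧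
      chosen.card ≤ (x.toSetSystem.covered x.toSetSystem.cheap).card := by
  have hR1 : p.R ^ 1 = p.R := pow_one _
  set sys := x.toSetSystem with hsys
  have hm : x.m ≤ p.R := h.m_le.trans (Nat.div_le_self _ _)
  have hn := h.n_le
  have hbW : (2 : ℤ) ^ (x.size * (p.R + 1)) < 2 ^ p.W := pow_lt_pow_right₀ (by norm_num) hW
  have hwb : ∀ z < p.R, |M 11 (z : ℤ)| ≤ 2 ^ (x.size * (p.R + 1)) := fun z hz => by
    rw [abs_of_nonneg (h.cost_bound z hz).1]; exact (h.cost_bound z hz).2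
  have hRW := p.R_lt_word (by omega)
  obtain ⟨M₁, h1, f1, q1⟩ := max_spec (p := p) (a := 1) (d := 0) (out := 12) (M := M)
    (body := fun Z _ => read 11 Z) (by omega) h.good (fun z _ => M 11 (z : ℤ)) _ (by
      intro Z Y i z y hz _ hZ _
      rw [eval_read, hZ]) (fun z hz _ _ => hwb z (hR1 ▸ hz)) hbW
  obtain ⟨hbig, z₀, hz₀, hbig₀⟩ := q1 0 (by simp)
  rw [Nat.cast_zero] at hbig hbig₀
  rw [hR1] at hbig hz₀
  have g1 := h.good.congr (M' := M₁) (by simp [f1])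
  obtain ⟨M₂, h2, f2, q2⟩ := min_spec (p := p) (a := 1) (d := 1) (out := 13) (M := M₁)
    (body := fun Z Y => .cond (read2 10 1 Y Z) (read 11 Z) (read 12 0)) (by omega) g1
    (fun z y => if Inc sys y z then M 11 (z : ℤ) else M₁ 12 0) (2 ^ (x.size * (p.R + 1))) (by
      intro Z Y i z y hz hy hZ hY
      rw [hR1] at hz hy
      rw [eval_cond, eval_read2 g1 hY hZ, eval_read, eval_read, hZ, eval_zero,
        f1 10 (by norm_num) (by norm_num), f1 11 (by norm_num) (by norm_num), h.inc y hy z hz]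
      simp only [ne_eq, ind_eq_zero, not_not]; rfl) (fun z hz y _ => by
        split_ifs
        · exact hwb z (hR1 ▸ hz)
        · rw [← hbig₀]; exact hwb z₀ hz₀) hbW
  have g2 := g1.congr (M' := M₂) (by simp [f2])
  -- Sets not containing e count with the largest cost of all, which never beats the cheapest set
  -- through e.
  have hmn : ∀ e : Fin x.m, (M₂ 13 ((e : ℕ) : ℤ) : ℝ) = D * sys.minCost e := by
    intro e
    obtain ⟨hle, z, hz, hval⟩ := q2 e (by rw [hR1]; exact e.2.trans_le hm)
    obtain ⟨S₀, hS₀, heS₀, hmin⟩ := exists_minCost hf (e := e) (Finset.mem_univ e)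
    have e1 : M₂ 13 ((e : ℕ) : ℤ) ≤ M 11 ((S₀ : ℕ) : ℤ) := by
      have := hle S₀ (by rw [hR1]; exact S₀.2.trans_le hn)
      rwa [if_pos (inc_val.2 ⟨hS₀, heS₀⟩)] at this
    have e2 : (M 11 ((S₀ : ℕ) : ℤ) : ℝ) = D * sys.minCost e := by rw [h.cost S₀, hmin]
    refine le_antisymm (e2 ▸ Int.cast_le.2 e1) ?_
    rw [← hval]
    split_ifs with hc
    · obtain ⟨e', S, he', rfl, hS, heS⟩ := hc
      rw [Fin.ext he'] at heS
      rw [h.cost S]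
      exact mul_le_mul_of_nonneg_left (minCost_le hS heS) h.scale_pos.le
    · rw [← e2]
      exact Int.cast_le.2 (hbig S₀ (S₀.2.trans_le hn))
  have hmnb : ∀ y < p.R, |M₂ 13 (y : ℤ)| ≤ 2 ^ (x.size * (p.R + 1)) := fun y hy => by
    obtain ⟨-, z, hz, hval⟩ := q2 y (hR1.symm ▸ hy)
    rw [← hval]
    split_ifs
    · exact hwb z (hR1 ▸ hz)
    · rw [← hbig₀]; exact hwb z₀ hz₀
  obtain ⟨M₃, h3, f3, q3⟩ := max_spec (p := p) (a := 1) (d := 0) (out := 14) (M := M₂)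
    (body := fun Y _ => .cond (lt Y (read 0 0)) (read 13 Y) 0) (by omega) g2
    (fun y _ => if y < x.m then M₂ 13 (y : ℤ) else 0) (2 ^ (x.size * (p.R + 1))) (by
      intro Y Z i y z hy _ hY _
      simp only [eval_cond, eval_lt, eval_read, hY, eval_zero, ne_eq, ind_eq_zero, not_not]
      rw [f2 0 (by norm_num) (by norm_num), f1 0 (by norm_num) (by norm_num), h.m_eq]
      simp only [Nat.cast_lt]) (fun y hy _ _ => by
        split_ifs
        · exact hmnb y (hR1 ▸ hy)
        · simp) hbW
  have g3 := g2.congr (M' := M₃) (by simp [f3])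
  have hthr : (M₃ 14 0 : ℝ) = D * sys.threshold := by
    obtain ⟨hge, y, hy, hval⟩ := q3 0 (by simp)
    rw [Nat.cast_zero] at hge hval
    apply le_antisymm
    · rw [← hval]
      split_ifs with hlt
      · have := hmn ⟨y, hlt⟩
        dsimp only at this
        rw [this]
        exact mul_le_mul_of_nonneg_left (minCost_le_threshold (Finset.mem_univ _)) h.scale_pos.le
      · push_cast
        exact mul_nonneg h.scale_pos.le (threshold_nonneg (cost_nonneg x))
    · by_cases hne : sys.univ.Nonempty
      · obtain ⟨e, -, he⟩ := exists_threshold hne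
        rw [he, ← hmn e]
        have := hge e (by rw [hR1]; exact e.2.trans_le hm)
        rw [if_pos e.2] at this
        exact Int.cast_le.2 this
      · have h0 : sys.threshold = 0 := by
          simp [threshold, Finset.not_nonempty_iff_eq_empty.1 hne]
        have := hge y hy
        have hy0 : ¬ y < x.m := fun h' => hne ⟨⟨y, h'⟩, Finset.mem_univ _⟩
        rw [if_neg hy0] at this
        rw [h0, mul_zero]
        exact_mod_cast this
  obtain ⟨M₄, h4, f4, q4⟩ := setArr_ind_spec (p := p) (d := 1) (out := 15) (M := M₃)
    (v := fun Z => (lt Z (read 0 1)).and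
      (not (lt (read 14 0) (read 11 Z * (read 0 0 + eq (read 0 0) 0))))) (by omega) g3
    (fun z => In sys.cheap z) (by
      intro Z i z hz hZ
      have e0 : M₃ 0 = M 0 := by simp (disch := omega) only [f3, f2, f1]
      have e11 : M₃ 11 = M 11 := by simp (disch := omega) only [f3, f2, f1]
      simp only [eval_and, eval_lt, eval_read, eval_not, eval_mul, eval_add, eval_eq, eval_one,
        eval_zero, hZ]
      rw [e0, e11, h.m_eq, h.n_eq, one_sub_ind, ind_mul_ind]
      refine ind_congr ?_
      rw [in_iff, not_lt, Nat.cast_lt]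
      have key : ∀ hz : z < x.n, M 11 (z : ℤ) * ((x.m : ℤ) + ind ((x.m : ℤ) = 0)) ≤ M₃ 14 0 ↔
          (⟨z, hz⟩ : Fin x.n) ∈ sys.cheap := by
        intro hz
        rw [mem_cheap_iff, ← Int.cast_le (R := ℝ), hthr, Int.cast_mul]
        have := h.cost ⟨z, hz⟩
        dsimp only at this
        rw [this, mul_assoc, mul_le_mul_iff_right₀ h.scale_pos]
        have e2 : (((x.m : ℤ) + ind ((x.m : ℤ) = 0) : ℤ) : ℝ) =
            ((x.m + if x.m = 0 then 1 else 0 : ℕ) : ℝ) := by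
          by_cases h0 : x.m = 0
          · rw [ind_true (by exact_mod_cast h0), if_pos h0]; push_cast; ring
          · rw [ind_false (by exact_mod_cast h0), if_neg h0]; push_cast; ring
        rw [e2]
      exact ⟨fun ⟨h1, h2⟩ => ⟨h1, (key h1).1 h2⟩, fun ⟨h1, h2⟩ => ⟨h1, (key h1).2 h2⟩⟩)
  have g4 := g3.congr (M' := M₄) (by simp [f4])
  have e410 : M₄ 10 = M 10 := by simp (disch := omega) only [f4, f3, f2, f1]
  have hch : sys.cheap ⊆ sys.fam := Finset.filter_subset _ _
  obtain ⟨M₅, h5, f5, q5⟩ := any_spec (p := p) (a := 1) (d := 1) (out := 16) (M := M₄)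
    (body := fun Z Y => (read 15 Z).and (read2 10 1 Y Z)) (by omega) g4
    (fun z y => In sys.cheap z ∧ Inc sys y z) (by
      intro Z Y i z y hz hy hZ hY
      rw [eval_and, eval_read, hZ, eval_read2 g4 hY hZ, q4 z hz, e410,
        h.inc y (hR1 ▸ hy) z (hR1 ▸ hz), ind_mul_ind])
  have g5 := g4.congr (M' := M₅) (by simp [f5])
  have q5' : ∀ y < p.R, M₅ 16 (y : ℤ) = ind (In (sys.covered sys.cheap) y) := fun y hy => by
    rw [q5 y (hR1.symm ▸ hy), hR1]
    exact ind_congr (exists_in_inc hn hch)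
  obtain ⟨M₆, h6, f6, q6⟩ := min_spec (p := p) (a := 1) (d := 1) (out := 17) (M := M₅)
    (body := fun Z Y => .cond ((read 15 Z).and (read2 10 1 Y Z)) Z (read 5 0)) (by omega) g5
    (fun z y => if In sys.cheap z ∧ Inc sys y z then (z : ℤ) else (p.R : ℤ)) p.R (by
      intro Z Y i z y hz hy hZ hY
      rw [eval_cond, eval_and, eval_read, eval_read, hZ, eval_zero, g5.1, eval_read2 g5 hY hZ,
        f5 15 (by norm_num) (by norm_num), f5 10 (by norm_num) (by norm_num), q4 z hz, e410,
        h.inc y (hR1 ▸ hy) z (hR1 ▸ hz), ind_mul_ind]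
      simp only [ne_eq, ind_eq_zero, not_not]; rfl) (fun z hz y _ => by
        rw [hR1] at hz
        split_ifs
        · rw [Nat.abs_cast]; exact_mod_cast hz.le
        · rw [Nat.abs_cast]) hRW
  have g6 := g5.congr (M' := M₆) (by simp [f6])
  have hfst : ∀ e ∈ sys.covered sys.cheap, ∃ S ∈ sys.cheap, e ∈ sys.set S ∧
      M₆ 17 ((e : ℕ) : ℤ) = ((S : ℕ) : ℤ) := by
    intro e he
    obtain ⟨hle, z, hz, hval⟩ := q6 e (by rw [hR1]; exact e.2.trans_le hm)
    obtain ⟨S₀, hS₀, heS₀⟩ := mem_covered.1 he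
    have h1 := hle S₀ (by rw [hR1]; exact S₀.2.trans_le hn)
    rw [if_pos ⟨in_val.2 hS₀, inc_val.2 ⟨hch hS₀, heS₀⟩⟩, ← hval] at h1
    split_ifs at h1 hval with hc
    · obtain ⟨⟨S, hS, rfl⟩, hinc⟩ := hc
      exact ⟨S, hS, (inc_val.1 hinc).2, hval.symm⟩
    · have := S₀.2
      omega
  obtain ⟨M₇, h7, f7, q7⟩ := any_spec (p := p) (a := 1) (d := 1) (out := 18) (M := M₆)
    (body := fun Y Z => (read 16 Y).and (eq Z (read 17 Y))) (by omega) g6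
    (fun y z => In (sys.covered sys.cheap) y ∧ (z : ℤ) = M₆ 17 (y : ℤ)) (by
      intro Y Z i y z hy hz hY hZ
      rw [eval_and, eval_eq, eval_read, eval_read, hY, hZ, f6 16 (by norm_num) (by norm_num),
        q5' y (hR1 ▸ hy), ind_mul_ind])
  set chosen : Finset (Fin x.n) := Finset.univ.filter fun S =>
    ∃ e ∈ sys.covered sys.cheap, ((S : ℕ) : ℤ) = M₆ 17 ((e : ℕ) : ℤ) with hchosen
  have hsub : chosen ⊆ sys.cheap := fun S hS => by
    obtain ⟨e, he, hSe⟩ := (Finset.mem_filter.1 hS).2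
    obtain ⟨S', hS', -, h'⟩ := hfst e he
    have : S = S' := Fin.ext (by rw [h'] at hSe; exact_mod_cast hSe)
    rwa [this]
  have hrun : p.Runs chooseCheap M M₇ := h1.seq (h2.seq (h3.seq (h4.seq (h5.seq (h6.seq h7)))))
  refine ⟨M₇, chosen, hrun, fun b hb => hrun.frame_lt (k := 12) rfl hb, ?_, fun z hz => ?_,
    fun y hy => ?_, fun z hz => ?_, hsub, (covered_mono hsub).antisymm fun e he => ?_, ?_⟩
  · simp (disch := omega) only [f7, f6, f5, f4]; exact hthr
  · simp (disch := omega) only [f7, f6, f5]; exact q4 z (hR1.symm ▸ hz)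
  · simp (disch := omega) only [f7, f6]; exact q5' y hy
  · rw [q7 z (hR1.symm ▸ hz), hR1, exists_in hm]
    refine ind_congr ⟨fun ⟨e, he, hz'⟩ => ?_, ?_⟩
    · obtain ⟨S, -, -, h'⟩ := hfst e he
      exact ⟨S, Finset.mem_filter.2 ⟨Finset.mem_univ _, e, he, h'.symm⟩,
        by rw [h'] at hz'; exact_mod_cast hz'.symm⟩
    · rintro ⟨S, hS, rfl⟩
      exact (Finset.mem_filter.1 hS).2
  · obtain ⟨S, hS, heS, h'⟩ := hfst e he
    exact mem_covered.2 ⟨S, Finset.mem_filter.2 ⟨Finset.mem_univ _, e, he, h'.symm⟩, heS⟩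
  -- Every chosen set is the first cheap set through some element, so there are at most as many
  -- chosen sets as elements in cheap sets.
  · rw [← Finset.card_map Fin.valEmbedding]
    refine (Finset.card_le_card (t := (sys.covered sys.cheap).image
      fun e : Fin x.m => (M₆ 17 ((e : ℕ) : ℤ)).toNat) ?_).trans Finset.card_image_le
    intro z hz
    obtain ⟨S, hS, rfl⟩ := Finset.mem_map.1 hz
    obtain ⟨e, he, hSe⟩ := (Finset.mem_filter.1 hS).2
    exact Finset.mem_image.2 ⟨e, he, by rw [← hSe]; rfl⟩

/-- The reduced system and a prime number are computed. -/
def reduce : Prog :=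
  .seq (setArr 1 19 fun Y => (lt Y (read 0 0)).and (not (read 16 Y))) <|
  .seq (setArr 1 20 fun Z => ((lt Z (read 0 1)).and (not (read 15 Z))).and
    (not (lt (read 0 0 * read 14 0) (read 11 Z)))) <|
  .seq (setArr (1 + 1) 21 <| split 1 (fun _ Y Z => (read2 10 1 Y Z).and
    ((read 19 Y).and (read 20 Z))) 0) <|
  .seq (setArr 1 23 fun Z => read 20 Z * read 11 Z) <|
  .seq (fold maxOp 1 1 71 fun X Y => (lt 1 X).and ((lt X Y).and (eq (Y % X) 0))) <|
  fold minOp 1 0 22 fun Y _ => .cond ((lt (read 5 0 / 2) Y).and (not (read 71 Y))) Y (read 5 0)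

open Classical in
lemma reduce_spec (hK : 2 ≤ p.K) {x : RatInstance} {D : ℝ}
    {M : Mem} (h : InstMem p x D M) (hW : x.size * (p.R + 1) < p.W)
    (h14 : (M 14 0 : ℝ) = D * x.toSetSystem.threshold)
    (h15 : ∀ z < p.R, M 15 (z : ℤ) = ind (In x.toSetSystem.cheap z))
    (h16 : ∀ y < p.R, M 16 (y : ℤ) = ind (In (x.toSetSystem.covered x.toSetSystem.cheap) y)) :
    ∃ M', p.Runs reduce M M' ∧ (∀ b < 19, M' b = M b) ∧ SysMem p x.toSetSystem.reduced M' ∧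
      (∀ S ∈ x.toSetSystem.reduced.fam, (M' 23 ((S : ℕ) : ℤ) : ℝ) =
        D * x.toSetSystem.reduced.cost S) ∧
      ∀ z < p.R, 0 ≤ M' 23 (z : ℤ) ∧ M' 23 (z : ℤ) ≤ 2 ^ (x.size * (p.R + 1)) := by
  have hR1 : p.R ^ 1 = p.R := pow_one _
  set sys := x.toSetSystem with hsys
  have hm : x.m ≤ p.R := h.m_le.trans (Nat.div_le_self _ _)
  have hn := h.n_le
  have hbW : (2 : ℤ) ^ (x.size * (p.R + 1)) < 2 ^ p.W := pow_lt_pow_right₀ (by norm_num) hW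
  have hRW := p.R_lt_word (by omega)
  obtain ⟨M₁, h1, f1, q1⟩ := setArr_ind_spec (p := p) (d := 1) (out := 19) (M := M)
    (v := fun Y => (lt Y (read 0 0)).and (not (read 16 Y))) (by omega) h.good
    (fun y => In sys.reduced.univ y) (by
      intro Y i y hy hY
      rw [eval_and, eval_lt, eval_not, eval_read, eval_read, hY, eval_zero, h.m_eq,
        h16 y (hR1 ▸ hy), one_sub_ind, ind_mul_ind]
      refine ind_congr ?_
      change _ ↔ In (sys.univ \ _) y
      rw [in_sdiff]
      refine and_congr ?_ Iff.rfl
      rw [in_iff, Nat.cast_lt]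
      exact ⟨fun h' => ⟨h', Finset.mem_univ _⟩, fun h' => h'.1⟩)
  have g1 := h.good.congr (M' := M₁) (by simp [f1])
  have hcard : sys.univ.card = x.m := Fintype.card_fin _
  obtain ⟨M₂, h2, f2, q2⟩ := setArr_ind_spec (p := p) (d := 1) (out := 20) (M := M₁)
    (v := fun Z => ((lt Z (read 0 1)).and (not (read 15 Z))).and
      (not (lt (read 0 0 * read 14 0) (read 11 Z)))) (by omega) g1
    (fun z => In sys.reduced.fam z) (by
      intro Z i z hz hZ
      simp only [eval_and, eval_lt, eval_not, eval_read, eval_mul, hZ, eval_zero, eval_one]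
      rw [f1 0 (by norm_num) (by norm_num), f1 11 (by norm_num) (by norm_num),
        f1 14 (by norm_num) (by norm_num), f1 15 (by norm_num) (by norm_num), h.m_eq, h.n_eq,
        h15 z (hR1 ▸ hz), one_sub_ind, one_sub_ind, ind_mul_ind, ind_mul_ind, not_lt, Nat.cast_lt]
      refine ind_congr ?_
      rw [in_iff, in_iff]
      have key : ∀ hz : z < x.n, M 11 (z : ℤ) ≤ (x.m : ℤ) * M 14 0 ↔
          sys.cost ⟨z, hz⟩ ≤ (sys.univ.card : ℝ) * sys.threshold := by
        intro hz
        have := h.cost ⟨z, hz⟩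
        dsimp only at this
        rw [← Int.cast_le (R := ℝ), this, Int.cast_mul, h14, hcard, mul_left_comm,
          mul_le_mul_iff_right₀ h.scale_pos]
        push_cast; rfl
      have hred : ∀ S, S ∈ sys.reduced.fam ↔ S ∉ sys.cheap ∧
          sys.cost S ≤ (sys.univ.card : ℝ) * sys.threshold := fun S => by
        rw [SetSystem.reduced, Finset.mem_filter, Finset.mem_sdiff]
        have : S ∈ sys.fam := Finset.mem_univ S
        tauto
      simp only [hred]
      constructor
      · rintro ⟨⟨h1, h2⟩, h3⟩
        exact ⟨h1, fun h' => h2 ⟨h1, h'⟩, (key h1).1 h3⟩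
      · rintro ⟨h1, h2, h3⟩
        exact ⟨⟨h1, fun h' => h2 h'.2⟩, (key h1).2 h3⟩)
  have g2 := g1.congr (M' := M₂) (by simp [f2])
  obtain ⟨M₃, h3, f3, q3⟩ := set2_ind_spec (p := p) (c := 1) (d := 1) (out := 21) (M := M₂)
    (body := fun Y Z => (read2 10 1 Y Z).and ((read 19 Y).and (read 20 Z))) hK g2
    (fun y z => Inc sys.reduced y z) (by
      intro Y Z i y z hy hz hY hZ
      have e10 : M₂ 10 = M 10 := by simp (disch := omega) only [f2, f1]
      rw [eval_and, eval_and, eval_read2 g2 hY hZ, eval_read, eval_read, hY, hZ, e10,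
        h.inc y (hR1 ▸ hy) z (hR1 ▸ hz), f2 19 (by norm_num) (by norm_num), q1 y hy, q2 z hz,
        ind_mul_ind, ind_mul_ind]
      refine ind_congr ⟨?_, ?_⟩
      · rintro ⟨⟨e, S, rfl, rfl, -, he⟩, h1, h2⟩
        exact inc_val.2 ⟨in_val.1 h2, Finset.mem_inter.2 ⟨he, in_val.1 h1⟩⟩
      · rintro ⟨e, S, rfl, rfl, hS, he⟩
        obtain ⟨h1, h2⟩ := Finset.mem_inter.1 he
        exact ⟨inc_val.2 ⟨Finset.mem_univ _, h1⟩, in_val.2 h2, in_val.2 hS⟩)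
  have g3 := g2.congr (M' := M₃) (by simp [f3])
  have hw : ∀ z < p.R, 0 ≤ ind (In sys.reduced.fam z) * M 11 (z : ℤ) ∧
      ind (In sys.reduced.fam z) * M 11 (z : ℤ) ≤ 2 ^ (x.size * (p.R + 1)) := fun z hz => by
    by_cases hin : In sys.reduced.fam z
    · rw [ind_true hin, one_mul]; exact h.cost_bound z hz
    · rw [ind_false hin, zero_mul]; exact ⟨le_rfl, by positivity⟩
  obtain ⟨M₄, h4, f4, q4⟩ := setArr_spec (p := p) (d := 1) (out := 23) (M := M₃)
    (v := fun Z => read 20 Z * read 11 Z) (by omega) g3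
    (fun z => ind (In sys.reduced.fam z) * M 11 (z : ℤ)) (by
      intro Z i z hz hZ
      have e11 : M₃ 11 = M 11 := by simp (disch := omega) only [f3, f2, f1]
      rw [eval_mul, eval_read, eval_read, hZ, e11, f3 20 (by norm_num) (by norm_num), q2 z hz])
    (fun z hz => by
      rw [abs_of_nonneg (hw z (hR1 ▸ hz)).1]; exact (hw z (hR1 ▸ hz)).2.trans_lt hbW)
  have g4 := g3.congr (M' := M₄) (by simp [f4])
  obtain ⟨M₅, h5, f5, q5⟩ := any_spec (p := p) (a := 1) (d := 1) (out := 71) (M := M₄)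
    (body := fun X Y => (lt 1 X).and ((lt X Y).and (eq (Y % X) 0))) (by omega) g4
    (fun a y => 1 < a ∧ a < y ∧ a ∣ y) (by
      intro X Y i a y ha hy hX hY
      rw [eval_and, eval_and, eval_lt, eval_lt, eval_eq, eval_mod, hX, hY, eval_zero, eval_one,
        ind_mul_ind, ind_mul_ind]
      refine ind_congr (and_congr (by norm_cast) (and_congr (by norm_cast) ?_))
      rw [← Int.dvd_iff_emod_eq_zero, Int.natCast_dvd_natCast])
  have g5 := g4.congr (M' := M₅) (by simp [f5])
  have hR8 : 8 ∣ p.R := by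
    rw [Params.R, show (8 : ℕ) = 2 ^ 3 by norm_num]; exact pow_dvd_pow 2 h.r_le
  have hRpos := p.R_pos
  have q5' : ∀ y < p.R, p.R / 2 < y → (M₅ 71 (y : ℤ) = ind (¬ y.Prime)) := fun y hy hy2 => by
    rw [q5 y (hR1.symm ▸ hy), hR1]
    refine ind_congr ?_
    rw [Nat.prime_def_lt']
    push Not
    constructor
    · rintro ⟨a, -, h1, h2, h3⟩
      exact fun _ => ⟨a, h1, h2, h3⟩
    · intro h'
      obtain ⟨a, h1, h2, h3⟩ := h' (by omega)
      exact ⟨a, by omega, h1, h2, h3⟩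
  obtain ⟨M₆, h6, f6, q6⟩ := min_spec (p := p) (a := 1) (d := 0) (out := 22) (M := M₅)
    (body := fun Y _ => .cond ((lt (read 5 0 / 2) Y).and (not (read 71 Y))) Y (read 5 0))
    (by omega) g5 (fun y _ => if p.R / 2 < y ∧ y.Prime then (y : ℤ) else (p.R : ℤ)) p.R (by
      intro Y Z i y z hy _ hY _
      rw [eval_cond, eval_and, eval_lt, eval_not, eval_div, eval_read, eval_read, hY, eval_zero,
        eval_two, g5.1]
      have hlt : ((p.R : ℤ) / 2 < (y : ℤ)) ↔ p.R / 2 < y := by norm_cast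
      by_cases hc : p.R / 2 < y
      · rw [q5' y (hR1 ▸ hy) hc, one_sub_ind, ind_mul_ind]
        simp only [ne_eq, ind_eq_zero, not_not, hlt]
      · rw [ind_false (fun h' => hc (hlt.1 h')), zero_mul]
        simp [hc]) (fun y hy _ _ => by
        rw [hR1] at hy
        split_ifs
        · rw [Nat.abs_cast]; exact_mod_cast hy.le
        · rw [Nat.abs_cast]) hRW
  have hrun : p.Runs reduce M M₆ := h1.seq (h2.seq (h3.seq (h4.seq (h5.seq h6))))
  have hfr : ∀ b < 19, M₆ b = M b := fun b hb => hrun.frame_lt (k := 19) rfl hb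
  have q4' : ∀ z < p.R, M₆ 23 (z : ℤ) = ind (In sys.reduced.fam z) * M 11 (z : ℤ) := fun z hz => by
    rw [f6 _ (by norm_num) (by norm_num), f5 _ (by norm_num) (by norm_num), q4 z (hR1.symm ▸ hz)]
  refine ⟨M₆, hrun, hfr,
    { good := h.good.congr (hfr 5 (by norm_num))
      m_le := h.m_le
      n_le := hn
      r_le := h.r_le
      el := fun y hy => by
        simp (disch := omega) only [f6, f5, f4, f3, f2]; exact q1 y (hR1.symm ▸ hy)
      fam := fun z hz => by
        simp (disch := omega) only [f6, f5, f4, f3]; exact q2 z (hR1.symm ▸ hz)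
      inc := fun y hy z hz => by
        simp (disch := omega) only [f6, f5, f4]
        exact q3 y (hR1.symm ▸ hy) z (hR1.symm ▸ hz)
      prime := ?_ }, fun S hS => ?_, fun z hz => by rw [q4' z hz]; exact hw z hz⟩
  · obtain ⟨hmin, y, hy, hval⟩ := q6 0 (by simp)
    rw [Nat.cast_zero] at hmin hval
    -- Bertrand's postulate gives a prime above R/2 and at most R. It is not R, which is divisible
    -- by 8.
    obtain ⟨q, hq, hq1, hq2⟩ := Nat.exists_prime_lt_and_le_two_mul (p.R / 2) (by omega)
    have hqR : q < p.R := by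
      refine lt_of_le_of_ne (by omega) fun h' => ?_
      have h8 : 8 ∣ q := h' ▸ hR8
      have := (Nat.prime_dvd_prime_iff_eq Nat.prime_two hq).1 ((by norm_num : 2 ∣ 8).trans h8)
      omega
    have h7 := hmin q (hR1.symm ▸ hqR)
    rw [if_pos ⟨hq1, hq⟩, ← hval] at h7
    split_ifs at h7 hval with hc
    · exact ⟨y, hc.2, hval.symm, hc.1, hR1 ▸ hy⟩
    · omega
  · rw [q4' S (S.2.trans_le hn), ind_true (in_val.2 hS), one_mul, h.cost S]; rfl

end PRAM

namespace PRAM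
variable {p : Params}
open PRAM.Expr SetSystem

/-! ### The whole algorithm -/

/-- The whole algorithm. -/
def algorithm (τ : ℕ) : Prog :=
  .seq (setResources (τ + 4)) <|
  .seq load <|
  .seq chooseCheap <|
  .seq reduce <|
  .seq (layers τ) <|
  .seq forward <|
  .seq (reverse τ) <|
  setArr 1 4 fun Z => not ((not (read 18 Z)).and (not (read 46 Z)))

/-- The costs of the reduced system are within polynomial factors, so that the epochs are short. -/
lemma iterations_le_reduced {x : RatInstance} {τ : ℕ} (hf : x.toSetSystem.Feasible)
    {σ : ℕ → FwdState (Fin x.m) (Fin x.n)} {t : ℕ → ℕ} (h : x.toSetSystem.reduced.ForwardRun τ σ t)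
    {r : ℕ} (hm : 8 * x.m ≤ 2 ^ r) {k : ℕ} (hk : k < x.toSetSystem.reduced.decompLength τ) :
    t k ≤ 3 * r := by
  have hc := cost_nonneg x
  set sys := x.toSetSystem with hsys
  have hcard : sys.univ.card = x.m := Fintype.card_fin _
  obtain ⟨e, he⟩ : sys.reduced.univ.Nonempty :=
    (remaining_nonempty_of_lt (Nat.zero_lt_of_lt hk)).mono (remaining_subset_univ τ 0)
  obtain ⟨S, hS, -⟩ := hf.reduced hc e he
  have hm1 : 0 < x.m := Fin.pos e
  have hm1' : (0 : ℝ) < x.m := by exact_mod_cast hm1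
  -- With β = 0 no cost could be above β/m and at most mβ, but the reduced system has a set.
  have hth : 0 < sys.threshold := by
    obtain ⟨-, h1, h2⟩ := mem_reduced_fam.1 hS
    have h3 := h1.trans_le h2
    rw [hcard, div_lt_iff₀ hm1'] at h3
    by_contra h0
    have h4 : sys.threshold = 0 := le_antisymm (not_lt.1 h0) (threshold_nonneg hc)
    simp [h4] at h3
  have hcard' : (sys.univ.card : ℝ) = x.m := by exact_mod_cast hcard
  have h1 := h.pow_mul_le (hf.reduced hc) (lo := sys.threshold / sys.univ.card)
    (hi := sys.univ.card * sys.threshold) (by rw [hcard']; positivity)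
    (fun S hS => (mem_reduced_fam.1 hS).2.1.le) (fun S hS => (mem_reduced_fam.1 hS).2.2) hk
  have h2 : (sys.reduced.univ.card : ℝ) ≤ sys.univ.card := by
    exact_mod_cast Finset.card_le_card Finset.sdiff_subset
  rw [hcard'] at h1 h2
  have h3 : (7 : ℝ) ^ t k ≤ 8 * x.m ^ 3 := by
    have : 7 ^ t k * (sys.threshold / x.m) ≤ 8 * x.m * (x.m * sys.threshold) :=
      h1.trans (by gcongr)
    rw [← mul_div_assoc, div_le_iff₀ hm1'] at this
    exact le_of_mul_le_mul_right (by linarith) hth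
  have h4 : 7 ^ t k ≤ 8 * x.m ^ 3 := by exact_mod_cast h3
  -- Cubing 8m ≤ 2^r bounds 8m³, and thus 7^t, by 2^(3r).
  have h5 : 8 * x.m ^ 3 ≤ 2 ^ (3 * r) := by
    have : (8 * x.m) ^ 3 ≤ (2 ^ r) ^ 3 := Nat.pow_le_pow_left hm 3
    rw [← pow_mul, mul_comm r, mul_pow] at this
    omega
  exact (Nat.pow_le_pow_iff_right (by norm_num)).1
    (((Nat.pow_le_pow_left (by norm_num : 2 ≤ 7) _).trans h4).trans h5)

/-- The two bounds on loops provide for the rounds of the independent set computation and for the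
number of layers. The word length allows for the initial costs and for the factor m! of every
forward iteration. -/
lemma algorithm_spec {x : RatInstance} {τ : ℕ} (hs : x.toSetSystem.IsSNC τ)
    (hf : x.toSetSystem.Feasible) (hr : p.r = max 3 (8 * (x.m + x.n)).size) (hK : p.K = τ + 4)
    (hB : 23 * p.r ≤ p.B) (hL : x.toSetSystem.decompLength τ ≤ p.B)
    (hW : p.r + x.size * (p.R + 1) + 3 * (p.r * p.R) ^ 2 < p.W) :
    ∃ M', p.Runs (algorithm τ) x.encode M' ∧
      ∃ σ t s, x.toSetSystem.AlgorithmRun τ σ t s (x.decode M') := by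
  have hR1 : p.R ^ 1 = p.R := pow_one _
  have hc := cost_nonneg x
  have hR : 8 * (x.m + x.n) < p.R := Nat.size_le.1 (hr ▸ le_max_right _ _)
  have hr3 : 3 ≤ p.r := hr ▸ le_max_left _ _
  have hrR : 1 ≤ p.r * p.R := Nat.mul_pos (by omega) p.R_pos
  have hrR2 : p.r * p.R ≤ (p.r * p.R) ^ 2 := Nat.le_self_pow (by norm_num) _
  obtain ⟨M₁, h1, g1, f1⟩ := hK ▸ setResources_spec (p := p) (M := x.encode) (s := 8 * (x.m + x.n))
    (by simp [RatInstance.encode]) hr (by omega)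
  obtain ⟨M₂, D, h2, i2⟩ := load_spec (p := p) (x := x) (M := M₁) (by omega) g1 (by omega) (by omega)
    hr3 (fun b hb => f1 b (by omega)) (by omega) (by omega)
  obtain ⟨M₃, chosen, h3, f3, q14, q15, q16, q18, c1, c2, c3⟩ :=
    chooseCheap_spec (by omega) hf i2 (by omega)
  obtain ⟨M₄, h4, f4, s4, q23, b23⟩ := reduce_spec (by omega) (i2.congr f3) (by omega) q14 q15 q16
  have hLm : x.toSetSystem.reduced.decompLength τ ≤ x.m :=
    (decompLength_le_card hs.reduced).trans
      ((Finset.card_le_univ _).trans (Fintype.card_fin _).le)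
  have hLB := hs.decompLength_reduced_le.trans hL
  obtain ⟨M₅, h5, l5, f5⟩ := layers_spec (p := p) (by omega) (hLm.trans (by omega)) hLB hs.reduced s4
  -- The forward run is fixed beforehand, and the machine is then shown to follow it.
  obtain ⟨σ, t, hrun⟩ := exists_forwardRun (hf.reduced hc) (reduced_cost_pos hc) τ
  have ht : ∀ k < x.toSetSystem.reduced.decompLength τ, t k ≤ 3 * p.r := fun k hk =>
    iterations_le_reduced hf hrun (r := p.r) (by have := hR; unfold Params.R at this; omega) hk
  have e23 : M₅ 23 = M₄ 23 := f5 23 (by norm_num)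
  have hT : ∑ k ∈ Finset.range (x.toSetSystem.reduced.decompLength τ), t k ≤ p.R * (3 * p.r) := by
    refine (Finset.sum_le_card_nsmul _ _ (3 * p.r) fun k hk => ht k (Finset.mem_range.1 hk)).trans ?_
    rw [Finset.card_range, smul_eq_mul]
    exact Nat.mul_le_mul_right _ (hLm.trans (by omega))
  -- m! ≤ m^m ≤ R^R. With at most 3rR iterations in total, the scale grows by at most 2^(3(rR)²).
  have hF : x.m.factorial ≤ 2 ^ (p.r * p.R) := by
    refine (Nat.factorial_le_pow _).trans ?_
    rw [pow_mul]
    exact (Nat.pow_le_pow_left (show x.m ≤ p.R by omega) _).trans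
      (Nat.pow_le_pow_right p.R_pos (by omega))
  have hword : p.R * (2 ^ (x.size * (p.R + 1)) * x.m.factorial ^
      ∑ k ∈ Finset.range (x.toSetSystem.reduced.decompLength τ), t k) < 2 ^ p.W := by
    have : x.m.factorial ^ ∑ k ∈ Finset.range (x.toSetSystem.reduced.decompLength τ), t k ≤
        2 ^ (3 * (p.r * p.R) ^ 2) := by
      refine (Nat.pow_le_pow_right (Nat.factorial_pos _) hT).trans
        ((Nat.pow_le_pow_left hF _).trans_eq ?_)
      rw [← pow_mul]; congr 1; ring
    calc _ ≤ 2 ^ p.r * (2 ^ (x.size * (p.R + 1)) * 2 ^ (3 * (p.r * p.R) ^ 2)) := by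
          unfold Params.R at *; gcongr
      _ = 2 ^ (p.r + x.size * (p.R + 1) + 3 * (p.r * p.R) ^ 2) := by rw [← pow_add, ← pow_add]; congr 1; ring
      _ < _ := Nat.pow_lt_pow_right (by norm_num) hW
  obtain ⟨M₆, h6, q6, f6⟩ := forward_spec (p := p) (by omega) (Nat.factorial_pos x.m)
    (fun d hd hd' => Nat.dvd_factorial hd hd') (hf.reduced hc) (reduced_cost_pos hc) hrun
    (hLm.trans (by omega)) hLB (fun k hk => (ht k hk).trans (by omega))
    (b := 2 ^ (x.size * (p.R + 1))) (by exact_mod_cast hword) l5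
    (by rw [f5 7 (by norm_num), f4 7 (by norm_num), f3 7 (by norm_num), i2.factor]) i2.scale_pos
    (by rw [e23]; exact q23) (by rw [e23]; exact b23)
  obtain ⟨M₇, B, s, h7, f7, hB', q46⟩ := reverse_spec (p := p) (by omega) hB (hLm.trans (by omega)) hLB
    hs.reduced (hrun.inv (reduced_cost_pos hc) le_rfl) hrun q6
  have g7 : p.Good M₇ := q6.good.congr (f7 5 (by norm_num))
  obtain ⟨M₈, h8, -, q8⟩ := setArr_ind_spec (p := p) (d := 1) (out := 4) (M := M₇)
    (v := fun Z => not ((not (read 18 Z)).and (not (read 46 Z)))) (by omega) g7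
    (fun z => In (chosen ∪ B) z) (by
      intro Z i z hz hZ
      rw [hR1] at hz
      rw [eval_not, eval_and, eval_not, eval_not, eval_read, eval_read, hZ, q46 z hz,
        f7 18 (by norm_num), f6 18 (by norm_num), f5 18 (by norm_num), f4 18 (by norm_num),
        q18 z hz, one_sub_ind, one_sub_ind, ind_mul_ind, one_sub_ind]
      refine ind_congr ?_
      rw [in_union]; tauto)
  refine ⟨M₈, h1.seq (h2.seq (h3.seq (h4.seq (h5.seq (h6.seq (h7.seq h8)))))) , σ, t, s, hrun, chosen,
    B, c1, c2, c3, hB', ?_⟩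
  ext S
  have hS : (S : ℕ) < p.R := S.2.trans (by omega)
  rw [RatInstance.decode, Finset.mem_filter, q8 S (hR1.symm ▸ hS)]
  simp

end PRAM

/-! ### Resource bounds and the NC statement -/

namespace PRAM
open SetSystem

lemma log_le_log_size (x : RatInstance) : Nat.log 2 x.m ≤ Nat.log 2 x.size :=
  Nat.log_mono_right (by unfold RatInstance.size; omega)

/-- Machine resources for the algorithm. -/
lemma exists_params (x : RatInstance) (τ c : ℕ) : ∃ p : Params,
    p.r = max 3 (8 * (x.m + x.n)).size ∧ p.K = τ + 4 ∧ 23 * p.r ≤ p.B ∧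
    c * (Nat.log 2 x.m + 1) ≤ p.B ∧
    p.r + x.size * (p.R + 1) + 3 * (p.r * p.R) ^ 2 < p.W ∧
    p.N = (x.size + 2) ^ (6 * τ + 60) ∧ p.W = (x.size + 2) ^ (6 * τ + 60) ∧
    p.B + 1 ≤ (Nat.log 2 x.size + 2) ^ (τ + c + 31) := by
  set s := x.size with hs
  set r := max 3 (8 * (x.m + x.n)).size with hr
  set l := Nat.log 2 s with hl
  have hmn : x.m + x.n ≤ s := by rw [hs]; unfold RatInstance.size; omega
  have hsl : s < 2 ^ (l + 1) := Nat.lt_pow_succ_log_self (by norm_num) s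
  have hrl : r ≤ l + 4 := by
    refine max_le (by omega) (Nat.size_le.2 ?_)
    have : 2 ^ (l + 4) = 8 * 2 ^ (l + 1) := by ring
    omega
  -- The summand 1 covers s = 0, where the logarithm is 0 by convention.
  have hla : 2 ^ l ≤ s + 1 := by
    rcases Nat.eq_zero_or_pos s with h0 | h0
    · simp [hl, h0]
    · exact (Nat.pow_log_le_self 2 h0.ne').trans (Nat.le_succ s)
  obtain ⟨a, ha⟩ : ∃ a, a = s + 2 := ⟨_, rfl⟩
  obtain ⟨q, hq⟩ : ∃ q, q = l + 2 := ⟨_, rfl⟩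
  have ha2 : 2 ≤ a := by omega
  have hq2 : 2 ≤ q := by omega
  have hR : 2 ^ r ≤ a ^ 5 := by
    calc 2 ^ r ≤ 2 ^ (l + 4) := Nat.pow_le_pow_right (by norm_num) hrl
      _ = 2 ^ 4 * 2 ^ l := by ring
      _ ≤ a ^ 4 * a := Nat.mul_le_mul (Nat.pow_le_pow_left ha2 4) (by omega)
      _ = a ^ 5 := by ring
  have hra : r ≤ a ^ 5 := Nat.lt_two_pow_self.le.trans hR
  have hpow : ∀ n, n ≤ a ^ n := fun n => Nat.lt_two_pow_self.le.trans (Nat.pow_le_pow_left ha2 n)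
  have hpow' : ∀ n, n ≤ q ^ n := fun n => Nat.lt_two_pow_self.le.trans (Nat.pow_le_pow_left hq2 n)
  have hsucc : ∀ n, a ^ n + 1 ≤ a ^ (n + 1) := fun n => by
    have := Nat.one_le_pow n a (by omega)
    rw [pow_succ]; nlinarith
  have hw1 : r * (τ + 4) + 1 ≤ a ^ (6 * τ + 60) :=
    calc r * (τ + 4) + 1 ≤ a ^ 5 * a ^ (τ + 4) + 1 := by gcongr; exact hpow _
      _ = a ^ (τ + 9) + 1 := by ring
      _ ≤ a ^ (τ + 10) := hsucc _
      _ ≤ _ := Nat.pow_le_pow_right (by omega) (by omega)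
  have hw2 : r + s * (2 ^ r + 1) + 3 * (r * 2 ^ r) ^ 2 < a ^ (6 * τ + 60) :=
    calc r + s * (2 ^ r + 1) + 3 * (r * 2 ^ r) ^ 2
        ≤ a ^ 5 + a * a ^ 6 + a ^ 2 * (a ^ 5 * a ^ 5) ^ 2 := by
          gcongr
          · omega
          · exact (Nat.succ_le_succ hR).trans (hsucc 5)
          · nlinarith
      _ ≤ a ^ 22 + a ^ 22 + a ^ 22 := by
          refine Nat.add_le_add (Nat.add_le_add ?_ ?_) (le_of_eq (by ring))
          · exact Nat.pow_le_pow_right (by omega) (by omega)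
          · rw [← pow_succ']; exact Nat.pow_le_pow_right (by omega) (by omega)
      _ < a ^ 2 * a ^ 22 := by
          have h4 : 4 * a ^ 22 ≤ a ^ 2 * a ^ 22 := Nat.mul_le_mul_right _ (by nlinarith)
          have := Nat.one_le_pow 22 a (by omega)
          omega
      _ = a ^ 24 := by ring
      _ ≤ _ := Nat.pow_le_pow_right (by omega) (by omega)
  have hp : (2 ^ r) ^ (τ + 4) ≤ a ^ (6 * τ + 60) := by
    refine (Nat.pow_le_pow_left hR _).trans ?_
    rw [← pow_mul]; exact Nat.pow_le_pow_right (by omega) (by omega)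
  -- The loop bound adds up the sampling rounds, the halvings in a fold and the layers. Each is
  -- linear in a logarithm, hence below q² times a constant.
  have hB : 23 * r + r * (τ + 4) + 1 + c * (Nat.log 2 x.m + 1) + 1 ≤ q ^ (τ + c + 31) := by
    have h1 : r ≤ q ^ 2 := by nlinarith
    have h2 : Nat.log 2 x.m + 1 ≤ q ^ 2 := by
      have := log_le_log_size x
      nlinarith
    have h3 : 2 ≤ 2 * q ^ 2 := by nlinarith
    calc _ ≤ (τ + c + 29) * q ^ 2 := by nlinarith
      _ ≤ q ^ (τ + c + 29) * q ^ 2 := Nat.mul_le_mul_right _ (hpow' _)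
      _ = _ := by rw [← pow_add]
  subst ha hq
  exact ⟨⟨r, τ + 4, _, _, 23 * r + r * (τ + 4) + 1 + c * (Nat.log 2 x.m + 1), hp, hw1, by omega⟩,
    rfl, rfl, Nat.le_add_right_of_le (Nat.le_add_right_of_le (Nat.le_add_right _ _)),
    Nat.le_add_left _ _, hw2, rfl, rfl, hB⟩

lemma Exec.mono {N N' W W' : ℕ} {P : Prog} {M M' : Mem} {t : ℕ} (hN : N ≤ N') (hW : W ≤ W')
    (h : Exec N W P M t M') : Exec N' W' P M t M' := by
  induction h with
  | skip M => exact .skip M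
  | par p a x v M h1 h2 =>
    exact .par p a x v M (h1.trans hN) fun i hi =>
      (h2 i hi).trans_le (pow_le_pow_right₀ (by norm_num) hW)
  | seq P Q M M' M'' t t' _ _ ih1 ih2 => exact .seq P Q M M' M'' t t' ih1 ih2
  | iteTrue c P Q M M' t hc _ ih => exact .iteTrue c P Q M M' t hc ih
  | iteFalse c P Q M M' t hc _ ih => exact .iteFalse c P Q M M' t hc ih
  | whileTrue c P M M' M'' t t' hc _ _ ih1 ih2 => exact .whileTrue c P M M' M'' t t' hc ih1 ih2
  | whileFalse c P M hc => exact .whileFalse c P M hc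

/-- The algorithm runs in NC on systems of logarithmic decomposition length. -/
lemma algorithm_solvesInNC (τ c : ℕ) :
    SolvesInNC RatInstance.size RatInstance.encode
      {x : RatInstance | x.toSetSystem.IsSNC τ ∧ x.toSetSystem.Feasible ∧
        x.toSetSystem.decompLength τ ≤ c * (Nat.log 2 x.m + 1)}
      (fun x M =>
        (∃ σ t s, x.toSetSystem.AlgorithmRun τ σ t s (x.decode M)) ∧
        x.toSetSystem.IsCover (x.decode M) ∧
        ∀ D, x.toSetSystem.IsCover D → x.toSetSystem.totalCost (x.decode M) ≤
          (1 + 8 * (τ : ℝ) ^ 2) * x.toSetSystem.totalCost D)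
      (algorithm τ) := by
  set P := algorithm τ with hP
  -- The exponent depends on c, but the program does not: c enters only through the loop bound used
  -- in the analysis.
  refine ⟨6 * τ + 60 + (P.length + (τ + c + 31) * P.depth), fun x ⟨hs, hf, hL⟩ => ?_⟩
  obtain ⟨p, hr, hK, hB, hB', hW, hN, hW', hBq⟩ := exists_params x τ c
  obtain ⟨M', ⟨t, ht, hexec⟩, σ, it, s, hrun⟩ :=
    algorithm_spec (p := p) hs hf hr hK hB (hL.trans hB') hW
  have hc := cost_nonneg x
  have hle : (x.size + 2) ^ (6 * τ + 60) ≤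
      (x.size + 2) ^ (6 * τ + 60 + (P.length + (τ + c + 31) * P.depth)) :=
    Nat.pow_le_pow_right (by omega) (by omega)
  refine ⟨t, M', hexec.mono (hN.trans_le hle) (hW'.trans_le hle), ?_, ⟨σ, it, s, hrun⟩,
    hrun.isCover hs hc, fun D hD => hrun.totalCost_le hs hf hc hD⟩
  have hq2 : 2 ≤ Nat.log 2 x.size + 2 := by omega
  calc t ≤ P.length * (p.B + 1) ^ P.depth := ht.trans (P.timeBound_le p.B)
    _ ≤ (Nat.log 2 x.size + 2) ^ P.length *
        ((Nat.log 2 x.size + 2) ^ (τ + c + 31)) ^ P.depth :=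
      Nat.mul_le_mul (Nat.lt_two_pow_self.le.trans (Nat.pow_le_pow_left hq2 _))
        (Nat.pow_le_pow_left hBq _)
    _ = (Nat.log 2 x.size + 2) ^ (P.length + (τ + c + 31) * P.depth) := by
      rw [← pow_mul, ← pow_add]
    _ ≤ _ := Nat.pow_le_pow_right (by omega) (by omega)

end PRAM

/-! ### The theorem -/

theorem mainTheorem2 :
    -- the two phases on an arbitrary system with positive costs
    (∃ C : ℝ, ∀ (E I : Type*) [DecidableEq E] [DecidableEq I] (sys : SetSystem E I) (τ : ℕ),
      1 ≤ τ → sys.IsSNC τ → sys.Feasible → (∀ S ∈ sys.fam, 0 < sys.cost S) →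
      (∃ σ t, sys.ForwardRun τ σ t) ∧
      ∀ σ t, sys.ForwardRun τ σ t →
        sys.IsMaximalPair (1 / 8) (σ (sys.decompLength τ)).A (σ (sys.decompLength τ)).α ∧
        (∀ ρ : ℝ, (∀ S ∈ sys.fam, ∀ S' ∈ sys.fam, sys.cost S ≤ ρ * sys.cost S') →
          ((∑ k ∈ Finset.range (sys.decompLength τ), t k : ℕ) : ℝ) ≤
            C * sys.decompLength τ * (1 + Real.log sys.univ.card + Real.log ρ)) ∧
        (∃ B s, sys.ReverseRun τ σ 0 B s) ∧
        ∀ B s, sys.ReverseRun τ σ 0 B s →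
          B ⊆ (σ (sys.decompLength τ)).A ∧ sys.IsCover B ∧
          (∀ e, 0 < (σ (sys.decompLength τ)).α e →
            (B.filter (fun S => e ∈ sys.set S)).card ≤ τ ^ 2) ∧
          s ≤ sys.decompLength τ ^ 2 ∧
          ∀ D, sys.IsCover D → sys.totalCost B ≤ 8 * (τ : ℝ) ^ 2 * sys.totalCost D) ∧
    -- the whole algorithm, with preprocessing of the costs
    (∃ C : ℝ, ∀ (E I : Type*) [DecidableEq E] [DecidableEq I] (sys : SetSystem E I) (τ : ℕ),
      1 ≤ τ → sys.IsSNC τ → sys.Feasible → (∀ S ∈ sys.fam, 0 ≤ sys.cost S) →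
      (∃ σ t s out, sys.AlgorithmRun τ σ t s out) ∧
      ∀ σ t s out, sys.AlgorithmRun τ σ t s out →
        sys.reduced.IsMaximalPair (1 / 8) (σ (sys.reduced.decompLength τ)).A
          (σ (sys.reduced.decompLength τ)).α ∧
        ((∑ k ∈ Finset.range (sys.reduced.decompLength τ), t k : ℕ) : ℝ) ≤
          C * sys.decompLength τ * (1 + Real.log sys.univ.card) ∧
        s ≤ sys.decompLength τ ^ 2 ∧
        (∀ e, 0 < (σ (sys.reduced.decompLength τ)).α e →
          (out.filter (fun S => e ∈ sys.set S)).card ≤ τ ^ 2) ∧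
        sys.IsCover out ∧
        ∀ D, sys.IsCover D → sys.totalCost out ≤ (1 + 8 * (τ : ℝ) ^ 2) * sys.totalCost D) ∧
    -- the implementation in NC for logarithmic decomposition length
    (∀ τ : ℕ, 1 ≤ τ → ∃ P : PRAM.Prog, ∀ c : ℕ,
      PRAM.SolvesInNC RatInstance.size RatInstance.encode
        {x : RatInstance | x.toSetSystem.IsSNC τ ∧ x.toSetSystem.Feasible ∧
          x.toSetSystem.decompLength τ ≤ c * (Nat.log 2 x.m + 1)}
        (fun x M =>
          (∃ σ t s, x.toSetSystem.AlgorithmRun τ σ t s (x.decode M)) ∧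
          x.toSetSystem.IsCover (x.decode M) ∧
          ∀ D, x.toSetSystem.IsCover D → x.toSetSystem.totalCost (x.decode M) ≤
            (1 + 8 * (τ : ℝ) ^ 2) * x.toSetSystem.totalCost D)
        P) := by
  -- The constants are those of `ForwardRun.sum_le` and `AlgorithmRun.iterations_le`.
  refine ⟨⟨3, ?_⟩, ⟨9, ?_⟩, fun τ _ => ⟨PRAM.algorithm τ, PRAM.algorithm_solvesInNC τ⟩⟩
  · intro E I _ _ sys τ _ hs hf hc
    refine ⟨SetSystem.exists_forwardRun hf hc τ, fun σ t h => ?_⟩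
    have hI := h.inv hc le_rfl
    have hmax := h.isMaximalPair hs hc
    obtain ⟨B, s, hB, -⟩ := SetSystem.exists_reverseRun hI h (Nat.zero_le _)
    refine ⟨hmax, fun ρ hρ => h.sum_le hf hc hρ, ⟨B, s, hB⟩, fun B s hr => ?_⟩
    have hinv := hr.inv hs hI h
    refine ⟨hinv.subset, hr.isCover hs hI h, fun e he => hr.freq hs hI h he, ?_, fun D hD => ?_⟩
    · simpa [sq] using hinv.count
    · exact (hr.totalCost_le hs hI h).trans
        (mul_le_mul_of_nonneg_left (hmax.2.1.sum_le_totalCost hD) (by positivity))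
  · intro E I _ _ sys τ _ hs hf hc
    refine ⟨SetSystem.exists_algorithmRun hf hc, fun σ t s out h => ?_⟩
    exact ⟨h.forward.isMaximalPair hs.reduced (SetSystem.reduced_cost_pos hc),
      h.iterations_le hs hf hc, h.count_le hs hc, fun e he => h.freq hs hc he,
      h.isCover hs hc, fun D hD => h.totalCost_le hs hf hc hD⟩
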